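/- Let $n\ge 0$ and $\Lambda(n)=\mathbb{Q}[d_1^{\pm1},\dots,d_n^{\pm1}]$, graded by $\deg d_i=1$. A \emph{univalent diagram} on $\{1,\dots,n\}$ is a finite graph (multiple edges and loops allowed) all of whose vertices have valency one or three, with a cyclic order of the three half-edges at every trivalent vertex, with a label in $\{1,\dots,n\}$ at every univalent vertex (``leg''), and with at least one leg on every connected component. A \emph{trivalent diagram} on the disjoint union of oriented intervals $I_1,\dots,I_n$ is a univalent diagram together with a linear order, for every $i$, of the legs labeled $i$ (that is, these legs are glued to distinct interior points of $I_i$, in this order along $I_i$). Diagrams are considered up to isomorphism. The degree of a diagram is half the number of its (univalent and trivalent) vertices. Let $\mathcal{A}(n)$ be the $\mathbb{Q}$-vector space generated by trivalent diagrams modulo (STU): if $l<r$ are consecutive legs of $T$ on an interval, $U$ is obtained from $T$ by exchanging the positions of $l$ and $r$, and $S$ is obtained from $T$ by joining the edges of $l$ and $r$ in a new trivalent vertex that is joined by an edge (the stem) to one new leg at the place of $l,r$, the cyclic order being (stem, $r$, $l$), then $S=T-U$. By inserting two legs with labels $i,j$ into an edge we mean: put two new trivalent vertices on the edge and join the first one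 to a new leg labeled $i$ and the second one to a new leg labeled $j$, both on the same side of the edge (for the cyclic orders of the new vertices). Let $\mathcal{C}(n)$ be the quotient of $\Lambda(n)\otimes_{\mathbb{Q}}\mathcal{A}(n)$ by the $\Lambda(n)$-submodule generated by the following relations. (CL1A) $P-P'=2d_i^2\,Y$. Here $Y$ has a trivalent vertex with half-edges, in cyclic order, $t,m,t'$, where the edge of $m$ ends in a leg on $I_i$, and the edges of $t$ and $t'$ end anywhere; $P$ is obtained by inserting two legs with label $i$ into the edge of $t'$, on the side of $m$, so that there is a row of three trivalent vertices whose legs are three consecutive points of $I_i$ in the order in which they occur in the row from $t$ to $t'$; and $P'$ is obtained from $P$ by exchanging the two ends of the row. (CL2A) $D'=d_id_j\,D$, where $D'$ is obtained from $D$ by inserting two legs with labels $i,j$ into an edge joining two different trivalent vertices, the new legs being glued to arbitrary places of $I_i$ and $I_j$. Let $\mathcal{D}(n)$ be the $\Lambda(n)$-module generated by univalent diagrams modulo the following relations. (AS) Reversing the cyclic order at one trivalent vertex changes the sign. (IHX) $I=H-X$, where $I,H,X$ differ only in the two different end vertices of one edge, which have cyclic orders $(e,p,q),(e,r,s)$ in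 $I$; $(e,q,r),(e,s,p)$ in $H$; and $(e,p,r),(e,s,q)$ in $X$ ($e$ denoting the edge). (IntV) A diagram is zero if it has a trivalent vertex whose three edges all lead to trivalent vertices. (CL1B) $G'=d_i^2\,G$, where $G$ has a connected component with exactly one trivalent vertex and three legs, labeled $j,i,k$ in the cyclic order, and $G'$ is obtained by inserting two legs with label $i$ into the edge ending at $k$, on the side of the leg $i$ (so that the component becomes a comb with ends $j,k$ and three legs $i$ between them on the same side). (CL2B) $G'=d_id_j\,G$, where $G'$ is obtained from $G$ by inserting two legs with labels $i,j$ into an edge joining two different trivalent vertices. The degrees of diagrams and $\deg d_i=1$ make $\mathcal{C}(n)$ and $\mathcal{D}(n)$ into $\mathbb{Z}$-graded $\Lambda(n)$-modules. For a univalent diagram $G$ let $W_i$ be the set of linear orders on the set of legs labeled $i$ such that, whenever $l_1<l_3<l_2$ are legs labeled $i$ and $l_1,l_2$ belong to the same connected component of $G$, then $l_3$ belongs to this component as well. Put $W=W_1\times\dots\times W_n$ and $$\chi(G)=\frac1{\#W}\sum_{w\in W}G_w\in\mathcal{C}(n),$$ where $G_w$ is the trivalent diagram given by $G$ and the orders $w$.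 \textbf{Proposition 7.} The map $\chi$ induces a well-defined isomorphism $\mathcal{D}(n)\to\mathcal{C}(n)$ of $\mathbb{Z}$-graded $\Lambda(n)$-modules. -/

import Mathlib

noncomputable section

open scoped TensorProduct Classical

namespace DiagramAlgebra

/-! ### The coefficient ring -/

/-- The ring `ℚ[d₁^{±1}, …, dₙ^{±1}]` of Laurent polynomials in `n` variables. -/
abbrev Lam (n : ℕ) : Type := AddMonoidAlgebra ℚ (Fin n →₀ ℤ)

/-- The variable `d_i`. -/
def d {n : ℕ} (i : Fin n) : Lam n := AddMonoidAlgebra.single (Finsupp.single i 1) 1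

/-- The homogeneous part of degree `k` of the Laurent polynomial ring, where `deg d_i = 1`. -/
def lamDeg (n : ℕ) (k : ℤ) : Submodule ℚ (Lam n) :=
  Submodule.span ℚ {a | ∃ e : Fin n →₀ ℤ, ∑ i, e i = k ∧ a = AddMonoidAlgebra.single e 1}

/-! ### Univalent diagrams -/

/-- A univalent diagram on the set `{1, …, n}`, given on its set `F` of half-edges (flags):
`opp` exchanges the two halves of every edge, and the orbits of `rot` are the vertices.  A vertex
has one or three flags; on the flags of a trivalent vertex `rot` is the (counterclockwise) cyclic
order.  Exactly the univalent vertices, that is the fixed points of `rot`, carry a label, and every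
connected component contains a univalent vertex. -/
structure UniDiagram (n : ℕ) (F : Type) where
  opp : F → F
  opp_opp : ∀ f, opp (opp f) = f
  opp_ne : ∀ f, opp f ≠ f
  rot : F → F
  rot_rot_rot : ∀ f, rot (rot (rot f)) = f
  label : F → Option (Fin n)
  label_isSome : ∀ f, (label f).isSome ↔ rot f = f
  exists_leg : ∀ f, ∃ u, rot u = u ∧ Relation.EqvGen (fun a b => b = opp a ∨ b = rot a) f u

namespace UniDiagram

variable {n : ℕ} {F : Type}

/-- Two flags lie in the same connected component. -/
def SameComponent (G : UniDiagram n F) (f g : F) : Prop :=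
  Relation.EqvGen (fun a b => b = G.opp a ∨ b = G.rot a) f g

/-- `f` is a flag of the vertex to which `v` belongs. -/
def SameVertex (G : UniDiagram n F) (v f : F) : Prop :=
  f = v ∨ f = G.rot v ∨ f = G.rot (G.rot v)

/-- The flag `f` belongs to a trivalent vertex. -/
def IsTri (G : UniDiagram n F) (f : F) : Prop := G.rot f ≠ f

/-- The number of vertices, univalent and trivalent ones; the degree is half of it. -/
def numVertices (G : UniDiagram n F) : ℕ := Nat.card (Quot fun f g : F => g = G.rot f)

/-- `φ` is an isomorphism of univalent diagrams. -/
structure IsIso {F' : Type} (G : UniDiagram n F) (G' : UniDiagram n F') (φ : F ≃ F') : Prop where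
  opp : ∀ f, G'.opp (φ f) = φ (G.opp f)
  rot : ∀ f, G'.rot (φ f) = φ (G.rot f)
  label : ∀ f, G'.label (φ f) = G.label f

theorem IsIso.refl (G : UniDiagram n F) : IsIso G G (Equiv.refl F) :=
  ⟨fun _ => rfl, fun _ => rfl, fun _ => rfl⟩

theorem IsIso.symm {F' : Type} {G : UniDiagram n F} {G' : UniDiagram n F'} {φ : F ≃ F'}
    (h : IsIso G G' φ) : IsIso G' G φ.symm :=
  ⟨fun f => by rw [Equiv.eq_symm_apply, ← h.opp, Equiv.apply_symm_apply],
   fun f => by rw [Equiv.eq_symm_apply, ← h.rot, Equiv.apply_symm_apply],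
   fun f => by rw [← h.label, Equiv.apply_symm_apply]⟩

theorem IsIso.trans {F' F'' : Type} {G : UniDiagram n F} {G' : UniDiagram n F'}
    {G'' : UniDiagram n F''} {φ : F ≃ F'} {ψ : F' ≃ F''}
    (h : IsIso G G' φ) (k : IsIso G' G'' ψ) : IsIso G G'' (φ.trans ψ) :=
  ⟨fun f => by simp [k.opp, h.opp], fun f => by simp [k.rot, h.rot],
   fun f => by simp [k.label, h.label]⟩

/-- A choice, for every `i`, of a linear order on the set of univalent vertices labeled `i`
(vertices with different labels are not related by `lt`). -/
@[ext]
structure LegOrder (G : UniDiagram n F) where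
  lt : F → F → Prop
  label_of_lt : ∀ f g, lt f g → ∃ i, G.label f = some i ∧ G.label g = some i
  irrefl : ∀ f, ¬ lt f f
  trans : ∀ f g h, lt f g → lt g h → lt f h
  total : ∀ f g i, G.label f = some i → G.label g = some i → f ≠ g → lt f g ∨ lt g f

/-- A univalent vertex that lies between two vertices of a connected component, with the same
label, belongs to that component. -/
def LegOrder.IsBlock {G : UniDiagram n F} (w : LegOrder G) : Prop :=
  ∀ l₁ l₂ l₃, G.SameComponent l₁ l₂ → w.lt l₁ l₃ → w.lt l₃ l₂ → G.SameComponent l₁ l₃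

/-- The set `W = W₁ × ⋯ × Wₙ` of linear orders over which one averages. -/
def BlockOrder (G : UniDiagram n F) : Type := {w : LegOrder G // w.IsBlock}

instance [Finite F] (G : UniDiagram n F) : Finite (BlockOrder G) :=
  Finite.of_injective (fun w : BlockOrder G => w.1.lt) fun _ _ h =>
    Subtype.ext (LegOrder.ext h)

instance [Finite F] (G : UniDiagram n F) : Fintype (BlockOrder G) := Fintype.ofFinite _

end UniDiagram

open UniDiagram

/-- A univalent diagram together with its (finite) set of flags. -/
structure BundledUni (n : ℕ) : Type 1 where
  Flag : Type
  finite : Finite Flag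
  graph : UniDiagram n Flag

instance uniSetoid (n : ℕ) : Setoid (BundledUni n) where
  r A B := ∃ φ : A.Flag ≃ B.Flag, IsIso A.graph B.graph φ
  iseqv :=
    ⟨fun A => ⟨_, IsIso.refl A.graph⟩, fun ⟨_, h⟩ => ⟨_, h.symm⟩,
      fun ⟨_, h⟩ ⟨_, k⟩ => ⟨_, h.trans k⟩⟩

/-- The isomorphism classes of univalent diagrams on `{1, …, n}`. -/
abbrev UniClass (n : ℕ) : Type 1 := Quotient (uniSetoid n)

/-- The isomorphism class of a univalent diagram. -/
def uniClass {n : ℕ} {F : Type} [hF : Finite F] (G : UniDiagram n F) : UniClass n :=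
  Quotient.mk _ ⟨F, hF, G⟩

/-! ### Trivalent diagrams on `n` oriented intervals -/

/-- A trivalent diagram on the disjoint union of `n` oriented intervals: a univalent diagram whose
univalent vertices labeled `i` are glued to the `i`-th interval.  Up to homeomorphisms the gluing
is the same as a linear order on these vertices, `lt` being the direction of the interval. -/
structure TriDiagram (n : ℕ) (F : Type) where
  graph : UniDiagram n F
  ord : LegOrder graph

/-- A trivalent diagram together with its (finite) set of flags. -/
structure BundledTri (n : ℕ) : Type 1 where
  Flag : Type
  finite : Finite Flag
  diag : TriDiagram n Flag

/-- Equivalence of trivalent diagrams. -/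
instance triSetoid (n : ℕ) : Setoid (BundledTri n) where
  r A B := ∃ φ : A.Flag ≃ B.Flag, IsIso A.diag.graph B.diag.graph φ ∧
    ∀ f g, B.diag.ord.lt (φ f) (φ g) ↔ A.diag.ord.lt f g
  iseqv :=
    ⟨fun A => ⟨_, IsIso.refl A.diag.graph, fun _ _ => Iff.rfl⟩,
      fun ⟨φ, h, k⟩ => ⟨φ.symm, h.symm, fun f g => by rw [← k]; simp⟩,
      fun ⟨φ, h, k⟩ ⟨ψ, h', k'⟩ => ⟨φ.trans ψ, h.trans h', fun f g => by
        rw [← k f g, ← k' (φ f) (φ g)]; rfl⟩⟩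

/-- The equivalence classes of trivalent diagrams on `n` intervals. -/
abbrev TriClass (n : ℕ) : Type 1 := Quotient (triSetoid n)

/-- The equivalence class of a trivalent diagram. -/
def triClass {n : ℕ} {F : Type} [hF : Finite F] (D : TriDiagram n F) : TriClass n :=
  Quotient.mk _ ⟨F, hF, D⟩

/-! ### Relation (STU) and the space `A(n)` -/

/-- The two flags of the edge that joins the trivalent vertex in (STU) to the interval. -/
inductive StemFlag
  | stem
  | foot

instance : Fintype StemFlag := ⟨{.stem, .foot}, fun x => by cases x <;> simp⟩

open StemFlag in
/-- `S`, `T`, `U` are the three diagrams of relation (STU).  In `T` the univalent vertices `l`, `r`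
are consecutive on an interval, `l` before `r`; in `U` their positions are exchanged; in `S` the
flags `l`, `r` belong to a trivalent vertex that is joined to the interval by the edge
`stem`--`foot`.  For an interval drawn at the bottom and directed from left to right, the
counterclockwise order of the new vertex is (stem, right, left). -/
structure IsSTU {n : ℕ} {F : Type} (S : TriDiagram n (F ⊕ StemFlag)) (T U : TriDiagram n F)
    (l r : F) : Prop where
  lt : T.ord.lt l r
  consecutive : ∀ f, ¬ (T.ord.lt l f ∧ T.ord.lt f r)
  graph_eq : U.graph = T.graph
  lt_iff : ∀ f g, U.ord.lt f g ↔ T.ord.lt (Equiv.swap l r f) (Equiv.swap l r g)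
  opp_old : ∀ f, S.graph.opp (.inl f) = .inl (T.graph.opp f)
  opp_stem : S.graph.opp (.inr stem) = .inr foot
  rot_stem : S.graph.rot (.inr stem) = .inl r
  rot_right : S.graph.rot (.inl r) = .inl l
  rot_left : S.graph.rot (.inl l) = .inr stem
  rot_old : ∀ f, f ≠ l → f ≠ r → S.graph.rot (.inl f) = .inl (T.graph.rot f)
  label_foot : S.graph.label (.inr foot) = T.graph.label l
  label_old : ∀ f, f ≠ l → f ≠ r → S.graph.label (.inl f) = T.graph.label f
  lt_old : ∀ f g, f ≠ l → f ≠ r → g ≠ l → g ≠ r →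
    (S.ord.lt (.inl f) (.inl g) ↔ T.ord.lt f g)
  lt_foot : ∀ f, f ≠ l → f ≠ r → (S.ord.lt (.inl f) (.inr foot) ↔ T.ord.lt f l)
  foot_lt : ∀ f, f ≠ l → f ≠ r → (S.ord.lt (.inr foot) (.inl f) ↔ T.ord.lt l f)

/-- The elements `S - T + U`. -/
def stuRel (n : ℕ) : Set (TriClass n →₀ ℚ) :=
  {x | ∃ (F : Type) (_ : Finite F) (S : TriDiagram n (F ⊕ StemFlag)) (T U : TriDiagram n F)
    (l r : F), IsSTU S T U l r ∧
    x = Finsupp.single (triClass S) 1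
      - (Finsupp.single (triClass T) 1 - Finsupp.single (triClass U) 1)}

/-- The space `A(n)` of trivalent diagrams on `n` intervals modulo (STU).  (Relation (InvV) concerns
trivalent vertices of the skeleton; `n` intervals have none.) -/
abbrev A (n : ℕ) : Type 1 := (TriClass n →₀ ℚ) ⧸ Submodule.span ℚ (stuRel n)

/-- The class of a trivalent diagram in `A(n)`. -/
def A.mk {n : ℕ} {F : Type} [Finite F] (D : TriDiagram n F) : A n :=
  Submodule.Quotient.mk (Finsupp.single (triClass D) 1)

/-! ### Insertion of two legs -/

/-- The flags that appear when two trivalent vertices `a`, `b` with legs are inserted. -/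
inductive InsFlag
  | aIn | aLeg | aOut | aFoot
  | bIn | bLeg | bOut | bFoot

instance : Fintype InsFlag :=
  ⟨{.aIn, .aLeg, .aOut, .aFoot, .bIn, .bLeg, .bOut, .bFoot}, fun x => by cases x <;> simp⟩

open InsFlag in
/-- `G'` is obtained from `G` by inserting two trivalent vertices `a`, `b` into the edge
`{x, opp x}`, in this order when one starts at `x`, where `a` (resp. `b`) is joined to a new
univalent vertex labeled `i` (resp. `j`), both on the same side of the edge. -/
structure IsInsertion {n : ℕ} {F : Type} (G : UniDiagram n F) (x : F) (i j : Fin n)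
    (G' : UniDiagram n (F ⊕ InsFlag)) : Prop where
  opp_x : G'.opp (.inl x) = .inr aIn
  opp_aOut : G'.opp (.inr aOut) = .inr bIn
  opp_bOut : G'.opp (.inr bOut) = .inl (G.opp x)
  opp_aLeg : G'.opp (.inr aLeg) = .inr aFoot
  opp_bLeg : G'.opp (.inr bLeg) = .inr bFoot
  opp_old : ∀ f, f ≠ x → f ≠ G.opp x → G'.opp (.inl f) = .inl (G.opp f)
  rot_aIn : G'.rot (.inr aIn) = .inr aLeg
  rot_aLeg : G'.rot (.inr aLeg) = .inr aOut
  rot_bIn : G'.rot (.inr bIn) = .inr bLeg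
  rot_bLeg : G'.rot (.inr bLeg) = .inr bOut
  rot_old : ∀ f, G'.rot (.inl f) = .inl (G.rot f)
  label_aFoot : G'.label (.inr aFoot) = some i
  label_bFoot : G'.label (.inr bFoot) = some j
  label_old : ∀ f, G'.label (.inl f) = G.label f

/-- The same for trivalent diagrams; the two new univalent vertices are glued to arbitrary places
of the intervals `i` and `j`. -/
structure IsTriInsertion {n : ℕ} {F : Type} (D : TriDiagram n F) (x : F) (i j : Fin n)
    (D' : TriDiagram n (F ⊕ InsFlag)) : Prop where
  graph : IsInsertion D.graph x i j D'.graph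
  lt_old : ∀ f g, D'.ord.lt (.inl f) (.inl g) ↔ D.ord.lt f g

/-! ### Relations (CL1A), (CL2A) and the module `C(n)` -/

open InsFlag in
/-- The diagrams of relation (CL1A).  In `Y` a trivalent vertex with flags `t`, `rot t`,
`rot (rot t)` is joined by `rot t` to a univalent vertex on the interval `i`; the edges at `t` and
`rot (rot t)` end anywhere.  In `P` this vertex is replaced by a row of three trivalent vertices
between the two ends, joined to three consecutive points of the interval `i` in the same order, all
on the same side.  `P'` is obtained from `P` by exchanging the two ends of the row. -/
structure IsCL1A {n : ℕ} {F : Type} (P P' : TriDiagram n (F ⊕ InsFlag)) (Y : TriDiagram n F)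
    (i : Fin n) (t : F) : Prop where
  isTri : Y.graph.IsTri t
  label_leg : Y.graph.label (Y.graph.opp (Y.graph.rot t)) = some i
  insertion : IsTriInsertion Y (Y.graph.rot (Y.graph.rot t)) i i P
  lt_first : P.ord.lt (.inl (Y.graph.opp (Y.graph.rot t))) (.inr aFoot)
  lt_second : P.ord.lt (.inr aFoot) (.inr bFoot)
  consecutive : ∀ f, ¬ (P.ord.lt (.inl (Y.graph.opp (Y.graph.rot t))) (.inl f) ∧
    P.ord.lt (.inl f) (.inr bFoot))
  opp_eq : ∀ f, P'.graph.opp f = P.graph.opp f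
  rot_eq : ∀ f, P'.graph.rot f = Equiv.swap (.inl t) (.inr bOut)
    (P.graph.rot (Equiv.swap (.inl t) (.inr bOut) f))
  label_eq : ∀ f, P'.graph.label f = P.graph.label f
  lt_iff : ∀ f g, P'.ord.lt f g ↔ P.ord.lt f g

/-- The elements `P - P' - 2 d_i² Y`. -/
def cl1aRel (n : ℕ) : Set (Lam n ⊗[ℚ] A n) :=
  {x | ∃ (F : Type) (_ : Finite F) (P P' : TriDiagram n (F ⊕ InsFlag)) (Y : TriDiagram n F)
    (i : Fin n) (t : F), IsCL1A P P' Y i t ∧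
    x = (1 : Lam n) ⊗ₜ[ℚ] A.mk P - (1 : Lam n) ⊗ₜ[ℚ] A.mk P' - (2 * d i ^ 2) ⊗ₜ[ℚ] A.mk Y}

/-- The elements `D' - d_i d_j D`, where `D'` is obtained from `D` by inserting two legs ending on
the intervals `i` and `j` into an edge that joins two trivalent vertices. -/
def cl2aRel (n : ℕ) : Set (Lam n ⊗[ℚ] A n) :=
  {y | ∃ (F : Type) (_ : Finite F) (D' : TriDiagram n (F ⊕ InsFlag)) (D : TriDiagram n F)
    (i j : Fin n) (x : F), D.graph.IsTri x ∧ D.graph.IsTri (D.graph.opp x) ∧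
    ¬ D.graph.SameVertex x (D.graph.opp x) ∧ IsTriInsertion D x i j D' ∧
    y = (1 : Lam n) ⊗ₜ[ℚ] A.mk D' - (d i * d j) ⊗ₜ[ℚ] A.mk D}

/-- The module `C(n)`. -/
abbrev C (n : ℕ) : Type 1 := (Lam n ⊗[ℚ] A n) ⧸ Submodule.span (Lam n) (cl1aRel n ∪ cl2aRel n)

/-- The class of a trivalent diagram in `C(n)`. -/
def C.mk {n : ℕ} {F : Type} [Finite F] (D : TriDiagram n F) : C n :=
  Submodule.Quotient.mk ((1 : Lam n) ⊗ₜ[ℚ] A.mk D)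

/-- The homogeneous part of degree `k` of `C(n)`: a diagram has half the number of its vertices
as its degree, and `deg d_i = 1`. -/
def C.deg (n : ℕ) (k : ℤ) : Submodule ℚ (C n) :=
  Submodule.span ℚ {x | ∃ (p q : ℤ) (a : Lam n) (F : Type) (_ : Finite F) (D : TriDiagram n F),
    p + q = k ∧ a ∈ lamDeg n p ∧ (D.graph.numVertices : ℤ) = 2 * q ∧ x = a • C.mk D}

/-! ### The relations between univalent diagrams and the module `D(n)` -/

/-- The generator given by a univalent diagram. -/
def gen {n : ℕ} {F : Type} [Finite F] (G : UniDiagram n F) : UniClass n →₀ Lam n :=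
  Finsupp.single (uniClass G) 1

/-- Relation (AS): `G'` differs from `G` by the cyclic order at one trivalent vertex. -/
def asRel (n : ℕ) : Set (UniClass n →₀ Lam n) :=
  {x | ∃ (F : Type) (_ : Finite F) (G G' : UniDiagram n F) (v : F), G.IsTri v ∧
    G'.opp = G.opp ∧ G'.label = G.label ∧
    (∀ f, G.SameVertex v f → G'.rot f = G.rot (G.rot f)) ∧
    (∀ f, ¬ G.SameVertex v f → G'.rot f = G.rot f) ∧
    x = gen G + gen G'}

/-- The diagrams of relation (IHX).  The edge `x`--`opp x` joins two different trivalent vertices of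
the diagram `I`, whose other flags are `p`, `q` and `r`, `s`.  In the plane, `p`, `q`, `r`, `s`
are the edges to the upper right, upper left, lower left, lower right; the edge is vertical in `I`,
and in `H` it joins the left edges `q`, `r` to the right edges `p`, `s`; `X` is `H` with `p` and `q`
exchanged. -/
structure IsIHX {n : ℕ} {F : Type} (I H X : UniDiagram n F) (x p q r s : F) : Prop where
  isTri : I.IsTri x
  isTri_opp : I.IsTri (I.opp x)
  not_same : ¬ I.SameVertex x (I.opp x)
  rot_x : I.rot x = p
  rot_p : I.rot p = q
  rot_y : I.rot (I.opp x) = r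
  rot_r : I.rot r = s
  oppH : H.opp = I.opp
  labelH : H.label = I.label
  rotH_x : H.rot x = q
  rotH_q : H.rot q = r
  rotH_y : H.rot (I.opp x) = s
  rotH_s : H.rot s = p
  rotH_old : ∀ f, ¬ I.SameVertex x f → ¬ I.SameVertex (I.opp x) f → H.rot f = I.rot f
  oppX : X.opp = I.opp
  labelX : X.label = I.label
  rotX_x : X.rot x = p
  rotX_p : X.rot p = r
  rotX_y : X.rot (I.opp x) = s
  rotX_s : X.rot s = q
  rotX_old : ∀ f, ¬ I.SameVertex x f → ¬ I.SameVertex (I.opp x) f → X.rot f = I.rot f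

/-- Relation (IHX): `I = H - X`. -/
def ihxRel (n : ℕ) : Set (UniClass n →₀ Lam n) :=
  {y | ∃ (F : Type) (_ : Finite F) (I H X : UniDiagram n F) (x p q r s : F),
    IsIHX I H X x p q r s ∧ y = gen I - (gen H - gen X)}

/-- Relation (IntV): a diagram with an internal vertex, that is a trivalent vertex whose three edges
all lead to trivalent vertices, is zero. -/
def intVRel (n : ℕ) : Set (UniClass n →₀ Lam n) :=
  {x | ∃ (F : Type) (_ : Finite F) (G : UniDiagram n F) (v : F), G.IsTri v ∧
    (∀ f, G.SameVertex v f → G.IsTri (G.opp f)) ∧ x = gen G}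

/-- Relation (CL1B): `G` has a connected component with one trivalent vertex and three legs, which
are labeled `j`, `i`, `k` in the cyclic order; in `G'` this component is a comb with ends `j`, `k`
and three teeth labeled `i` on the same side. -/
def cl1bRel (n : ℕ) : Set (UniClass n →₀ Lam n) :=
  {y | ∃ (F : Type) (_ : Finite F) (G' : UniDiagram n (F ⊕ InsFlag)) (G : UniDiagram n F)
    (i j k : Fin n) (t : F), G.IsTri t ∧ G.label (G.opp t) = some j ∧
    G.label (G.opp (G.rot t)) = some i ∧ G.label (G.opp (G.rot (G.rot t))) = some k ∧
    IsInsertion G (G.rot (G.rot t)) i i G' ∧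
    y = gen G' - d i ^ 2 • gen G}

/-- Relation (CL2B): `G'` is obtained from `G` by inserting two legs labeled `i` and `j` into an edge
that joins two trivalent vertices. -/
def cl2bRel (n : ℕ) : Set (UniClass n →₀ Lam n) :=
  {y | ∃ (F : Type) (_ : Finite F) (G' : UniDiagram n (F ⊕ InsFlag)) (G : UniDiagram n F)
    (i j : Fin n) (x : F), G.IsTri x ∧ G.IsTri (G.opp x) ∧ ¬ G.SameVertex x (G.opp x) ∧
    IsInsertion G x i j G' ∧ y = gen G' - (d i * d j) • gen G}

/-- The module `D(n)`. -/
abbrev D (n : ℕ) : Type 1 := (UniClass n →₀ Lam n) ⧸ Submodule.span (Lam n)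
  (ihxRel n ∪ asRel n ∪ intVRel n ∪ cl1bRel n ∪ cl2bRel n)

/-- The class of a univalent diagram in `D(n)`. -/
def D.mk {n : ℕ} {F : Type} [Finite F] (G : UniDiagram n F) : D n :=
  Submodule.Quotient.mk (gen G)

/-- The homogeneous part of degree `k` of `D(n)`. -/
def D.deg (n : ℕ) (k : ℤ) : Submodule ℚ (D n) :=
  Submodule.span ℚ {x | ∃ (p q : ℤ) (a : Lam n) (F : Type) (_ : Finite F) (G : UniDiagram n F),
    p + q = k ∧ a ∈ lamDeg n p ∧ (G.numVertices : ℤ) = 2 * q ∧ x = a • D.mk G}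

/-! ### The averaged gluing map -/

/-- `χ(G)`, the average of the diagrams obtained by gluing the legs of `G` to the intervals
according to the linear orders in `W`. -/
def chi {n : ℕ} {F : Type} [Finite F] (G : UniDiagram n F) : C n :=
  (Fintype.card (BlockOrder G) : ℚ)⁻¹ • ∑ w : BlockOrder G, C.mk ⟨G, w.1⟩

/-- The submodules `ℳ k` are a `ℤ`-grading of the module `M` over the graded Laurent polynomial
ring. -/
def IsGrading {n : ℕ} {M : Type 1} [AddCommGroup M] [Module ℚ M] [Module (Lam n) M]
    (ℳ : ℤ → Submodule ℚ M) : Prop :=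
  DirectSum.IsInternal ℳ ∧
    ∀ (k l : ℤ) (a : Lam n) (x : M), a ∈ lamDeg n k → x ∈ ℳ l → a • x ∈ ℳ (k + l)

end DiagramAlgebra

end

/-!
The inverse of the averaged gluing map `χ` is constructed on trivalent diagrams.

Call a function on trivalent diagrams with values in a `Λ(n)`-module a weight (`IsWeight`) if it
satisfies (STU) and (CL2A). Since the variables `d_i` are invertible, a weight satisfies much more.
Suppose that a vertex has a leg, and its two other edges lead to trivalent vertices. If two legs
are inserted into one of these edges, then they form with the old leg a row of three, and any leg
of this row can be regarded as the old one (`isIso_row`). So the old leg can be moved freely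
(`IsWeight.swap_of_legVertex`), whence diagrams with an internal vertex have weight zero
(`IsWeight.eq_zero_of_isInternal`), and (AS) and (IHX) follow (`IsWeight.flip`, `IsWeight.ihx`).
Consequently averages of weights over the block orders respect (AS), (IHX), (IntV) and (CL2B).

Conversely, (STU) prescribes how the value of a function changes when two consecutive legs are
exchanged: by the value at a diagram with one leg less. By induction on the number of legs these
prescriptions are consistent. It suffices to check that the changes are antisymmetric, that
exchanges of disjoint pairs commute, and that the six exchanges of three consecutive legs close up,
which is (IHX) (`exists_potential`). The constant that is left free is fixed by the requirement
that the average is the given diagram. This defines `unglue`, a weight whose average over the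
gluings of `G` is the class of `G` in `D(n)` (`avg_unglue`). A difference of two sides of a
relation that does not change under exchanges equals its average (`avg_eq_of_swap_invariant`); this
principle also shows that two functions that satisfy (STU) and have equal averages coincide
(`SatisfiesSTU.ext`).

For (CL1A), turn the row in `P'` around: its three vertices change their cyclic orders, so `-P'` is
`P` with the order of the three legs reversed. Thus (CL1A) says that `rowSum`, the sum over these
two orders, is `2 d_i² Y`. If an end of the row leads to a trivalent vertex, this follows from
(CL2A). If both ends are legs, the row is a component of the diagram, and the orders in `W` can be
paired by reversing the order of the legs of this component. The sum over such a pair does not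
depend on the order inside the component: an exchange of two of its legs changes both summands by
opposite amounts, because joining legs of this component twice produces an internal vertex
(`IsWeight.add_reversal_eq`). Hence the average of the row sums is twice the average of the comb
(`IsWeight.avg_row`), so that (CL1A) implies (CL1B). In the other direction, (CL1B) gives the
average of (CL1A), and the two sides of (CL1A) change in the same way under exchanges of legs
(`IsWeight.rowSum_eq`); for an exchange with a leg of the row this is `IsWeight.join_add_join`.

So `χ` is defined on `D(n)`, `unglue` is defined on `C(n)`, and they are inverse to each other. For
the gradings, the relations of `D(n)` are compatible with the automorphism of `Λ(n)` that
multiplies every `d_i` by `4`; the resulting map `rescale` has the homogeneous parts of `D(n)` in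
different eigenspaces. The grading of `C(n)` is transported along `χ`.
-/

noncomputable section

open scoped TensorProduct Classical

namespace DiagramAlgebra

open UniDiagram UniDiagram.LegOrder

variable {n : ℕ} {F F' : Type}

/-! ### Linear orders on the legs -/

namespace UniDiagram.LegOrder

variable {G : UniDiagram n F} {G' : UniDiagram n F'}

theorem asymm (w : LegOrder G) {f g : F} (h : w.lt f g) : ¬ w.lt g f :=
  fun h' => w.irrefl _ (w.trans _ _ _ h h')

theorem ne_of_lt (w : LegOrder G) {f g : F} (h : w.lt f g) : f ≠ g := by
  rintro rfl; exact w.irrefl _ h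

theorem label_eq (w : LegOrder G) {f g : F} (h : w.lt f g) : G.label f = G.label g := by
  obtain ⟨i, h1, h2⟩ := w.label_of_lt _ _ h
  rw [h1, h2]

theorem rot_left (w : LegOrder G) {f g : F} (h : w.lt f g) : G.rot f = f := by
  obtain ⟨i, h1, h2⟩ := w.label_of_lt _ _ h
  rw [← G.label_isSome, h1]; rfl

theorem rot_right (w : LegOrder G) {f g : F} (h : w.lt f g) : G.rot g = g := by
  obtain ⟨i, h1, h2⟩ := w.label_of_lt _ _ h
  rw [← G.label_isSome, h2]; rfl

theorem total' (w : LegOrder G) {f g : F} (hf : G.rot f = f) (hl : G.label f = G.label g)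
    (hne : f ≠ g) : w.lt f g ∨ w.lt g f := by
  rw [← G.label_isSome] at hf
  obtain ⟨i, hi⟩ := Option.isSome_iff_exists.1 hf
  exact w.total f g i hi (hl ▸ hi) hne

/-- The order on the legs of `G` induced by a label preserving embedding of its flags. -/
def comap (w : LegOrder G') (e : F → F') (he : Function.Injective e)
    (hl : ∀ f, G'.label (e f) = G.label f) : LegOrder G where
  lt f g := w.lt (e f) (e g)
  label_of_lt f g h := by simpa only [hl] using w.label_of_lt _ _ h
  irrefl f := w.irrefl _
  trans f g h := w.trans _ _ _
  total f g i hf hg hne := w.total _ _ i (by rw [hl, hf]) (by rw [hl, hg]) (he.ne hne)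

/-- The order on the legs of `G` pulled back along a map `e` that sends legs to legs with the same
label; legs with the same image are ordered by the index `k`. -/
def pull (w : LegOrder G') (e : F → F') (k : F → ℕ)
    (hl : ∀ f i, G.label f = some i → G'.label (e f) = some i)
    (hk : ∀ f g i, G.label f = some i → G.label g = some i → e f = e g → k f = k g → f = g) :
    LegOrder G where
  lt f g := (∃ i, G.label f = some i ∧ G.label g = some i) ∧
    (w.lt (e f) (e g) ∨ e f = e g ∧ k f < k g)
  label_of_lt f g h := h.1
  irrefl f h := by
    rcases h.2 with h | h
    · exact w.irrefl _ h
    · exact lt_irrefl _ h.2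
  trans f g h := by
    rintro ⟨⟨i, h1, h2⟩, h3⟩ ⟨⟨j, h4, h5⟩, h6⟩
    have : i = j := by rw [h2] at h4; exact Option.some.inj h4
    subst this
    refine ⟨⟨i, h1, h5⟩, ?_⟩
    rcases h3 with h3 | h3 <;> rcases h6 with h6 | h6
    · exact Or.inl (w.trans _ _ _ h3 h6)
    · rw [← h6.1]; exact Or.inl h3
    · rw [h3.1]; exact Or.inl h6
    · exact Or.inr ⟨h3.1.trans h6.1, h3.2.trans h6.2⟩
  total f g i hf hg hne := by
    by_cases he : e f = e g
    · rcases lt_trichotomy (k f) (k g) with h | h | h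
      · exact Or.inl ⟨⟨i, hf, hg⟩, Or.inr ⟨he, h⟩⟩
      · exact absurd (hk f g i hf hg he h) hne
      · exact Or.inr ⟨⟨i, hg, hf⟩, Or.inr ⟨he.symm, h⟩⟩
    · rcases w.total _ _ i (hl _ _ hf) (hl _ _ hg) he with h | h
      · exact Or.inl ⟨⟨i, hf, hg⟩, Or.inl h⟩
      · exact Or.inr ⟨⟨i, hg, hf⟩, Or.inl h⟩

/-- The order in which the places of `l` and `r` are exchanged (for legs with equal labels). -/
def swap (w : LegOrder G) (l r : F) : LegOrder G :=
  if h : G.label l = G.label r then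
    w.comap (Equiv.swap l r) (Equiv.injective _) fun f => by
      rw [Equiv.swap_apply_def]; split_ifs with h1 h2
      · rw [h1, h]
      · rw [h2, h]
      · rfl
  else w

theorem swap_lt_iff (w : LegOrder G) {l r : F} (h : G.label l = G.label r) (f g : F) :
    (w.swap l r).lt f g ↔ w.lt (Equiv.swap l r f) (Equiv.swap l r g) := by
  rw [swap, dif_pos h]; rfl

theorem swap_swap (w : LegOrder G) (l r : F) : (w.swap l r).swap l r = w := by
  by_cases h : G.label l = G.label r
  · ext f g; simp [swap_lt_iff _ h]
  · simp [swap, h]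

theorem swap_comm (w : LegOrder G) (l r : F) : w.swap l r = w.swap r l := by
  by_cases h : G.label l = G.label r
  · ext f g; rw [swap_lt_iff _ h, swap_lt_iff _ h.symm, Equiv.swap_comm]
  · have h' : ¬ G.label r = G.label l := fun h' => h h'.symm
    simp [swap, h, h']

/-- The legs `l`, `r` are consecutive on an interval, `l` before `r`. -/
structure Consec (w : LegOrder G) (l r : F) : Prop where
  lt : w.lt l r
  not_between : ∀ f, ¬ (w.lt l f ∧ w.lt f r)

namespace Consec

variable {w : LegOrder G} {l r : F}

theorem label (h : w.Consec l r) : G.label l = G.label r := w.label_eq h.lt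
theorem ne (h : w.Consec l r) : l ≠ r := w.ne_of_lt h.lt
theorem rot_left (h : w.Consec l r) : G.rot l = l := w.rot_left h.lt
theorem rot_right (h : w.Consec l r) : G.rot r = r := w.rot_right h.lt

theorem lt_left_iff (h : w.Consec l r) {f : F} (hl : f ≠ l) :
    w.lt f l ↔ w.lt f r := by
  refine ⟨fun hf => w.trans _ _ _ hf h.lt, fun hf => ?_⟩
  rcases w.total' (h.rot_left) (h.label.trans (w.label_eq hf).symm) hl.symm with h' | h'
  · exact absurd ⟨h', hf⟩ (h.not_between f)
  · exact h'

theorem right_lt_iff (h : w.Consec l r) {f : F} (hr : f ≠ r) :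
    w.lt r f ↔ w.lt l f := by
  refine ⟨fun hf => w.trans _ _ _ h.lt hf, fun hf => ?_⟩
  rcases w.total' (h.rot_right) (h.label.symm.trans (w.label_eq hf)) hr.symm with h' | h'
  · exact h'
  · exact absurd ⟨hf, h'⟩ (h.not_between f)

theorem swap_lt (h : w.Consec l r) (f g : F) :
    (w.swap l r).lt f g ↔ (w.lt f g ∧ ¬ (f = l ∧ g = r)) ∨ (f = r ∧ g = l) := by
  rw [swap_lt_iff _ h.label]
  have hne := h.ne
  by_cases hfl : f = l
  · subst hfl
    by_cases hgf : g = f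
    · subst hgf; simp [w.irrefl, hne]
    · by_cases hgr : g = r
      · subst hgr; simp [w.asymm h.lt, hne]
      · rw [Equiv.swap_apply_left, Equiv.swap_apply_of_ne_of_ne hgf hgr, h.right_lt_iff hgr]
        simp [hgr, hgf]
  · by_cases hfr : f = r
    · subst hfr
      by_cases hgl : g = l
      · subst hgl; simp [h.lt]
      · by_cases hgr : g = f
        · subst hgr; simp [w.irrefl, hgl]
        · rw [Equiv.swap_apply_right, Equiv.swap_apply_of_ne_of_ne hgl hgr,
            ← h.right_lt_iff hgr]
          simp [hgl, hfl]
    · rw [Equiv.swap_apply_of_ne_of_ne hfl hfr]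
      by_cases hgl : g = l
      · subst hgl
        rw [Equiv.swap_apply_left, ← h.lt_left_iff hfl]; simp [hfl, hfr]
      · by_cases hgr : g = r
        · subst hgr
          rw [Equiv.swap_apply_right, h.lt_left_iff hfl]; simp [hfl, hfr]
        · rw [Equiv.swap_apply_of_ne_of_ne hgl hgr]; simp [hfl, hfr]

theorem swap (h : w.Consec l r) : (w.swap l r).Consec r l := by
  refine ⟨(h.swap_lt _ _).2 (Or.inr ⟨rfl, rfl⟩), fun f hf => ?_⟩
  rw [h.swap_lt, h.swap_lt] at hf
  have hne := h.ne
  rcases hf with ⟨(⟨h1, h2⟩ | ⟨h1, h2⟩), (⟨h3, h4⟩ | ⟨h3, h4⟩)⟩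
  · exact w.irrefl _ (w.trans _ _ _ h.lt (w.trans _ _ _ h1 h3))
  · exact w.irrefl _ (h3 ▸ h1)
  · exact w.irrefl _ (h2 ▸ h3)
  · exact hne (h2 ▸ h3)

theorem left_unique (h : w.Consec l r) {l' : F} (h' : w.Consec l' r) : l = l' := by
  by_contra hne
  rcases w.total' h.rot_left (h.label.trans h'.label.symm) hne with hl | hl
  · exact h.not_between _ ⟨hl, h'.lt⟩
  · exact h'.not_between _ ⟨hl, h.lt⟩

theorem right_unique (h : w.Consec l r) {r' : F} (h' : w.Consec l r') : r = r' := by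
  by_contra hne
  rcases w.total' h.rot_right (h.label.symm.trans h'.label) hne with hl | hl
  · exact h'.not_between _ ⟨h.lt, hl⟩
  · exact h.not_between _ ⟨h'.lt, hl⟩

/-- Exchanging two consecutive legs does not affect another disjoint pair of consecutive legs. -/
theorem swap_of_disjoint (h : w.Consec l r) {l' r' : F} (h' : w.Consec l' r') (h1 : l' ≠ l)
    (h2 : l' ≠ r) (h3 : r' ≠ l) (_ : r' ≠ r) : (w.swap l r).Consec l' r' := by
  refine ⟨(h.swap_lt _ _).2 (Or.inl ⟨h'.lt, fun hh => h1 hh.1⟩), fun f hf => ?_⟩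
  rw [h.swap_lt, h.swap_lt] at hf
  rcases hf with ⟨(⟨h5, h6⟩ | ⟨h5, h6⟩), (⟨h7, h8⟩ | ⟨h7, h8⟩)⟩
  · exact h'.not_between f ⟨h5, h7⟩
  · exact h3 h8
  · exact h2 h5
  · exact h2 h5

end Consec

/-- If two orders differ, some pair of legs is consecutive in the first one and ordered in the
opposite way by the second one. -/
theorem exists_consec_inversion [Finite F] {w w₀ : LegOrder G} (hne : w ≠ w₀) :
    ∃ l r, w.Consec l r ∧ w₀.lt r l := by
  have key : ∀ (k : ℕ) (f g : F), {h | w.lt f h ∧ w.lt h g}.ncard = k → w.lt f g → w₀.lt g f →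
      ∃ l r, w.Consec l r ∧ w₀.lt r l := by
    intro k
    induction k using Nat.strong_induction_on with
    | _ k ih =>
      intro f g hk hfg hgf
      by_cases hb : ∃ h, w.lt f h ∧ w.lt h g
      · obtain ⟨h, h1, h2⟩ := hb
        have hl := (w.label_eq h1).symm
        by_cases h3 : w₀.lt h f
        · refine ih _ ?_ f h rfl h1 h3
          rw [← hk]
          refine Set.ncard_lt_ncard ⟨fun x hx => ⟨hx.1, w.trans _ _ _ hx.2 h2⟩, fun hs => ?_⟩
          exact w.irrefl h (hs (a := h) ⟨h1, h2⟩).2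
        · have h4 := (w₀.total' (w.rot_right h1) hl (w.ne_of_lt h1).symm).resolve_left h3
          refine ih _ ?_ h g rfl h2 (w₀.trans _ _ _ hgf h4)
          rw [← hk]
          refine Set.ncard_lt_ncard ⟨fun x hx => ⟨w.trans _ _ _ h1 hx.1, hx.2⟩, fun hs => ?_⟩
          exact w.irrefl h (hs (a := h) ⟨h1, h2⟩).1
      · exact ⟨f, g, ⟨hfg, fun h hh => hb ⟨h, hh⟩⟩, hgf⟩
  have hex : ∃ f g, w.lt f g ∧ w₀.lt g f := by
    by_contra hcon
    push Not at hcon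
    refine hne (LegOrder.ext ?_)
    funext f g
    apply propext
    have h1 : ∀ f g, w.lt f g → w₀.lt f g := fun f g h =>
      (w₀.total' (w.rot_left h) (w.label_eq h) (w.ne_of_lt h)).resolve_right (hcon f g h)
    refine ⟨h1 f g, fun h => ?_⟩
    rcases w.total' (w₀.rot_left h) (w₀.label_eq h) (w₀.ne_of_lt h) with h2 | h2
    · exact h2
    · exact absurd (h1 _ _ h2) (w₀.asymm h)
  obtain ⟨f, g, h1, h2⟩ := hex
  exact key _ f g rfl h1 h2

/-- The pairs of legs that are ordered differently by `w` and `w₀`. -/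
def inversions (w w₀ : LegOrder G) : Set (F × F) := {p | w.lt p.1 p.2 ∧ w₀.lt p.2 p.1}

theorem inversions_swap_ssubset {w w₀ : LegOrder G} {l r : F} (h : w.Consec l r)
    (h₀ : w₀.lt r l) : (w.swap l r).inversions w₀ ⊂ w.inversions w₀ := by
  refine ⟨fun p hp => ?_, fun hs => ?_⟩
  · obtain ⟨h1, h2⟩ := hp
    rcases (h.swap_lt _ _).1 h1 with h3 | h3
    · exact ⟨h3.1, h2⟩
    · rw [h3.1, h3.2] at h2; exact absurd h₀ (w₀.asymm h2)
  · exact w.asymm h.lt (absurd (hs (a := (l, r)) ⟨h.lt, h₀⟩).1 ((w.swap l r).asymm h.swap.lt))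

theorem ncard_inversions_swap_lt [Finite F] {w w₀ : LegOrder G} {l r : F} (h : w.Consec l r)
    (h₀ : w₀.lt r l) : ((w.swap l r).inversions w₀).ncard < (w.inversions w₀).ncard :=
  Set.ncard_lt_ncard (inversions_swap_ssubset h h₀) (Set.toFinite _)

/-- Bubble sort: every order is obtained from `w₀` by exchanging consecutive legs, each time
creating a new inversion. -/
theorem induction_on [Finite F] (w₀ : LegOrder G) {p : LegOrder G → Prop} (h₀ : p w₀)
    (hs : ∀ w l r, w.Consec l r → w₀.lt r l → p (w.swap l r) → p w) (w : LegOrder G) : p w := by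
  induction hk : (w.inversions w₀).ncard using Nat.strong_induction_on generalizing w with
  | _ k ih =>
    by_cases hw : w = w₀
    · rw [hw]; exact h₀
    · obtain ⟨l, r, h1, h2⟩ := exists_consec_inversion hw
      exact hs w l r h1 h2 (ih _ (hk ▸ ncard_inversions_swap_lt h1 h2) _ rfl)

theorem eq_of_swap_invariant [Finite F] {α : Type*} {h : LegOrder G → α}
    (hs : ∀ w l r, w.Consec l r → h w = h (w.swap l r)) (w w' : LegOrder G) : h w = h w' :=
  induction_on w' (p := fun w => h w = h w') rfl
    (fun w l r hc _ hw => (hs w l r hc).trans hw) w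

theorem consec_swap_left {w : LegOrder G} {a b c : F} (hab : w.Consec a b) (hbc : w.Consec b c) :
    (w.swap a b).Consec a c := by
  have hac := w.trans _ _ _ hab.lt hbc.lt
  refine ⟨(hab.swap_lt _ _).2 (Or.inl ⟨hac, fun h => hbc.ne h.2.symm⟩), fun f hf => ?_⟩
  rw [hab.swap_lt, hab.swap_lt] at hf
  rcases hf with ⟨(⟨h5, h6⟩ | ⟨h5, h6⟩), (⟨h7, h8⟩ | ⟨h7, h8⟩)⟩
  · by_cases hfb : f = b
    · exact h6 ⟨rfl, hfb⟩
    · by_cases hfc : f = c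
      · exact w.irrefl _ (hfc ▸ h7)
      · exact hab.not_between f ⟨h5, (hbc.lt_left_iff hfb).2 h7⟩
  · exact w.ne_of_lt hac h8.symm
  · exact hab.ne h5
  · exact hab.ne h5

theorem consec_swap_right {w : LegOrder G} {a b c : F} (hab : w.Consec a b) (hbc : w.Consec b c) :
    (w.swap b c).Consec a c := by
  have hac := w.trans _ _ _ hab.lt hbc.lt
  refine ⟨(hbc.swap_lt _ _).2 (Or.inl ⟨hac, fun h => hab.ne h.1⟩), fun f hf => ?_⟩
  rw [hbc.swap_lt, hbc.swap_lt] at hf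
  rcases hf with ⟨(⟨h5, h6⟩ | ⟨h5, h6⟩), (⟨h7, h8⟩ | ⟨h7, h8⟩)⟩
  · by_cases hfb : f = b
    · exact h8 ⟨hfb, rfl⟩
    · by_cases hfa : f = a
      · exact w.irrefl _ (hfa ▸ h5)
      · exact hbc.not_between f ⟨(hab.right_lt_iff hfb).2 h5, h7⟩
  · exact hbc.ne h8.symm
  · exact w.ne_of_lt hac h5
  · exact w.ne_of_lt hac h5

end UniDiagram.LegOrder

open UniDiagram.LegOrder

/-- A function on the orders with prescribed differences along exchanges of consecutive legs exists
if the differences are antisymmetric and consistent on the squares and hexagons of the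
permutohedron. -/
theorem exists_potential {M : Type*} [AddCommGroup M] [Finite F] {G : UniDiagram n F}
    (cost : LegOrder G → F → F → M)
    (hanti : ∀ w l r, w.Consec l r → cost (w.swap l r) r l = - cost w l r)
    (hsq : ∀ w l r l' r', w.Consec l r → w.Consec l' r' → l' ≠ l → l' ≠ r → r' ≠ l → r' ≠ r →
      cost w l r + cost (w.swap l r) l' r' = cost w l' r' + cost (w.swap l' r') l r)
    (hhex : ∀ w a b c, w.Consec a b → w.Consec b c →
      cost w a b + cost (w.swap a b) a c + cost ((w.swap a b).swap a c) b c =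
      cost w b c + cost (w.swap b c) a c + cost ((w.swap b c).swap a c) a b) :
    ∃ h : LegOrder G → M, ∀ w l r, w.Consec l r → h w - h (w.swap l r) = cost w l r := by
  rcases isEmpty_or_nonempty (LegOrder G) with hE | ⟨⟨w₀⟩⟩
  · exact ⟨fun _ => 0, fun w => (hE.false w).elim⟩
  -- potentials exist on the orders with at most `k` inversions, by induction on `k`
  have key : ∀ k : ℕ, ∃ h : LegOrder G → M, ∀ w l r, (w.inversions w₀).ncard ≤ k → w.Consec l r →
      w₀.lt r l → h w - h (w.swap l r) = cost w l r := by
    intro k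
    induction k with
    | zero =>
      refine ⟨fun _ => 0, fun w l r hk h1 h2 => ?_⟩
      have := ncard_inversions_swap_lt h1 h2
      omega
    | succ k ih =>
      obtain ⟨h, hh⟩ := ih
      refine ⟨fun w => if hw : (w.inversions w₀).ncard = k + 1 ∧
        ∃ p : F × F, w.Consec p.1 p.2 ∧ w₀.lt p.2 p.1 then
          cost w hw.2.choose.1 hw.2.choose.2 + h (w.swap hw.2.choose.1 hw.2.choose.2) else h w, ?_⟩
      intro w l r hk h1 h2
      have hlt := ncard_inversions_swap_lt h1 h2
      have hno : ¬ (((w.swap l r).inversions w₀).ncard = k + 1 ∧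
        ∃ p : F × F, (w.swap l r).Consec p.1 p.2 ∧ w₀.lt p.2 p.1) := by
        rintro ⟨h3, -⟩; omega
      simp only [dif_neg hno]
      by_cases hw : (w.inversions w₀).ncard = k + 1 ∧
        ∃ p : F × F, w.Consec p.1 p.2 ∧ w₀.lt p.2 p.1
      · rw [dif_pos hw]
        obtain ⟨h3, h4⟩ := hw.2.choose_spec
        generalize hw.2.choose = p at h3 h4
        obtain ⟨l', r'⟩ := p
        simp only at h3 h4 ⊢
        have hlt' := ncard_inversions_swap_lt h3 h4
        suffices cost w l' r' + h (w.swap l' r') = cost w l r + h (w.swap l r) by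
          rw [this]; abel
        have hex : ∀ a b c, w.Consec a b → w.Consec b c → w₀.lt b a → w₀.lt c b →
            cost w a b + h (w.swap a b) = cost w b c + h (w.swap b c) := by
          intro a b c hab hbc hab₀ hbc₀
          have hac₀ := w₀.trans _ _ _ hbc₀ hab₀
          have c1 := consec_swap_left hab hbc
          have c2 := consec_swap_right hab hbc
          have c3 : ((w.swap a b).swap a c).Consec b c := by
            have := consec_swap_right hab.swap c1
            exact this
          have c4 : ((w.swap b c).swap a c).Consec a b := by
            have := consec_swap_left c2 hbc.swap
            exact this
          have l1 := ncard_inversions_swap_lt hab hab₀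
          have l2 := ncard_inversions_swap_lt hbc hbc₀
          have l3 := ncard_inversions_swap_lt c1 hac₀
          have l4 := ncard_inversions_swap_lt c2 hac₀
          have e1 := hh _ a c (by omega) c1 hac₀
          have e2 := hh _ a c (by omega) c2 hac₀
          have e3 := hh _ b c (by omega) c3 hbc₀
          have e4 := hh _ a b (by omega) c4 hab₀
          have e5 := hhex w a b c hab hbc
          have e6 : ((w.swap a b).swap a c).swap b c = ((w.swap b c).swap a c).swap a b := by
            ext f g
            have hl1 := hab.label
            have hl2 := hbc.label
            rw [swap_lt_iff _ hl2, swap_lt_iff _ (hl1.trans hl2), swap_lt_iff _ hl1,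
              swap_lt_iff _ hl1, swap_lt_iff _ (hl1.trans hl2), swap_lt_iff _ hl2]
            have hne1 := hab.ne
            have hne2 := hbc.ne
            have hne3 := w.ne_of_lt (w.trans _ _ _ hab.lt hbc.lt)
            have : ∀ f, Equiv.swap a b (Equiv.swap a c (Equiv.swap b c f)) =
                Equiv.swap b c (Equiv.swap a c (Equiv.swap a b f)) := by
              intro f
              simp only [Equiv.swap_apply_def]
              grind
            rw [this, this]
          rw [e6] at e3
          rw [← sub_eq_zero]
          have : cost w a b + h (w.swap a b) - (cost w b c + h (w.swap b c)) =
              (cost w a b + cost (w.swap a b) a c + cost ((w.swap a b).swap a c) b c) -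
              (cost w b c + cost (w.swap b c) a c + cost ((w.swap b c).swap a c) a b) := by
            rw [← e1, ← e2, ← e3, ← e4]; abel
          rw [this, e5, sub_self]
        by_cases hll : l' = l
        · subst hll
          rw [h1.right_unique h3]
        by_cases hrr : r' = r
        · subst hrr
          exact absurd (h3.left_unique h1) hll
        by_cases hlr : l' = r
        · subst hlr
          exact (hex l l' r' h1 h3 h2 h4).symm
        by_cases hrl : r' = l
        · subst hrl
          exact hex l' r' r h3 h1 h4 h2
        have c1 := h1.swap_of_disjoint h3 hll hlr hrl hrr
        have c2 := h3.swap_of_disjoint h1 (Ne.symm hll) (Ne.symm hrl) (Ne.symm hlr) (Ne.symm hrr)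
        have e1 := hh _ l' r' (by omega) c1 h4
        have e2 := hh _ l r (by omega) c2 h2
        have e3 := hsq w l r l' r' h1 h3 hll hlr hrl hrr
        have e4 : (w.swap l r).swap l' r' = (w.swap l' r').swap l r := by
          ext f g
          rw [c1.swap_lt, h1.swap_lt, c2.swap_lt, h3.swap_lt]
          grind
        rw [e4] at e1
        rw [← sub_eq_zero]
        have : cost w l' r' + h (w.swap l' r') - (cost w l r + h (w.swap l r)) =
            (cost w l' r' + cost (w.swap l' r') l r) -
              (cost w l r + cost (w.swap l r) l' r') := by
          rw [← e1, ← e2]; abel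
        rw [this, e3, sub_self]
      · rw [dif_neg hw]
        refine hh w l r ?_ h1 h2
        by_contra hcon
        exact hw ⟨by omega, (l, r), h1, h2⟩
  obtain ⟨h, hh⟩ := key (Nat.card (F × F))
  refine ⟨h, fun w l r hc => ?_⟩
  have hle : ∀ w : LegOrder G, (w.inversions w₀).ncard ≤ Nat.card (F × F) := fun w => by
    rw [← Set.ncard_univ]; exact Set.ncard_le_ncard (Set.subset_univ _) (Set.toFinite _)
  rcases w₀.total' hc.rot_left hc.label hc.ne with h1 | h1
  · have := hh _ r l (hle _) hc.swap h1
    rw [swap_comm _ r l, swap_swap, hanti w l r hc] at this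
    rw [← neg_sub, this, neg_neg]
  · exact hh _ l r (hle _) hc h1

/-! ### Components and averages over block orders -/

namespace UniDiagram

variable {G : UniDiagram n F} {G' : UniDiagram n F'}

theorem SameComponent.refl (G : UniDiagram n F) (f : F) : G.SameComponent f f :=
  Relation.EqvGen.refl f

theorem SameComponent.symm {f g : F} (h : G.SameComponent f g) : G.SameComponent g f :=
  Relation.EqvGen.symm _ _ h

theorem SameComponent.trans {f g h : F} (h₁ : G.SameComponent f g) (h₂ : G.SameComponent g h) :
    G.SameComponent f h :=
  Relation.EqvGen.trans _ _ _ h₁ h₂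

theorem sameComponent_opp (G : UniDiagram n F) (f : F) : G.SameComponent f (G.opp f) :=
  Relation.EqvGen.rel _ _ (Or.inl rfl)

theorem sameComponent_rot (G : UniDiagram n F) (f : F) : G.SameComponent f (G.rot f) :=
  Relation.EqvGen.rel _ _ (Or.inr rfl)

/-- Components are the smallest sets of flags that are closed under `opp` and `rot`. -/
theorem SameComponent.closed {p : F → Prop} (ho : ∀ f, p f → p (G.opp f))
    (hr : ∀ f, p f → p (G.rot f)) {f g : F} (h : G.SameComponent f g) : p f ↔ p g := by
  have h1 : ∀ f, p (G.opp f) → p f := fun f h => by simpa only [G.opp_opp] using ho _ h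
  have h2 : ∀ f, p (G.rot f) → p f := fun f h => by
    simpa only [G.rot_rot_rot] using hr _ (hr _ h)
  induction h with
  | rel f g h =>
    rcases h with rfl | rfl
    · exact ⟨ho _, h1 _⟩
    · exact ⟨hr _, h2 _⟩
  | refl => rfl
  | symm _ _ _ ih => exact ih.symm
  | trans _ _ _ _ _ ih1 ih2 => exact ih1.trans ih2

theorem SameComponent.map {e : F → F'} (ho : ∀ f, G'.SameComponent (e f) (e (G.opp f)))
    (hr : ∀ f, G'.SameComponent (e f) (e (G.rot f))) {f g : F} (h : G.SameComponent f g) :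
    G'.SameComponent (e f) (e g) := by
  refine ((SameComponent.closed (p := fun x => G'.SameComponent (e f) (e x)) ?_ ?_ h).1
    (SameComponent.refl _ _))
  · exact fun x hx => hx.trans (ho x)
  · exact fun x hx => hx.trans (hr x)

/-- Two flags of legs with the same label in the same component: these legs form a block in the
orders of `BlockOrder`. -/
def SameBlock (G : UniDiagram n F) (f g : F) : Prop :=
  G.SameComponent f g ∧ G.label f = G.label g

theorem SameBlock.refl (f : F) : G.SameBlock f f := ⟨SameComponent.refl _ _, rfl⟩
theorem SameBlock.symm {f g : F} (h : G.SameBlock f g) : G.SameBlock g f :=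
  ⟨h.1.symm, h.2.symm⟩
theorem SameBlock.trans {f g h : F} (h₁ : G.SameBlock f g) (h₂ : G.SameBlock g h) :
    G.SameBlock f h := ⟨h₁.1.trans h₂.1, h₁.2.trans h₂.2⟩

namespace LegOrder

theorem IsBlock.sameBlock {w : LegOrder G} (hw : w.IsBlock) {a b c : F} (h : G.SameBlock a b)
    (h1 : w.lt a c) (h2 : w.lt c b) : G.SameBlock a c :=
  ⟨hw a b c h.1 h1 h2, w.label_eq h1⟩

theorem IsBlock.lt_iff_left {w : LegOrder G} (hw : w.IsBlock) {f f' g : F}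
    (h : G.SameBlock f f') (hg : ¬ G.SameBlock f g) : w.lt f g ↔ w.lt f' g := by
  have key : ∀ f f', G.SameBlock f f' → ¬ G.SameBlock f g → w.lt f g → w.lt f' g := by
    intro f f' h hg hfg
    have hne : f' ≠ g := by rintro rfl; exact hg h
    have hl : G.label f' = G.label g := h.2.symm.trans (w.label_eq hfg)
    have hr : G.rot g = g := w.rot_right hfg
    rcases w.total' hr hl.symm hne.symm with h1 | h1
    · exact absurd (hw.sameBlock h hfg h1) hg
    · exact h1
  exact ⟨key f f' h hg, key f' f h.symm fun h' => hg (h.trans h')⟩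

theorem IsBlock.lt_iff_right {w : LegOrder G} (hw : w.IsBlock) {f f' g : F}
    (h : G.SameBlock f f') (hg : ¬ G.SameBlock f g) : w.lt g f ↔ w.lt g f' := by
  have key : ∀ f f', G.SameBlock f f' → ¬ G.SameBlock f g → w.lt g f → w.lt g f' := by
    intro f f' h hg hfg
    have hne : f' ≠ g := by rintro rfl; exact hg h
    have hl : G.label f' = G.label g := h.2.symm.trans (w.label_eq hfg).symm
    have hr : G.rot g = g := w.rot_left hfg
    rcases w.total' hr hl.symm hne.symm with h1 | h1
    · exact h1
    · exact absurd ((hw.sameBlock h.symm h1 hfg)) fun h' => hg (h.trans h')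
  exact ⟨key f f' h hg, key f' f h.symm fun h' => hg (h.trans h')⟩

theorem IsBlock.swap {w : LegOrder G} (hw : w.IsBlock) {k k' : F} (h : G.SameBlock k k') :
    (w.swap k k').IsBlock := by
  have hs : ∀ f, G.SameComponent (Equiv.swap k k' f) f := fun f => by
    rw [Equiv.swap_apply_def]; split_ifs with h1 h2
    · rw [h1]; exact h.1.symm
    · rw [h2]; exact h.1
    · exact SameComponent.refl _ _
  intro a b c h1 h2 h3
  rw [swap_lt_iff _ h.2] at h2 h3
  exact (hs a).symm.trans ((hw _ _ _ (((hs a).trans h1).trans (hs b).symm) h2 h3).trans (hs c))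

/-- The flag at whose place `f` is put when the blocks of `k` and `k'` are exchanged. -/
def exchange (G : UniDiagram n F) (k k' f : F) : F :=
  if G.SameBlock f k then k' else if G.SameBlock f k' then k else f

theorem exchange_label {k k' : F} (hk : G.label k = G.label k') (f : F) :
    G.label (exchange G k k' f) = G.label f := by
  unfold exchange; split_ifs with h1 h2
  · rw [h1.2, hk]
  · rw [h2.2, hk]
  · rfl

theorem exchange_sameBlock_iff {k k' : F} (f g : F) :
    G.SameBlock (exchange G k k' f) (exchange G k k' g) ↔ G.SameBlock f g := by
  have hs : ∀ {a b : F}, G.SameBlock a b → G.SameBlock b a := fun h => h.symm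
  have ht : ∀ {a b c : F}, G.SameBlock a b → G.SameBlock b c → G.SameBlock a c :=
    fun h h' => h.trans h'
  have hr : ∀ a, G.SameBlock a a := fun a => SameBlock.refl a
  unfold exchange
  split_ifs <;> grind

theorem exchange_exchange_sameBlock {k k' : F} (f : F) :
    G.SameBlock (exchange G k k' (exchange G k k' f)) f := by
  have hs : ∀ {a b : F}, G.SameBlock a b → G.SameBlock b a := fun h => h.symm
  have ht : ∀ {a b c : F}, G.SameBlock a b → G.SameBlock b c → G.SameBlock a c :=
    fun h h' => h.trans h'
  have hr : ∀ a, G.SameBlock a a := fun a => SameBlock.refl a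
  unfold exchange
  split_ifs <;> grind

/-- Exchange the places of the blocks of `k` and `k'` in a block order, keeping the orders inside
the blocks. -/
def exchangeBlocks (w : LegOrder G) (hw : w.IsBlock) (k k' : F) (hk : G.label k = G.label k') :
    LegOrder G where
  lt f g := (G.SameBlock f g ∧ w.lt f g) ∨
    (¬ G.SameBlock f g ∧ w.lt (exchange G k k' f) (exchange G k k' g))
  label_of_lt f g h := by
    rcases h with h | h
    · exact w.label_of_lt _ _ h.2
    · have := w.label_of_lt _ _ h.2
      rwa [exchange_label hk, exchange_label hk] at this
  irrefl f h := by
    rcases h with h | h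
    · exact w.irrefl _ h.2
    · exact h.1 (SameBlock.refl f)
  trans f g h := by
    rintro (⟨h1, h2⟩ | ⟨h1, h2⟩) (⟨h3, h4⟩ | ⟨h3, h4⟩)
    · exact Or.inl ⟨h1.trans h3, w.trans _ _ _ h2 h4⟩
    · refine Or.inr ⟨fun h5 => h3 (h1.symm.trans h5), ?_⟩
      refine (hw.lt_iff_left ?_ ?_).1 h4
      · rw [exchange_sameBlock_iff]; exact h1.symm
      · rw [exchange_sameBlock_iff]; exact h3
    · refine Or.inr ⟨fun h5 => h1 (h5.trans h3.symm), ?_⟩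
      refine (hw.lt_iff_right ?_ ?_).1 h2
      · rw [exchange_sameBlock_iff]; exact h3
      · rw [exchange_sameBlock_iff]; exact fun h' => h1 h'.symm
    · refine Or.inr ⟨fun h5 => h1 ?_, w.trans _ _ _ h2 h4⟩
      rw [← exchange_sameBlock_iff (k := k) (k' := k')] at h5 ⊢
      exact hw.sameBlock h5 h2 h4
  total f g i hf hg hne := by
    by_cases hb : G.SameBlock f g
    · rcases w.total f g i hf hg hne with h | h
      · exact Or.inl (Or.inl ⟨hb, h⟩)
      · exact Or.inr (Or.inl ⟨hb.symm, h⟩)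
    · have hb' : ¬ G.SameBlock g f := fun h => hb h.symm
      have hne' : exchange G k k' f ≠ exchange G k k' g := fun h => hb (by
        rw [← exchange_sameBlock_iff (k := k) (k' := k'), h]; exact SameBlock.refl _)
      rcases w.total _ _ i (by rw [exchange_label hk, hf]) (by rw [exchange_label hk, hg]) hne'
        with h | h
      · exact Or.inl (Or.inr ⟨hb, h⟩)
      · exact Or.inr (Or.inr ⟨hb', h⟩)

variable {w : LegOrder G} (hw : w.IsBlock) {k k' : F} (hk : G.label k = G.label k')

theorem exchangeBlocks_isBlock : (w.exchangeBlocks hw k k' hk).IsBlock := by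
  intro a b c h1 h2 h3
  have hl := ((w.exchangeBlocks hw k k' hk).label_eq h2).trans
    ((w.exchangeBlocks hw k k' hk).label_eq h3)
  by_contra hcon
  have hac : ¬ G.SameBlock a c := fun h => hcon h.1
  have hcb : ¬ G.SameBlock c b := fun h => hcon (h1.trans h.symm.1)
  have hab : G.SameBlock a b := ⟨h1, hl⟩
  have h4 := (h2.resolve_left fun h => hac h.1).2
  have h5 := (h3.resolve_left fun h => hcb h.1).2
  rw [← exchange_sameBlock_iff (k := k) (k' := k')] at hab hac
  exact hac (hw.sameBlock hab h4 h5)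

theorem exchangeBlocks_exchangeBlocks :
    (w.exchangeBlocks hw k k' hk).exchangeBlocks (exchangeBlocks_isBlock hw hk) k k' hk = w := by
  ext f g
  by_cases hb : G.SameBlock f g
  · simp only [exchangeBlocks, hb, true_and, not_true, false_and, or_false]
  · simp only [exchangeBlocks, hb, exchange_sameBlock_iff, not_false_iff, false_and, true_and,
      false_or]
    have hf := exchange_exchange_sameBlock (G := G) (k := k) (k' := k') f
    have hg := exchange_exchange_sameBlock (G := G) (k := k) (k' := k') g
    rw [hw.lt_iff_left hf fun h => hb (hf.symm.trans (h.trans hg)),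
      hw.lt_iff_right hg fun h => hb (hg.symm.trans h).symm]

/-- Exchanging two adjacent blocks that are inverted with respect to `w₀` removes inversions. -/
theorem inversions_exchangeBlocks_ssubset {w₀ : LegOrder G} (hw₀ : w₀.IsBlock) {l r : F}
    (h : w.Consec l r) (h₀ : w₀.lt r l) (hb : ¬ G.SameBlock l r) :
    (w.exchangeBlocks hw l r h.label).inversions w₀ ⊂ w.inversions w₀ := by
  refine ⟨?_, fun hs => ?_⟩
  · rintro ⟨f, g⟩ ⟨h1, h2⟩
    refine ⟨?_, h2⟩
    simp only at h1 h2 ⊢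
    rcases h1 with h1 | ⟨hfg, h1⟩
    · exact h1.2
    have hrl : ¬ G.SameBlock r l := fun h => hb h.symm
    unfold exchange at h1
    by_cases hfl : G.SameBlock f l
    · rw [if_pos hfl] at h1
      have hgl : ¬ G.SameBlock g l := fun h' => hfg (hfl.trans h'.symm)
      rw [if_neg hgl] at h1
      by_cases hgr : G.SameBlock g r
      · rw [if_pos hgr] at h1
        exact absurd h.lt (w.asymm h1)
      · rw [if_neg hgr] at h1
        have := w.trans _ _ _ h.lt h1
        exact (hw.lt_iff_left hfl.symm fun h' => hgl h'.symm).1 this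
    · rw [if_neg hfl] at h1
      by_cases hfr : G.SameBlock f r
      · rw [if_pos hfr] at h1
        have hgr : ¬ G.SameBlock g r := fun h' => hfg (hfr.trans h'.symm)
        by_cases hgl : G.SameBlock g l
        · -- here `w₀` would order the two blocks in both ways
          have h3 : w₀.lt f g := (hw₀.lt_iff_left hfr.symm (fun h' => hgr h'.symm)).1
            ((hw₀.lt_iff_right hgl.symm fun h' => hb h').1 h₀)
          exact absurd h2 (w₀.asymm h3)
        · rw [if_neg hgl, if_neg hgr] at h1
          have hne1 : g ≠ l := by rintro rfl; exact hgl (SameBlock.refl _)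
          have hne2 : g ≠ r := by rintro rfl; exact hgr (SameBlock.refl _)
          exact (hw.lt_iff_left hfr.symm fun h' => hgr h'.symm).1 ((h.right_lt_iff hne2).2 h1)
      · rw [if_neg hfr] at h1
        have hne1 : f ≠ l := by rintro rfl; exact hfl (SameBlock.refl _)
        have hne2 : f ≠ r := by rintro rfl; exact hfr (SameBlock.refl _)
        by_cases hgl : G.SameBlock g l
        · rw [if_pos hgl] at h1
          exact (hw.lt_iff_right hgl.symm fun h' => hfl h'.symm).1
            ((h.lt_left_iff hne1).2 h1)
        · rw [if_neg hgl] at h1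
          by_cases hgr : G.SameBlock g r
          · rw [if_pos hgr] at h1
            exact (hw.lt_iff_right hgr.symm fun h' => hfr h'.symm).1
              ((h.lt_left_iff hne1).1 h1)
          · rwa [if_neg hgr] at h1
  · have h1 := (hs (a := (l, r)) ⟨h.lt, h₀⟩).1
    rcases h1 with h1 | h1
    · exact hb h1.1
    · have h2 := h1.2
      simp only [exchange, if_pos (SameBlock.refl _)] at h2
      rw [if_neg fun h' : G.SameBlock r l => hb h'.symm] at h2
      exact w.asymm h.lt h2

end LegOrder

/-- Block orders exist: order first the components and then the legs inside a component. -/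
instance nonempty_blockOrder [Finite F] (G : UniDiagram n F) : Nonempty (BlockOrder G) := by
  obtain ⟨N, ⟨e⟩⟩ := Finite.exists_equiv_fin F
  let S : Setoid F := ⟨G.SameComponent, SameComponent.refl G, SameComponent.symm,
    SameComponent.trans⟩
  let c : F → Fin N := fun f => e (Quotient.out (Quotient.mk S f))
  have hc : ∀ f g, c f = c g ↔ G.SameComponent f g := fun f g => by
    simp only [c, EmbeddingLike.apply_eq_iff_eq, Quotient.out_inj, Quotient.eq]
    rfl
  let w : LegOrder G :=
    { lt := fun f g => (∃ i, G.label f = some i ∧ G.label g = some i) ∧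
        toLex (c f, e f) < toLex (c g, e g)
      label_of_lt := fun f g h => h.1
      irrefl := fun f h => lt_irrefl _ h.2
      trans := by
        rintro f g h ⟨⟨i, h1, h2⟩, h3⟩ ⟨⟨j, h4, h5⟩, h6⟩
        exact ⟨⟨i, h1, by rw [h5, ← h4, h2]⟩, h3.trans h6⟩
      total := fun f g i hf hg hne => by
        rcases lt_trichotomy (toLex (c f, e f)) (toLex (c g, e g)) with h | h | h
        · exact Or.inl ⟨⟨i, hf, hg⟩, h⟩
        · have h2 : (c f, e f) = (c g, e g) := toLex.injective h
          exact absurd (e.injective (Prod.mk.inj h2).2) hne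
        · exact Or.inr ⟨⟨i, hg, hf⟩, h⟩ }
  refine ⟨w, fun a b d h1 h2 h3 => ?_⟩
  rw [← hc] at h1 ⊢
  have h4 := h2.2
  have h5 := h3.2
  rw [Prod.Lex.toLex_lt_toLex] at h4 h5
  simp only at h4 h5
  rcases h4 with h4 | h4
  · rcases h5 with h5 | h5
    · exact absurd (h4.trans h5) (h1 ▸ lt_irrefl _)
    · rw [h5.1, ← h1] at h4; exact absurd h4 (lt_irrefl _)
  · exact h4.1

/-- An embedding of the flags of `G` into those of `G'` that preserves labels and identifies the
components of `G` with components of `G'`; legs of `G'` may be missing in `G`. -/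
structure BlockEmbedding (G : UniDiagram n F) (G' : UniDiagram n F') (e : F → F') : Prop where
  inj : Function.Injective e
  label : ∀ f, G'.label (e f) = G.label f
  comp : ∀ f g, G'.SameComponent (e f) (e g) ↔ G.SameComponent f g

namespace BlockEmbedding

variable {e : F → F'} (he : BlockEmbedding G G' e)
include he

theorem sameBlock (f g : F) : G'.SameBlock (e f) (e g) ↔ G.SameBlock f g := by
  unfold SameBlock; rw [he.comp, he.label, he.label]

/-- Forget the legs that are missing in `G`. -/
def restrict (w : BlockOrder G') : BlockOrder G :=
  ⟨w.1.comap e he.inj he.label, fun _ _ _ h h1 h2 =>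
    (he.comp _ _).1 (w.2 _ _ _ ((he.comp _ _).2 h) h1 h2)⟩

theorem card_fiber_eq [Finite F] [Finite F'] (u₀ u : BlockOrder G) :
    Nat.card {w // he.restrict w = u} = Nat.card {w // he.restrict w = u₀} := by
  have hswap : ∀ (u : BlockOrder G) (k k' : F) (hb : G.SameBlock k k'),
      Nat.card {w // he.restrict w = u} =
        Nat.card {w // he.restrict w = ⟨u.1.swap k k', u.2.swap hb⟩} := by
    intro u k k' hb
    have hb' := (he.sameBlock k k').2 hb
    have hinv : Function.Involutive fun w : BlockOrder G' =>
        (⟨w.1.swap (e k) (e k'), w.2.swap hb'⟩ : BlockOrder G') := fun w =>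
      Subtype.ext (LegOrder.swap_swap _ _ _)
    refine Nat.card_congr (hinv.toPerm.subtypeEquiv fun w => ?_)
    have hr : he.restrict ⟨w.1.swap (e k) (e k'), w.2.swap hb'⟩ =
        ⟨(he.restrict w).1.swap k k', (he.restrict w).2.swap hb⟩ := by
      refine Subtype.ext (LegOrder.ext ?_)
      funext f g
      apply propext
      change (w.1.swap (e k) (e k')).lt (e f) (e g) ↔ ((he.restrict w).1.swap k k').lt f g
      rw [swap_lt_iff _ hb'.2, swap_lt_iff _ hb.2, he.inj.swap_apply, he.inj.swap_apply]
      rfl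
    change he.restrict w = u ↔ he.restrict ⟨w.1.swap (e k) (e k'), w.2.swap hb'⟩ = _
    rw [hr]
    constructor
    · rintro rfl; rfl
    · intro h
      have := congrArg (fun v : BlockOrder G => v.1.swap k k') h
      simp only [swap_swap] at this
      exact Subtype.ext this
  have hexc : ∀ (u : BlockOrder G) (k k' : F) (hl : G.label k = G.label k'),
      Nat.card {w // he.restrict w = u} =
        Nat.card {w // he.restrict w = ⟨u.1.exchangeBlocks u.2 k k' hl,
          exchangeBlocks_isBlock u.2 hl⟩} := by
    intro u k k' hl
    have hl' : G'.label (e k) = G'.label (e k') := by rw [he.label, he.label, hl]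
    have hinv : Function.Involutive fun w : BlockOrder G' =>
        (⟨w.1.exchangeBlocks w.2 (e k) (e k') hl', exchangeBlocks_isBlock w.2 hl'⟩ :
          BlockOrder G') := fun w => Subtype.ext (exchangeBlocks_exchangeBlocks w.2 hl')
    refine Nat.card_congr (hinv.toPerm.subtypeEquiv fun w => ?_)
    have hex : ∀ f, exchange G' (e k) (e k') (e f) = e (exchange G k k' f) := fun f => by
      unfold exchange
      rw [he.sameBlock, he.sameBlock]
      split_ifs <;> rfl
    have hr : he.restrict ⟨w.1.exchangeBlocks w.2 (e k) (e k') hl',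
        exchangeBlocks_isBlock w.2 hl'⟩ =
        ⟨(he.restrict w).1.exchangeBlocks (he.restrict w).2 k k' hl,
          exchangeBlocks_isBlock _ hl⟩ := by
      refine Subtype.ext (LegOrder.ext ?_)
      funext f g
      apply propext
      simp only [restrict, comap, exchangeBlocks, hex, he.sameBlock]
    change he.restrict w = u ↔ he.restrict ⟨w.1.exchangeBlocks w.2 (e k) (e k') hl',
        exchangeBlocks_isBlock w.2 hl'⟩ = _
    rw [hr]
    constructor
    · rintro rfl; rfl
    · intro h
      have h' := congrArg (fun v : BlockOrder G => v.1.exchangeBlocks v.2 k k' hl) h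
      simp only [exchangeBlocks_exchangeBlocks] at h'
      exact Subtype.ext h'
  induction hk : (u.1.inversions u₀.1).ncard using Nat.strong_induction_on generalizing u with
  | _ N ih =>
    by_cases hu : u.1 = u₀.1
    · rw [Subtype.ext hu]
    · obtain ⟨l, r, h1, h2⟩ := exists_consec_inversion hu
      by_cases hb : G.SameBlock l r
      · rw [hswap u l r hb]
        exact ih _ (hk ▸ ncard_inversions_swap_lt h1 h2) _ rfl
      · rw [hexc u l r h1.label]
        exact ih _ (hk ▸ Set.ncard_lt_ncard (inversions_exchangeBlocks_ssubset u.2 u₀.2 h1 h2 hb)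
          (Set.toFinite _)) _ rfl

end BlockEmbedding

end UniDiagram

section Average

variable {M : Type*} [AddCommGroup M] [Module ℚ M]

/-- The average of a function over the block orders. -/
def avg [Finite F] (G : UniDiagram n F) (φ : LegOrder G → M) : M :=
  (Fintype.card (BlockOrder G) : ℚ)⁻¹ • ∑ w : BlockOrder G, φ w.1

variable [Finite F] [Finite F'] {G : UniDiagram n F} {G' : UniDiagram n F'}

theorem card_blockOrder_ne_zero : (Fintype.card (BlockOrder G) : ℚ) ≠ 0 :=
  Nat.cast_ne_zero.2 Fintype.card_ne_zero

theorem avg_congr {φ ψ : LegOrder G → M} (h : ∀ w : LegOrder G, w.IsBlock → φ w = ψ w) :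
    avg G φ = avg G ψ := by
  unfold avg
  rw [Finset.sum_congr rfl fun w _ => h w.1 w.2]

theorem avg_const (m : M) : avg G (fun _ => m) = m := by
  unfold avg
  rw [Finset.sum_const, Finset.card_univ, ← Nat.cast_smul_eq_nsmul ℚ, smul_smul,
    inv_mul_cancel₀ card_blockOrder_ne_zero, one_smul]

theorem avg_add (φ ψ : LegOrder G → M) : avg G (fun w => φ w + ψ w) = avg G φ + avg G ψ := by
  unfold avg; rw [Finset.sum_add_distrib, smul_add]

theorem avg_sub (φ ψ : LegOrder G → M) : avg G (fun w => φ w - ψ w) = avg G φ - avg G ψ := by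
  unfold avg; rw [Finset.sum_sub_distrib, smul_sub]

theorem avg_map {N : Type*} [AddCommGroup N] [Module ℚ N] (t : M →ₗ[ℚ] N) (φ : LegOrder G → M) :
    avg G (fun w => t (φ w)) = t (avg G φ) := by
  unfold avg; rw [map_smul, map_sum]

theorem avg_eq_of_swap_invariant {φ : LegOrder G → M}
    (hs : ∀ w l r, w.Consec l r → φ w = φ (w.swap l r)) (w : LegOrder G) : φ w = avg G φ := by
  rw [avg_congr (ψ := fun _ => φ w) fun w' _ => eq_of_swap_invariant hs w' w, avg_const]

/-- The average of a function that only depends on the order of the legs of `G`. -/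
theorem avg_comap {e : F → F'} (he : BlockEmbedding G G' e) (φ : LegOrder G → M) :
    avg G' (fun w => φ (w.comap e he.inj he.label)) = avg G φ := by
  obtain ⟨u₀⟩ := nonempty_blockOrder G
  obtain ⟨w₀⟩ := nonempty_blockOrder G'
  set N := Nat.card {w // he.restrict w = u₀} with hN
  have h1 : ∀ u, Fintype.card {w // he.restrict w = u} = N := fun u => by
    rw [← Nat.card_eq_fintype_card, he.card_fiber_eq u₀ u]
  have hsum : ∀ {M : Type _} [AddCommGroup M] (ψ : BlockOrder G → M),
      ∑ w : BlockOrder G', ψ (he.restrict w) = N • ∑ u : BlockOrder G, ψ u := by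
    intro M _ ψ
    rw [← Finset.sum_fiberwise (g := he.restrict) Finset.univ, Finset.smul_sum]
    refine Finset.sum_congr rfl fun u _ => ?_
    rw [Finset.sum_congr rfl (g := fun _ => ψ u) fun w hw => by rw [(Finset.mem_filter.1 hw).2],
      Finset.sum_const, ← h1 u, Fintype.card_subtype]
  have hcard : Fintype.card (BlockOrder G') = N * Fintype.card (BlockOrder G) := by
    have : ∑ w : BlockOrder G', (1 : ℤ) = N • ∑ u : BlockOrder G, (1 : ℤ) := by
      rw [← Finset.sum_fiberwise (g := he.restrict) Finset.univ, Finset.smul_sum]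
      refine Finset.sum_congr rfl fun u _ => ?_
      rw [Finset.sum_const, ← h1 u, Fintype.card_subtype]
    simp only [Finset.sum_const, Finset.card_univ, nsmul_eq_mul, mul_one] at this
    exact_mod_cast this
  have hN0 : (N : ℚ) ≠ 0 := by
    intro h0
    have h0' : N = 0 := by exact_mod_cast h0
    have := Fintype.card_ne_zero (α := BlockOrder G')
    rw [hcard, h0', zero_mul] at this
    exact this rfl
  have := hsum (fun u => φ u.1)
  unfold avg
  change _ • ∑ w : BlockOrder G', (fun u : BlockOrder G => φ u.1) (he.restrict w) = _
  rw [this, hcard, ← Nat.cast_smul_eq_nsmul ℚ, smul_smul]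
  congr 1
  rw [Nat.cast_mul, mul_inv, mul_comm, ← mul_assoc, mul_inv_cancel₀ hN0, one_mul]

end Average

/-! ### Constructions with diagrams -/

namespace UniDiagram

@[ext]
theorem ext' {G G' : UniDiagram n F} (ho : ∀ f, G.opp f = G'.opp f)
    (hr : ∀ f, G.rot f = G'.rot f) (hl : ∀ f, G.label f = G'.label f) : G = G' := by
  cases G; cases G'
  obtain rfl := funext ho
  obtain rfl := funext hr
  obtain rfl := funext hl
  rfl

variable (G : UniDiagram n F)

theorem opp_injective : Function.Injective G.opp :=
  Function.LeftInverse.injective G.opp_opp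

theorem rot_injective : Function.Injective G.rot := fun f g h => by
  rw [← G.rot_rot_rot f, h, G.rot_rot_rot]

theorem label_eq_none {f : F} (h : G.rot f ≠ f) : G.label f = none := by
  rw [← Option.not_isSome_iff_eq_none, G.label_isSome]; exact h

theorem rot_eq_of_label {f : F} {i : Fin n} (h : G.label f = some i) : G.rot f = f := by
  rw [← G.label_isSome, h]; rfl

theorem exists_label {f : F} (h : G.rot f = f) : ∃ i, G.label f = some i :=
  Option.isSome_iff_exists.1 ((G.label_isSome f).2 h)

variable {G}

theorem IsTri.rot {f : F} (h : G.IsTri f) : G.IsTri (G.rot f) := fun h' =>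
  h (G.rot_injective h')

theorem IsTri.rot_rot_ne {f : F} (h : G.IsTri f) : G.rot (G.rot f) ≠ f := fun h' => by
  have := G.rot_rot_rot f
  rw [h'] at this
  exact h this

theorem SameVertex.rot {v f : F} (h : G.SameVertex v f) : G.SameVertex v (G.rot f) := by
  rcases h with rfl | rfl | rfl
  · exact Or.inr (Or.inl rfl)
  · exact Or.inr (Or.inr rfl)
  · exact Or.inl (G.rot_rot_rot _)

theorem SameVertex.symm {v f : F} (h : G.SameVertex v f) : G.SameVertex f v := by
  rcases h with rfl | rfl | rfl
  · exact Or.inl rfl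
  · exact Or.inr (Or.inr (G.rot_rot_rot _).symm)
  · exact Or.inr (Or.inl (G.rot_rot_rot _).symm)

theorem SameVertex.trans {v f g : F} (h : G.SameVertex v f) (h' : G.SameVertex f g) :
    G.SameVertex v g := by
  rcases h' with rfl | rfl | rfl
  · exact h
  · exact h.rot
  · exact h.rot.rot

theorem SameVertex.isTri {v f : F} (hv : G.IsTri v) (h : G.SameVertex v f) : G.IsTri f := by
  rcases h with rfl | rfl | rfl
  · exact hv
  · exact hv.rot
  · exact hv.rot.rot

theorem eqvGen_map {α β : Type*} {r : α → α → Prop} {r' : β → β → Prop} (e : α → β)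
    (h : ∀ a b, r a b → Relation.EqvGen r' (e a) (e b)) {a b : α} (hab : Relation.EqvGen r a b) :
    Relation.EqvGen r' (e a) (e b) := by
  induction hab with
  | rel a b hr => exact h a b hr
  | refl => exact .refl _
  | symm _ _ _ ih => exact .symm _ _ ih
  | trans _ _ _ _ _ ih1 ih2 => exact .trans _ _ _ ih1 ih2

/-- The diagram with the same flags, edges and labels as `G` in which `σ` renames the flags at the
vertices: `σ` cuts off the vertices from the edges and glues them again in another way. -/
def conj (G : UniDiagram n F) (σ : Equiv.Perm F) (hσ : ∀ f, G.rot f = f → σ f = f)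
    (hconn : ∀ f, Relation.EqvGen (fun a b => b = G.opp a ∨ b = σ (G.rot (σ.symm a))) f (σ f)) :
    UniDiagram n F :=
  have hfix : ∀ f, σ (G.rot (σ.symm f)) = f ↔ G.rot f = f := fun f => by
    constructor
    · intro h
      have h1 : G.rot (σ.symm f) = σ.symm f := by rw [Equiv.eq_symm_apply]; exact h
      have h2 := hσ _ h1
      rw [Equiv.apply_symm_apply] at h2
      rwa [← h2] at h1
    · intro h
      have h1 : σ.symm f = f := by rw [Equiv.symm_apply_eq]; exact (hσ f h).symm
      rw [h1, h, hσ f h]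
  { opp := G.opp
    opp_opp := G.opp_opp
    opp_ne := G.opp_ne
    rot := fun f => σ (G.rot (σ.symm f))
    rot_rot_rot := fun f => by simp [G.rot_rot_rot]
    label := G.label
    label_isSome := fun f => by rw [G.label_isSome, hfix]
    exists_leg := fun f => by
      obtain ⟨u, hu, hfu⟩ := G.exists_leg f
      refine ⟨u, (hfix u).2 hu, eqvGen_map id ?_ hfu⟩
      rintro a b (rfl | rfl)
      · exact .rel _ _ (Or.inl rfl)
      · refine .trans _ _ _ (hconn a) (.trans _ _ _ (.rel _ _ (Or.inr ?_)) (.symm _ _ (hconn _)))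
        simp }

theorem sameVertex_iff_ne {v f : F} : ¬ G.SameVertex v f ↔
    f ≠ v ∧ f ≠ G.rot v ∧ f ≠ G.rot (G.rot v) := by
  unfold SameVertex
  push Not
  rfl

/-- Reverse the cyclic order at the vertex of `v`. -/
def flip (G : UniDiagram n F) (v : F) : UniDiagram n F :=
  G.conj (Equiv.swap (G.rot v) (G.rot (G.rot v)))
    (fun f hf => by
      by_cases h : G.SameVertex v f
      · have h1 : G.rot v = v := by
          have := G.rot_rot_rot v
          rcases h with h | h | h <;> grind
        rw [h1, h1, Equiv.swap_self]; rfl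
      · rw [sameVertex_iff_ne] at h
        exact Equiv.swap_apply_of_ne_of_ne h.2.1 h.2.2)
    (fun f => by
      by_cases hv : G.rot v = v
      · rw [hv, hv, Equiv.swap_self]; exact .refl _
      have h2 := IsTri.rot_rot_ne (G := G) hv
      -- in the flipped vertex, the third flag follows `v` and the second one follows the third
      have h3 : ∀ a, a = G.rot v ∨ a = G.rot (G.rot v) → Relation.EqvGen (fun a b => b = G.opp a ∨
          b = Equiv.swap (G.rot v) (G.rot (G.rot v)) (G.rot
            ((Equiv.swap (G.rot v) (G.rot (G.rot v))).symm a))) v a := by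
        have h4 : Relation.EqvGen (fun a b => b = G.opp a ∨
          b = Equiv.swap (G.rot v) (G.rot (G.rot v)) (G.rot
            ((Equiv.swap (G.rot v) (G.rot (G.rot v))).symm a))) v (G.rot (G.rot v)) := by
          refine .rel _ _ (Or.inr ?_)
          rw [Equiv.symm_swap, Equiv.swap_apply_of_ne_of_ne (Ne.symm hv) h2.symm,
            Equiv.swap_apply_left]
        rintro a (rfl | rfl)
        · refine .trans _ _ _ h4 (.rel _ _ (Or.inr ?_))
          rw [Equiv.symm_swap, Equiv.swap_apply_right, Equiv.swap_apply_right]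
        · exact h4
      by_cases h1 : f = G.rot v
      · rw [h1, Equiv.swap_apply_left]
        exact .trans _ _ _ (.symm _ _ (h3 _ (Or.inl rfl))) (h3 _ (Or.inr rfl))
      by_cases h2 : f = G.rot (G.rot v)
      · rw [h2, Equiv.swap_apply_right]
        exact .trans _ _ _ (.symm _ _ (h3 _ (Or.inr rfl))) (h3 _ (Or.inl rfl))
      · rw [Equiv.swap_apply_of_ne_of_ne h1 h2]; exact .refl _)

theorem flip_opp (G : UniDiagram n F) (v f : F) : (G.flip v).opp f = G.opp f := rfl
theorem flip_label (G : UniDiagram n F) (v f : F) : (G.flip v).label f = G.label f := rfl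

theorem flip_rot (G : UniDiagram n F) (v f : F) :
    (G.flip v).rot f = if G.SameVertex v f then G.rot (G.rot f) else G.rot f := by
  change Equiv.swap (G.rot v) (G.rot (G.rot v)) (G.rot
            ((Equiv.swap (G.rot v) (G.rot (G.rot v))).symm f)) = _
  rw [Equiv.symm_swap]
  have a := G.rot_rot_rot
  simp only [Equiv.swap_apply_def, SameVertex]
  grind

/-- The edge of `x` joins two different trivalent vertices. -/
structure InnerEdge (G : UniDiagram n F) (x : F) : Prop where
  isTri : G.IsTri x
  isTri_opp : G.IsTri (G.opp x)
  not_same : ¬ G.SameVertex x (G.opp x)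

/-- The six flags at the ends of an inner edge are different. -/
structure SixFlags (x p q y r s : F) : Prop where
  xp : x ≠ p
  xq : x ≠ q
  xy : x ≠ y
  xr : x ≠ r
  xs : x ≠ s
  pq : p ≠ q
  py : p ≠ y
  pr : p ≠ r
  ps : p ≠ s
  qy : q ≠ y
  qr : q ≠ r
  qs : q ≠ s
  yr : y ≠ r
  ys : y ≠ s
  rs : r ≠ s

namespace InnerEdge

variable {G : UniDiagram n F} {x : F}

theorem opp (h : G.InnerEdge x) : G.InnerEdge (G.opp x) :=
  ⟨h.isTri_opp, by rw [G.opp_opp]; exact h.isTri, by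
    rw [G.opp_opp]; exact fun h' => h.not_same h'.symm⟩

theorem sixFlags (h : G.InnerEdge x) : SixFlags x (G.rot x) (G.rot (G.rot x)) (G.opp x)
    (G.rot (G.opp x)) (G.rot (G.rot (G.opp x))) := by
  have h1 := h.isTri
  have h2 := h.isTri_opp
  have h3 := h.not_same
  have a1 := G.rot_rot_rot x
  have a2 := G.rot_rot_rot (G.opp x)
  unfold IsTri at h1 h2
  unfold SameVertex at h3
  constructor <;> grind

end InnerEdge

section
variable {G : UniDiagram n F} {x : F}

theorem InnerEdge.isTri_of_ne (h : G.InnerEdge x) {f : F} (hf : G.rot f = f) :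
    ¬ G.SameVertex x f ∧ ¬ G.SameVertex (G.opp x) f :=
  ⟨fun h' => (h'.isTri h.isTri) hf, fun h' => (h'.isTri h.isTri_opp) hf⟩

/-- The diagram `H` of relation (IHX) for `I = G` and the edge of `x`. -/
def ihxH (h : G.InnerEdge x) : UniDiagram n F :=
  G.conj (Equiv.swap (G.rot x) (G.rot (G.rot x)) * Equiv.swap (G.rot (G.rot x)) (G.rot (G.opp x)) *
    Equiv.swap (G.rot (G.opp x)) (G.rot (G.rot (G.opp x))))
    (fun f hf => by
      have h1 := h.isTri_of_ne hf
      rw [sameVertex_iff_ne, sameVertex_iff_ne] at h1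
      simp only [Equiv.Perm.mul_apply, Equiv.swap_apply_def]
      grind)
    (fun f => by
      obtain ⟨xp, xq, xy, xr, xs, pq, py, pr, ps, qy, qr, qs, yr, ys, rs⟩ := h.sixFlags
      have a1 := G.rot_rot_rot x
      have a2 := G.rot_rot_rot (G.opp x)
      set p := G.rot x
      set q := G.rot p
      set r := G.rot (G.opp x)
      set s := G.rot r
      set σ := Equiv.swap p q * Equiv.swap q r * Equiv.swap r s with hσ
      have s1 : σ x = x := by simp only [σ, Equiv.Perm.mul_apply, Equiv.swap_apply_def]; grind
      have s2 : σ p = q := by simp only [σ, Equiv.Perm.mul_apply, Equiv.swap_apply_def]; grind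
      have s3 : σ q = r := by simp only [σ, Equiv.Perm.mul_apply, Equiv.swap_apply_def]; grind
      have s4 : σ r = s := by simp only [σ, Equiv.Perm.mul_apply, Equiv.swap_apply_def]; grind
      have s5 : σ s = p := by simp only [σ, Equiv.Perm.mul_apply, Equiv.swap_apply_def]; grind
      have s6 : σ (G.opp x) = G.opp x := by
        simp only [σ, Equiv.Perm.mul_apply, Equiv.swap_apply_def]; grind
      set R := Relation.EqvGen fun a b => b = G.opp a ∨ b = σ (G.rot (σ.symm a))
      have hR : Equivalence R := Relation.EqvGen.is_equivalence _
      have r1 : ∀ a, R (σ a) (σ (G.rot a)) := fun a => .rel _ _ (Or.inr (by simp))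
      have r2 : R x (G.opp x) := .rel _ _ (Or.inl rfl)
      have e1 : R x q := by have := r1 x; rwa [s1, s2] at this
      have e2 : R q r := by have := r1 p; rwa [s2, s3] at this
      have e3 : R (G.opp x) s := by have := r1 (G.opp x); rwa [s6, s4] at this
      have e4 : R s p := by have := r1 r; rwa [s4, s5] at this
      have e5 := hR.trans (hR.trans (hR.symm e1) r2) e3
      by_cases h1 : f = p
      · rw [h1, s2]; exact hR.symm (hR.trans e5 e4)
      by_cases h2 : f = q
      · rw [h2, s3]; exact e2
      by_cases h3 : f = r
      · rw [h3, s4]; exact hR.trans (hR.symm e2) e5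
      by_cases h4 : f = s
      · rw [h4, s5]; exact e4
      have : σ f = f := by simp only [σ, Equiv.Perm.mul_apply, Equiv.swap_apply_def]; grind
      rw [this]; exact hR.refl _)

/-- The diagram `X` of relation (IHX) for `I = G` and the edge of `x`. -/
def ihxX (h : G.InnerEdge x) : UniDiagram n F :=
  G.conj (Equiv.swap (G.rot (G.rot x)) (G.rot (G.opp x)) *
    Equiv.swap (G.rot (G.opp x)) (G.rot (G.rot (G.opp x))))
    (fun f hf => by
      have h1 := h.isTri_of_ne hf
      rw [sameVertex_iff_ne, sameVertex_iff_ne] at h1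
      simp only [Equiv.Perm.mul_apply, Equiv.swap_apply_def]
      grind)
    (fun f => by
      obtain ⟨xp, xq, xy, xr, xs, pq, py, pr, ps, qy, qr, qs, yr, ys, rs⟩ := h.sixFlags
      have a1 := G.rot_rot_rot x
      have a2 := G.rot_rot_rot (G.opp x)
      set p := G.rot x
      set q := G.rot p
      set r := G.rot (G.opp x)
      set s := G.rot r
      set σ := Equiv.swap q r * Equiv.swap r s with hσ
      have s1 : σ x = x := by simp only [σ, Equiv.Perm.mul_apply, Equiv.swap_apply_def]; grind
      have s2 : σ p = p := by simp only [σ, Equiv.Perm.mul_apply, Equiv.swap_apply_def]; grind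
      have s3 : σ q = r := by simp only [σ, Equiv.Perm.mul_apply, Equiv.swap_apply_def]; grind
      have s4 : σ r = s := by simp only [σ, Equiv.Perm.mul_apply, Equiv.swap_apply_def]; grind
      have s5 : σ s = q := by simp only [σ, Equiv.Perm.mul_apply, Equiv.swap_apply_def]; grind
      have s6 : σ (G.opp x) = G.opp x := by
        simp only [σ, Equiv.Perm.mul_apply, Equiv.swap_apply_def]; grind
      set R := Relation.EqvGen fun a b => b = G.opp a ∨ b = σ (G.rot (σ.symm a))
      have hR : Equivalence R := Relation.EqvGen.is_equivalence _
      have r1 : ∀ a, R (σ a) (σ (G.rot a)) := fun a => .rel _ _ (Or.inr (by simp))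
      have r2 : R x (G.opp x) := .rel _ _ (Or.inl rfl)
      have e1 : R x p := by have := r1 x; rwa [s1, s2] at this
      have e2 : R p r := by have := r1 p; rwa [s2, s3] at this
      have e3 : R (G.opp x) s := by have := r1 (G.opp x); rwa [s6, s4] at this
      have e4 : R s q := by have := r1 r; rwa [s4, s5] at this
      have e5 := hR.trans (hR.symm (hR.trans e1 e2)) (hR.trans r2 e3)
      by_cases h2 : f = q
      · rw [h2, s3]; exact hR.symm (hR.trans e5 e4)
      by_cases h3 : f = r
      · rw [h3, s4]; exact e5
      by_cases h4 : f = s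
      · rw [h4, s5]; exact e4
      have : σ f = f := by simp only [σ, Equiv.Perm.mul_apply, Equiv.swap_apply_def]; grind
      rw [this]; exact hR.refl _)

theorem ihxH_opp (h : G.InnerEdge x) (f : F) : (ihxH h).opp f = G.opp f := rfl
theorem ihxH_label (h : G.InnerEdge x) (f : F) : (ihxH h).label f = G.label f := rfl
theorem ihxX_opp (h : G.InnerEdge x) (f : F) : (ihxX h).opp f = G.opp f := rfl
theorem ihxX_label (h : G.InnerEdge x) (f : F) : (ihxX h).label f = G.label f := rfl

theorem symm_mul_swap (a b c d e f z : F) :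
    (Equiv.swap a b * Equiv.swap c d * Equiv.swap e f).symm z
    = Equiv.swap e f (Equiv.swap c d (Equiv.swap a b z)) := by
  rw [Equiv.symm_apply_eq]; simp

theorem symm_mul_swap' (a b c d z : F) : (Equiv.swap a b * Equiv.swap c d).symm z
    = Equiv.swap c d (Equiv.swap a b z) := by
  rw [Equiv.symm_apply_eq]; simp

theorem ihxH_rot (h : G.InnerEdge x) (f : F) : (ihxH h).rot f =
    if f = x then G.rot (G.rot x) else
    if f = G.rot (G.rot x) then G.rot (G.opp x) else
    if f = G.rot (G.opp x) then x else
    if f = G.opp x then G.rot (G.rot (G.opp x)) else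
    if f = G.rot (G.rot (G.opp x)) then G.rot x else
    if f = G.rot x then G.opp x else G.rot f := by
  change (Equiv.swap (G.rot x) (G.rot (G.rot x)) *
    Equiv.swap (G.rot (G.rot x)) (G.rot (G.opp x)) *
    Equiv.swap (G.rot (G.opp x)) (G.rot (G.rot (G.opp x)))) (G.rot (Equiv.symm _ f)) = _
  obtain ⟨xp, xq, xy, xr, xs, pq, py, pr, ps, qy, qr, qs, yr, ys, rs⟩ := h.sixFlags
  have a := G.rot_rot_rot
  rw [symm_mul_swap]
  simp only [Equiv.Perm.mul_apply]
  split_ifs <;> simp only [Equiv.swap_apply_def] <;> grind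

theorem ihxX_rot (h : G.InnerEdge x) (f : F) : (ihxX h).rot f =
    if f = x then G.rot x else
    if f = G.rot x then G.rot (G.opp x) else
    if f = G.rot (G.opp x) then x else
    if f = G.opp x then G.rot (G.rot (G.opp x)) else
    if f = G.rot (G.rot (G.opp x)) then G.rot (G.rot x) else
    if f = G.rot (G.rot x) then G.opp x else G.rot f := by
  change (Equiv.swap (G.rot (G.rot x)) (G.rot (G.opp x)) *
    Equiv.swap (G.rot (G.opp x)) (G.rot (G.rot (G.opp x)))) (G.rot (Equiv.symm _ f)) = _
  obtain ⟨xp, xq, xy, xr, xs, pq, py, pr, ps, qy, qr, qs, yr, ys, rs⟩ := h.sixFlags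
  have a := G.rot_rot_rot
  rw [symm_mul_swap']
  simp only [Equiv.Perm.mul_apply, Equiv.swap_apply_def]
  grind

theorem isIHX (h : G.InnerEdge x) : IsIHX G (ihxH h) (ihxX h) x (G.rot x) (G.rot (G.rot x))
    (G.rot (G.opp x)) (G.rot (G.rot (G.opp x))) := by
  obtain ⟨xp, xq, xy, xr, xs, pq, py, pr, ps, qy, qr, qs, yr, ys, rs⟩ := h.sixFlags
  refine ⟨h.isTri, h.isTri_opp, h.not_same, rfl, rfl, rfl, rfl, rfl, rfl, ?_, ?_, ?_, ?_, ?_,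
    rfl, rfl, ?_, ?_, ?_, ?_, ?_⟩
  all_goals
    simp only [ihxH_rot, ihxX_rot, sameVertex_iff_ne]
    grind

theorem _root_.DiagramAlgebra.IsIHX.innerEdge {I H X : UniDiagram n F} {x p q r s : F}
    (h : IsIHX I H X x p q r s) : I.InnerEdge x := ⟨h.isTri, h.isTri_opp, h.not_same⟩

theorem _root_.DiagramAlgebra.IsIHX.eq {I H X : UniDiagram n F} {x p q r s : F}
    (h : IsIHX I H X x p q r s) : p = I.rot x ∧ q = I.rot (I.rot x) ∧ r = I.rot (I.opp x) ∧
      s = I.rot (I.rot (I.opp x)) ∧ H = ihxH h.innerEdge ∧ X = ihxX h.innerEdge := by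
  have h1 := h.innerEdge.sixFlags
  have h4 := h.rotH_old
  have h5 := h.rotX_old
  have h6 := h.rotH_x
  have h7 := h.rotH_q
  have h8 := h.rotH_y
  have h9 := h.rotH_s
  have h10 := h.rotX_x
  have h11 := h.rotX_p
  have h12 := h.rotX_y
  have h13 := h.rotX_s
  have h14 := H.rot_rot_rot
  have h15 := X.rot_rot_rot
  obtain ⟨xp, xq, xy, xr, xs, pq, py, pr, ps, qy, qr, qs, yr, ys, rs⟩ := h1
  have hp := h.rot_x
  have hq := h.rot_p
  have hr := h.rot_y
  have hs := h.rot_r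
  subst hp hq hr hs
  refine ⟨rfl, rfl, rfl, rfl, ?_, ?_⟩
  · ext f
    · rw [ihxH_opp, h.oppH]
    · rw [ihxH_rot]
      simp only [sameVertex_iff_ne] at h4
      grind
    · rw [ihxH_label, h.labelH]
  · ext f
    · rw [ihxX_opp, h.oppX]
    · rw [ihxX_rot]
      simp only [sameVertex_iff_ne] at h5
      grind
    · rw [ihxX_label, h.labelX]

end

end UniDiagram

namespace UniDiagram

/-! ### Isomorphisms -/

section
variable {G : UniDiagram n F} {G' : UniDiagram n F'} {φ : F ≃ F'}

theorem IsIso.sameVertex (h : IsIso G G' φ) (f g : F) :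
    G'.SameVertex (φ f) (φ g) ↔ G.SameVertex f g := by
  simp only [SameVertex, h.rot, φ.injective.eq_iff]

theorem IsIso.isTri (h : IsIso G G' φ) (f : F) : G'.IsTri (φ f) ↔ G.IsTri f := by
  simp only [IsTri, h.rot, ne_eq, φ.injective.eq_iff]

theorem IsIso.innerEdge (h : IsIso G G' φ) {x : F} (hx : G.InnerEdge x) :
    G'.InnerEdge (φ x) :=
  ⟨(h.isTri x).2 hx.isTri, by rw [h.opp, h.isTri]; exact hx.isTri_opp, by
    rw [h.opp, h.sameVertex]; exact hx.not_same⟩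

theorem IsIso.flip (h : IsIso G G' φ) (v : F) : IsIso (G.flip v) (G'.flip (φ v)) φ := by
  refine ⟨fun f => h.opp f, fun f => ?_, fun f => h.label f⟩
  simp only [flip_rot, h.sameVertex, h.rot, apply_ite φ]

theorem IsIso.ihxH (h : IsIso G G' φ) {x : F} (hx : G.InnerEdge x) (hx' : G'.InnerEdge (φ x)) :
    IsIso (ihxH hx) (ihxH hx') φ := by
  refine ⟨fun f => h.opp f, fun f => ?_, fun f => h.label f⟩
  simp only [ihxH_rot, h.rot, h.opp, φ.injective.eq_iff, apply_ite φ]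

theorem IsIso.ihxX (h : IsIso G G' φ) {x : F} (hx : G.InnerEdge x) (hx' : G'.InnerEdge (φ x)) :
    IsIso (ihxX hx) (ihxX hx') φ := by
  refine ⟨fun f => h.opp f, fun f => ?_, fun f => h.label f⟩
  simp only [ihxX_rot, h.rot, h.opp, φ.injective.eq_iff, apply_ite φ]

end

/-! ### Joining two legs -/

/-- `l` and `r` are two different legs. -/
structure LegPair (G : UniDiagram n F) (l r : F) : Prop where
  left : G.rot l = l
  right : G.rot r = r
  ne : l ≠ r

theorem LegPair.symm {G : UniDiagram n F} {l r : F} (h : G.LegPair l r) : G.LegPair r l :=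
  ⟨h.right, h.left, h.ne.symm⟩

theorem LegOrder.Consec.legPair {G : UniDiagram n F} {w : LegOrder G} {l r : F}
    (h : w.Consec l r) : G.LegPair l r := ⟨h.rot_left, h.rot_right, h.ne⟩

open StemFlag in
/-- Join the legs `l` and `r` in a new trivalent vertex with a new leg, as in the diagram `S` of
relation (STU). -/
def join (G : UniDiagram n F) (l r : F) (h : G.LegPair l r) : UniDiagram n (F ⊕ StemFlag) where
  opp
    | .inl f => .inl (G.opp f)
    | .inr stem => .inr foot
    | .inr foot => .inr stem
  opp_opp f := by rcases f with f | (_ | _) <;> simp [G.opp_opp]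
  opp_ne f := by rcases f with f | (_ | _) <;> simp [G.opp_ne]
  rot
    | .inl f => if f = l then .inr stem else if f = r then .inl l else .inl (G.rot f)
    | .inr stem => .inl r
    | .inr foot => .inr foot
  rot_rot_rot f := by
    have hne := h.ne
    have h1 := h.left
    have h2 := h.right
    have h3 := G.rot_injective
    have h4 := G.rot_rot_rot
    rcases f with f | (_ | _)
    · by_cases hl : f = l
      · simp [hl, hne.symm]
      by_cases hr : f = r
      · simp [hr, hne.symm]
      have e1 : G.rot f ≠ l := fun e => hl (h3 (e.trans h1.symm))
      have e2 : G.rot f ≠ r := fun e => hr (h3 (e.trans h2.symm))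
      have e3 : G.rot (G.rot f) ≠ l := fun e => e1 (h3 (e.trans h1.symm))
      have e4 : G.rot (G.rot f) ≠ r := fun e => e2 (h3 (e.trans h2.symm))
      simp [hl, hr, e1, e2, e3, e4, h4]
    · simp [hne.symm]
    · rfl
  label
    | .inl f => if f = l ∨ f = r then none else G.label f
    | .inr stem => none
    | .inr foot => G.label l
  label_isSome f := by
    have hne := h.ne
    rcases f with f | (_ | _)
    · by_cases hl : f = l
      · simp [hl]
      by_cases hr : f = r
      · simp [hr, hne.symm, hne]
      simp only [hl, hr, or_self, if_false, G.label_isSome, Sum.inl.injEq]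
    · simp
    · simp only [G.label_isSome, h.left]
  exists_leg f := by
    have hne := h.ne
    set R := Relation.EqvGen fun a b : F ⊕ StemFlag => b = (match a with
      | .inl f => .inl (G.opp f)
      | .inr stem => .inr foot
      | .inr foot => .inr stem) ∨ b = (match a with
      | .inl f => if f = l then .inr stem else if f = r then .inl l else .inl (G.rot f)
      | .inr stem => .inl r
      | .inr foot => .inr foot)
    have hR : Equivalence R := Relation.EqvGen.is_equivalence _
    have e1 : R (.inr stem) (.inr foot) := .rel _ _ (Or.inl rfl)
    have e2 : R (.inl l) (.inr stem) := .rel _ _ (Or.inr (by simp))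
    have e3 : R (.inl r) (.inl l) := .rel _ _ (Or.inr (by simp [hne.symm]))
    rcases f with f | (_ | _)
    · obtain ⟨u, hu, hfu⟩ := G.exists_leg f
      have h1 : R (.inl f) (.inl u) := by
        refine eqvGen_map Sum.inl ?_ hfu
        rintro a b (rfl | rfl)
        · exact .rel _ _ (Or.inl rfl)
        · by_cases hl : a = l
          · rw [hl, h.left]; exact .refl _
          by_cases hr : a = r
          · rw [hr, h.right]; exact .refl _
          exact .rel _ _ (Or.inr (by simp [hl, hr]))
      by_cases hl : u = l
      · exact ⟨.inr foot, rfl, hR.trans h1 (hl ▸ hR.trans e2 e1)⟩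
      by_cases hr : u = r
      · exact ⟨.inr foot, rfl, hR.trans h1 (hr ▸ hR.trans e3 (hR.trans e2 e1))⟩
      exact ⟨.inl u, by simp [hl, hr, hu], h1⟩
    · exact ⟨.inr foot, rfl, e1⟩
    · exact ⟨.inr foot, rfl, .refl _⟩

section
variable {G : UniDiagram n F} {l r : F} (h : G.LegPair l r)

open StemFlag

@[simp] theorem join_opp_inl (f : F) : (G.join l r h).opp (.inl f) = .inl (G.opp f) := rfl
@[simp] theorem join_opp_stem : (G.join l r h).opp (.inr stem) = .inr foot := rfl
@[simp] theorem join_opp_foot : (G.join l r h).opp (.inr foot) = .inr stem := rfl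
theorem join_rot_inl (f : F) : (G.join l r h).rot (.inl f) =
    if f = l then .inr stem else if f = r then .inl l else .inl (G.rot f) := rfl
@[simp] theorem join_rot_left : (G.join l r h).rot (.inl l) = .inr stem := by
  simp [join_rot_inl]
@[simp] theorem join_rot_right : (G.join l r h).rot (.inl r) = .inl l := by
  simp [join_rot_inl, h.ne.symm]
theorem join_rot_of_ne {f : F} (hl : f ≠ l) (hr : f ≠ r) :
    (G.join l r h).rot (.inl f) = .inl (G.rot f) := by
  simp [join_rot_inl, hl, hr]
@[simp] theorem join_rot_stem : (G.join l r h).rot (.inr stem) = .inl r := rfl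
@[simp] theorem join_rot_foot : (G.join l r h).rot (.inr foot) = .inr foot := rfl
theorem join_label_inl (f : F) : (G.join l r h).label (.inl f) =
    if f = l ∨ f = r then none else G.label f := rfl
@[simp] theorem join_label_stem : (G.join l r h).label (.inr stem) = none := rfl
@[simp] theorem join_label_foot : (G.join l r h).label (.inr foot) = G.label l := rfl

/-- The place of a leg of `join`: the new leg is at the place of `l`. -/
def place (l : F) : F ⊕ StemFlag → F
  | .inl f => f
  | .inr _ => l

/-- The order on the legs of `join` in which the new leg is at the place of `l`. -/
def LegOrder.join (w : LegOrder G) (h : G.LegPair l r) : LegOrder (G.join l r h) :=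
  w.pull (place l) (fun _ => 0)
    (fun f i hf => by
      rcases f with f | (_ | _)
      · rw [join_label_inl] at hf
        split_ifs at hf
        exact hf
      · exact absurd hf (by simp)
      · exact hf)
    (fun f g i hf hg hfg _ => by
      rcases f with f | (_ | _) <;> rcases g with g | (_ | _) <;>
        simp_all [place, join_label_inl])

theorem LegOrder.join_lt (w : LegOrder G) (f g : F ⊕ StemFlag) : (w.join h).lt f g ↔
    (∃ i, (G.join l r h).label f = some i ∧ (G.join l r h).label g = some i) ∧
      w.lt (place l f) (place l g) := by
  change (_ ∧ (_ ∨ _ ∧ 0 < 0)) ↔ _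
  simp

theorem LegOrder.join_lt_inl (w : LegOrder G) {f g : F} (h1 : f ≠ l) (h2 : f ≠ r)
    (h3 : g ≠ l) (h4 : g ≠ r) : (w.join h).lt (.inl f) (.inl g) ↔ w.lt f g := by
  rw [join_lt]
  simp only [join_label_inl, h1, h2, h3, h4, or_self, if_false, place, and_iff_right_iff_imp]
  exact w.label_of_lt _ _

theorem LegOrder.join_lt_foot (w : LegOrder G) {f : F} (h1 : f ≠ l) (h2 : f ≠ r) :
    (w.join h).lt (.inl f) (.inr foot) ↔ w.lt f l := by
  rw [join_lt]
  simp only [join_label_inl, join_label_foot, h1, h2, or_self, if_false, place,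
    and_iff_right_iff_imp]
  exact w.label_of_lt _ _

theorem LegOrder.join_foot_lt (w : LegOrder G) {f : F} (h1 : f ≠ l) (h2 : f ≠ r) :
    (w.join h).lt (.inr foot) (.inl f) ↔ w.lt l f := by
  rw [join_lt]
  simp only [join_label_inl, join_label_foot, h1, h2, or_self, if_false, place,
    and_iff_right_iff_imp]
  exact w.label_of_lt _ _

end

end UniDiagram

/-- The class of the trivalent diagram given by `G` and the order `w` of its legs. -/
def tri [Finite F] (G : UniDiagram n F) (w : LegOrder G) : TriClass n := triClass ⟨G, w⟩

theorem TriDiagram.ext' {D D' : TriDiagram n F} (h : D.graph = D'.graph)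
    (hl : ∀ f g, D.ord.lt f g ↔ D'.ord.lt f g) : D = D' := by
  obtain ⟨G, w⟩ := D
  obtain ⟨G', w'⟩ := D'
  simp only at h hl
  subst h
  congr 1
  ext f g
  exact hl f g

section
variable [Finite F] [Finite F'] {G : UniDiagram n F} {G' : UniDiagram n F'}

theorem tri_eq_of_iso {φ : F ≃ F'} (h : IsIso G G' φ) {w : LegOrder G} {w' : LegOrder G'}
    (hw : ∀ f g, w'.lt (φ f) (φ g) ↔ w.lt f g) : tri G w = tri G' w' :=
  Quotient.sound ⟨φ, h, hw⟩

theorem tri_comap {φ : F ≃ F'} (h : IsIso G G' φ) (w' : LegOrder G') :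
    tri G (w'.comap φ φ.injective h.label) = tri G' w' :=
  tri_eq_of_iso h fun _ _ => Iff.rfl

theorem uniClass_eq_of_iso {φ : F ≃ F'} (h : IsIso G G' φ) : uniClass G = uniClass G' :=
  Quotient.sound ⟨φ, h⟩

end

section
variable {G : UniDiagram n F} {G' : UniDiagram n F'}

open StemFlag in
theorem isSTU_join {w : LegOrder G} {l r : F} (hc : w.Consec l r) :
    IsSTU ⟨G.join l r hc.legPair, w.join hc.legPair⟩ ⟨G, w⟩ ⟨G, w.swap l r⟩ l r where
  lt := hc.lt
  consecutive := hc.not_between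
  graph_eq := rfl
  lt_iff f g := swap_lt_iff _ hc.label _ _
  opp_old _ := rfl
  opp_stem := rfl
  rot_stem := rfl
  rot_right := join_rot_right hc.legPair
  rot_left := join_rot_left hc.legPair
  rot_old f h1 h2 := join_rot_of_ne hc.legPair h1 h2
  label_foot := rfl
  label_old f h1 h2 := by simp [join_label_inl, h1, h2]
  lt_old f g h1 h2 h3 h4 := join_lt_inl _ _ h1 h2 h3 h4
  lt_foot f h1 h2 := join_lt_foot _ _ h1 h2
  foot_lt f h1 h2 := join_foot_lt _ _ h1 h2

open StemFlag in
/-- The diagrams `S` and `U` of relation (STU) are determined by `T`. -/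
theorem IsSTU.exists_consec {S : TriDiagram n (F ⊕ StemFlag)} {T U : TriDiagram n F} {l r : F}
    (h : IsSTU S T U l r) : ∃ hc : T.ord.Consec l r,
      S = ⟨T.graph.join l r hc.legPair, T.ord.join hc.legPair⟩ ∧
      U = ⟨T.graph, T.ord.swap l r⟩ := by
  have hc : T.ord.Consec l r := ⟨h.lt, h.consecutive⟩
  refine ⟨hc, ?_, ?_⟩
  · have hfoot : S.graph.rot (.inr foot) = .inr foot := by
      obtain ⟨i, hi⟩ := T.graph.exists_label hc.rot_left
      exact S.graph.rot_eq_of_label (h.label_foot.trans hi)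
    have hg : S.graph = T.graph.join l r hc.legPair := by
      ext1 f
      · rcases f with f | (_ | _)
        · exact h.opp_old f
        · exact h.opp_stem
        · have hs := S.graph.opp_opp (.inr stem)
          rwa [h.opp_stem] at hs
      · rcases f with f | (_ | _)
        · by_cases hl : f = l
          · rw [hl, h.rot_left, join_rot_left]
          by_cases hr : f = r
          · rw [hr, h.rot_right, join_rot_right]
          rw [h.rot_old f hl hr, join_rot_of_ne _ hl hr]
        · exact h.rot_stem
        · exact hfoot
      · rcases f with f | (_ | _)
        · rw [join_label_inl]
          split_ifs with hf
          · refine S.graph.label_eq_none ?_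
            rcases hf with rfl | rfl
            · rw [h.rot_left]; simp
            · rw [h.rot_right]; simp [hc.ne]
          · rw [not_or] at hf
            exact h.label_old f hf.1 hf.2
        · refine S.graph.label_eq_none ?_
          rw [h.rot_stem]; simp
        · exact h.label_foot
    refine TriDiagram.ext' hg fun f g => ?_
    have hS : ∀ {f g}, S.ord.lt f g → ∃ i, (T.graph.join l r hc.legPair).label f = some i ∧
        (T.graph.join l r hc.legPair).label g = some i := fun {f g} hlt => by
      have := S.ord.label_of_lt _ _ hlt
      rwa [hg] at this
    have key : ((∃ i, (T.graph.join l r hc.legPair).label f = some i ∧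
        (T.graph.join l r hc.legPair).label g = some i) →
        (S.ord.lt f g ↔ (T.ord.join hc.legPair).lt f g)) →
        (S.ord.lt f g ↔ (T.ord.join hc.legPair).lt f g) := fun hk =>
      ⟨fun hlt => (hk (hS hlt)).1 hlt, fun hlt =>
        (hk ((T.ord.join hc.legPair).label_of_lt _ _ hlt)).2 hlt⟩
    refine key ?_
    rintro ⟨i, h1, h2⟩
    rcases f with f | (_ | _)
    · have hf : f ≠ l ∧ f ≠ r := by
        rw [join_label_inl] at h1
        split_ifs at h1 with hf
        exact not_or.1 hf
      rcases g with g | (_ | _)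
      · have hg : g ≠ l ∧ g ≠ r := by
          rw [join_label_inl] at h2
          split_ifs at h2 with hg
          exact not_or.1 hg
        exact (h.lt_old f g hf.1 hf.2 hg.1 hg.2).trans
          (join_lt_inl hc.legPair T.ord hf.1 hf.2 hg.1 hg.2).symm
      · simp at h2
      · exact (h.lt_foot f hf.1 hf.2).trans (join_lt_foot hc.legPair T.ord hf.1 hf.2).symm
    · simp at h1
    · rcases g with g | (_ | _)
      · have hg : g ≠ l ∧ g ≠ r := by
          rw [join_label_inl] at h2
          split_ifs at h2 with hg
          exact not_or.1 hg
        exact (h.foot_lt g hg.1 hg.2).trans (join_foot_lt hc.legPair T.ord hg.1 hg.2).symm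
      · simp at h2
      · exact ⟨fun h => absurd h (S.ord.irrefl _), fun h => absurd h (LegOrder.irrefl _ _)⟩
  · refine TriDiagram.ext' h.graph_eq fun f g => ?_
    exact (h.lt_iff f g).trans (swap_lt_iff T.ord hc.label f g).symm

end

section
variable {G : UniDiagram n F} {G' : UniDiagram n F'}

/-- An isomorphism extends to the diagrams obtained by joining two legs. -/
theorem UniDiagram.IsIso.join {φ : F ≃ F'} (h : IsIso G G' φ) {l r : F} (hl : G.LegPair l r)
    (hl' : G'.LegPair (φ l) (φ r)) :
    IsIso (G.join l r hl) (G'.join (φ l) (φ r) hl') (Equiv.sumCongr φ (Equiv.refl _)) := by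
  refine ⟨fun f => ?_, fun f => ?_, fun f => ?_⟩
  · rcases f with f | (_ | _) <;> simp [h.opp]
  · rcases f with f | (_ | _)
    · simp only [Equiv.sumCongr_apply, Sum.map_inl, join_rot_inl, φ.injective.eq_iff]
      split_ifs <;> simp [h.rot]
    · rfl
    · rfl
  · rcases f with f | (_ | _)
    · simp only [Equiv.sumCongr_apply, Sum.map_inl, join_label_inl, φ.injective.eq_iff, h.label]
    · rfl
    · exact h.label l

theorem tri_join_eq [Finite F] [Finite F'] {φ : F ≃ F'} (h : IsIso G G' φ) {l r : F}
    (hl : G.LegPair l r) (hl' : G'.LegPair (φ l) (φ r)) {w : LegOrder G} {w' : LegOrder G'}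
    (hw : ∀ f g, w'.lt (φ f) (φ g) ↔ w.lt f g) :
    tri (G.join l r hl) (w.join hl) = tri (G'.join (φ l) (φ r) hl') (w'.join hl') := by
  refine tri_eq_of_iso (h.join hl hl') fun f g => ?_
  rw [join_lt, join_lt, (h.join hl hl').label, (h.join hl hl').label]
  have hp : ∀ f, place (φ l) (Equiv.sumCongr φ (Equiv.refl _) f) = φ (place l f) := by
    rintro (f | _) <;> rfl
  rw [hp, hp, hw]

end

/-! ### Cutting off a leg at a trivalent vertex -/

namespace UniDiagram

variable (G : UniDiagram n F)

variable {G} in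
theorem eq_opp_of_opp_eq {f z : F} (h : G.opp f = z) : f = G.opp z := by rw [← h, G.opp_opp]

variable {G} in
theorem sameVertex_of_rot_eq {f z : F} (h : G.rot f = z) : G.SameVertex z f := by
  rw [← h]; exact Or.inr (Or.inr (G.rot_rot_rot _).symm)

theorem IsTri.opp_ne_rot {G : UniDiagram n F} {z : F} (hz : G.IsTri z)
    (hleg : G.rot (G.opp z) = G.opp z) {f : F} (h : G.SameVertex z f) : f ≠ G.opp z := fun h' =>
  (h.isTri hz) (by rw [h', hleg])

open StemFlag in
/-- The diagram obtained from `G` by deleting a leg `z`--`opp z` at a trivalent vertex; the two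
other flags of the vertex become legs. -/
def unjoin (z : F) (hleg : G.rot (G.opp z) = G.opp z) :
    UniDiagram n {f : F // f ≠ z ∧ f ≠ G.opp z} where
  opp f := ⟨G.opp f.1, fun h => f.2.2 (eq_opp_of_opp_eq h),
    fun h => f.2.1 (G.opp_injective h)⟩
  opp_opp f := Subtype.ext (G.opp_opp _)
  opp_ne f h := G.opp_ne _ (congrArg Subtype.val h)
  rot f := if h : G.SameVertex z f.1 then f else
    ⟨G.rot f.1, fun h' => h (sameVertex_of_rot_eq h'),
      fun h' => f.2.2 (G.rot_injective (h'.trans hleg.symm))⟩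
  rot_rot_rot f := by
    by_cases h : G.SameVertex z f.1
    · simp [h]
    · have h1 : ¬ G.SameVertex z (G.rot f.1) := fun h' => h (by
          simpa only [G.rot_rot_rot] using h'.rot.rot)
      have h2 : ¬ G.SameVertex z (G.rot (G.rot f.1)) := fun h' => h (by
          simpa only [G.rot_rot_rot] using h'.rot)
      simp [h, h1, h2, G.rot_rot_rot]
  label f := if G.SameVertex z f.1 then G.label (G.opp z) else G.label f.1
  label_isSome f := by
    by_cases h : G.SameVertex z f.1
    · simp only [if_pos h, dif_pos h, iff_true]
      rw [G.label_isSome, hleg]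
    · simp only [if_neg h, dif_neg h, G.label_isSome, Subtype.ext_iff]
  exists_leg := by
    rintro ⟨f, hf⟩
    by_contra hcon
    push Not at hcon
    set T : {f : F // f ≠ z ∧ f ≠ G.opp z} → {f : F // f ≠ z ∧ f ≠ G.opp z} :=
      fun f => if h : G.SameVertex z f.1 then f else
        ⟨G.rot f.1, fun h' => h (sameVertex_of_rot_eq h'),
          fun h' => f.2.2 (G.rot_injective (h'.trans hleg.symm))⟩ with hT
    set R := Relation.EqvGen fun a b : {f : F // f ≠ z ∧ f ≠ G.opp z} =>
      b = ⟨G.opp a.1, fun h => a.2.2 (eq_opp_of_opp_eq h),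
        fun h => a.2.1 (G.opp_injective h)⟩ ∨ b = T a with hR
    -- a component without legs does not meet the cut vertex, so it is a component of `G`
    have hns : ∀ g, R ⟨f, hf⟩ g → ¬ G.SameVertex z g.1 := fun g hg h => by
      refine hcon g ?_ hg
      simp only [dif_pos h]
    obtain ⟨u, hu, hfu⟩ := G.exists_leg f
    have key := (SameComponent.closed (G := G) (p := fun g => ∃ hg, R ⟨f, hf⟩ ⟨g, hg⟩) ?_ ?_ hfu).1
      ⟨hf, .refl _⟩
    · obtain ⟨hu', hR'⟩ := key
      refine hcon _ ?_ hR'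
      have h := hns _ hR'
      simp only [dif_neg h, hu]
    · rintro g ⟨hg, hRg⟩
      exact ⟨_, .trans _ _ _ hRg (.rel _ _ (Or.inl rfl))⟩
    · rintro g ⟨hg, hRg⟩
      have h := hns _ hRg
      refine ⟨?_, .trans _ _ _ hRg (.rel _ _ (Or.inr ?_))⟩
      · exact ⟨fun h' => h (sameVertex_of_rot_eq h'),
          fun h' => hg.2 (G.rot_injective (h'.trans hleg.symm))⟩
      · simp only [hT, dif_neg h]

open StemFlag in
/-- A diagram with a leg at a trivalent vertex is the diagram `S` of a relation (STU). -/
theorem exists_unjoin [Finite F] (w : LegOrder G) (z : F) (hz : G.IsTri z)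
    (hleg : G.rot (G.opp z) = G.opp z) :
    ∃ (F₀ : Type) (_ : Finite F₀) (T : UniDiagram n F₀) (u : LegOrder T) (l r : F₀)
      (hc : u.Consec l r) (φ : F₀ ⊕ StemFlag ≃ F), IsIso (T.join l r hc.legPair) G φ ∧
      φ (.inr stem) = z ∧ ∀ f g, w.lt (φ f) (φ g) ↔ (u.join hc.legPair).lt f g := by
  have hv : ∀ {f : F}, G.SameVertex z f → f ≠ G.opp z := fun h => hz.opp_ne_rot hleg h
  have hzo : z ≠ G.opp z := (G.opp_ne z).symm
  have a3 := G.rot_rot_rot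
  set T := G.unjoin z hleg with hT
  let l : {f : F // f ≠ z ∧ f ≠ G.opp z} := ⟨G.rot (G.rot z), hz.rot_rot_ne,
    hv (Or.inr (Or.inr rfl))⟩
  let r : {f : F // f ≠ z ∧ f ≠ G.opp z} := ⟨G.rot z, hz, hv (Or.inr (Or.inl rfl))⟩
  have hlr : l ≠ r := fun h => hz.rot (congrArg Subtype.val h)
  have hsv : ∀ f : {f : F // f ≠ z ∧ f ≠ G.opp z}, G.SameVertex z f.1 ↔ f = l ∨ f = r := by
    intro f
    constructor
    · rintro (h | h | h)
      · exact absurd h f.2.1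
      · exact Or.inr (Subtype.ext h)
      · exact Or.inl (Subtype.ext h)
    · rintro (h | h)
      · exact Or.inr (Or.inr (congrArg Subtype.val h))
      · exact Or.inr (Or.inl (congrArg Subtype.val h))
  have hTl : ∀ f, T.label f = if f = l ∨ f = r then G.label (G.opp z) else G.label f.1 := by
    intro f
    change (if G.SameVertex z f.1 then _ else _) = _
    simp only [hsv]
  have hTr : ∀ f, T.rot f = if f = l ∨ f = r then f else T.rot f := by
    intro f
    split_ifs with h
    · change dite _ _ _ = _
      rw [dif_pos ((hsv f).2 h)]
    · rfl
  have hTr' : ∀ f, ¬ (f = l ∨ f = r) → (T.rot f).1 = G.rot f.1 := by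
    intro f h
    rw [← hsv] at h
    change (dite _ _ _ : {f : F // f ≠ z ∧ f ≠ G.opp z}).1 = _
    rw [dif_neg h]
  let e : {f : F // f ≠ z ∧ f ≠ G.opp z} → F := fun f => if f = l ∨ f = r then G.opp z else f.1
  let k : {f : F // f ≠ z ∧ f ≠ G.opp z} → ℕ := fun f => if f = r then 1 else 0
  let u : LegOrder T := w.pull e k
    (fun f i h => by
      rw [hTl] at h
      simp only [e]
      split_ifs at h ⊢
      · exact h
      · exact h)
    (fun f g i _ _ h1 h2 => by
      have := f.2.2
      have := g.2.2
      simp only [e, k] at h1 h2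
      grind)
  have hu : ∀ f g, u.lt f g ↔ (∃ i, T.label f = some i ∧ T.label g = some i) ∧
      (w.lt (e f) (e g) ∨ e f = e g ∧ k f < k g) := fun f g => Iff.rfl
  obtain ⟨i, hi⟩ := G.exists_label hleg
  have hel : e l = G.opp z := by simp [e]
  have her : e r = G.opp z := by simp [e]
  have hee : ∀ f, f ≠ l → f ≠ r → e f = f.1 := fun f h1 h2 => by simp [e, h1, h2]
  have hlabl : T.label l = some i := by rw [hTl]; simp [hi]
  have hlabr : T.label r = some i := by rw [hTl]; simp [hi]
  have hc : u.Consec l r := by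
    refine ⟨⟨⟨i, hlabl, hlabr⟩, Or.inr ⟨hel.trans her.symm, by simp [k, hlr]⟩⟩, ?_⟩
    rintro f ⟨h1, h2⟩
    rw [hu, hel] at h1
    rw [hu, her] at h2
    have hw := w.asymm (f := e f) (g := G.opp z)
    have hw' := w.irrefl (G.opp z)
    have hne := f.2.2
    simp only [k] at h1 h2
    by_cases hfl : f = l
    · rw [hfl, hel] at h1; simp [hw', hlr] at h1
    by_cases hfr : f = r
    · rw [hfr, her] at h2; simp [hw'] at h2
    simp only [hfr, if_false] at h1 h2
    rcases h1.2 with h1 | h1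
    · rcases h2.2 with h2 | h2
      · exact hw h2 h1
      · exact hw' (h2.1 ▸ h1)
    · omega
  let φ : {f : F // f ≠ z ∧ f ≠ G.opp z} ⊕ StemFlag → F := fun f => match f with
    | .inl f => f.1
    | .inr stem => z
    | .inr foot => G.opp z
  have hφ : Function.Bijective φ := by
    constructor
    · rintro (f | (_ | _)) (g | (_ | _)) h
      · exact congrArg _ (Subtype.ext h)
      · exact absurd h f.2.1
      · exact absurd h f.2.2
      · exact absurd h.symm g.2.1
      · rfl
      · exact absurd h hzo
      · exact absurd h.symm g.2.2
      · exact absurd h.symm hzo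
      · rfl
    · intro f
      by_cases h1 : f = z
      · exact ⟨.inr stem, h1.symm⟩
      by_cases h2 : f = G.opp z
      · exact ⟨.inr foot, h2.symm⟩
      · exact ⟨.inl ⟨f, h1, h2⟩, rfl⟩
  have hiso : IsIso (T.join l r hc.legPair) G (Equiv.ofBijective φ hφ) := by
    refine ⟨fun f => ?_, fun f => ?_, fun f => ?_⟩
    · rcases f with f | (_ | _)
      · rfl
      · rfl
      · exact G.opp_opp z
    · rcases f with f | (_ | _)
      · simp only [Equiv.ofBijective_apply, join_rot_inl]
        split_ifs with h1 h2
        · rw [h1]; exact a3 z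
        · rw [h2]
        · exact (hTr' f (by tauto)).symm
      · rfl
      · exact hleg
    · rcases f with f | (_ | _)
      · simp only [Equiv.ofBijective_apply, join_label_inl]
        rw [hTl]
        split_ifs with h1
        · refine G.label_eq_none ?_
          exact ((hsv f).2 h1).isTri hz
        · rfl
      · exact G.label_eq_none hz
      · exact (hi.trans hlabl.symm)
  refine ⟨_, inferInstance, T, u, l, r, hc, Equiv.ofBijective φ hφ, hiso, rfl, fun f g => ?_⟩
  have hS : ∀ {f g}, w.lt (φ f) (φ g) → ∃ i, (T.join l r hc.legPair).label f = some i ∧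
      (T.join l r hc.legPair).label g = some i := fun {f g} hlt => by
    have := w.label_of_lt _ _ hlt
    have hl := hiso.label
    simp only [Equiv.ofBijective_apply] at hl
    rwa [hl, hl] at this
  rw [join_lt]
  simp only [Equiv.ofBijective_apply]
  refine ⟨fun h => ?_, fun h => ?_⟩
  all_goals
    have hlab : ∃ i, (T.join l r hc.legPair).label f = some i ∧
      (T.join l r hc.legPair).label g = some i := by
      first | exact hS h | exact h.1
    have hlab' := hlab
    obtain ⟨j, h1, h2⟩ := hlab
    have hpl : ∀ f j, (T.join l r hc.legPair).label f = some j → e (place l f) = φ f ∧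
        k (place l f) = 0 ∧ T.label (place l f) = some j := by
      rintro (f | (_ | _)) j hj
      · rw [join_label_inl] at hj
        split_ifs at hj with hf
        rw [not_or] at hf
        exact ⟨hee f hf.1 hf.2, by simp [k, place, hf.2], hj⟩
      · simp at hj
      · exact ⟨hel, by simp [k, place, hlr], hj⟩
    obtain ⟨p1, p2, p3⟩ := hpl f j h1
    obtain ⟨q1, q2, q3⟩ := hpl g j h2
  · refine ⟨hlab', ?_⟩
    rw [hu, p1, q1]
    exact ⟨⟨j, p3, q3⟩, Or.inl h⟩
  · have h := h.2
    rw [hu, p1, q1, p2, q2] at h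
    rcases h.2 with h | h
    · exact h
    · omega

/-! ### Insertion of two legs -/

open InsFlag in
/-- Insert two trivalent vertices with legs labeled `i` and `j` into the edge of `x`. -/
def ins (x : F) (i j : Fin n) : UniDiagram n (F ⊕ InsFlag) where
  opp
    | .inl f => if f = x then .inr aIn else if f = G.opp x then .inr bOut else .inl (G.opp f)
    | .inr aIn => .inl x
    | .inr aLeg => .inr aFoot
    | .inr aOut => .inr bIn
    | .inr aFoot => .inr aLeg
    | .inr bIn => .inr aOut
    | .inr bLeg => .inr bFoot
    | .inr bOut => .inl (G.opp x)
    | .inr bFoot => .inr bLeg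
  opp_opp f := by
    have h1 := G.opp_ne x
    rcases f with f | f
    · by_cases hx : f = x
      · simp [hx]
      by_cases hx' : f = G.opp x
      · simp [hx', h1]
      have h2 : G.opp f ≠ x := fun h => hx' (by rw [← h, G.opp_opp])
      have h3 : G.opp f ≠ G.opp x := fun h => hx (G.opp_injective h)
      simp [hx, hx', h2, h3, G.opp_opp]
    · cases f <;> simp [h1]
  opp_ne f := by
    rcases f with f | f
    · by_cases hx : f = x
      · simp [hx]
      by_cases hx' : f = G.opp x
      · simp [hx', G.opp_ne]
      simp [hx, hx', G.opp_ne]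
    · cases f <;> simp
  rot
    | .inl f => .inl (G.rot f)
    | .inr aIn => .inr aLeg
    | .inr aLeg => .inr aOut
    | .inr aOut => .inr aIn
    | .inr aFoot => .inr aFoot
    | .inr bIn => .inr bLeg
    | .inr bLeg => .inr bOut
    | .inr bOut => .inr bIn
    | .inr bFoot => .inr bFoot
  rot_rot_rot f := by
    rcases f with f | f
    · simp [G.rot_rot_rot]
    · cases f <;> rfl
  label
    | .inl f => G.label f
    | .inr aFoot => some i
    | .inr bFoot => some j
    | _ => none
  label_isSome f := by
    rcases f with f | f
    · simp [G.label_isSome]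
    · cases f <;> simp
  exists_leg f := by
    set R := Relation.EqvGen fun a b : F ⊕ InsFlag => b = (match a with
      | .inl f => if f = x then .inr aIn else if f = G.opp x then .inr bOut else .inl (G.opp f)
      | .inr aIn => .inl x
      | .inr aLeg => .inr aFoot
      | .inr aOut => .inr bIn
      | .inr aFoot => .inr aLeg
      | .inr bIn => .inr aOut
      | .inr bLeg => .inr bFoot
      | .inr bOut => .inl (G.opp x)
      | .inr bFoot => .inr bLeg) ∨ b = (match a with
      | .inl f => .inl (G.rot f)
      | .inr aIn => .inr aLeg
      | .inr aLeg => .inr aOut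
      | .inr aOut => .inr aIn
      | .inr aFoot => .inr aFoot
      | .inr bIn => .inr bLeg
      | .inr bLeg => .inr bOut
      | .inr bOut => .inr bIn
      | .inr bFoot => .inr bFoot)
    have hR : Equivalence R := Relation.EqvGen.is_equivalence _
    have e1 : R (.inr aIn) (.inr aLeg) := .rel _ _ (Or.inr rfl)
    have e2 : R (.inr aLeg) (.inr aOut) := .rel _ _ (Or.inr rfl)
    have e3 : R (.inr aOut) (.inr bIn) := .rel _ _ (Or.inl rfl)
    have e4 : R (.inr bIn) (.inr bLeg) := .rel _ _ (Or.inr rfl)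
    have e5 : R (.inr bLeg) (.inr bOut) := .rel _ _ (Or.inr rfl)
    have e6 : R (.inr aLeg) (.inr aFoot) := .rel _ _ (Or.inl rfl)
    have e7 : R (.inr bLeg) (.inr bFoot) := .rel _ _ (Or.inl rfl)
    have e8 : R (.inr aIn) (.inl x) := .rel _ _ (Or.inl rfl)
    have e9 : R (.inr bOut) (.inl (G.opp x)) := .rel _ _ (Or.inl rfl)
    have b4 := hR.trans e4 e7
    have a4 := hR.trans (hR.trans e2 e3) b4
    have a5 := hR.trans (hR.symm e2) e6
    rcases f with f | f
    · obtain ⟨u, hu, hfu⟩ := G.exists_leg f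
      refine ⟨.inl u, congrArg _ hu, eqvGen_map Sum.inl ?_ hfu⟩
      rintro a b (rfl | rfl)
      · by_cases hx : a = x
        · rw [hx]
          exact hR.trans (hR.symm e8) (hR.trans (hR.trans e1 (hR.trans a4 (hR.symm e7)))
            (hR.trans e5 e9))
        by_cases hx' : a = G.opp x
        · rw [hx', G.opp_opp]
          exact hR.symm (hR.trans (hR.symm e8) (hR.trans (hR.trans e1 (hR.trans a4 (hR.symm e7)))
            (hR.trans e5 e9)))
        exact .rel _ _ (Or.inl (by simp [hx, hx']))
      · exact .rel _ _ (Or.inr rfl)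
    · cases f
      · exact ⟨.inr aFoot, rfl, hR.trans e1 e6⟩
      · exact ⟨.inr aFoot, rfl, e6⟩
      · exact ⟨.inr aFoot, rfl, a5⟩
      · exact ⟨.inr aFoot, rfl, hR.refl _⟩
      · exact ⟨.inr bFoot, rfl, b4⟩
      · exact ⟨.inr bFoot, rfl, e7⟩
      · exact ⟨.inr bFoot, rfl, hR.trans (hR.symm e5) e7⟩
      · exact ⟨.inr bFoot, rfl, hR.refl _⟩

section
open InsFlag
variable (x : F) (i j : Fin n)

theorem ins_opp_inl (f : F) : (G.ins x i j).opp (.inl f) =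
    if f = x then .inr aIn else if f = G.opp x then .inr bOut else .inl (G.opp f) := rfl
@[simp] theorem ins_opp_x : (G.ins x i j).opp (.inl x) = .inr aIn := by simp [ins_opp_inl]
@[simp] theorem ins_opp_opp_x : (G.ins x i j).opp (.inl (G.opp x)) = .inr bOut := by
  simp [ins_opp_inl, G.opp_ne]
theorem ins_opp_of_ne {f : F} (h : f ≠ x) (h' : f ≠ G.opp x) :
    (G.ins x i j).opp (.inl f) = .inl (G.opp f) := by simp [ins_opp_inl, h, h']
@[simp] theorem ins_opp_aIn : (G.ins x i j).opp (.inr aIn) = .inl x := rfl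
@[simp] theorem ins_opp_aLeg : (G.ins x i j).opp (.inr aLeg) = .inr aFoot := rfl
@[simp] theorem ins_opp_aOut : (G.ins x i j).opp (.inr aOut) = .inr bIn := rfl
@[simp] theorem ins_opp_aFoot : (G.ins x i j).opp (.inr aFoot) = .inr aLeg := rfl
@[simp] theorem ins_opp_bIn : (G.ins x i j).opp (.inr bIn) = .inr aOut := rfl
@[simp] theorem ins_opp_bLeg : (G.ins x i j).opp (.inr bLeg) = .inr bFoot := rfl
@[simp] theorem ins_opp_bOut : (G.ins x i j).opp (.inr bOut) = .inl (G.opp x) := rfl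
@[simp] theorem ins_opp_bFoot : (G.ins x i j).opp (.inr bFoot) = .inr bLeg := rfl
@[simp] theorem ins_rot_inl (f : F) : (G.ins x i j).rot (.inl f) = .inl (G.rot f) := rfl
@[simp] theorem ins_rot_aIn : (G.ins x i j).rot (.inr aIn) = .inr aLeg := rfl
@[simp] theorem ins_rot_aLeg : (G.ins x i j).rot (.inr aLeg) = .inr aOut := rfl
@[simp] theorem ins_rot_aOut : (G.ins x i j).rot (.inr aOut) = .inr aIn := rfl
@[simp] theorem ins_rot_aFoot : (G.ins x i j).rot (.inr aFoot) = .inr aFoot := rfl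
@[simp] theorem ins_rot_bIn : (G.ins x i j).rot (.inr bIn) = .inr bLeg := rfl
@[simp] theorem ins_rot_bLeg : (G.ins x i j).rot (.inr bLeg) = .inr bOut := rfl
@[simp] theorem ins_rot_bOut : (G.ins x i j).rot (.inr bOut) = .inr bIn := rfl
@[simp] theorem ins_rot_bFoot : (G.ins x i j).rot (.inr bFoot) = .inr bFoot := rfl
@[simp] theorem ins_label_inl (f : F) : (G.ins x i j).label (.inl f) = G.label f := rfl
@[simp] theorem ins_label_aIn : (G.ins x i j).label (.inr aIn) = none := rfl
@[simp] theorem ins_label_aLeg : (G.ins x i j).label (.inr aLeg) = none := rfl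
@[simp] theorem ins_label_aOut : (G.ins x i j).label (.inr aOut) = none := rfl
@[simp] theorem ins_label_aFoot : (G.ins x i j).label (.inr aFoot) = some i := rfl
@[simp] theorem ins_label_bIn : (G.ins x i j).label (.inr bIn) = none := rfl
@[simp] theorem ins_label_bLeg : (G.ins x i j).label (.inr bLeg) = none := rfl
@[simp] theorem ins_label_bOut : (G.ins x i j).label (.inr bOut) = none := rfl
@[simp] theorem ins_label_bFoot : (G.ins x i j).label (.inr bFoot) = some j := rfl

theorem isInsertion_ins : IsInsertion G x i j (G.ins x i j) where
  opp_x := by simp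
  opp_aOut := rfl
  opp_bOut := rfl
  opp_aLeg := rfl
  opp_bLeg := rfl
  opp_old f h h' := by simp [ins_opp_inl, h, h']
  rot_aIn := rfl
  rot_aLeg := rfl
  rot_bIn := rfl
  rot_bLeg := rfl
  rot_old _ := rfl
  label_aFoot := rfl
  label_bFoot := rfl
  label_old _ := rfl

variable {G x i j} in
/-- The result of an insertion is determined. -/
theorem _root_.DiagramAlgebra.IsInsertion.eq_ins {G' : UniDiagram n (F ⊕ InsFlag)}
    (h : IsInsertion G x i j G') : G' = G.ins x i j := by
  have hopp : ∀ {f g}, G'.opp f = g → G'.opp g = f := fun {f g} h => by rw [← h, G'.opp_opp]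
  have hrot : ∀ {f g k}, G'.rot f = g → G'.rot g = k → G'.rot k = f := fun {f g k} h h' => by
    rw [← h', ← h, G'.rot_rot_rot]
  have hnone : ∀ {f g}, G'.rot f = g → g ≠ f → G'.label f = none := fun {f g} h h' =>
    G'.label_eq_none (h ▸ h')
  ext1 f
  · rcases f with f | f
    · rw [ins_opp_inl]
      split_ifs with h1 h2
      · rw [h1, h.opp_x]
      · rw [h2, hopp h.opp_bOut]
      · exact h.opp_old f h1 h2
    · cases f
      · exact hopp h.opp_x
      · exact h.opp_aLeg
      · exact h.opp_aOut
      · exact hopp h.opp_aLeg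
      · exact hopp h.opp_aOut
      · exact h.opp_bLeg
      · exact h.opp_bOut
      · exact hopp h.opp_bLeg
  · rcases f with f | f
    · exact h.rot_old f
    · cases f
      · exact h.rot_aIn
      · exact h.rot_aLeg
      · exact hrot h.rot_aIn h.rot_aLeg
      · exact G'.rot_eq_of_label h.label_aFoot
      · exact h.rot_bIn
      · exact h.rot_bLeg
      · exact hrot h.rot_bIn h.rot_bLeg
      · exact G'.rot_eq_of_label h.label_bFoot
  · rcases f with f | f
    · exact h.label_old f
    · cases f
      · exact hnone h.rot_aIn (by simp)
      · exact hnone h.rot_aLeg (by simp)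
      · exact hnone (hrot h.rot_aIn h.rot_aLeg) (by simp)
      · exact h.label_aFoot
      · exact hnone h.rot_bIn (by simp)
      · exact hnone h.rot_bLeg (by simp)
      · exact hnone (hrot h.rot_bIn h.rot_bLeg) (by simp)
      · exact h.label_bFoot

/-- Insertions do not change the components. -/
theorem blockEmbedding_ins : BlockEmbedding G (G.ins x i j) Sum.inl where
  inj := Sum.inl_injective
  label _ := rfl
  comp f g := by
    set G' := G.ins x i j
    have hopp := G'.sameComponent_opp
    have hrot := G'.sameComponent_rot
    have e1 := hrot (.inr aIn)
    have e2 := hrot (.inr aLeg)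
    have e3 := hopp (.inr aOut)
    have e4 := hrot (.inr bIn)
    have e5 := hrot (.inr bLeg)
    have e6 := (hopp (.inr aIn)).symm.trans (e1.trans (e2.trans (e3.trans (e4.trans
      (e5.trans (hopp (.inr bOut)))))))
    constructor
    · intro h
      have h1 : ∀ a, G.SameComponent (Sum.elim id (fun _ => x) a)
          (Sum.elim id (fun _ => x) (G'.opp a)) := by
        rintro (a | a)
        · change G.SameComponent a (Sum.elim id (fun _ => x) ((G.ins x i j).opp (.inl a)))
          rw [ins_opp_inl]
          split_ifs with h1 h2
          · rw [h1]; exact SameComponent.refl G _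
          · rw [h2]; exact (G.sameComponent_opp x).symm
          · exact G.sameComponent_opp a
        · cases a
          all_goals first | exact SameComponent.refl G _ | exact G.sameComponent_opp x
      have h2 : ∀ a, G.SameComponent (Sum.elim id (fun _ => x) a)
          (Sum.elim id (fun _ => x) (G'.rot a)) := by
        rintro (a | a)
        · exact G.sameComponent_rot a
        · cases a <;> exact SameComponent.refl G _
      exact SameComponent.map h1 h2 h
    · intro h
      refine SameComponent.map (fun a => ?_) (fun a => hrot (.inl a)) h
      by_cases hx : a = x
      · rw [hx]; exact e6
      by_cases hx' : a = G.opp x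
      · rw [hx', G.opp_opp]; exact e6.symm
      have := hopp (.inl a)
      rwa [show G'.opp (.inl a) = .inl (G.opp a) from ins_opp_of_ne G x i j hx hx'] at this

end

end UniDiagram

theorem IsTriInsertion.eq_ins {D : TriDiagram n F} {x : F} {i j : Fin n}
    {D' : TriDiagram n (F ⊕ InsFlag)} (h : IsTriInsertion D x i j D') :
    ∃ w : LegOrder (D.graph.ins x i j), D' = ⟨D.graph.ins x i j, w⟩ ∧
      w.comap Sum.inl Sum.inl_injective (fun _ => rfl) = D.ord := by
  obtain ⟨G', w'⟩ := D'
  have hg := h.graph.eq_ins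
  simp only at hg
  subst hg
  refine ⟨w', rfl, ?_⟩
  ext f g
  exact h.lt_old f g

theorem isTriInsertion_ins (G : UniDiagram n F) (x : F) (i j : Fin n)
    (w : LegOrder (G.ins x i j)) :
    IsTriInsertion ⟨G, w.comap Sum.inl Sum.inl_injective (fun _ => rfl)⟩ x i j
      ⟨G.ins x i j, w⟩ :=
  ⟨G.isInsertion_ins x i j, fun _ _ => Iff.rfl⟩

/-! ### Orders on the legs after an insertion -/

namespace UniDiagram

open InsFlag StemFlag

/-- The order on the old legs after an insertion. -/
def LegOrder.old {G : UniDiagram n F} {x : F} {i j : Fin n} (w : LegOrder (G.ins x i j)) :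
    LegOrder G :=
  w.comap Sum.inl Sum.inl_injective fun _ => rfl

theorem LegOrder.old_lt {G : UniDiagram n F} {x : F} {i j : Fin n} (w : LegOrder (G.ins x i j))
    (f g : F) : w.old.lt f g ↔ w.lt (.inl f) (.inl g) := Iff.rfl

/-- The order after an insertion in which the two new legs directly follow the leg `u`. -/
def LegOrder.lift {G : UniDiagram n F} (w : LegOrder G) (x : F) (i : Fin n) (u : F)
    (hu : G.label u = some i) : LegOrder (G.ins x i i) :=
  w.pull (Sum.elim id fun _ => u)
    (fun f => match f with
      | .inl _ => 0
      | .inr bFoot => 2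
      | .inr _ => 1)
    (fun f j h => by
      rcases f with f | f
      · exact h
      · cases f <;> simp_all)
    (fun f g j hf hg h1 h2 => by
      rcases f with f | f
      · rcases g with g | g
        · exact congrArg _ h1
        · cases g <;> simp_all
      · rcases g with g | g
        · cases f <;> simp_all
        · cases f <;> cases g <;> simp_all)

section lift
variable {G : UniDiagram n F} (w : LegOrder G) (x : F) (i : Fin n) (u : F)
  (hu : G.label u = some i)

@[simp] theorem LegOrder.lift_inl (f g : F) :
    (w.lift x i u hu).lt (.inl f) (.inl g) ↔ w.lt f g := by
  change (_ ∧ (w.lt f g ∨ _ ∧ 0 < 0)) ↔ _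
  simp only [lt_irrefl, and_false, or_false, and_iff_right_iff_imp]
  exact w.label_of_lt _ _

@[simp] theorem LegOrder.lift_inl_aFoot (f : F) :
    (w.lift x i u hu).lt (.inl f) (.inr aFoot) ↔ w.lt f u ∨ f = u := by
  change (_ ∧ (w.lt f u ∨ f = u ∧ 0 < 1)) ↔ _
  simp only [zero_lt_one, and_true, and_iff_right_iff_imp]
  rintro (h | rfl)
  · exact ⟨i, (w.label_eq h).trans hu, rfl⟩
  · exact ⟨i, hu, rfl⟩

@[simp] theorem LegOrder.lift_inl_bFoot (f : F) :
    (w.lift x i u hu).lt (.inl f) (.inr bFoot) ↔ w.lt f u ∨ f = u := by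
  change (_ ∧ (w.lt f u ∨ f = u ∧ 0 < 2)) ↔ _
  simp only [zero_lt_two, and_true, and_iff_right_iff_imp]
  rintro (h | rfl)
  · exact ⟨i, (w.label_eq h).trans hu, rfl⟩
  · exact ⟨i, hu, rfl⟩

@[simp] theorem LegOrder.lift_aFoot_inl (f : F) :
    (w.lift x i u hu).lt (.inr aFoot) (.inl f) ↔ w.lt u f := by
  change (_ ∧ (w.lt u f ∨ u = f ∧ 1 < 0)) ↔ _
  simp only [not_lt_zero, and_false, or_false, and_iff_right_iff_imp]
  exact fun h => ⟨i, rfl, (w.label_eq h).symm.trans hu⟩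

@[simp] theorem LegOrder.lift_bFoot_inl (f : F) :
    (w.lift x i u hu).lt (.inr bFoot) (.inl f) ↔ w.lt u f := by
  change (_ ∧ (w.lt u f ∨ u = f ∧ 2 < 0)) ↔ _
  simp only [not_lt_zero, and_false, or_false, and_iff_right_iff_imp]
  exact fun h => ⟨i, rfl, (w.label_eq h).symm.trans hu⟩

@[simp] theorem LegOrder.lift_aFoot_bFoot : (w.lift x i u hu).lt (.inr aFoot) (.inr bFoot) := by
  change (_ ∧ (w.lt u u ∨ u = u ∧ 1 < 2))
  exact ⟨⟨i, rfl, rfl⟩, Or.inr ⟨rfl, by norm_num⟩⟩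

theorem LegOrder.lift_old : (w.lift x i u hu).old = w := by
  ext f g; exact lift_inl w x i u hu f g

end lift

/-! ### Isomorphisms between joins and insertions -/

/-- Joining two old legs commutes with an insertion. -/
def joinInsEquiv (F : Type) : (F ⊕ InsFlag) ⊕ StemFlag ≃ (F ⊕ StemFlag) ⊕ InsFlag where
  toFun
    | .inl (.inl f) => .inl (.inl f)
    | .inl (.inr a) => .inr a
    | .inr s => .inl (.inr s)
  invFun
    | .inl (.inl f) => .inl (.inl f)
    | .inr a => .inl (.inr a)
    | .inl (.inr s) => .inr s
  left_inv := by rintro ((f | a) | s) <;> rfl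
  right_inv := by rintro ((f | s) | a) <;> rfl

theorem LegPair.ins {G : UniDiagram n F} {l r : F} (h : G.LegPair l r) (x : F) (i j : Fin n) :
    (G.ins x i j).LegPair (.inl l) (.inl r) :=
  ⟨congrArg Sum.inl h.left, congrArg Sum.inl h.right, Sum.inl_injective.ne h.ne⟩

theorem isIso_join_ins (G : UniDiagram n F) {l r : F} (h : G.LegPair l r) (x : F) (i j : Fin n) :
    IsIso ((G.ins x i j).join (.inl l) (.inl r) (h.ins x i j)) ((G.join l r h).ins (.inl x) i j)
      (joinInsEquiv F) := by
  have e1 : ∀ f, joinInsEquiv F (.inl (.inl f)) = .inl (.inl f) := fun _ => rfl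
  have e2 : ∀ a, joinInsEquiv F (.inl (.inr a)) = .inr a := fun _ => rfl
  have e3 : ∀ s, joinInsEquiv F (.inr s) = .inl (.inr s) := fun _ => rfl
  refine ⟨?_, ?_, ?_⟩
  · rintro ((f | a) | (_ | _))
    · simp only [e1, join_opp_inl, ins_opp_inl, Sum.inl.injEq]
      split_ifs <;> simp [e1, e2]
    · cases a <;> simp [e1, e2]
    · simp [e3, ins_opp_inl]
    · simp [e3, ins_opp_inl]
  · rintro ((f | a) | (_ | _))
    · simp only [e1, join_rot_inl, ins_rot_inl, Sum.inl.injEq]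
      split_ifs <;> simp [e1, e3]
    · cases a <;> simp [e2, join_rot_inl]
    · simp [e1, e3]
    · simp [e3]
  · rintro ((f | a) | (_ | _))
    · simp only [e1, join_label_inl, ins_label_inl, Sum.inl.injEq]
    · cases a <;> simp [e2, join_label_inl]
    · simp [e3]
    · simp [e3]

/-- The order on the legs of the insertion in a joined diagram that corresponds to an order of the
joined diagram after the insertion. -/
def LegOrder.joinIns {G : UniDiagram n F} {l r : F} (h : G.LegPair l r) {x : F} {i j : Fin n}
    (w : LegOrder (G.ins x i j)) : LegOrder ((G.join l r h).ins (.inl x) i j) :=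
  (w.join (h.ins x i j)).comap (joinInsEquiv F).symm (Equiv.injective _)
    (isIso_join_ins G h x i j).symm.label

theorem LegOrder.joinIns_old {G : UniDiagram n F} {l r : F} (h : G.LegPair l r) {x : F}
    {i j : Fin n} (w : LegOrder (G.ins x i j)) : (w.joinIns h).old = w.old.join h := by
  ext f g
  change (w.join (h.ins x i j)).lt ((joinInsEquiv F).symm (.inl f)) ((joinInsEquiv F).symm (.inl g))
    ↔ _
  rw [join_lt, join_lt, (isIso_join_ins G h x i j).symm.label,
    (isIso_join_ins G h x i j).symm.label]
  rcases f with f | (_ | _) <;> rcases g with g | (_ | _) <;> rfl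

theorem tri_join_ins [Finite F] {G : UniDiagram n F} {l r : F} (h : G.LegPair l r) {x : F}
    {i j : Fin n} (w : LegOrder (G.ins x i j)) :
    tri _ (w.join (h.ins x i j)) = tri _ (w.joinIns h) :=
  tri_eq_of_iso (isIso_join_ins G h x i j) fun f g => by
    change (w.join (h.ins x i j)).lt ((joinInsEquiv F).symm _) ((joinInsEquiv F).symm _) ↔ _
    rw [Equiv.symm_apply_apply, Equiv.symm_apply_apply]

/-- The permutation of the flags of an insertion next to a vertex with a leg that rotates the roles
of the three vertices in the resulting row. -/
def rowMap (z z₁ z₂ l : F) : F ⊕ InsFlag → F ⊕ InsFlag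
  | .inl f => if f = z₂ then .inr bIn else if f = z then .inr bLeg else
      if f = z₁ then .inr bOut else if f = l then .inr bFoot else .inl f
  | .inr aIn => .inl z₂
  | .inr aLeg => .inl z
  | .inr aOut => .inl z₁
  | .inr aFoot => .inl l
  | .inr bIn => .inr aIn
  | .inr bLeg => .inr aLeg
  | .inr bOut => .inr aOut
  | .inr bFoot => .inr aFoot

/-- The inverse of `rowMap`. -/
def rowMapInv (z z₁ z₂ l : F) : F ⊕ InsFlag → F ⊕ InsFlag
  | .inl f => if f = z₂ then .inr aIn else if f = z then .inr aLeg else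
      if f = z₁ then .inr aOut else if f = l then .inr aFoot else .inl f
  | .inr bIn => .inl z₂
  | .inr bLeg => .inl z
  | .inr bOut => .inl z₁
  | .inr bFoot => .inl l
  | .inr aIn => .inr bIn
  | .inr aLeg => .inr bLeg
  | .inr aOut => .inr bOut
  | .inr aFoot => .inr bFoot

/-- A vertex with flags `z, rot z, rot (rot z)` such that `z` leads to a leg and the other two edges
leave the vertex. -/
structure LegVertex (G : UniDiagram n F) (z : F) : Prop where
  isTri : G.IsTri z
  leg : G.rot (G.opp z) = G.opp z
  left : ¬ G.SameVertex z (G.opp (G.rot (G.rot z)))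
  right : ¬ G.SameVertex z (G.opp (G.rot z))

section
variable {G : UniDiagram n F} {z : F}

/-- The rotation of the roles in a row as an equivalence. -/
def rowEquiv (h : G.LegVertex z) : F ⊕ InsFlag ≃ F ⊕ InsFlag where
  toFun := rowMap z (G.rot z) (G.rot (G.rot z)) (G.opp z)
  invFun := rowMapInv z (G.rot z) (G.rot (G.rot z)) (G.opp z)
  left_inv f := by
    have h1 := h.isTri
    have h2 := h1.rot
    have h3 := h1.rot_rot_ne
    have h4 := G.opp_ne z
    have h5 := sameVertex_iff_ne.1 fun h' => h1.opp_ne_rot h.leg h' rfl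
    unfold IsTri at h1 h2
    rcases f with f | f
    · simp only [rowMap]
      split_ifs <;> simp_all [rowMapInv]
    · cases f <;> simp_all [rowMap, rowMapInv, Ne.symm]
  right_inv f := by
    have h1 := h.isTri
    have h2 := h1.rot
    have h3 := h1.rot_rot_ne
    have h4 := G.opp_ne z
    have h5 := sameVertex_iff_ne.1 fun h' => h1.opp_ne_rot h.leg h' rfl
    unfold IsTri at h1 h2
    rcases f with f | f
    · simp only [rowMapInv]
      split_ifs <;> simp_all [rowMap]
    · cases f <;> simp_all [rowMap, rowMapInv, Ne.symm]

open InsFlag in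
/-- The defining properties of an insertion characterize it up to isomorphism. -/
theorem isIso_ins {G' : UniDiagram n F'} {φ : F ⊕ InsFlag ≃ F'} {x : F} {i j : Fin n}
    (opp_x : G'.opp (φ (.inl x)) = φ (.inr aIn))
    (opp_aOut : G'.opp (φ (.inr aOut)) = φ (.inr bIn))
    (opp_bOut : G'.opp (φ (.inr bOut)) = φ (.inl (G.opp x)))
    (opp_aLeg : G'.opp (φ (.inr aLeg)) = φ (.inr aFoot))
    (opp_bLeg : G'.opp (φ (.inr bLeg)) = φ (.inr bFoot))
    (opp_old : ∀ f, f ≠ x → f ≠ G.opp x → G'.opp (φ (.inl f)) = φ (.inl (G.opp f)))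
    (rot_aIn : G'.rot (φ (.inr aIn)) = φ (.inr aLeg))
    (rot_aLeg : G'.rot (φ (.inr aLeg)) = φ (.inr aOut))
    (rot_bIn : G'.rot (φ (.inr bIn)) = φ (.inr bLeg))
    (rot_bLeg : G'.rot (φ (.inr bLeg)) = φ (.inr bOut))
    (rot_old : ∀ f, G'.rot (φ (.inl f)) = φ (.inl (G.rot f)))
    (label_aFoot : G'.label (φ (.inr aFoot)) = some i)
    (label_bFoot : G'.label (φ (.inr bFoot)) = some j)
    (label_old : ∀ f, G'.label (φ (.inl f)) = G.label f) : IsIso (G.ins x i j) G' φ := by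
  have hopp : ∀ {f g}, G'.opp f = g → G'.opp g = f := fun {f g} h => by rw [← h, G'.opp_opp]
  have hrot : ∀ {f g k}, G'.rot f = g → G'.rot g = k → G'.rot k = f := fun {f g k} h h' => by
    rw [← h', ← h, G'.rot_rot_rot]
  have hnone : ∀ {f g : InsFlag}, G'.rot (φ (.inr f)) = φ (.inr g) → g ≠ f →
      G'.label (φ (.inr f)) = none := fun {f g} h h' => G'.label_eq_none (by
        rw [h]; exact fun h'' => h' (Sum.inr_injective (φ.injective h'')))
  refine ⟨?_, ?_, ?_⟩
  · rintro (f | f)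
    · rw [ins_opp_inl]
      split_ifs with h1 h2
      · rw [h1, opp_x]
      · rw [h2, hopp opp_bOut]
      · exact opp_old f h1 h2
    · cases f
      · exact hopp opp_x
      · exact opp_aLeg
      · exact opp_aOut
      · exact hopp opp_aLeg
      · exact hopp opp_aOut
      · exact opp_bLeg
      · exact opp_bOut
      · exact hopp opp_bLeg
  · rintro (f | f)
    · exact rot_old f
    · cases f
      · exact rot_aIn
      · exact rot_aLeg
      · exact hrot rot_aIn rot_aLeg
      · exact G'.rot_eq_of_label label_aFoot
      · exact rot_bIn
      · exact rot_bLeg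
      · exact hrot rot_bIn rot_bLeg
      · exact G'.rot_eq_of_label label_bFoot
  · rintro (f | f)
    · exact label_old f
    · cases f
      · exact hnone rot_aIn (by simp)
      · exact hnone rot_aLeg (by simp)
      · exact hnone (hrot rot_aIn rot_aLeg) (by simp)
      · exact label_aFoot
      · exact hnone rot_bIn (by simp)
      · exact hnone rot_bLeg (by simp)
      · exact hnone (hrot rot_bIn rot_bLeg) (by simp)
      · exact label_bFoot

/-- In the row that arises by inserting two legs next to a vertex with a leg of the same label, any
two neighbouring vertices can be regarded as inserted. -/
theorem isIso_row (h : G.LegVertex z) {i : Fin n} (hi : G.label (G.opp z) = some i) :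
    IsIso (G.ins (G.opp (G.rot (G.rot z))) i i) (G.ins (G.rot z) i i) (rowEquiv h) := by
  have h1 := h.isTri
  have h2 := h1.rot
  have h3 := h1.rot_rot_ne
  have h4 := G.opp_ne z
  have h5 := sameVertex_iff_ne.1 fun h' => h1.opp_ne_rot h.leg h' rfl
  have h6 := sameVertex_iff_ne.1 h.left
  have h7 := sameVertex_iff_ne.1 h.right
  have h8 := h.leg
  have a3 := G.rot_rot_rot
  have o2 := G.opp_opp
  have hinj := G.opp_injective
  have hrinj := G.rot_injective
  have q1 : ∀ {f}, G.IsTri f → G.label f = none := fun hf => G.label_eq_none hf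
  have t1 := q1 h1
  have t2 := q1 h2
  have t3 := q1 h2.rot
  unfold IsTri at h1 h2
  have hz : G.rot (G.rot (G.rot z)) = z := a3 z
  have r1 : rowEquiv h (.inl (G.rot (G.rot z))) = .inr bIn := by simp [rowEquiv, rowMap]
  have r2 : rowEquiv h (.inl z) = .inr bLeg := by simp [rowEquiv, rowMap, Ne.symm h3]
  have r3 : rowEquiv h (.inl (G.rot z)) = .inr bOut := by
    simp [rowEquiv, rowMap, h1, Ne.symm h2]
  have r4 : rowEquiv h (.inl (G.opp z)) = .inr bFoot := by simp [rowEquiv, rowMap, h5]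
  have r5 : ∀ f, f ≠ G.rot (G.rot z) → f ≠ z → f ≠ G.rot z → f ≠ G.opp z →
      rowEquiv h (.inl f) = .inl f := fun f k1 k2 k3 k4 => by
    simp [rowEquiv, rowMap, k1, k2, k3, k4]
  have r6 : rowEquiv h (.inr aIn) = .inl (G.rot (G.rot z)) := rfl
  have r7 : rowEquiv h (.inr aLeg) = .inl z := rfl
  have r8 : rowEquiv h (.inr aOut) = .inl (G.rot z) := rfl
  have r9 : rowEquiv h (.inr aFoot) = .inl (G.opp z) := rfl
  have r10 : rowEquiv h (.inr bIn) = .inr aIn := rfl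
  have r11 : rowEquiv h (.inr bLeg) = .inr aLeg := rfl
  have r12 : rowEquiv h (.inr bOut) = .inr aOut := rfl
  have r13 : rowEquiv h (.inr bFoot) = .inr aFoot := rfl
  apply isIso_ins
  · rw [r5 _ h6.2.2 h6.1 h6.2.1 (fun e => h3 (hinj e)), r6, ins_opp_of_ne, G.opp_opp]
    · exact h6.2.1
    · exact fun e => h2 (hinj e)
  · rw [r8, r10, ins_opp_x]
  · rw [r12, o2, r1, ins_opp_aOut]
  · rw [r7, r9, ins_opp_of_ne _ _ _ _ (Ne.symm h1) (fun e => h7.1 e.symm)]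
  · rw [r11, r13, ins_opp_aLeg]
  · intro f k1 k2
    rw [o2] at k2
    by_cases k3 : f = z
    · rw [k3, r2, r4, ins_opp_bLeg]
    by_cases k4 : f = G.rot z
    · rw [k4, r3, ins_opp_bOut, r5 _ h7.2.2 h7.1 h7.2.1 (fun e => h1 (hinj e))]
    by_cases k5 : f = G.opp z
    · rw [k5, r4, o2, r2, ins_opp_bFoot]
    rw [r5 f k2 k3 k4 k5]
    by_cases k6 : f = G.opp (G.rot z)
    · rw [k6, o2, r3, ins_opp_opp_x]
    rw [ins_opp_of_ne _ _ _ _ k4 k6, r5]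
    · exact fun e => k1 (eq_opp_of_opp_eq e)
    · exact fun e => k5 (eq_opp_of_opp_eq e)
    · exact fun e => k6 (eq_opp_of_opp_eq e)
    · exact fun e => k3 (hinj e)
  · rw [r6, r7, ins_rot_inl, a3]
  · rw [r7, r8, ins_rot_inl]
  · rw [r10, r11, ins_rot_aIn]
  · rw [r11, r12, ins_rot_aLeg]
  · intro f
    by_cases k2 : f = G.rot (G.rot z)
    · rw [k2, r1, a3, r2, ins_rot_bIn]
    by_cases k3 : f = z
    · rw [k3, r2, r3, ins_rot_bLeg]
    by_cases k4 : f = G.rot z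
    · rw [k4, r3, r1, ins_rot_bOut]
    by_cases k5 : f = G.opp z
    · rw [k5, r4, h8, r4, ins_rot_bFoot]
    rw [r5 f k2 k3 k4 k5, ins_rot_inl, r5]
    · exact fun e => k4 (hrinj e)
    · exact fun e => k2 (hrinj (e.trans (a3 z).symm))
    · exact fun e => k3 (hrinj e)
    · exact fun e => k5 (hrinj (e.trans h8.symm))
  · rw [r9, ins_label_inl, hi]
  · rw [r13, ins_label_aFoot]
  · intro f
    by_cases k2 : f = G.rot (G.rot z)
    · rw [k2, r1, t3, ins_label_bIn]
    by_cases k3 : f = z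
    · rw [k3, r2, t1, ins_label_bLeg]
    by_cases k4 : f = G.rot z
    · rw [k4, r3, t2, ins_label_bOut]
    by_cases k5 : f = G.opp z
    · rw [k5, r4, hi, ins_label_bFoot]
    rw [r5 f k2 k3 k4 k5, ins_label_inl]

/-- In the row of three legs, the legs of the new vertices directly follow the leg `u`; regarding
another pair of vertices as inserted puts the old leg to the place of the first new leg. -/
theorem old_row (h : G.LegVertex z) {i : Fin n} (hi : G.label (G.opp z) = some i)
    (w : LegOrder (G.ins (G.opp (G.rot (G.rot z))) i i)) {f g : F}
    (hf : G.rot f = f) (hg : G.rot g = g) :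
    (w.comap (rowEquiv h).symm (Equiv.injective _) (isIso_row h hi).symm.label).old.lt f g ↔
      w.lt (if f = G.opp z then .inr aFoot else .inl f)
        (if g = G.opp z then .inr aFoot else .inl g) := by
  have key : ∀ f, G.rot f = f → (rowEquiv h).symm (.inl f) =
      if f = G.opp z then .inr aFoot else .inl f := by
    intro f hf
    have h1 : ∀ v, G.SameVertex z v → f ≠ v := fun v hv h' => hv.isTri h.isTri (h' ▸ hf)
    change rowMapInv z (G.rot z) (G.rot (G.rot z)) (G.opp z) (.inl f) = _
    simp only [rowMapInv]
    rw [if_neg (h1 _ (Or.inr (Or.inr rfl))), if_neg (h1 _ (Or.inl rfl)),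
      if_neg (h1 _ (Or.inr (Or.inl rfl)))]
  rw [old_lt]
  change w.lt ((rowEquiv h).symm (.inl f)) ((rowEquiv h).symm (.inl g)) ↔ _
  rw [key f hf, key g hg]

end

end UniDiagram

/-! ### Joining several legs -/

namespace UniDiagram

open StemFlag

/-- The same order of the legs, for another diagram with the same flags and labels. -/
def LegOrder.copy {G : UniDiagram n F} (w : LegOrder G) (G' : UniDiagram n F)
    (h : ∀ f, G'.label f = G.label f) : LegOrder G' :=
  w.comap id Function.injective_id fun f => (h f).symm

theorem LegOrder.copy_lt {G : UniDiagram n F} (w : LegOrder G) (G' : UniDiagram n F)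
    (h : ∀ f, G'.label f = G.label f) (f g : F) : (w.copy G' h).lt f g ↔ w.lt f g := Iff.rfl

theorem LegPair.ne_of_join {G : UniDiagram n F} {a b c : F} {h : G.LegPair a b}
    (hc : (G.join a b h).rot (.inl c) = .inl c) : c ≠ a ∧ c ≠ b ∧ G.rot c = c := by
  rw [join_rot_inl] at hc
  have := h.ne
  split_ifs at hc with h1 h2
  · exact absurd (Sum.inl_injective hc) (by rw [h2]; exact h.ne)
  · exact ⟨h1, h2, Sum.inl_injective hc⟩

section order
variable {G : UniDiagram n F} {w : LegOrder G} {a b c : F}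

theorem LegOrder.Consec.join_foot_left (hab : w.Consec a b) (hbc : w.Consec b c) :
    (w.join hab.legPair).Consec (.inr foot) (.inl c) := by
  have hac := w.trans _ _ _ hab.lt hbc.lt
  have h1 := (w.ne_of_lt hac).symm
  refine ⟨(join_foot_lt hab.legPair w h1 hbc.ne.symm).2 hac, fun f hf => ?_⟩
  rw [join_lt, join_lt] at hf
  rcases f with f | f
  · obtain ⟨⟨⟨i, h2, h3⟩, h4⟩, h5, h6⟩ := hf
    rw [join_label_inl] at h3
    split_ifs at h3 with h7
    rw [not_or] at h7
    exact hbc.not_between f ⟨(hab.right_lt_iff h7.2).2 h4, h6⟩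
  · exact w.irrefl _ hf.1.2

theorem LegOrder.Consec.join_foot_right (hab : w.Consec a b) (hbc : w.Consec b c) :
    (w.join hbc.legPair).Consec (.inl a) (.inr foot) := by
  have hac := w.trans _ _ _ hab.lt hbc.lt
  refine ⟨(join_lt_foot hbc.legPair w hab.ne (w.ne_of_lt hac)).2 hab.lt, fun f hf => ?_⟩
  rw [join_lt, join_lt] at hf
  rcases f with f | f
  · exact hab.not_between f ⟨hf.1.2, hf.2.2⟩
  · exact w.irrefl _ hf.2.2

theorem LegOrder.label_of_join_inl {h : G.LegPair a b} {f : F} {i : Fin n}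
    (hf : (G.join a b h).label (.inl f) = some i) : f ≠ a ∧ f ≠ b ∧ G.label f = some i := by
  rw [join_label_inl] at hf
  split_ifs at hf with h7
  rw [not_or] at h7
  exact ⟨h7.1, h7.2, hf⟩

/-- Two orders on the legs of a joined diagram agree if they agree on old legs and on pairs of an
old leg and the new leg. -/
theorem LegOrder.join_ext {h : G.LegPair a b} {v v' : LegOrder (G.join a b h)}
    (h1 : ∀ f g, f ≠ a → f ≠ b → g ≠ a → g ≠ b → (v.lt (.inl f) (.inl g) ↔ v'.lt (.inl f) (.inl g)))
    (h2 : ∀ f, f ≠ a → f ≠ b → (v.lt (.inl f) (.inr foot) ↔ v'.lt (.inl f) (.inr foot)))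
    (h3 : ∀ f, f ≠ a → f ≠ b → (v.lt (.inr foot) (.inl f) ↔ v'.lt (.inr foot) (.inl f))) :
    v = v' := by
  ext f g
  suffices (∃ i, (G.join a b h).label f = some i ∧ (G.join a b h).label g = some i) →
      (v.lt f g ↔ v'.lt f g) from
    ⟨fun hl => (this (v.label_of_lt _ _ hl)).1 hl, fun hl => (this (v'.label_of_lt _ _ hl)).2 hl⟩
  rintro ⟨i, hf, hg⟩
  rcases f with f | (_ | _)
  · have hf' := label_of_join_inl hf
    rcases g with g | (_ | _)
    · have hg' := label_of_join_inl hg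
      exact h1 f g hf'.1 hf'.2.1 hg'.1 hg'.2.1
    · simp at hg
    · exact h2 f hf'.1 hf'.2.1
  · simp at hf
  · rcases g with g | (_ | _)
    · have hg' := label_of_join_inl hg
      exact h3 g hg'.1 hg'.2.1
    · simp at hg
    · exact iff_of_false (v.irrefl _) (v'.irrefl _)

theorem LegOrder.join_swap_foot_left (hab : w.Consec a b) (hbc : w.Consec b c) :
    (w.join hab.legPair).swap (.inr foot) (.inl c) =
      ((w.swap b c).swap a c).join hab.legPair := by
  have hac := w.trans _ _ _ hab.lt hbc.lt
  have n1 := hab.ne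
  have n2 := hbc.ne
  have n3 := w.ne_of_lt hac
  have hk := hab.join_foot_left hbc
  have hk2 := consec_swap_right hab hbc
  apply join_ext
  · intro f g h1 h2 h3 h4
    rw [hk.swap_lt, join_lt_inl _ _ h1 h2 h3 h4, join_lt_inl _ _ h1 h2 h3 h4, hk2.swap_lt,
      hbc.swap_lt]
    simp [h1, h2, h3, h4]
  · intro f h1 h2
    rw [hk.swap_lt, join_lt_foot _ _ h1 h2, join_lt_foot _ _ h1 h2, hk2.swap_lt, hbc.swap_lt]
    simp [h1, h2, n1, n3]
  · intro f h1 h2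
    rw [hk.swap_lt, join_foot_lt _ _ h1 h2, join_foot_lt _ _ h1 h2, hk2.swap_lt, hbc.swap_lt]
    simp [h1, h2, n1, n3]

theorem LegOrder.join_swap_foot_right (hab : w.Consec a b) (hbc : w.Consec b c) :
    (w.join hbc.legPair).swap (.inl a) (.inr foot) =
      ((w.swap a b).swap a c).join hbc.legPair := by
  have hac := w.trans _ _ _ hab.lt hbc.lt
  have n1 := hab.ne
  have n2 := hbc.ne
  have n3 := w.ne_of_lt hac
  have hk := hab.join_foot_right hbc
  have hk2 := consec_swap_left hab hbc
  apply join_ext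
  · intro f g h1 h2 h3 h4
    rw [hk.swap_lt, join_lt_inl _ _ h1 h2 h3 h4, join_lt_inl _ _ h1 h2 h3 h4, hk2.swap_lt,
      hab.swap_lt]
    simp [h1, h2, h3, h4]
  · intro f h1 h2
    rw [hk.swap_lt, join_lt_foot _ _ h1 h2, join_lt_foot _ _ h1 h2, hk2.swap_lt, hab.swap_lt]
    simp [h1, h2, n2, n1.symm]
  · intro f h1 h2
    rw [hk.swap_lt, join_foot_lt _ _ h1 h2, join_foot_lt _ _ h1 h2, hk2.swap_lt, hab.swap_lt]
    simp [h1, h2, n2, n1.symm]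

theorem LegOrder.Consec.join_of_disjoint (h : w.Consec a b) {l r : F} (h' : w.Consec l r)
    (h1 : l ≠ a) (h2 : l ≠ b) (h3 : r ≠ a) (h4 : r ≠ b) :
    (w.join h.legPair).Consec (.inl l) (.inl r) := by
  refine ⟨(join_lt_inl _ _ h1 h2 h3 h4).2 h'.lt, fun f hf => ?_⟩
  rw [join_lt, join_lt] at hf
  rcases f with f | f
  · exact h'.not_between _ ⟨hf.1.2, hf.2.2⟩
  · exact h'.not_between _ ⟨hf.1.2, hf.2.2⟩

theorem LegOrder.join_swap_of_disjoint (h : w.Consec a b) {l r : F} (h' : w.Consec l r)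
    (h1 : l ≠ a) (h2 : l ≠ b) (h3 : r ≠ a) (h4 : r ≠ b) :
    (w.join h.legPair).swap (.inl l) (.inl r) = (w.swap l r).join h.legPair := by
  have hk := h.join_of_disjoint h' h1 h2 h3 h4
  apply join_ext
  · intro f g k1 k2 k3 k4
    rw [hk.swap_lt, join_lt_inl _ _ k1 k2 k3 k4, join_lt_inl _ _ k1 k2 k3 k4, h'.swap_lt]
    simp
  · intro f k1 k2
    rw [hk.swap_lt, join_lt_foot _ _ k1 k2, join_lt_foot _ _ k1 k2, h'.swap_lt]
    simp [h1.symm, h3.symm]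
  · intro f k1 k2
    rw [hk.swap_lt, join_foot_lt _ _ k1 k2, join_foot_lt _ _ k1 k2, h'.swap_lt]
    simp [h1.symm, h3.symm]

end order

section
variable {G : UniDiagram n F} {a b c : F}

theorem innerEdge_join (h1 : G.LegPair a b)
    (h2 : (G.join a b h1).LegPair (.inr foot) (.inl c)) :
    ((G.join a b h1).join (.inr foot) (.inl c) h2).InnerEdge (.inl (.inr stem)) := by
  have hc := LegPair.ne_of_join h2.right
  have := h1.ne
  refine ⟨?_, ?_, ?_⟩
  · simp [IsTri, join_rot_inl]
  · simp [IsTri]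
  · simp [SameVertex, join_rot_inl, hc.2.1.symm]

/-- Exchange the two flags of the inner stem of a diagram that arises by joining legs twice. -/
def stemSwap (F : Type) : (F ⊕ StemFlag) ⊕ StemFlag ≃ (F ⊕ StemFlag) ⊕ StemFlag :=
  Equiv.sumCongr (Equiv.sumCongr (Equiv.refl _) (Equiv.swap stem foot)) (Equiv.refl _)

@[simp] theorem stemSwap_inl_inl (f : F) : stemSwap F (.inl (.inl f)) = .inl (.inl f) := rfl
@[simp] theorem stemSwap_inr (s : StemFlag) : stemSwap F (.inr s) = .inr s := rfl
@[simp] theorem stemSwap_stem : stemSwap F (.inl (.inr stem)) = .inl (.inr foot) := by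
  simp [stemSwap]
@[simp] theorem stemSwap_foot : stemSwap F (.inl (.inr foot)) = .inl (.inr stem) := by
  simp [stemSwap]

/-- For `I = [[a b] c]` the diagram `H` is `[a [b c]]`. -/
theorem isIso_ihxH_join (h1 : G.LegPair a b)
    (h2 : (G.join a b h1).LegPair (.inr foot) (.inl c)) (k1 : G.LegPair b c)
    (k2 : (G.join b c k1).LegPair (.inl a) (.inr foot)) :
    IsIso ((G.join b c k1).join (.inl a) (.inr foot) k2) (ihxH (innerEdge_join h1 h2))
      (stemSwap F) := by
  obtain ⟨ca, cb, -⟩ := LegPair.ne_of_join h2.right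
  have ab := h1.ne
  refine ⟨?_, ?_, ?_⟩
  · rintro ((f | (_ | _)) | (_ | _)) <;> simp [ihxH_opp]
  · rintro ((f | (_ | _)) | (_ | _))
    · by_cases fa : f = a
      · subst fa
        simp [ihxH_rot, join_rot_inl, cb.symm]
      by_cases fb : f = b
      · subst fb
        simp [ihxH_rot, join_rot_inl, cb.symm, ab.symm]
      by_cases fc : f = c
      · subst fc
        simp [ihxH_rot, join_rot_inl, ca, cb.symm]
      simp [ihxH_rot, join_rot_inl, fa, fb, fc, cb.symm]
    all_goals simp [ihxH_rot, join_rot_inl, cb.symm]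
  · rintro ((f | (_ | _)) | (_ | _)) <;>
      simp [ihxH_label, join_label_inl]
    · grind
    · rintro (h | h)
      · exact absurd h ab
      · exact absurd h.symm ca

/-- For `I = [[a b] c]` the diagram `X` is `[b [a c]]`. -/
theorem isIso_ihxX_join (h1 : G.LegPair a b)
    (h2 : (G.join a b h1).LegPair (.inr foot) (.inl c)) (k1 : G.LegPair a c)
    (k2 : (G.join a c k1).LegPair (.inl b) (.inr foot)) (hl : G.label b = G.label a) :
    IsIso ((G.join a c k1).join (.inl b) (.inr foot) k2) (ihxX (innerEdge_join h1 h2))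
      (stemSwap F) := by
  obtain ⟨ca, cb, -⟩ := LegPair.ne_of_join h2.right
  have ab := h1.ne
  refine ⟨?_, ?_, ?_⟩
  · rintro ((f | (_ | _)) | (_ | _)) <;> simp [ihxX_opp]
  · rintro ((f | (_ | _)) | (_ | _))
    · by_cases fa : f = a
      · subst fa
        simp [ihxX_rot, join_rot_inl, ab, ca.symm, cb.symm]
      by_cases fb : f = b
      · subst fb
        simp [ihxX_rot, join_rot_inl]
      by_cases fc : f = c
      · subst fc
        simp [ihxX_rot, join_rot_inl, cb, cb.symm]
      simp [ihxX_rot, join_rot_inl, fa, fb, fc, cb.symm]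
    all_goals simp [ihxX_rot, join_rot_inl, cb.symm]
  · rintro ((f | (_ | _)) | (_ | _)) <;>
      simp [ihxX_label, join_label_inl, hl, ab.symm]
    · grind
    · exact fun h => absurd h.symm cb

/-- Joining two disjoint pairs of legs does not depend on the order of the two steps. -/
theorem isIso_join_join {l r : F} (h1 : G.LegPair a b)
    (h2 : (G.join a b h1).LegPair (.inl l) (.inl r)) (k1 : G.LegPair l r)
    (k2 : (G.join l r k1).LegPair (.inl a) (.inl b)) :
    IsIso ((G.join a b h1).join (.inl l) (.inl r) h2) ((G.join l r k1).join (.inl a) (.inl b) k2)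
      (Equiv.trans (Equiv.sumAssoc _ _ _) (Equiv.trans
        (Equiv.sumCongr (Equiv.refl _) (Equiv.sumComm _ _)) (Equiv.sumAssoc _ _ _).symm)) := by
  obtain ⟨la, lb, -⟩ := LegPair.ne_of_join h2.left
  obtain ⟨ra, rb, -⟩ := LegPair.ne_of_join h2.right
  have ab := h1.ne
  have lr := k1.ne
  refine ⟨?_, ?_, ?_⟩
  · rintro ((f | (_ | _)) | (_ | _)) <;> simp
  · rintro ((f | (_ | _)) | (_ | _))
    · by_cases fa : f = a
      · subst fa
        simp [join_rot_inl, la.symm, ra.symm]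
      by_cases fb : f = b
      · subst fb
        simp [join_rot_inl, lb.symm, rb.symm]
      by_cases fl : f = l
      · subst fl
        simp [join_rot_inl, la, lb]
      by_cases fr : f = r
      · subst fr
        simp [join_rot_inl, ra, rb]
      simp [join_rot_inl, fa, fb, fl, fr]
    all_goals simp [join_rot_inl]
  · rintro ((f | (_ | _)) | (_ | _)) <;> simp [join_label_inl, la, lb, la.symm, ra.symm]
    grind

end

section
variable {G : UniDiagram n F} {G' : UniDiagram n F'} {a b : F}

theorem tri_eq_of_iso_of_label [Finite F] [Finite F'] {φ : F ≃ F'} (h : IsIso G G' φ)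
    {w : LegOrder G} {w' : LegOrder G'}
    (hw : ∀ f g i, G.label f = some i → G.label g = some i →
      (w'.lt (φ f) (φ g) ↔ w.lt f g)) : tri G w = tri G' w' := by
  refine tri_eq_of_iso h fun f g => ⟨fun hl => ?_, fun hl => ?_⟩
  · obtain ⟨i, hf, hg⟩ := w'.label_of_lt _ _ hl
    rw [h.label] at hf hg
    exact (hw f g i hf hg).1 hl
  · obtain ⟨i, hf, hg⟩ := w.label_of_lt _ _ hl
    exact (hw f g i hf hg).2 hl

theorem label_place {h : G.LegPair a b} {f : F ⊕ StemFlag} {i : Fin n}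
    (hf : (G.join a b h).label f = some i) : G.label (place a f) = some i := by
  rcases f with f | (_ | _)
  · exact (label_of_join_inl hf).2.2
  · simp at hf
  · exact hf

theorem LegOrder.join_lt_of_label (h : G.LegPair a b) (w : LegOrder G) {f g : F ⊕ StemFlag}
    {i : Fin n} (hf : (G.join a b h).label f = some i) (hg : (G.join a b h).label g = some i) :
    (w.join h).lt f g ↔ w.lt (place a f) (place a g) := by
  rw [join_lt, and_iff_right ⟨i, hf, hg⟩]

theorem LegOrder.join_join_lt_of_label (h : G.LegPair a b) {c e : F ⊕ StemFlag}
    (h' : (G.join a b h).LegPair c e) (w : LegOrder G)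
    {f g : (F ⊕ StemFlag) ⊕ StemFlag} {i : Fin n}
    (hf : ((G.join a b h).join c e h').label f = some i)
    (hg : ((G.join a b h).join c e h').label g = some i) :
    ((w.join h).join h').lt f g ↔ w.lt (place a (place c f)) (place a (place c g)) := by
  rw [join_lt_of_label _ _ hf hg, join_lt_of_label _ _ (label_place hf) (label_place hg)]

end

section
variable [Finite F] {G : UniDiagram n F} {w : LegOrder G} {a b c : F}

/-- Reversing the cyclic order at the vertex of a join amounts to exchanging the two legs. -/
theorem tri_flip_join (h : w.Consec a b) :
    tri ((G.join a b h.legPair).flip (.inr stem))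
      ((w.join h.legPair).copy _ fun _ => rfl) =
    tri (G.join b a h.legPair.symm) ((w.swap a b).join h.legPair.symm) := by
  have ab := h.ne
  refine tri_eq_of_iso (φ := Equiv.refl _) ⟨?_, ?_, ?_⟩ ?_
  · rintro (f | (_ | _)) <;> rfl
  · rintro (f | (_ | _))
    · simp only [Equiv.refl_apply, flip_rot, SameVertex, join_rot_inl, join_rot_stem]
      by_cases fa : f = a
      · subst fa; simp [ab, ab.symm]
      by_cases fb : f = b
      · subst fb; simp [ab.symm]
      simp [fa, fb, ab.symm]
    · simp [flip_rot, SameVertex]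
    · simp [flip_rot, SameVertex]
  · rintro (f | (_ | _))
    · simp only [Equiv.refl_apply, flip_label, join_label_inl, or_comm]
    · rfl
    · simp [flip_label, h.label]
  · intro f g
    change ((w.swap a b).join h.legPair.symm).lt f g ↔ (w.join h.legPair).lt f g
    rw [join_lt, join_lt]
    have hl : ∀ f, (G.join b a h.legPair.symm).label f = (G.join a b h.legPair).label f := by
      rintro (f | (_ | _))
      · simp only [join_label_inl, or_comm]
      · rfl
      · simp [h.label]
    rw [hl, hl]
    refine and_congr_right fun ⟨i, hf, hg⟩ => ?_
    rw [swap_lt_iff _ h.label]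
    have key : ∀ f, (G.join a b h.legPair).label f = some i →
        Equiv.swap a b (place b f) = place a f := by
      rintro (f | _) hf
      · have := label_of_join_inl hf
        exact Equiv.swap_apply_of_ne_of_ne this.1 this.2.1
      · exact Equiv.swap_apply_right _ _
    rw [key f hf, key g hg]

theorem tri_ihxH_join (hab : w.Consec a b) (hbc : w.Consec b c) :
    tri (ihxH (innerEdge_join hab.legPair (hab.join_foot_left hbc).legPair))
      (((w.join hab.legPair).join (hab.join_foot_left hbc).legPair).copy _ (ihxH_label _)) =
    tri _ ((w.join hbc.legPair).join (hab.join_foot_right hbc).legPair) := by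
  have hiso := isIso_ihxH_join hab.legPair (hab.join_foot_left hbc).legPair hbc.legPair
    (hab.join_foot_right hbc).legPair
  refine (tri_eq_of_iso_of_label hiso fun f g i hf hg => ?_).symm
  rw [copy_lt, join_join_lt_of_label _ _ _ hf hg,
    join_join_lt_of_label _ _ _ ((hiso.label f).trans hf) ((hiso.label g).trans hg)]
  have key : ∀ f, ((G.join b c hbc.legPair).join _ _ (hab.join_foot_right hbc).legPair).label f
      = some i → place a (place (.inr foot) (stemSwap F f)) = place b (place (.inl a) f) := by
    rintro ((f | (_ | _)) | (_ | _)) h <;> simp_all [place, join_label_inl]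
  rw [key f hf, key g hg]

theorem tri_ihxX_join (hab : w.Consec a b) (hbc : w.Consec b c) :
    tri (ihxX (innerEdge_join hab.legPair (hab.join_foot_left hbc).legPair))
      (((w.join hab.legPair).join (hab.join_foot_left hbc).legPair).copy _ (ihxX_label _)) =
    tri _ (((w.swap a b).join (consec_swap_left hab hbc).legPair).join
      (hab.swap.join_foot_right (consec_swap_left hab hbc)).legPair) := by
  have hac := consec_swap_left hab hbc
  have hiso := isIso_ihxX_join hab.legPair (hab.join_foot_left hbc).legPair hac.legPair
    (hab.swap.join_foot_right hac).legPair hab.label.symm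
  refine (tri_eq_of_iso_of_label hiso fun f g i hf hg => ?_).symm
  rw [copy_lt, join_join_lt_of_label _ _ _ hf hg,
    join_join_lt_of_label _ _ _ ((hiso.label f).trans hf) ((hiso.label g).trans hg),
    swap_lt_iff _ hab.label]
  have key : ∀ f, ((G.join a c hac.legPair).join _ _ (hab.swap.join_foot_right hac).legPair).label f
      = some i → place a (place (.inr foot) (stemSwap F f)) =
        Equiv.swap a b (place a (place (.inl b) f)) := by
    rintro ((f | (_ | _)) | (_ | _)) h <;> simp_all [place, join_label_inl]
    exact (Equiv.swap_apply_of_ne_of_ne (fun e => by simp_all) (fun e => by simp_all)).symm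
  rw [key f hf, key g hg]

theorem tri_join_join (h : w.Consec a b) {l r : F} (h' : w.Consec l r)
    (h1 : l ≠ a) (h2 : l ≠ b) (h3 : r ≠ a) (h4 : r ≠ b) :
    tri _ ((w.join h.legPair).join (h.join_of_disjoint h' h1 h2 h3 h4).legPair) =
    tri _ ((w.join h'.legPair).join
      (h'.join_of_disjoint h h1.symm h3.symm h2.symm h4.symm).legPair) := by
  have hiso := isIso_join_join h.legPair (h.join_of_disjoint h' h1 h2 h3 h4).legPair h'.legPair
      (h'.join_of_disjoint h h1.symm h3.symm h2.symm h4.symm).legPair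
  refine tri_eq_of_iso_of_label hiso fun f g i hf hg => ?_
  rw [join_join_lt_of_label _ _ _ hf hg,
    join_join_lt_of_label _ _ _ ((hiso.label f).trans hf) ((hiso.label g).trans hg)]
  have key : ∀ f, ((G.join a b h.legPair).join _ _
      (h.join_of_disjoint h' h1 h2 h3 h4).legPair).label f = some i →
      place l (place (.inl a) ((Equiv.trans (Equiv.sumAssoc _ _ _) (Equiv.trans
        (Equiv.sumCongr (Equiv.refl _) (Equiv.sumComm _ _)) (Equiv.sumAssoc _ _ _).symm)) f)) =
      place a (place (.inl l) f) := by
    rintro ((f | (_ | _)) | (_ | _)) h <;> simp_all [place, join_label_inl]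
  rw [key f hf, key g hg]

end

end UniDiagram

/-! ### Weights: functions that satisfy (STU) and (CL2A) -/

theorem d_mul_inv (i : Fin n) :
    (AddMonoidAlgebra.single (Finsupp.single i (-1)) 1 : Lam n) * d i = 1 := by
  rw [d, AddMonoidAlgebra.single_mul_single, ← Finsupp.single_add, neg_add_cancel,
    Finsupp.single_zero, one_mul]
  rfl

theorem d_smul_injective {M : Type*} [AddCommGroup M] [Module (Lam n) M] (i j : Fin n) {x y : M}
    (h : (d i * d j) • x = (d i * d j) • y) : x = y := by
  have h1 : IsUnit (d i * d j) := (IsUnit.of_mul_eq_one_right _ (d_mul_inv i)).mul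
    (IsUnit.of_mul_eq_one_right _ (d_mul_inv j))
  exact h1.smul_left_cancel.1 h

/-- A function on trivalent diagrams with values in a module over the Laurent polynomials that
satisfies relations (STU) and (CL2A). -/
structure IsWeight {M : Type*} [AddCommGroup M] [Module (Lam n) M] (s : TriClass n → M) :
    Prop where
  stu : ∀ {F : Type} [Finite F] {G : UniDiagram n F} {w : LegOrder G} {l r : F}
    (hc : w.Consec l r), s (tri _ (w.join hc.legPair)) = s (tri G w) - s (tri G (w.swap l r))
  cl2 : ∀ {F : Type} [Finite F] {G : UniDiagram n F} {x : F} (_ : G.InnerEdge x) {i j : Fin n}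
    (w : LegOrder (G.ins x i j)), s (tri _ w) = (d i * d j) • s (tri G w.old)

theorem tri_congr [Finite F] {G G' : UniDiagram n F} {w : LegOrder G} {w' : LegOrder G'}
    (h : G = G') (hw : ∀ f g, w.lt f g ↔ w'.lt f g) : tri G w = tri G' w' :=
  congrArg triClass (TriDiagram.ext' h hw)

namespace UniDiagram

variable {G : UniDiagram n F}

theorem SameVertex.flip_iff (v a f : F) : (G.flip v).SameVertex a f ↔ G.SameVertex a f := by
  have h1 := G.rot_rot_rot
  unfold SameVertex
  simp only [flip_rot]
  have h2 : G.SameVertex v a → G.SameVertex v (G.rot (G.rot a)) := fun h => h.rot.rot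
  have h3 : G.SameVertex v (G.rot a) → G.SameVertex v a := fun h => by
    have := h.rot.rot; rwa [h1] at this
  have h4 : G.SameVertex v a → G.SameVertex v (G.rot a) := fun h => h.rot
  split_ifs <;> grind

theorem isTri_flip (v f : F) : (G.flip v).IsTri f ↔ G.IsTri f := by
  unfold IsTri
  rw [flip_rot]
  have h1 := G.rot_rot_rot f
  split_ifs with h
  · grind
  · rfl

theorem flip_congr {v v' : F} (h : G.SameVertex v v') : G.flip v = G.flip v' := by
  have : ∀ f, G.SameVertex v f ↔ G.SameVertex v' f := fun f =>
    ⟨fun h' => h.symm.trans h', fun h' => h.trans h'⟩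
  ext1 f
  · rfl
  · simp only [flip_rot, this]
  · rfl

/-- The trivalent vertex of `v` is internal: all its edges lead to trivalent vertices. -/
structure IsInternal (G : UniDiagram n F) (v : F) : Prop where
  isTri : G.IsTri v
  opp : ∀ f, G.SameVertex v f → G.IsTri (G.opp f)

theorem IsInternal.mk' {v : F} (h0 : G.IsTri v) (h1 : G.IsTri (G.opp v))
    (h2 : G.IsTri (G.opp (G.rot v))) (h3 : G.IsTri (G.opp (G.rot (G.rot v)))) :
    G.IsInternal v := by
  refine ⟨h0, ?_⟩
  rintro f (rfl | rfl | rfl) <;> assumption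

theorem IsInternal.congr {v v' : F} (h : G.IsInternal v) (h' : G.SameVertex v v') :
    G.IsInternal v' :=
  ⟨h'.isTri h.isTri, fun f hf => h.opp f (h'.trans hf)⟩

open StemFlag in
/-- Facts about a join that is transported along an isomorphism. -/
theorem isTri_of_isIso_join {T : UniDiagram n F} {G' : UniDiagram n F'} {l r : F}
    {h : T.LegPair l r} {φ : F ⊕ StemFlag ≃ F'} (hφ : IsIso (T.join l r h) G' φ) {f : F}
    (hl : f ≠ l) (hr : f ≠ r) : T.IsTri f ↔ G'.IsTri (φ (.inl f)) := by
  rw [hφ.isTri]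
  unfold IsTri
  rw [join_rot_of_ne h hl hr, ne_eq, ne_eq, Sum.inl_injective.eq_iff]

theorem isTri_ins_inl {x : F} {i j : Fin n} (f : F) :
    (G.ins x i j).IsTri (.inl f) ↔ G.IsTri f := by
  unfold IsTri
  rw [ins_rot_inl, ne_eq, ne_eq, Sum.inl_injective.eq_iff]

end UniDiagram

namespace IsWeight

open StemFlag InsFlag

variable {M : Type*} [AddCommGroup M] [Module (Lam n) M] {s : TriClass n → M} (hs : IsWeight s)
variable [Finite F] {G : UniDiagram n F}
include hs

/-- A leg at a vertex whose two other edges lead to trivalent vertices can be exchanged with its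
neighbour: insert two legs at one of these edges; by (CL2A) all three legs of the resulting row
can play the role of the old one. -/
theorem swap_of_legVertex {w : LegOrder G} {l r : F} (hc : w.Consec l r)
    (hz : G.LegVertex (G.opp l)) (h1 : G.IsTri (G.opp (G.rot (G.opp l))))
    (h2 : G.IsTri (G.opp (G.rot (G.rot (G.opp l))))) : s (tri G (w.swap l r)) = s (tri G w) := by
  obtain ⟨i, hi⟩ := G.exists_label hc.rot_left
  have hi' : G.label (G.opp (G.opp l)) = some i := by rwa [G.opp_opp]
  have hir : G.label r = some i := hc.label ▸ hi
  have e1 : G.InnerEdge (G.opp (G.rot (G.rot (G.opp l)))) :=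
    InnerEdge.opp ⟨hz.isTri.rot.rot, h2, fun h => hz.left
      (SameVertex.trans (Or.inr (Or.inr rfl)) h)⟩
  have e2 : G.InnerEdge (G.rot (G.opp l)) :=
    ⟨hz.isTri.rot, h1, fun h => hz.right (SameVertex.trans (Or.inr (Or.inl rfl)) h)⟩
  set W := w.lift (G.opp (G.rot (G.rot (G.opp l)))) i r hir with hW
  have k1 := hs.cl2 e1 W
  rw [← tri_comap (isIso_row hz hi').symm W, hs.cl2 e2, hW, lift_old] at k1
  rw [← d_smul_injective i i k1]
  congr 2
  have hne := hc.ne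
  ext f g
  suffices G.rot f = f → G.rot g = g → ((w.swap l r).lt f g ↔ _) from
    ⟨fun h => (this (rot_left _ h) (rot_right _ h)).1 h,
      fun h => (this (rot_left _ h) (rot_right _ h)).2 h⟩
  intro hf hg
  rw [old_row hz hi' _ hf hg, G.opp_opp, hc.swap_lt]
  by_cases fl : f = l
  · subst fl
    by_cases gl : g = f
    · subst gl; simp [LegOrder.irrefl, hne]
    by_cases gr : g = r
    · subst gr; simp [w.irrefl, hne, gl]
    · simp [gl, gr, hne, hc.right_lt_iff gr]
  · by_cases gl : g = l
    · subst gl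
      by_cases fr : f = r
      · subst fr; simp [fl]
      · simp [fl, fr, hne, hc.lt_left_iff fl]
    · simp [fl, gl]

/-- Relation (AS) at a vertex with a leg. -/
theorem flip_of_leg {z : F} (hz : G.IsTri z) (hleg : G.rot (G.opp z) = G.opp z) (w : LegOrder G) :
    s (tri (G.flip z) (w.copy _ (flip_label _ _))) = - s (tri G w) := by
  obtain ⟨F₀, _, T, u, l, r, hc, φ, hφ, rfl, hw⟩ := exists_unjoin G w z hz hleg
  rw [← tri_eq_of_iso hφ hw, ← tri_eq_of_iso (hφ.flip (.inr stem))
    (w := (u.join hc.legPair).copy _ (flip_label _ _)) hw, tri_flip_join hc, hs.stu hc,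
    hs.stu hc.swap, swap_comm _ r l, swap_swap, neg_sub]

/-- A diagram with a loop at a vertex with a leg has weight zero. -/
theorem eq_zero_of_loop {z : F} (hz : G.IsTri z) (hleg : G.rot (G.opp z) = G.opp z)
    (hloop : G.opp (G.rot z) = G.rot (G.rot z)) (w : LegOrder G) : s (tri G w) = 0 := by
  obtain ⟨F₀, _, T, u, l, r, hc, φ, hφ, rfl, hw⟩ := exists_unjoin G w z hz hleg
  rw [← tri_eq_of_iso hφ hw, hs.stu hc, sub_eq_zero]
  have h1 : T.opp r = l := by
    rw [hφ.rot, hφ.rot, hφ.opp, join_rot_stem, join_rot_right] at hloop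
    exact Sum.inl_injective (φ.injective hloop)
  have h2 : T.opp l = r := by rw [← h1, T.opp_opp]
  refine congrArg s <| tri_eq_of_iso (w := u) (w' := u.swap l r) (φ := Equiv.swap l r)
    ⟨fun f => ?_, fun f => ?_, fun f => ?_⟩
    (fun f g => by rw [swap_lt_iff _ hc.label, Equiv.swap_apply_self, Equiv.swap_apply_self])
  · have h3 := T.opp_injective
    have h4 := T.opp_opp
    simp only [Equiv.swap_apply_def]
    grind
  · have h3 := T.rot_injective
    have h4 := hc.rot_left
    have h5 := hc.rot_right
    simp only [Equiv.swap_apply_def]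
    grind
  · simp only [Equiv.swap_apply_def]
    have := hc.label
    grind

/-- A leg whose neighbours at its vertex are trivalent can be exchanged with the next leg, even if
its vertex has a loop. -/
theorem swap_of_isTri {w : LegOrder G} {l r : F} (hc : w.Consec l r) (h0 : G.IsTri (G.opp l))
    (h1 : G.IsTri (G.opp (G.rot (G.opp l)))) (h2 : G.IsTri (G.opp (G.rot (G.rot (G.opp l))))) :
    s (tri G (w.swap l r)) = s (tri G w) := by
  have hleg : G.rot (G.opp (G.opp l)) = G.opp (G.opp l) := by rw [G.opp_opp, hc.rot_left]
  by_cases hloop : G.opp (G.rot (G.opp l)) = G.rot (G.rot (G.opp l))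
  · rw [hs.eq_zero_of_loop h0 hleg hloop, hs.eq_zero_of_loop h0 hleg hloop]
  have hloop' : G.opp (G.rot (G.rot (G.opp l))) ≠ G.rot (G.opp l) := fun h =>
    hloop (eq_opp_of_opp_eq h).symm
  have h3 := h0.rot_rot_ne
  have h4 := h0.rot
  have key : ∀ f, f ≠ G.opp l → G.IsTri f → G.opp f ≠ G.opp l := fun f _ hf h => by
    rw [G.opp_injective h] at hf
    exact hf hc.rot_left
  refine hs.swap_of_legVertex hc ⟨h0, hleg, ?_, ?_⟩ h1 h2
  · rintro (h | h | h)
    · exact key _ h3 h0.rot.rot h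
    · exact hloop' h
    · exact G.opp_ne _ h
  · rintro (h | h | h)
    · exact key _ h0 h0.rot h
    · exact G.opp_ne _ h
    · exact hloop h

/-- Relation (IntV): insert two legs into an edge at the internal vertex and cut off the first one.
By (STU) the weight is a difference of two values, which agree as in both diagrams the old internal
vertex has a leg that can be moved freely. -/
theorem eq_zero_of_isInternal {v : F} (hv : G.IsInternal v) (w : LegOrder G) :
    s (tri G w) = 0 := by
  -- choose the flag of the vertex such that its edge is not a loop
  obtain ⟨x, hx, hxo⟩ : ∃ x, G.SameVertex v x ∧ ¬ G.SameVertex x (G.opp x) := by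
    by_contra! hcon
    have h1 := hcon v (Or.inl rfl)
    have h2 := hcon (G.rot v) (Or.inr (Or.inl rfl))
    have h3 := hcon (G.rot (G.rot v)) (Or.inr (Or.inr rfl))
    have := hv.isTri
    have := this.rot_rot_ne
    have := G.rot_rot_rot v
    have := G.opp_opp
    have := G.opp_ne
    unfold SameVertex IsTri at *
    grind
  have hv := hv.congr hx
  have hin : G.InnerEdge x := ⟨hv.isTri, hv.opp x (Or.inl rfl), hxo⟩
  obtain ⟨u, hu, -⟩ := G.exists_leg x
  obtain ⟨i, hi⟩ := G.exists_label hu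
  have h1 := hs.cl2 hin (w.lift x i u hi)
  rw [lift_old] at h1
  suffices s (tri _ (w.lift x i u hi)) = 0 from
    d_smul_injective i i (by rw [← h1, this, smul_zero])
  obtain ⟨F₀, _, T, u', l, r, hc, φ, hφ, hz, hw⟩ := exists_unjoin _ (w.lift x i u hi) (.inr aLeg)
    (by simp [IsTri]) (by simp)
  rw [← tri_eq_of_iso hφ hw, hs.stu hc, sub_eq_zero]
  have e1 : φ (.inl r) = .inr aOut := by rw [← join_rot_stem hc.legPair, ← hφ.rot, hz]; simp
  have e2 : φ (.inl l) = .inr aIn := by rw [← join_rot_right hc.legPair, ← hφ.rot, e1]; simp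
  have e3 : φ (.inl (T.opp l)) = .inl x := by
    rw [← join_opp_inl hc.legPair, ← hφ.opp, e2]; simp
  have ne : ∀ {f : F₀} {g : F}, φ (.inl f) = .inl g → f ≠ l ∧ f ≠ r := fun {f g} h =>
    ⟨fun h' => by subst h'; rw [e2] at h; simp at h, fun h' => by subst h'; rw [e1] at h; simp at h⟩
  have rot : ∀ {f g}, φ (.inl f) = .inl g → φ (.inl (T.rot f)) = .inl (G.rot g) := fun {f g} h => by
    rw [← join_rot_of_ne hc.legPair (ne h).1 (ne h).2, ← hφ.rot, h, ins_rot_inl]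
  have tri : ∀ {f g}, φ (.inl f) = .inl g → (T.IsTri f ↔ G.IsTri g) := fun {f g} h => by
    rw [isTri_of_isIso_join hφ (ne h).1 (ne h).2, h, isTri_ins_inl]
  have e4 := rot e3
  have e5 := rot e4
  have hne : ∀ f, f ≠ x → G.SameVertex x f → f ≠ G.opp x := fun f _ hf h => hxo (h ▸ hf)
  have e6 : φ (.inl (T.opp (T.rot (T.opp l)))) = .inl (G.opp (G.rot x)) := by
    rw [← join_opp_inl hc.legPair, ← hφ.opp, e4, ins_opp_of_ne _ _ _ _ hv.isTri
      (hne _ hv.isTri (Or.inr (Or.inl rfl)))]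
  have e7 : φ (.inl (T.opp (T.rot (T.rot (T.opp l))))) = .inl (G.opp (G.rot (G.rot x))) := by
    rw [← join_opp_inl hc.legPair, ← hφ.opp, e5, ins_opp_of_ne _ _ _ _ hv.isTri.rot_rot_ne
      (hne _ hv.isTri.rot_rot_ne (Or.inr (Or.inr rfl)))]
  exact (hs.swap_of_isTri hc ((tri e3).2 hv.isTri) ((tri e6).2 (hv.opp _ (Or.inr (Or.inl rfl))))
    ((tri e7).2 (hv.opp _ (Or.inr (Or.inr rfl))))).symm

/-- Relation (AS): a vertex with a leg arises by joining two legs, and a vertex without a leg is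
internal. -/
theorem flip {v : F} (hv : G.IsTri v) (w : LegOrder G) :
    s (tri (G.flip v) (w.copy _ (flip_label _ _))) = - s (tri G w) := by
  by_cases h : ∃ f, G.SameVertex v f ∧ ¬ G.IsTri (G.opp f)
  · obtain ⟨f, h1, h2⟩ := h
    have h3 := hs.flip_of_leg (h1.isTri hv) (not_not.1 h2) w
    rw [← h3]
    exact congrArg s (tri_congr (flip_congr h1) fun _ _ => Iff.rfl)
  · push Not at h
    have h1 : (G.flip v).IsInternal v := ⟨(isTri_flip _ _).2 hv, fun f hf =>
      (isTri_flip _ _).2 (h f ((SameVertex.flip_iff _ _ _).1 hf))⟩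
    rw [hs.eq_zero_of_isInternal ⟨hv, h⟩, hs.eq_zero_of_isInternal h1, neg_zero]

end IsWeight

/-! ### Relation (IHX) for weights -/

namespace UniDiagram

open StemFlag

theorem LegOrder.swap_braid {G : UniDiagram n F} {w : LegOrder G} {a b c : F}
    (hab : G.label a = G.label b) (hbc : G.label b = G.label c) :
    ((w.swap b c).swap a c).swap a b = ((w.swap a b).swap a c).swap b c := by
  have hac := hab.trans hbc
  ext f g
  simp only [swap_lt_iff _ hab, swap_lt_iff _ hbc, swap_lt_iff _ hac]
  have key : ∀ f, Equiv.swap b c (Equiv.swap a c (Equiv.swap a b f)) =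
      Equiv.swap a b (Equiv.swap a c (Equiv.swap b c f)) := fun f => by
    simp only [Equiv.swap_apply_def]
    grind
  rw [key, key]

theorem LegOrder.Consec.of_join_foot {G : UniDiagram n F} {w : LegOrder G} {a b c : F}
    (hab : w.Consec a b) (h : (w.join hab.legPair).Consec (.inr foot) (.inl c)) :
    w.Consec b c := by
  obtain ⟨ca, cb, -⟩ := LegPair.ne_of_join h.rot_right
  have h1 := (join_foot_lt hab.legPair w ca cb).1 h.lt
  refine ⟨(hab.right_lt_iff cb).2 h1, fun f hf => ?_⟩
  have fb := w.ne_of_lt hf.1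
  have fa : f ≠ a := fun h => w.asymm hab.lt (h ▸ hf.1)
  exact h.not_between (.inl f) ⟨(join_foot_lt hab.legPair w fa fb.symm).2
    ((hab.right_lt_iff fb.symm).1 hf.1), (join_lt_inl _ _ fa fb.symm ca cb).2 hf.2⟩

theorem LegOrder.Consec.of_iso {G : UniDiagram n F} {G' : UniDiagram n F'} {w : LegOrder G}
    {w' : LegOrder G'} {φ : F ≃ F'} (hw : ∀ f g, w'.lt (φ f) (φ g) ↔ w.lt f g) {l r : F}
    (h : w'.Consec (φ l) (φ r)) : w.Consec l r :=
  ⟨(hw _ _).1 h.lt, fun f hf => h.not_between (φ f) ⟨(hw _ _).2 hf.1, (hw _ _).2 hf.2⟩⟩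

end UniDiagram

/-- Relation (IHX) for `s` at the edge of `x`. -/
def SatisfiesIHX {M : Type*} [AddCommGroup M] (s : TriClass n → M) [Finite F] {G : UniDiagram n F}
    (w : LegOrder G) {x : F} (h : G.InnerEdge x) : Prop :=
  s (tri G w) = s (tri (ihxH h) (w.copy _ (ihxH_label h))) -
    s (tri (ihxX h) (w.copy _ (ihxX_label h)))

theorem SatisfiesIHX.of_iso {M : Type*} [AddCommGroup M] {s : TriClass n → M} [Finite F]
    [Finite F'] {G : UniDiagram n F} {G' : UniDiagram n F'} {φ : F ≃ F'} (h : IsIso G G' φ)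
    {w : LegOrder G} {w' : LegOrder G'} (hw : ∀ f g, w'.lt (φ f) (φ g) ↔ w.lt f g) {x : F}
    {hx : G.InnerEdge x} (hs : SatisfiesIHX s w hx) : SatisfiesIHX s w' (h.innerEdge hx) := by
  unfold SatisfiesIHX at hs ⊢
  rw [← tri_eq_of_iso h hw, hs, tri_eq_of_iso (h.ihxH hx (h.innerEdge hx))
    (w := w.copy _ (ihxH_label hx)) (w' := w'.copy _ (ihxH_label (h.innerEdge hx)))
    (fun f g => hw f g),
    tri_eq_of_iso (h.ihxX hx (h.innerEdge hx))
    (w := w.copy _ (ihxX_label hx)) (w' := w'.copy _ (ihxX_label (h.innerEdge hx)))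
    (fun f g => hw f g)]

namespace IsWeight

open StemFlag InsFlag

variable {M : Type*} [AddCommGroup M] [Module (Lam n) M] {s : TriClass n → M} (hs : IsWeight s)
variable [Finite F] {G : UniDiagram n F}
include hs

/-- Relation (IHX) for a diagram that arises by joining three legs is the Jacobi identity for
permutations of these legs. -/
theorem ihx_join {w : LegOrder G} {a b c : F} (hab : w.Consec a b) (hbc : w.Consec b c) :
    SatisfiesIHX s ((w.join hab.legPair).join (hab.join_foot_left hbc).legPair)
      (innerEdge_join hab.legPair (hab.join_foot_left hbc).legPair) := by
  have hac := consec_swap_left hab hbc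
  have hac' := consec_swap_right hab hbc
  have h1 : ((w.swap b c).swap a c).Consec a b := consec_swap_left hac' hbc.swap
  have h2 : ((w.swap a b).swap a c).Consec b c := consec_swap_right hab.swap hac
  unfold SatisfiesIHX
  rw [tri_ihxH_join hab hbc, tri_ihxX_join hab hbc, hs.stu (hab.join_foot_left hbc),
    hs.stu (hab.join_foot_right hbc), hs.stu (hab.swap.join_foot_right hac),
    join_swap_foot_left hab hbc, join_swap_foot_right hab hbc, join_swap_foot_right hab.swap hac,
    swap_comm _ b a, swap_swap, hs.stu hab, hs.stu h1, hs.stu hbc, hs.stu h2, hs.stu hac,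
    hs.stu hac', swap_braid hab.label hbc.label]
  abel

theorem ihx_of_leg {x : F} (h : G.InnerEdge x)
    (hleg : G.rot (G.opp (G.rot (G.opp x))) = G.opp (G.rot (G.opp x))) (w : LegOrder G) :
    SatisfiesIHX s w h := by
  obtain ⟨F₁, _, T, u, l, r, hc, φ, hφ, hz, hw⟩ := exists_unjoin G w _ h.isTri_opp.rot hleg
  have e1 : φ (.inl r) = G.rot (G.rot (G.opp x)) := by
    rw [← join_rot_stem hc.legPair, ← hφ.rot, hz]
  have e2 : φ (.inl l) = G.opp x := by
    rw [← join_rot_right hc.legPair, ← hφ.rot, e1, G.rot_rot_rot]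
  have e3 : φ (.inl (T.opp l)) = x := by
    rw [← join_opp_inl hc.legPair, ← hφ.opp, e2, G.opp_opp]
  have hlr : T.opp l ≠ r := fun h' => h.not_same (by
    rw [h', e1] at e3
    nth_rewrite 1 [← e3]
    exact SameVertex.symm (Or.inr (Or.inr rfl)))
  have ht : T.IsTri (T.opp l) := by
    rw [isTri_of_isIso_join hφ (T.opp_ne l) hlr, e3]; exact h.isTri
  obtain ⟨F₂, _, T', u', a, b, hc', ψ, hψ, hz', hw'⟩ := exists_unjoin T u _ ht
    (by rw [T.opp_opp, hc.rot_left])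
  have e4 : ψ (.inr foot) = l := by
    rw [← join_opp_stem hc'.legPair, ← hψ.opp, hz', T.opp_opp]
  obtain ⟨y, hy⟩ := ψ.surjective r
  obtain ⟨c, rfl⟩ : ∃ c, y = .inl c := by
    rcases y with c | (_ | _)
    · exact ⟨c, rfl⟩
    · exact absurd (hz'.symm.trans hy) hlr
    · exact absurd (e4.symm.trans hy) hc.ne
  subst e4 hy
  have hc'' := hc.of_iso hw'
  have hbc := hc'.of_join_foot hc''
  have hiso := (hψ.join hc''.legPair hc.legPair).trans hφ
  have e5 : (Equiv.trans (Equiv.sumCongr ψ (Equiv.refl StemFlag)) φ) (.inl (.inr stem)) = x := by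
    rw [← e3, ← hz']; rfl
  subst e5
  refine SatisfiesIHX.of_iso hiso (fun f g => ?_) (hs.ihx_join hc' hbc)
  rw [Equiv.trans_apply, Equiv.trans_apply, hw, join_lt, join_lt,
    (hψ.join hc''.legPair hc.legPair).label, (hψ.join hc''.legPair hc.legPair).label]
  have hp : ∀ f, place (ψ (.inr foot)) (Equiv.sumCongr ψ (Equiv.refl _) f) =
      ψ (place (.inr foot) f) := by rintro (f | _) <;> rfl
  rw [hp, hp, hw']

/-- Relation (IHX) for the diagram with the opposite cyclic order at one end of the edge. -/
theorem ihx_of_flip {x : F} (h : G.InnerEdge x) (h' : (G.flip x).InnerEdge x) (w : LegOrder G)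
    (hf : SatisfiesIHX s (w.copy (G.flip x) (flip_label _ _)) h') : SatisfiesIHX s w h := by
  unfold SatisfiesIHX at hf ⊢
  obtain ⟨xp, xq, xy, xr, xs, pq, py, pr, ps, qy, qr, qs, yr, ys, rs⟩ := h.sixFlags
  have a1 := G.rot_rot_rot
  have n1 := h.not_same
  have f1 : (G.flip x).rot x = G.rot (G.rot x) := by simp [flip_rot, SameVertex]
  have f2 : (G.flip x).rot (G.rot (G.rot x)) = G.rot x := by simp [flip_rot, SameVertex, a1]
  have f3 : (G.flip x).rot (G.opp x) = G.rot (G.opp x) := by simp [flip_rot, n1]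
  have f4 : (G.flip x).rot (G.rot (G.opp x)) = G.rot (G.rot (G.opp x)) := by
    have : ¬ G.SameVertex x (G.rot (G.opp x)) := fun h => n1 (by
      have := h.rot.rot; rwa [a1] at this)
    simp [flip_rot, this]
  have old : ∀ f, ¬ G.SameVertex x f → (G.flip x).rot f = G.rot f := fun f hf => by
    rw [flip_rot, if_neg hf]
  have k1 : tri (ihxH h') ((w.copy (G.flip x) (flip_label _ _)).copy _ (ihxH_label h')) =
      tri (ihxX h) (w.copy _ (ihxX_label h)) := by
    refine tri_congr (UniDiagram.ext' (fun f => rfl) (fun f => ?_) fun f => rfl)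
      fun _ _ => Iff.rfl
    simp only [ihxX_rot, ihxH_rot, flip_opp, f1, f2, f3, f4]
    have := old f
    rw [sameVertex_iff_ne] at this
    grind
  have k2 : tri (ihxX h') ((w.copy (G.flip x) (flip_label _ _)).copy _ (ihxX_label h')) =
      tri (ihxH h) (w.copy _ (ihxH_label h)) := by
    refine tri_congr (UniDiagram.ext' (fun f => rfl) (fun f => ?_) fun f => rfl)
      fun _ _ => Iff.rfl
    simp only [ihxX_rot, ihxH_rot, flip_opp, f1, f2, f3, f4]
    have := old f
    rw [sameVertex_iff_ne] at this
    grind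
  rw [k1, k2, hs.flip h.isTri] at hf
  rw [← neg_sub, ← hf, neg_neg]

/-- Relation (IHX) with the roles of the two ends of the edge exchanged. -/
theorem ihx_of_opp {x : F} (h : G.InnerEdge x) (w : LegOrder G)
    (hf : SatisfiesIHX s w h.opp) : SatisfiesIHX s w h := by
  unfold SatisfiesIHX at hf ⊢
  rw [hf]
  obtain ⟨xp, xq, xy, xr, xs, pq, py, pr, ps, qy, qr, qs, yr, ys, rs⟩ := h.sixFlags
  have a1 := G.rot_rot_rot
  have o1 := G.opp_opp
  congr 1
  · refine congrArg s (tri_congr (UniDiagram.ext' (fun f => rfl) (fun f => ?_) fun f => rfl)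
      fun _ _ => Iff.rfl)
    simp only [ihxH_rot, o1]
    grind
  · have t1 : (ihxX h).IsTri x := by
      unfold IsTri; rw [ihxX_rot]; simp [xp.symm]
    have t2 : ((ihxX h).flip x).IsTri (G.opp x) := by
      rw [isTri_flip]; unfold IsTri; rw [ihxX_rot]; grind
    rw [← neg_neg (s (tri (ihxX h) _)), ← hs.flip t1, ← hs.flip t2]
    refine congrArg s (tri_eq_of_iso_of_label (φ := Equiv.swap x (G.opp x))
      ⟨fun f => ?_, fun f => ?_, fun f => ?_⟩ fun f g i hf hg => ?_)
    · simp only [flip_opp, ihxX_opp, Equiv.swap_apply_def]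
      grind
    · have n1 : ∀ f, (ihxX h).SameVertex x f ↔ f = x ∨ f = G.rot x ∨ f = G.rot (G.opp x) := by
        intro f; unfold SameVertex; simp only [ihxX_rot]; grind
      have n2 : ∀ f, (ihxX h).SameVertex (G.opp x) f ↔
          f = G.opp x ∨ f = G.rot (G.rot (G.opp x)) ∨ f = G.rot (G.rot x) := by
        intro f; unfold SameVertex; simp only [ihxX_rot]; grind
      simp only [flip_rot, SameVertex.flip_iff, n1, n2]
      simp only [ihxX_rot, o1, Equiv.swap_apply_def]
      grind
    · have l1 := G.label_eq_none h.isTri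
      have l2 := G.label_eq_none h.isTri_opp
      simp only [flip_label, ihxX_label, Equiv.swap_apply_def]
      grind
    · have l1 := G.label_eq_none h.isTri
      have l2 := G.label_eq_none h.isTri_opp
      rw [ihxX_label] at hf hg
      rw [Equiv.swap_apply_of_ne_of_ne, Equiv.swap_apply_of_ne_of_ne]
      · exact Iff.rfl
      all_goals rintro rfl; simp_all

/-- Relation (IHX): if one of the four outer edges is a leg, then the diagrams arise by joining three
legs; otherwise their vertices at the edge are internal. -/
theorem ihx {x : F} (h : G.InnerEdge x) (w : LegOrder G) : SatisfiesIHX s w h := by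
  have hfl : ∀ {G : UniDiagram n F} {x : F}, G.InnerEdge x → (G.flip x).InnerEdge x :=
    fun {G x} h => ⟨(isTri_flip _ _).2 h.isTri, (isTri_flip _ _).2 h.isTri_opp, fun h' =>
      h.not_same ((SameVertex.flip_iff _ _ _).1 h')⟩
  have f1 : ∀ {G : UniDiagram n F} {x : F}, G.InnerEdge x →
      (G.flip x).rot x = G.rot (G.rot x) := fun {G x} h => by
    rw [flip_rot, if_pos (show G.SameVertex x x from Or.inl rfl)]
  by_cases hr : G.rot (G.opp (G.rot (G.opp x))) = G.opp (G.rot (G.opp x))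
  · exact hs.ihx_of_leg h hr w
  by_cases hsl : G.rot (G.opp (G.rot (G.rot (G.opp x)))) = G.opp (G.rot (G.rot (G.opp x)))
  · refine hs.ihx_of_opp h w (hs.ihx_of_flip h.opp (hfl h.opp) w (hs.ihx_of_opp _ _
      (hs.ihx_of_leg _ ?_ _)))
    simp only [flip_opp, G.opp_opp, f1 h.opp]
    rw [flip_rot]
    split_ifs
    · rw [hsl, hsl]
    · exact hsl
  by_cases hp : G.rot (G.opp (G.rot x)) = G.opp (G.rot x)
  · refine hs.ihx_of_opp h w (hs.ihx_of_leg _ ?_ _)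
    rw [G.opp_opp, hp]
  by_cases hq : G.rot (G.opp (G.rot (G.rot x))) = G.opp (G.rot (G.rot x))
  · refine hs.ihx_of_flip h (hfl h) w (hs.ihx_of_opp _ _ (hs.ihx_of_leg _ ?_ _))
    simp only [flip_opp, G.opp_opp, f1 h]
    rw [flip_rot]
    split_ifs
    · rw [hq, hq]
    · exact hq
  obtain ⟨xp, xq, xy, xr, xs, pq, py, pr, ps, qy, qr, qs, yr, ys, rs⟩ := h.sixFlags
  have a1 := G.rot_rot_rot
  have tH : ∀ f, G.IsTri f → (ihxH h).IsTri f := fun f hf => by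
    unfold IsTri at hf ⊢; rw [ihxH_rot]; grind
  have tX : ∀ f, G.IsTri f → (ihxX h).IsTri f := fun f hf => by
    unfold IsTri at hf ⊢; rw [ihxX_rot]; grind
  have i1 : G.IsInternal x := .mk' h.isTri h.isTri_opp hp hq
  have i2 : (ihxH h).IsInternal x := by
    have e1 : (ihxH h).rot x = G.rot (G.rot x) := by simp [ihxH_rot]
    have e2 : (ihxH h).rot (G.rot (G.rot x)) = G.rot (G.opp x) := by
      simp [ihxH_rot, xq.symm]
    refine .mk' (tH _ h.isTri) (tH _ h.isTri_opp) ?_ ?_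
    · rw [e1, ihxH_opp]; exact tH _ hq
    · rw [e1, e2, ihxH_opp]; exact tH _ hr
  have i3 : (ihxX h).IsInternal x := by
    have e1 : (ihxX h).rot x = G.rot x := by simp [ihxX_rot]
    have e2 : (ihxX h).rot (G.rot x) = G.rot (G.opp x) := by
      simp [ihxX_rot, xp.symm]
    refine .mk' (tX _ h.isTri) (tX _ h.isTri_opp) ?_ ?_
    · rw [e1, ihxX_opp]; exact tX _ hp
    · rw [e1, e2, ihxX_opp]; exact tX _ hr
  unfold SatisfiesIHX
  rw [hs.eq_zero_of_isInternal i1, hs.eq_zero_of_isInternal i2, hs.eq_zero_of_isInternal i3,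
    sub_zero]

end IsWeight

/-! ### Joining legs is compatible with local changes of a diagram -/

namespace UniDiagram

open StemFlag

section
variable {G : UniDiagram n F} {l r : F}

theorem IsTri.ne_left {v : F} (hv : G.IsTri v) (h : G.LegPair l r) : v ≠ l := fun e =>
  hv (by rw [e, h.left])

theorem IsTri.join_rot {v : F} (hv : G.IsTri v) (h : G.LegPair l r) :
    (G.join l r h).rot (.inl v) = .inl (G.rot v) :=
  join_rot_of_ne h (hv.ne_left h) (hv.ne_left h.symm)

theorem IsTri.join {v : F} (hv : G.IsTri v) (h : G.LegPair l r) :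
    (G.join l r h).IsTri (.inl v) := fun e => hv (Sum.inl_injective (by
      rw [← hv.join_rot h, e]))

theorem IsTri.sameVertex_join {v : F} (hv : G.IsTri v) (h : G.LegPair l r) (f : F ⊕ StemFlag) :
    (G.join l r h).SameVertex (.inl v) f ↔ ∃ g, f = .inl g ∧ G.SameVertex v g := by
  unfold SameVertex
  rw [hv.join_rot h, hv.rot.join_rot h]
  constructor
  · rintro (rfl | rfl | rfl)
    · exact ⟨_, rfl, Or.inl rfl⟩
    · exact ⟨_, rfl, Or.inr (Or.inl rfl)⟩
    · exact ⟨_, rfl, Or.inr (Or.inr rfl)⟩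
  · rintro ⟨g, rfl, rfl | rfl | rfl⟩ <;> simp

theorem InnerEdge.join {x : F} (hx : G.InnerEdge x) (h : G.LegPair l r) :
    (G.join l r h).InnerEdge (.inl x) := by
  refine ⟨hx.isTri.join h, hx.isTri_opp.join h, fun h' => hx.not_same ?_⟩
  obtain ⟨g, hg, hg'⟩ := (hx.isTri.sameVertex_join h _).1 h'
  rw [join_opp_inl] at hg
  rwa [Sum.inl_injective hg]

theorem IsInternal.join {v : F} (hv : G.IsInternal v) (h : G.LegPair l r) :
    (G.join l r h).IsInternal (.inl v) := by
  refine ⟨hv.isTri.join h, fun f hf => ?_⟩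
  obtain ⟨g, rfl, hg⟩ := (hv.isTri.sameVertex_join h _).1 hf
  exact (hv.opp g hg).join h

theorem LegPair.congr {G' : UniDiagram n F} (h : G.LegPair l r)
    (hl : ∀ f, G'.label f = G.label f) : G'.LegPair l r := by
  have : ∀ f, G.rot f = f → G'.rot f = f := fun f hf => by
    rw [← G'.label_isSome, hl, G.label_isSome]; exact hf
  exact ⟨this l h.left, this r h.right, h.ne⟩

theorem LegOrder.Consec.copy {G' : UniDiagram n F} {w : LegOrder G} (h : w.Consec l r)
    (hl : ∀ f, G'.label f = G.label f) : (w.copy G' hl).Consec l r := ⟨h.lt, h.not_between⟩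

theorem LegOrder.copy_swap {G' : UniDiagram n F} {w : LegOrder G} (h : w.Consec l r)
    (hl : ∀ f, G'.label f = G.label f) : (w.copy G' hl).swap l r = (w.swap l r).copy G' hl := by
  ext f g
  rw [swap_lt_iff _ (h.copy hl).label, copy_lt, copy_lt, swap_lt_iff _ h.label]

theorem tri_join_copy [Finite F] {G' : UniDiagram n F} (w : LegOrder G) (h : G.LegPair l r)
    (hl : ∀ f, G'.label f = G.label f) {K : UniDiagram n (F ⊕ StemFlag)}
    (hK : G'.join l r (h.congr hl) = K) (hKl : ∀ f, K.label f = (G.join l r h).label f) :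
    tri (G'.join l r (h.congr hl)) ((w.copy G' hl).join (h.congr hl)) =
      tri K ((w.join h).copy K hKl) := by
  refine tri_congr hK fun f g => ?_
  rw [copy_lt, join_lt, join_lt, hK, hKl, hKl]
  rfl

theorem flip_join {v : F} (hv : G.IsTri v) (h : G.LegPair l r) (h' : (G.flip v).LegPair l r) :
    (G.flip v).join l r h' = (G.join l r h).flip (.inl v) := by
  have hs : ∀ f, (G.join l r h).SameVertex (.inl v) (.inl f) ↔ G.SameVertex v f := fun f => by
    rw [hv.sameVertex_join h]
    exact ⟨fun ⟨g, e, hg⟩ => Sum.inl_injective e ▸ hg, fun hf => ⟨f, rfl, hf⟩⟩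
  have hs' : ∀ s, ¬ (G.join l r h).SameVertex (.inl v) (.inr s) := fun s => by
    rw [hv.sameVertex_join h]; simp
  refine UniDiagram.ext' ?_ ?_ ?_
  · rintro (f | (_ | _)) <;> rfl
  · rintro (f | (_ | _))
    · rw [flip_rot]
      simp only [hs]
      by_cases hf : G.SameVertex v f
      · have ht := hf.isTri hv
        rw [if_pos hf, ht.join_rot h, ht.rot.join_rot h, join_rot_of_ne _ (ht.ne_left h)
          (ht.ne_left h.symm), flip_rot, if_pos hf]
      · rw [if_neg hf, join_rot_inl, join_rot_inl, flip_rot, if_neg hf]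
    · rw [flip_rot, if_neg (hs' _)]; rfl
    · rw [flip_rot, if_neg (hs' _)]; rfl
  · rintro (f | (_ | _)) <;> rfl

section
variable {x : F} (hx : G.InnerEdge x) (h : G.LegPair l r)
include hx h

theorem ihxH_join (h' : (ihxH hx).LegPair l r) :
    (ihxH hx).join l r h' = ihxH (hx.join h) := by
  refine UniDiagram.ext' ?_ ?_ ?_
  · rintro (f | (_ | _)) <;> rfl
  · have t1 := hx.isTri
    have t2 := hx.isTri_opp
    have e1 := t1.join_rot h
    have e2 := t1.rot.join_rot h
    have e3 := t2.join_rot h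
    have e4 := t2.rot.join_rot h
    have n1 := t1.ne_left h
    have n2 := t1.rot.ne_left h
    have n3 := t1.rot.rot.ne_left h
    have n4 := t2.ne_left h
    have n5 := t2.rot.ne_left h
    have n6 := t2.rot.rot.ne_left h
    have m1 := t1.ne_left h.symm
    have m2 := t1.rot.ne_left h.symm
    have m3 := t1.rot.rot.ne_left h.symm
    have m4 := t2.ne_left h.symm
    have m5 := t2.rot.ne_left h.symm
    have m6 := t2.rot.rot.ne_left h.symm
    rintro (f | (_ | _))
    · simp only [ihxH_rot, join_opp_inl, e1, e2, e3, e4, Sum.inl.injEq]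
      rw [join_rot_inl, join_rot_inl, ihxH_rot]
      by_cases fl : f = l
      · subst fl; simp [n1.symm, n2.symm, n3.symm, n4.symm, n5.symm, n6.symm]
      by_cases fr : f = r
      · subst fr; simp [fl, m1.symm, m2.symm, m3.symm, m4.symm, m5.symm, m6.symm]
      simp only [fl, fr, if_false, apply_ite (Sum.inl (β := StemFlag))]
    · simp only [ihxH_rot, join_opp_inl, e1, e2, e3, e4]; simp
    · simp only [ihxH_rot, join_opp_inl, e1, e2, e3, e4]; simp
  · rintro (f | (_ | _)) <;> rfl

theorem ihxX_join (h' : (ihxX hx).LegPair l r) :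
    (ihxX hx).join l r h' = ihxX (hx.join h) := by
  refine UniDiagram.ext' ?_ ?_ ?_
  · rintro (f | (_ | _)) <;> rfl
  · have t1 := hx.isTri
    have t2 := hx.isTri_opp
    have e1 := t1.join_rot h
    have e2 := t1.rot.join_rot h
    have e3 := t2.join_rot h
    have e4 := t2.rot.join_rot h
    have n1 := t1.ne_left h
    have n2 := t1.rot.ne_left h
    have n3 := t1.rot.rot.ne_left h
    have n4 := t2.ne_left h
    have n5 := t2.rot.ne_left h
    have n6 := t2.rot.rot.ne_left h
    have m1 := t1.ne_left h.symm
    have m2 := t1.rot.ne_left h.symm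
    have m3 := t1.rot.rot.ne_left h.symm
    have m4 := t2.ne_left h.symm
    have m5 := t2.rot.ne_left h.symm
    have m6 := t2.rot.rot.ne_left h.symm
    rintro (f | (_ | _))
    · simp only [ihxX_rot, join_opp_inl, e1, e2, e3, e4, Sum.inl.injEq]
      rw [join_rot_inl, join_rot_inl, ihxX_rot]
      by_cases fl : f = l
      · subst fl; simp [n1.symm, n2.symm, n3.symm, n4.symm, n5.symm, n6.symm]
      by_cases fr : f = r
      · subst fr; simp [fl, m1.symm, m2.symm, m3.symm, m4.symm, m5.symm, m6.symm]
      simp only [fl, fr, if_false, apply_ite (Sum.inl (β := StemFlag))]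
    · simp only [ihxX_rot, join_opp_inl, e1, e2, e3, e4]; simp
    · simp only [ihxX_rot, join_opp_inl, e1, e2, e3, e4]; simp
  · rintro (f | (_ | _)) <;> rfl

end

end

/-! ### The number of legs -/

/-- The number of legs. -/
def numLegs (G : UniDiagram n F) : ℕ := {f | G.rot f = f}.ncard

theorem numLegs_join [Finite F] {G : UniDiagram n F} {l r : F} (h : G.LegPair l r) :
    (G.join l r h).numLegs + 1 = G.numLegs := by
  have hinj : Set.InjOn (place l) {f | (G.join l r h).rot f = f} := by
    rintro (f | (_ | _)) hf (g | (_ | _)) hg hfg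
    · exact congrArg _ hfg
    · simp at hg
    · exact absurd hfg (LegPair.ne_of_join hf).1
    · simp at hf
    · rfl
    · simp at hf
    · exact absurd hfg.symm (LegPair.ne_of_join hg).1
    · simp at hg
    · rfl
  have himg : place l '' {f | (G.join l r h).rot f = f} = {f | G.rot f = f} \ {r} := by
    ext f
    constructor
    · rintro ⟨g | (_ | _), hg, rfl⟩
      · have := LegPair.ne_of_join hg
        exact ⟨this.2.2, this.2.1⟩
      · simp at hg
      · exact ⟨h.left, h.ne⟩
    · rintro ⟨h1, h2⟩
      by_cases hl : f = l
      · exact ⟨.inr foot, rfl, hl.symm⟩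
      · refine ⟨.inl f, ?_, rfl⟩
        have h2 : f ≠ r := h2
        have h1 : G.rot f = f := h1
        change (G.join l r h).rot (.inl f) = .inl f
        rw [join_rot_of_ne h hl h2, h1]
  unfold numLegs
  rw [← hinj.ncard_image, himg]
  exact Set.ncard_sdiff_singleton_add_one (s := {f | G.rot f = f}) h.right (Set.toFinite _)

theorem IsIso.numLegs {G : UniDiagram n F} {G' : UniDiagram n F'} {φ : F ≃ F'}
    (h : IsIso G G' φ) : G'.numLegs = G.numLegs := by
  unfold UniDiagram.numLegs
  rw [← Set.ncard_image_of_injective _ φ.injective]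
  congr 1
  ext f
  constructor
  · intro hf
    refine ⟨φ.symm f, ?_, φ.apply_symm_apply f⟩
    have hf : G'.rot f = f := hf
    change G.rot _ = _
    rw [h.symm.rot, hf]
  · rintro ⟨g, hg, rfl⟩
    have hg : G.rot g = g := hg
    change G'.rot _ = _
    rw [h.rot, hg]

theorem IsIso.blockEmbedding {G : UniDiagram n F} {G' : UniDiagram n F'} {φ : F ≃ F'}
    (h : IsIso G G' φ) : BlockEmbedding G G' φ := by
  have key : ∀ {F F' : Type} {G : UniDiagram n F} {G' : UniDiagram n F'} {φ : F ≃ F'},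
      IsIso G G' φ → ∀ f g, G.SameComponent f g → G'.SameComponent (φ f) (φ g) :=
    fun {F F' G G' φ} h f g hfg => hfg.map
      (fun f => by rw [← h.opp]; exact G'.sameComponent_opp _)
      (fun f => by rw [← h.rot]; exact G'.sameComponent_rot _)
  refine ⟨φ.injective, h.label, fun f g => ⟨fun hfg => ?_, key h f g⟩⟩
  simpa using key h.symm _ _ hfg

end UniDiagram

/-! ### The relations in the module `D(n)` -/

namespace D

open StemFlag

variable [Finite F] [Finite F'] {G : UniDiagram n F}

theorem eq_zero_of_mem {x : UniClass n →₀ Lam n}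
    (h : x ∈ ihxRel n ∪ asRel n ∪ intVRel n ∪ cl1bRel n ∪ cl2bRel n) :
    (Submodule.Quotient.mk x : D n) = 0 :=
  (Submodule.Quotient.mk_eq_zero _).2 (Submodule.subset_span h)

theorem mk_eq_of_iso {G' : UniDiagram n F'} {φ : F ≃ F'} (h : IsIso G G' φ) :
    D.mk G = D.mk G' := by
  unfold D.mk gen
  rw [uniClass_eq_of_iso h]

theorem mk_flip {v : F} (hv : G.IsTri v) : D.mk (G.flip v) = - D.mk G := by
  refine eq_neg_of_add_eq_zero_right (eq_zero_of_mem (Or.inl (Or.inl (Or.inl (Or.inr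
    ⟨F, inferInstance, G, G.flip v, v, hv, rfl, rfl, fun f hf => ?_, fun f hf => ?_, rfl⟩)))))
  · rw [flip_rot, if_pos hf]
  · rw [flip_rot, if_neg hf]

theorem mk_ihx {x : F} (h : G.InnerEdge x) : D.mk G = D.mk (ihxH h) - D.mk (ihxX h) :=
  sub_eq_zero.1 (eq_zero_of_mem (x := gen G - (gen (ihxH h) - gen (ihxX h)))
    (Or.inl (Or.inl (Or.inl (Or.inl
      ⟨F, inferInstance, G, ihxH h, ihxX h, x, _, _, _, _, isIHX h, rfl⟩)))))

theorem mk_of_isInternal {v : F} (hv : G.IsInternal v) : D.mk G = 0 :=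
  eq_zero_of_mem (Or.inl (Or.inl (Or.inr ⟨F, inferInstance, G, v, hv.isTri, hv.opp, rfl⟩)))

theorem mk_ins {x : F} (h : G.InnerEdge x) (i j : Fin n) :
    D.mk (G.ins x i j) = (d i * d j) • D.mk G :=
  sub_eq_zero.1 (eq_zero_of_mem (x := gen (G.ins x i j) - (d i * d j) • gen G)
    (Or.inr ⟨F, inferInstance, G.ins x i j, G, i, j, x, h.isTri, h.isTri_opp, h.not_same,
      G.isInsertion_ins x i j, rfl⟩))

end D

/-! ### Local changes of a diagram do not affect its components -/

namespace UniDiagram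

variable {G : UniDiagram n F}

theorem blockEmbedding_id {G' : UniDiagram n F} (ho : ∀ f, G'.opp f = G.opp f)
    (hl : ∀ f, G'.label f = G.label f) (h : ∀ f, G.SameComponent f (G'.rot f))
    (h' : ∀ f, G'.SameComponent f (G.rot f)) : BlockEmbedding G' G id where
  inj := Function.injective_id
  label f := (hl f).symm
  comp f g := by
    constructor
    · exact fun hfg => hfg.map (fun f => by rw [← ho]; exact G'.sameComponent_opp f) h'
    · exact fun hfg => hfg.map (fun f => by rw [ho]; exact G.sameComponent_opp f) h

theorem SameVertex.sameComponent {v f : F} (h : G.SameVertex v f) : G.SameComponent v f := by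
  have h1 := G.sameComponent_rot
  rcases h with rfl | rfl | rfl
  · exact SameComponent.refl _ _
  · exact h1 _
  · exact (h1 _).trans (h1 _)

theorem blockEmbedding_flip (v : F) : BlockEmbedding (G.flip v) G id := by
  refine blockEmbedding_id (flip_opp G v) (flip_label G v) (fun f => ?_) fun f => ?_
  · rw [flip_rot]
    split_ifs
    · exact SameVertex.sameComponent (Or.inr (Or.inr rfl))
    · exact G.sameComponent_rot f
  · by_cases h : G.SameVertex v f
    · have h1 := flip_rot G v f
      have h2 := flip_rot G v (G.rot (G.rot f))
      rw [if_pos h] at h1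
      rw [if_pos h.rot.rot, G.rot_rot_rot] at h2
      have h3 := (G.flip v).sameComponent_rot f
      have h4 := (G.flip v).sameComponent_rot (G.rot (G.rot f))
      rw [h1] at h3
      rw [h2] at h4
      exact h3.trans h4
    · have h1 := flip_rot G v f
      rw [if_neg h] at h1
      rw [← h1]
      exact (G.flip v).sameComponent_rot f

theorem blockEmbedding_of_isIHX {I H X : UniDiagram n F} {x p q r s : F}
    (h : IsIHX I H X x p q r s) : BlockEmbedding H I id ∧ BlockEmbedding X I id := by
  obtain ⟨h1, h2, h3, h4, h5, h6, h7, h8, h9, h10, h11, h12, h13, h14, h15, h16, h17, h18, h19,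
    h20, h21⟩ := h
  have key : ∀ {J K : UniDiagram n F} {p q r s : F}, J.rot x = p → J.rot p = q →
      J.rot (J.opp x) = r → J.rot r = s → (∀ f, f = x ∨ f = p ∨ f = q ∨ f = J.opp x ∨
      f = r ∨ f = s → K.rot f = x ∨ K.rot f = p ∨ K.rot f = q ∨ K.rot f = J.opp x ∨
      K.rot f = r ∨ K.rot f = s) → (∀ f, ¬ (f = x ∨ f = p ∨ f = q ∨ f = J.opp x ∨
      f = r ∨ f = s) → K.rot f = J.rot f) → ∀ f, J.SameComponent f (K.rot f) := by
    intro J K p q r s e1 e2 e3 e4 hc hn f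
    by_cases hf : f = x ∨ f = p ∨ f = q ∨ f = J.opp x ∨ f = r ∨ f = s
    · have k1 := J.sameComponent_rot x
      have k2 := J.sameComponent_rot p
      have k3 := J.sameComponent_rot (J.opp x)
      have k4 := J.sameComponent_rot r
      have k5 := J.sameComponent_opp x
      rw [e1] at k1
      rw [e2] at k2
      rw [e3] at k3
      rw [e4] at k4
      have hx : ∀ g, (g = x ∨ g = p ∨ g = q ∨ g = J.opp x ∨ g = r ∨ g = s) →
          J.SameComponent x g := by
        rintro g (rfl | rfl | rfl | rfl | rfl | rfl)
        · exact SameComponent.refl _ _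
        · exact k1
        · exact k1.trans k2
        · exact k5
        · exact k5.trans k3
        · exact (k5.trans k3).trans k4
      exact (hx f hf).symm.trans (hx _ (hc f hf))
    · rw [hn f hf]
      exact J.sameComponent_rot f
  have a1 := I.rot_rot_rot
  have a2 := H.rot_rot_rot
  have a3 := X.rot_rot_rot
  simp only [sameVertex_iff_ne] at h14 h21
  refine ⟨blockEmbedding_id (fun f => by rw [h8]) (fun f => by rw [h9]) ?_ ?_,
    blockEmbedding_id (fun f => by rw [h15]) (fun f => by rw [h16]) ?_ ?_⟩
  · refine key h4 h5 h6 h7 ?_ ?_ <;> grind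
  · refine key (p := q) (q := r) (r := s) (s := p) h10 h11 (by rw [h8]; exact h12) h13 ?_ ?_ <;>
      rw [h8] <;> grind
  · refine key h4 h5 h6 h7 ?_ ?_ <;> grind
  · refine key (p := p) (q := r) (r := s) (s := q) h17 h18 (by rw [h15]; exact h19) h20 ?_ ?_ <;>
      rw [h15] <;> grind

theorem numLegs_congr {G' : UniDiagram n F} (hl : ∀ f, G'.label f = G.label f) :
    G'.numLegs = G.numLegs := by
  unfold numLegs
  congr 1
  ext f
  change G'.rot f = f ↔ G.rot f = f
  rw [← UniDiagram.label_isSome, hl, G.label_isSome]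

end UniDiagram

theorem avg_copy {M : Type*} [AddCommGroup M] [Module ℚ M] [Finite F] {G G' : UniDiagram n F}
    (h : BlockEmbedding G' G id) (φ : LegOrder G' → M) :
    avg G (fun w => φ (w.copy G' fun f => (h.label f).symm)) = avg G' φ :=
  avg_comap h φ

/-! ### Functions on trivalent diagrams that satisfy (STU) -/

section
variable {M : Type*} [AddCommGroup M]

/-- Relation (STU) for diagrams with less than `m` legs. -/
def SatisfiesSTU (m : ℕ) (s : TriClass n → M) : Prop :=
  ∀ {F : Type} [Finite F] {G : UniDiagram n F} {w : LegOrder G} {l r : F} (hc : w.Consec l r),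
    G.numLegs < m → s (tri _ (w.join hc.legPair)) = s (tri G w) - s (tri G (w.swap l r))

variable [Module ℚ M] [Finite F] [Finite F']

/-- By (STU) a function on trivalent diagrams is determined by its averages. -/
theorem SatisfiesSTU.ext {m : ℕ} {s t : TriClass n → M} (hs : SatisfiesSTU m s)
    (ht : SatisfiesSTU m t) (h : ∀ {F : Type} [Finite F] (G : UniDiagram n F), G.numLegs < m →
      avg G (fun w => s (tri G w)) = avg G (fun w => t (tri G w)))
    {G : UniDiagram n F} (hG : G.numLegs < m) (w : LegOrder G) : s (tri G w) = t (tri G w) := by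
  induction hk : G.numLegs using Nat.strong_induction_on generalizing F with
  | _ k ih =>
    rw [← sub_eq_zero]
    rw [avg_eq_of_swap_invariant (φ := fun w => s (tri G w) - t (tri G w)) _ w, avg_sub,
      h G hG, sub_self]
    intro w l r hc
    have h1 := numLegs_join hc.legPair
    have h2 := ih _ (by omega) (G := G.join l r hc.legPair) (by omega) (w.join hc.legPair) rfl
    rw [hs hc hG, ht hc hG] at h2
    rwa [sub_eq_sub_iff_sub_eq_sub]

end

/-! ### The inverse of the averaging map -/

/-- `s` satisfies (STU), and inverts the averaging map, on diagrams with less than `m` legs. -/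
structure IsInverseBelow (m : ℕ) (s : TriClass n → D n) : Prop where
  stu : SatisfiesSTU m s
  avg_eq : ∀ {F : Type} [Finite F] (G : UniDiagram n F), G.numLegs < m →
    avg G (fun w => s (tri G w)) = D.mk G

namespace IsInverseBelow

open StemFlag InsFlag

variable {m : ℕ} {s : TriClass n → D n} (hs : IsInverseBelow m s) [Finite F] {G : UniDiagram n F}
include hs

theorem eq_zero_of_isInternal (hG : G.numLegs < m) {v : F} (hv : G.IsInternal v)
    (w : LegOrder G) : s (tri G w) = 0 := by
  induction hk : G.numLegs using Nat.strong_induction_on generalizing F with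
  | _ k ih =>
    rw [avg_eq_of_swap_invariant (φ := fun w => s (tri G w)) _ w, hs.avg_eq G hG,
      D.mk_of_isInternal hv]
    intro w l r hc
    have h1 := numLegs_join hc.legPair
    have h2 := ih _ (by omega) (by omega) (hv.join hc.legPair) (w.join hc.legPair) rfl
    rwa [hs.stu hc hG, sub_eq_zero] at h2

theorem flip (hG : G.numLegs < m) {v : F} (hv : G.IsTri v) (w : LegOrder G) :
    s (tri (G.flip v) (w.copy _ (flip_label _ _))) = - s (tri G w) := by
  induction hk : G.numLegs using Nat.strong_induction_on generalizing F with
  | _ k ih =>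
    have hG' : (G.flip v).numLegs < m := by rwa [numLegs_congr (flip_label G v)]
    rw [eq_neg_iff_add_eq_zero, avg_eq_of_swap_invariant (φ := fun w =>
      s (tri (G.flip v) (w.copy _ (flip_label _ _))) + s (tri G w)) _ w, avg_add, hs.avg_eq G hG,
      avg_copy (blockEmbedding_flip v) (fun w => s (tri (G.flip v) w)), hs.avg_eq _ hG',
      D.mk_flip hv, neg_add_cancel]
    intro w l r hc
    have hp := hc.legPair
    have h1 := numLegs_join hp
    have h2 := ih _ (by omega) (by omega) (hv.join hp) (w.join hp) rfl
    rw [← tri_join_copy w hp (flip_label G v) (flip_join hv hp _),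
      hs.stu (hc.copy (flip_label G v)) hG', hs.stu hc hG, copy_swap hc] at h2
    rw [← sub_eq_zero, ← sub_eq_zero.2 h2]
    abel

theorem ihx (hG : G.numLegs < m) {x : F} (hx : G.InnerEdge x) (w : LegOrder G) :
    SatisfiesIHX s w hx := by
  induction hk : G.numLegs using Nat.strong_induction_on generalizing F with
  | _ k ih =>
    have hH : (ihxH hx).numLegs < m := by rwa [numLegs_congr (ihxH_label hx)]
    have hX : (ihxX hx).numLegs < m := by rwa [numLegs_congr (ihxX_label hx)]
    have hb := blockEmbedding_of_isIHX (isIHX hx)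
    unfold SatisfiesIHX
    rw [← sub_eq_zero, avg_eq_of_swap_invariant (φ := fun w => s (tri G w) -
      (s (tri _ (w.copy _ (ihxH_label hx))) - s (tri _ (w.copy _ (ihxX_label hx))))) _ w,
      avg_sub, avg_sub, hs.avg_eq G hG, avg_copy hb.1 (fun w => s (tri (ihxH hx) w)),
      avg_copy hb.2 (fun w => s (tri (ihxX hx) w)), hs.avg_eq _ hH, hs.avg_eq _ hX, D.mk_ihx hx,
      sub_self]
    intro w l r hc
    have hp := hc.legPair
    have h1 := numLegs_join hp
    have h2 := ih _ (by omega) (by omega) (hx.join hp) (w.join hp) rfl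
    unfold SatisfiesIHX at h2
    rw [← tri_join_copy w hp (ihxH_label hx) (ihxH_join hx hp _),
      ← tri_join_copy w hp (ihxX_label hx) (ihxX_join hx hp _),
      hs.stu (hc.copy (ihxH_label hx)) hH, hs.stu (hc.copy (ihxX_label hx)) hX, hs.stu hc hG,
      copy_swap hc, copy_swap hc] at h2
    rw [← sub_eq_zero, ← sub_eq_zero.2 h2]
    abel

end IsInverseBelow

namespace IsInverseBelow

open StemFlag InsFlag

section
variable {m : ℕ} {s : TriClass n → D n} (hs : IsInverseBelow m s) [Finite F] {G : UniDiagram n F}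
include hs

/-- The values of `s` on the joins of `G` are the differences of a function on the orders of the
legs of `G`. -/
theorem exists_difference (hG : G.numLegs < m + 1) : ∃ φ : LegOrder G → D n,
    (∀ (w : LegOrder G) (l r : F) (hc : w.Consec l r),
      φ w - φ (w.swap l r) = s (tri _ (w.join hc.legPair))) ∧ avg G φ = D.mk G := by
  let cost : LegOrder G → F → F → D n := fun w l r =>
    if hc : w.Consec l r then s (tri _ (w.join hc.legPair)) else 0
  have hcost : ∀ {w : LegOrder G} {l r : F} (hc : w.Consec l r),
      cost w l r = s (tri _ (w.join hc.legPair)) := fun hc => dif_pos hc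
  have hlt : ∀ {l r : F} (h : G.LegPair l r), (G.join l r h).numLegs < m := fun h => by
    have := numLegs_join h
    omega
  obtain ⟨φ, hφ⟩ := exists_potential cost
    (fun w l r hc => by
      rw [hcost hc, hcost hc.swap, ← tri_flip_join hc]
      exact hs.flip (hlt _) (by simp [IsTri]) _)
    (fun w l r l' r' hc hc' h1 h2 h3 h4 => by
      have k1 := hc.swap_of_disjoint hc' h1 h2 h3 h4
      have k2 := hc'.swap_of_disjoint hc h1.symm h3.symm h2.symm h4.symm
      have e := congrArg s (tri_join_join hc hc' h1 h2 h3 h4)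
      rw [hs.stu (hc.join_of_disjoint hc' h1 h2 h3 h4) (hlt _),
        hs.stu (hc'.join_of_disjoint hc h1.symm h3.symm h2.symm h4.symm) (hlt _),
        join_swap_of_disjoint hc hc' h1 h2 h3 h4,
        join_swap_of_disjoint hc' hc h1.symm h3.symm h2.symm h4.symm] at e
      rw [hcost hc, hcost k1, hcost hc', hcost k2, ← sub_eq_zero, ← sub_eq_zero.2 e]
      abel)
    (fun w a b c hab hbc => by
      have hac := consec_swap_left hab hbc
      have hac' := consec_swap_right hab hbc
      have h1 : ((w.swap b c).swap a c).Consec a b := consec_swap_left hac' hbc.swap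
      have h2 : ((w.swap a b).swap a c).Consec b c := consec_swap_right hab.swap hac
      have hn : ((G.join a b hab.legPair).join _ _ (hab.join_foot_left hbc).legPair).numLegs
          < m := by
        have := numLegs_join (hab.join_foot_left hbc).legPair
        have := hlt hab.legPair
        omega
      have e := hs.ihx hn (innerEdge_join hab.legPair (hab.join_foot_left hbc).legPair)
        ((w.join hab.legPair).join (hab.join_foot_left hbc).legPair)
      unfold SatisfiesIHX at e
      rw [tri_ihxH_join hab hbc, tri_ihxX_join hab hbc, hs.stu (hab.join_foot_left hbc) (hlt _),
        hs.stu (hab.join_foot_right hbc) (hlt _), hs.stu (hab.swap.join_foot_right hac) (hlt _),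
        join_swap_foot_left hab hbc, join_swap_foot_right hab hbc,
        join_swap_foot_right hab.swap hac, swap_comm _ b a, swap_swap] at e
      rw [hcost hab, hcost hac, hcost h2, hcost hbc, hcost hac', hcost h1, ← sub_eq_zero,
        ← sub_eq_zero.2 e]
      abel)
  refine ⟨fun w => φ w - avg G φ + D.mk G, fun w l r hc => ?_, ?_⟩
  · rw [← hcost hc, ← hφ w l r hc, add_sub_add_right_eq_sub, sub_sub_sub_cancel_right]
  · rw [avg_add, avg_sub, avg_const, avg_const, sub_self, zero_add]

end

theorem exists_succ {m : ℕ} {s : TriClass n → D n} (hs : IsInverseBelow m s) :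
    ∃ t : TriClass n → D n, IsInverseBelow (m + 1) t := by
  have h : ∀ (F : Type) (_ : Finite F) (G : UniDiagram n F), ∃ φ : LegOrder G → D n,
      G.numLegs < m + 1 → (∀ (w : LegOrder G) (l r : F) (hc : w.Consec l r),
        φ w - φ (w.swap l r) = s (tri _ (w.join hc.legPair))) ∧ avg G φ = D.mk G := by
    intro F _ G
    by_cases hG : G.numLegs < m + 1
    · obtain ⟨φ, h1, h2⟩ := hs.exists_difference hG
      exact ⟨φ, fun _ => ⟨h1, h2⟩⟩
    · exact ⟨fun _ => 0, fun h => absurd h hG⟩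
  choose φ hφ using h
  -- the functions `φ` are invariant under isomorphisms
  have hinv : ∀ {F F' : Type} [Finite F] [Finite F'] {G : UniDiagram n F} {G' : UniDiagram n F'}
      {ψ : F ≃ F'} (hψ : IsIso G G' ψ), G.numLegs < m + 1 → ∀ (w : LegOrder G'),
      φ F inferInstance G (w.comap ψ ψ.injective hψ.label) = φ F' inferInstance G' w := by
    intro F F' _ _ G G' ψ hψ hG w
    obtain ⟨h1, h2⟩ := hφ F inferInstance G hG
    obtain ⟨h3, h4⟩ := hφ F' inferInstance G' (by rwa [hψ.numLegs])
    rw [← sub_eq_zero, avg_eq_of_swap_invariant (φ := fun w =>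
      φ F inferInstance G (w.comap ψ ψ.injective hψ.label) - φ F' inferInstance G' w) _ w,
      avg_sub, avg_comap hψ.blockEmbedding, h2, h4, D.mk_eq_of_iso hψ, sub_self]
    intro w l r hc
    obtain ⟨l, rfl⟩ := ψ.surjective l
    obtain ⟨r, rfl⟩ := ψ.surjective r
    have hc' : (w.comap ψ ψ.injective hψ.label).Consec l r := hc.of_iso fun _ _ => Iff.rfl
    have hsw : (w.swap (ψ l) (ψ r)).comap ψ ψ.injective hψ.label =
        (w.comap ψ ψ.injective hψ.label).swap l r := by
      ext f g
      rw [swap_lt_iff _ hc'.label]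
      change (w.swap (ψ l) (ψ r)).lt (ψ f) (ψ g) ↔
        w.lt (ψ (Equiv.swap l r f)) (ψ (Equiv.swap l r g))
      rw [swap_lt_iff _ hc.label, ← ψ.injective.map_swap, ← ψ.injective.map_swap]
    rw [sub_eq_sub_iff_sub_eq_sub, hsw, h1 _ _ _ hc', h3 _ _ _ hc]
    exact congrArg s (tri_join_eq hψ hc'.legPair hc.legPair fun _ _ => Iff.rfl)
  have hφs : ∀ {F : Type} [Finite F] {G : UniDiagram n F} (w : LegOrder G), G.numLegs < m →
      φ F inferInstance G w = s (tri G w) := by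
    intro F _ G w hG
    obtain ⟨h1, h2⟩ := hφ F inferInstance G (by omega)
    rw [← sub_eq_zero, avg_eq_of_swap_invariant (φ := fun w =>
      φ F inferInstance G w - s (tri G w)) _ w, avg_sub, h2, hs.avg_eq _ hG, sub_self]
    intro w l r hc
    rw [sub_eq_sub_iff_sub_eq_sub, h1 _ _ _ hc, hs.stu hc hG]
  let t : TriClass n → D n := fun c =>
    φ c.out.Flag c.out.finite c.out.diag.graph c.out.diag.ord
  have ht : ∀ {F : Type} [Finite F] {G : UniDiagram n F} (w : LegOrder G), G.numLegs < m + 1 →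
      t (tri G w) = φ F inferInstance G w := by
    intro F hF G w hG
    have hfin : Finite (Quotient.out (s := triSetoid n) ⟦⟨F, hF, ⟨G, w⟩⟩⟧).Flag :=
      BundledTri.finite _
    obtain ⟨ψ, hψ, hw⟩ := Quotient.mk_out (s := triSetoid n) ⟨F, hF, ⟨G, w⟩⟩
    rw [← hinv hψ (by rw [← hψ.numLegs]; exact hG) w]
    refine congrArg (φ _ _ _) (LegOrder.ext ?_)
    ext f g
    exact (hw f g).symm
  refine ⟨t, fun {F} _ {G w l r} hc hG => ?_, fun {F} _ G hG => ?_⟩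
  · have h1 := numLegs_join hc.legPair
    rw [ht _ hG, ht _ hG, (hφ F _ G hG).1 _ _ _ hc, ht _ (by omega), hφs _ (by omega)]
  · rw [← (hφ F _ G hG).2]
    exact avg_congr fun w _ => ht w hG

theorem exists_of (n m : ℕ) : ∃ s : TriClass n → D n, IsInverseBelow m s := by
  induction m with
  | zero => exact ⟨fun _ => 0, fun _ h => absurd h (Nat.not_lt_zero _), fun _ h =>
      absurd h (Nat.not_lt_zero _)⟩
  | succ m ih =>
    obtain ⟨s, hs⟩ := ih
    exact exists_succ hs

theorem mono {m k : ℕ} {s : TriClass n → D n} (hs : IsInverseBelow m s) (h : k ≤ m) :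
    IsInverseBelow k s :=
  ⟨fun hc hG => hs.stu hc (hG.trans_le h), fun G hG => hs.avg_eq G (hG.trans_le h)⟩

theorem eq_on {m : ℕ} {s t : TriClass n → D n} (hs : IsInverseBelow m s)
    (ht : IsInverseBelow m t) [Finite F] {G : UniDiagram n F} (hG : G.numLegs < m)
    (w : LegOrder G) : s (tri G w) = t (tri G w) :=
  SatisfiesSTU.ext hs.stu ht.stu (fun G hG => by rw [hs.avg_eq G hG, ht.avg_eq G hG]) hG w

end IsInverseBelow

/-- The number of legs of a trivalent diagram. -/
def TriClass.numLegs (c : TriClass n) : ℕ := c.out.diag.graph.numLegs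

theorem numLegs_tri [Finite F] (G : UniDiagram n F) (w : LegOrder G) :
    TriClass.numLegs (tri G w) = G.numLegs := by
  obtain ⟨ψ, hψ, -⟩ := Quotient.mk_out (s := triSetoid n) ⟨F, inferInstance, ⟨G, w⟩⟩
  exact hψ.numLegs.symm

/-- The inverse of the averaging map on trivalent diagrams. -/
def unglue (n : ℕ) (c : TriClass n) : D n :=
  (IsInverseBelow.exists_of n (TriClass.numLegs c + 1)).choose c

theorem unglue_isInverseBelow (n m : ℕ) : IsInverseBelow m (unglue n) := by
  obtain ⟨s, hs⟩ := IsInverseBelow.exists_of n m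
  have key : ∀ {F : Type} [Finite F] {G : UniDiagram n F} (w : LegOrder G), G.numLegs < m →
      unglue n (tri G w) = s (tri G w) := by
    intro F _ G w hG
    have h := (IsInverseBelow.exists_of n (TriClass.numLegs (tri G w) + 1)).choose_spec
    exact h.eq_on (hs.mono (by rw [numLegs_tri]; omega)) (by rw [numLegs_tri]; omega) w
  refine ⟨fun {F} _ {G w l r} hc hG => ?_, fun {F} _ G hG => ?_⟩
  · have := numLegs_join hc.legPair
    rw [key _ hG, key _ hG, key _ (by omega), hs.stu hc hG]
  · rw [avg_congr fun w _ => key w hG, hs.avg_eq G hG]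

theorem unglue_stu [Finite F] {G : UniDiagram n F} {w : LegOrder G} {l r : F}
    (hc : w.Consec l r) : unglue n (tri _ (w.join hc.legPair)) =
      unglue n (tri G w) - unglue n (tri G (w.swap l r)) :=
  (unglue_isInverseBelow n (G.numLegs + 1)).stu hc (Nat.lt_succ_self _)

theorem avg_unglue [Finite F] (G : UniDiagram n F) :
    avg G (fun w => unglue n (tri G w)) = D.mk G :=
  (unglue_isInverseBelow n (G.numLegs + 1)).avg_eq G (Nat.lt_succ_self _)

theorem unglue_of_isInternal [Finite F] {G : UniDiagram n F} {v : F} (hv : G.IsInternal v)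
    (w : LegOrder G) : unglue n (tri G w) = 0 :=
  (unglue_isInverseBelow n (G.numLegs + 1)).eq_zero_of_isInternal (Nat.lt_succ_self _) hv w

/-! ### Relation (CL2A) -/

namespace UniDiagram

open StemFlag InsFlag

theorem LegOrder.Consec.old {G : UniDiagram n F} {x : F} {i j : Fin n}
    {w : LegOrder (G.ins x i j)} {l r : F} (h : w.Consec (.inl l) (.inl r)) : w.old.Consec l r :=
  ⟨h.lt, fun f hf => h.not_between (.inl f) hf⟩

theorem LegOrder.old_swap {G : UniDiagram n F} {x : F} {i j : Fin n}
    {w : LegOrder (G.ins x i j)} {l r : F} (h : w.Consec (.inl l) (.inl r)) :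
    (w.swap (.inl l) (.inl r)).old = w.old.swap l r := by
  ext f g
  rw [old_lt, h.swap_lt, h.old.swap_lt, old_lt]
  simp

theorem LegOrder.old_swap_inr {G : UniDiagram n F} {x : F} {i j : Fin n}
    {w : LegOrder (G.ins x i j)} {l r : F ⊕ InsFlag} (h : w.Consec l r)
    (hnew : ∀ f g, ¬ (l = .inl f ∧ r = .inl g)) : (w.swap l r).old = w.old := by
  ext f g
  rw [old_lt, old_lt, h.swap_lt]
  have h1 := hnew f g
  have h2 := hnew g f
  grind

/-- If a leg of an inserted vertex is joined to another leg, then this vertex becomes internal. -/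
theorem isInternal_join_ins {G : UniDiagram n F} {x : F} (hx : G.InnerEdge x) {i j : Fin n}
    {l r : F ⊕ InsFlag} (h : (G.ins x i j).LegPair l r)
    (hnew : ∀ f g, ¬ (l = .inl f ∧ r = .inl g)) :
    ∃ v, ((G.ins x i j).join l r h).IsInternal v := by
  have tri : ∀ {f}, (G.ins x i j).IsTri f → ((G.ins x i j).join l r h).IsTri (.inl f) :=
    fun hf => hf.join h
  have tl : ((G.ins x i j).join l r h).IsTri (.inl l) := by simp [IsTri]
  have tr : ((G.ins x i j).join l r h).IsTri (.inl r) := by simp [IsTri, h.ne]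
  have ha : l = .inr aFoot ∨ r = .inr aFoot → ∃ v, ((G.ins x i j).join l r h).IsInternal v := by
    intro hl
    have t1 : (G.ins x i j).IsTri (.inr aIn) := by simp [IsTri]
    have t2 : (G.ins x i j).IsTri (.inr aLeg) := by simp [IsTri]
    refine ⟨.inl (.inr aIn), .mk' (tri t1) ?_ ?_ ?_⟩
    · simp only [join_opp_inl, ins_opp_aIn]
      exact tri ((isTri_ins_inl _).2 hx.isTri)
    · rw [t1.join_rot, ins_rot_aIn, join_opp_inl, ins_opp_aLeg]
      rcases hl with rfl | rfl
      · exact tl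
      · exact tr
    · rw [t1.join_rot, ins_rot_aIn, t2.join_rot, ins_rot_aLeg, join_opp_inl, ins_opp_aOut]
      exact tri (by simp [IsTri])
  have hb : l = .inr bFoot ∨ r = .inr bFoot → ∃ v, ((G.ins x i j).join l r h).IsInternal v := by
    intro hl
    have t1 : (G.ins x i j).IsTri (.inr bIn) := by simp [IsTri]
    have t2 : (G.ins x i j).IsTri (.inr bLeg) := by simp [IsTri]
    refine ⟨.inl (.inr bIn), .mk' (tri t1) ?_ ?_ ?_⟩
    · simp only [join_opp_inl, ins_opp_bIn]
      exact tri (by simp [IsTri])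
    · rw [t1.join_rot, ins_rot_bIn, join_opp_inl, ins_opp_bLeg]
      rcases hl with rfl | rfl
      · exact tl
      · exact tr
    · rw [t1.join_rot, ins_rot_bIn, t2.join_rot, ins_rot_bLeg, join_opp_inl, ins_opp_bOut]
      exact tri ((isTri_ins_inl _).2 hx.isTri_opp)
  have key : ∀ f : F ⊕ InsFlag, (G.ins x i j).rot f = f →
      (∃ g, f = .inl g) ∨ f = .inr aFoot ∨ f = .inr bFoot := by
    rintro (f | f) hf
    · exact Or.inl ⟨f, rfl⟩
    · cases f <;> simp_all
  rcases key l h.left with ⟨f, hf⟩ | hl | hl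
  · rcases key r h.right with ⟨g, hg⟩ | hr | hr
    · exact absurd ⟨hf, hg⟩ (hnew f g)
    · exact ha (Or.inr hr)
    · exact hb (Or.inr hr)
  · exact ha (Or.inl hl)
  · exact hb (Or.inl hl)

end UniDiagram

/-- Multiplication by a Laurent polynomial as a linear map over the rationals. -/
def smulMap (M : Type*) [AddCommGroup M] [Module ℚ M] [Module (Lam n) M] (a : Lam n) :
    M →ₗ[ℚ] M :=
  (DistribSMul.toAddMonoidHom M a).toRatLinearMap

theorem avg_smul {M : Type*} [AddCommGroup M] [Module ℚ M] [Module (Lam n) M] [Finite F]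
    {G : UniDiagram n F} (a : Lam n) (φ : LegOrder G → M) :
    avg G (fun w => a • φ w) = a • avg G φ :=
  avg_map (smulMap M a) φ

theorem unglue_ins [Finite F] {G : UniDiagram n F} {x : F} (hx : G.InnerEdge x) {i j : Fin n}
    (w : LegOrder (G.ins x i j)) :
    unglue n (tri _ w) = (d i * d j) • unglue n (tri G w.old) := by
  induction hk : G.numLegs using Nat.strong_induction_on generalizing F with
  | _ k ih =>
    rw [← sub_eq_zero, avg_eq_of_swap_invariant (φ := fun w => unglue n (tri (G.ins x i j) w) -
      (d i * d j) • unglue n (tri G w.old)) _ w, avg_sub, avg_unglue]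
    · have h1 := avg_comap (G.blockEmbedding_ins x i j)
        (fun u => unglue n (tri G u))
      rw [avg_unglue] at h1
      rw [D.mk_ins hx, avg_smul, ← h1]
      exact sub_self _
    intro w l r hc
    rw [sub_eq_sub_iff_sub_eq_sub, ← unglue_stu hc]
    by_cases hnew : ∀ f g, ¬ (l = .inl f ∧ r = .inl g)
    · obtain ⟨v, hv⟩ := isInternal_join_ins hx hc.legPair hnew
      rw [unglue_of_isInternal hv, old_swap_inr hc hnew, sub_self]
    · push Not at hnew
      obtain ⟨f, g, rfl, rfl⟩ := hnew
      have h1 := numLegs_join hc.old.legPair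
      rw [old_swap hc, ← smul_sub, ← unglue_stu hc.old]
      have h2 := ih _ (by omega) (hx.join hc.old.legPair) (w.joinIns hc.old.legPair) rfl
      rw [joinIns_old, ← tri_join_ins] at h2
      exact h2

theorem isWeight_unglue (n : ℕ) : IsWeight (unglue n) :=
  ⟨fun hc => unglue_stu hc, @fun _ _ _ _ hx _ _ w => unglue_ins hx w⟩

/-! ### A row of three trivalent vertices -/

namespace UniDiagram

/-- Three different trivalent vertices in a row, with flags `t, t₁, t₂` and `a₁, a₂, a₃` and
`b₁, b₂, b₃` in cyclic order; the edges `t₂`--`a₁` and `a₃`--`b₁` join neighbouring vertices. -/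
structure Row (K : UniDiagram n F) (t t₁ t₂ a₁ a₂ a₃ b₁ b₂ b₃ : F) : Prop where
  rot_t : K.rot t = t₁
  rot_t₁ : K.rot t₁ = t₂
  rot_a₁ : K.rot a₁ = a₂
  rot_a₂ : K.rot a₂ = a₃
  rot_b₁ : K.rot b₁ = b₂
  rot_b₂ : K.rot b₂ = b₃
  opp_t₂ : K.opp t₂ = a₁
  opp_a₃ : K.opp a₃ = b₁
  nodup : [t, t₁, t₂, a₁, a₂, a₃, b₁, b₂, b₃].Nodup

end UniDiagram

namespace IsWeight

variable {M : Type*} [AddCommGroup M] [Module (Lam n) M] {s : TriClass n → M} (hs : IsWeight s)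
variable [Finite F] {K : UniDiagram n F} {t t₁ t₂ a₁ a₂ a₃ b₁ b₂ b₃ : F}
include hs

/-- If the third edge at the end `b` of a row leads to a trivalent vertex, then (IHX) at the edge
between `a` and `b` moves this end to the vertex `a`, as the third diagram of the relation has an
internal vertex. -/
theorem slide_right (h : K.Row t t₁ t₂ a₁ a₂ a₃ b₁ b₂ b₃) (hb : K.IsTri (K.opp b₂)) :
    ∃ (H : UniDiagram n F) (hl : ∀ f, H.label f = K.label f), (∀ f, H.opp f = K.opp f) ∧
      (H.rot a₃ = b₂ ∧ H.rot b₂ = a₂ ∧ H.rot a₂ = a₃ ∧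
        H.rot b₁ = a₁ ∧ H.rot a₁ = b₃ ∧ H.rot b₃ = b₁) ∧
      (∀ f, f ≠ a₁ → f ≠ a₂ → f ≠ a₃ → f ≠ b₁ → f ≠ b₂ → f ≠ b₃ → H.rot f = K.rot f) ∧
      ∀ Q : LegOrder K, s (tri K Q) = s (tri H (Q.copy H hl)) := by
  obtain ⟨h1, h2, h3, h4, h5, h6, h7, h8, h9⟩ := h
  simp only [List.nodup_cons, List.mem_cons, List.not_mem_nil, or_false, not_or, not_false_iff,
    List.nodup_nil, and_true] at h9
  obtain ⟨⟨n1, n2, n3, n4, n5, n6, n7, n8⟩, ⟨m2, m3, m4, m5, m6, m7, m8⟩,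
    ⟨k3, k4, k5, k6, k7, k8⟩, ⟨a4, a5, a6, a7, a8⟩, ⟨b5, b6, b7, b8⟩, ⟨c6, c7, c8⟩, ⟨e7, e8⟩,
    f8⟩ := h9
  have r1 := K.rot_rot_rot a₁
  have r2 := K.rot_rot_rot b₁
  rw [h3, h4] at r1
  rw [h5, h6] at r2
  have hin : K.InnerEdge a₃ := by
    refine ⟨?_, ?_, ?_⟩
    · unfold IsTri; rw [r1]; exact a5
    · unfold IsTri; rw [h8, h5]; exact Ne.symm e7
    · rw [h8]; unfold SameVertex; rw [r1, h3]; grind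
  have hX : (ihxX hin).IsInternal a₃ := by
    have t1 : ∀ f, K.IsTri f → (ihxX hin).IsTri f := fun f hf => by
      unfold IsTri at hf ⊢; rw [ihxX_rot]; grind
    have ea : (ihxX hin).rot a₃ = a₁ := by simp only [ihxX_rot, if_true, r1]
    have eb : (ihxX hin).rot a₁ = b₂ := by
      rw [ihxX_rot]; grind
    refine .mk' (t1 _ hin.isTri) (t1 _ hin.isTri_opp) ?_ ?_
    · rw [ea, ihxX_opp]
      refine t1 _ ?_
      rw [← h7, K.opp_opp]
      unfold IsTri
      have := K.rot_rot_rot t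
      grind
    · rw [ea, eb, ihxX_opp]
      exact t1 _ hb
  have tH1 : (ihxH hin).IsTri a₃ := by
    unfold IsTri; rw [ihxH_rot]; grind
  have tH2 : ((ihxH hin).flip a₃).IsTri b₁ := by
    rw [isTri_flip]; unfold IsTri; rw [ihxH_rot]; grind
  have hr : ∀ f, (((ihxH hin).flip a₃).flip b₁).rot f =
      if f = a₃ then b₂ else if f = b₂ then a₂ else if f = a₂ then a₃ else
      if f = b₁ then a₁ else if f = a₁ then b₃ else if f = b₃ then b₁ else K.rot f := fun f => by
    have hH : ∀ f, (ihxH hin).rot f =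
      if f = a₃ then a₂ else if f = a₂ then b₂ else if f = b₂ then a₃ else
      if f = b₁ then b₃ else if f = b₃ then a₁ else if f = a₁ then b₁ else K.rot f := fun f => by
      rw [ihxH_rot]; simp only [r1, h8, h5, h6, h3]
    have v1 : ∀ f, (ihxH hin).SameVertex a₃ f ↔ f = a₃ ∨ f = a₂ ∨ f = b₂ := fun f => by
      unfold SameVertex; simp only [hH]; grind
    have v2 : ∀ f, (ihxH hin).SameVertex b₁ f ↔ f = b₁ ∨ f = b₃ ∨ f = a₁ := fun f => by
      unfold SameVertex; simp only [hH]; grind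
    simp only [flip_rot, SameVertex.flip_iff, v1, v2, hH]
    grind
  refine ⟨((ihxH hin).flip a₃).flip b₁, fun _ => rfl, fun _ => rfl, ?_, ?_, fun Q => ?_⟩
  · simp only [hr]; grind
  · intro f; rw [hr]; grind
  · have h10 := hs.ihx hin Q
    unfold SatisfiesIHX at h10
    rw [hs.eq_zero_of_isInternal hX, sub_zero] at h10
    rw [h10, ← neg_neg (s (tri (ihxH hin) _)), ← hs.flip tH1, ← hs.flip tH2]
    rfl

/-- If the middle edge at the beginning of a row leads to a trivalent vertex, then this vertex can
be moved along the row to its end: apply (IHX) to both edges of the row, the third diagram of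
the first relation has an internal vertex. -/
theorem slide_left (h : K.Row t t₁ t₂ a₁ a₂ a₃ b₁ b₂ b₃) (hb : K.IsTri (K.opp t₁)) :
    ∃ (H X : UniDiagram n F) (hH : ∀ f, H.label f = K.label f) (hX : ∀ f, X.label f = K.label f),
      (∀ f, H.opp f = K.opp f) ∧ (∀ f, X.opp f = K.opp f) ∧
      (∀ f, H.rot f = if f = t₂ then t₁ else if f = t₁ then a₂ else if f = a₂ then t₂ else
        if f = a₃ then a₁ else if f = a₁ then b₂ else if f = b₂ then a₃ else
        if f = b₁ then b₃ else if f = b₃ then t else if f = t then b₁ else K.rot f) ∧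
      (∀ f, X.rot f = if f = t₂ then t₁ else if f = t₁ then a₂ else if f = a₂ then t₂ else
        if f = a₃ then t else if f = t then b₂ else if f = b₂ then a₃ else
        if f = b₁ then b₃ else if f = b₃ then a₁ else if f = a₁ then b₁ else K.rot f) ∧
      ∀ Q : LegOrder K, s (tri K Q) = s (tri H (Q.copy H hH)) - s (tri X (Q.copy X hX)) := by
  obtain ⟨h1, h2, h3, h4, h5, h6, h7, h8, h9⟩ := h
  simp only [List.nodup_cons, List.mem_cons, List.not_mem_nil, or_false, not_or, not_false_iff,
    List.nodup_nil, and_true] at h9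
  obtain ⟨⟨n1, n2, n3, n4, n5, n6, n7, n8⟩, ⟨m2, m3, m4, m5, m6, m7, m8⟩,
    ⟨k3, k4, k5, k6, k7, k8⟩, ⟨a4, a5, a6, a7, a8⟩, ⟨b5, b6, b7, b8⟩, ⟨c6, c7, c8⟩, ⟨e7, e8⟩,
    f8⟩ := h9
  have r0 := K.rot_rot_rot t
  have r1 := K.rot_rot_rot a₁
  have r2 := K.rot_rot_rot b₁
  rw [h1, h2] at r0
  rw [h3, h4] at r1
  rw [h5, h6] at r2
  have hin : K.InnerEdge t₂ := by
    refine ⟨?_, ?_, ?_⟩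
    · unfold IsTri; rw [r0]; exact n2
    · unfold IsTri; rw [h7, h3]; exact Ne.symm a4
    · rw [h7]; unfold SameVertex; rw [r0, h1]; grind
  have hX : (ihxX hin).IsInternal a₁ := by
    have t1 : ∀ f, K.IsTri f → (ihxX hin).IsTri f := fun f hf => by
      unfold IsTri at hf ⊢; rw [ihxX_rot]; grind
    have ea : (ihxX hin).rot a₁ = a₃ := by
      rw [ihxX_rot]; grind
    have eb : (ihxX hin).rot a₃ = t₁ := by
      rw [ihxX_rot]; grind
    refine .mk' ?_ ?_ ?_ ?_
    · rw [← h7]; exact t1 _ hin.isTri_opp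
    · rw [ihxX_opp, ← h7, K.opp_opp]; exact t1 _ hin.isTri
    · rw [ea, ihxX_opp, h8]
      refine t1 _ ?_
      unfold IsTri; rw [h5]; exact Ne.symm e7
    · rw [ea, eb, ihxX_opp]
      exact t1 _ hb
  have hH : ∀ f, (ihxH hin).rot f =
      if f = t₂ then t₁ else if f = t₁ then a₂ else if f = a₂ then t₂ else
      if f = a₁ then a₃ else if f = a₃ then t else if f = t then a₁ else K.rot f := fun f => by
      rw [ihxH_rot]; simp only [r0, h7, h1, h3, h4]
  have hin2 : (ihxH hin).InnerEdge a₃ := by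
    refine ⟨?_, ?_, ?_⟩
    · unfold IsTri; rw [hH]; grind
    · unfold IsTri; rw [ihxH_opp, h8, hH]; grind
    · rw [ihxH_opp, h8]; unfold SameVertex; simp only [hH]; grind
  have e1 : (ihxH hin).rot a₃ = t := by rw [hH]; grind
  have e2 : (ihxH hin).rot t = a₁ := by rw [hH]; grind
  have e3 : (ihxH hin).rot b₁ = b₂ := by rw [hH]; grind
  have e4 : (ihxH hin).rot b₂ = b₃ := by rw [hH]; grind
  refine ⟨ihxH hin2, ihxX hin2, fun _ => rfl, fun _ => rfl, fun _ => rfl, fun _ => rfl, ?_, ?_,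
    fun Q => ?_⟩
  · intro f
    rw [ihxH_rot]
    simp only [ihxH_opp, h8, e1, e2, e3, e4, hH]
    grind
  · intro f
    rw [ihxX_rot]
    simp only [ihxH_opp, h8, e1, e2, e3, e4, hH]
    grind
  · have h10 := hs.ihx hin Q
    unfold SatisfiesIHX at h10
    rw [hs.eq_zero_of_isInternal hX, sub_zero] at h10
    have h11 := hs.ihx hin2 (Q.copy _ (ihxH_label hin))
    unfold SatisfiesIHX at h11
    rw [h10, h11]
    rfl

end IsWeight

namespace UniDiagram

open StemFlag InsFlag

theorem Row.join {K : UniDiagram n F} {t t₁ t₂ a₁ a₂ a₃ b₁ b₂ b₃ : F}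
    (h : K.Row t t₁ t₂ a₁ a₂ a₃ b₁ b₂ b₃) {l r : F} (hp : K.LegPair l r) :
    (K.join l r hp).Row (.inl t) (.inl t₁) (.inl t₂) (.inl a₁) (.inl a₂) (.inl a₃) (.inl b₁)
      (.inl b₂) (.inl b₃) := by
  have hn := h.nodup.map (f := (Sum.inl : F → F ⊕ StemFlag)) Sum.inl_injective
  have hn' := h.nodup
  simp only [List.nodup_cons, List.mem_cons, not_or] at hn'
  have i1 : K.IsTri t := by unfold IsTri; rw [h.rot_t]; grind
  have i2 : K.IsTri t₁ := by unfold IsTri; rw [h.rot_t₁]; grind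
  have i3 : K.IsTri a₁ := by unfold IsTri; rw [h.rot_a₁]; grind
  have i4 : K.IsTri a₂ := by unfold IsTri; rw [h.rot_a₂]; grind
  have i5 : K.IsTri b₁ := by unfold IsTri; rw [h.rot_b₁]; grind
  have i6 : K.IsTri b₂ := by unfold IsTri; rw [h.rot_b₂]; grind
  exact ⟨by rw [i1.join_rot, h.rot_t], by rw [i2.join_rot, h.rot_t₁],
    by rw [i3.join_rot, h.rot_a₁], by rw [i4.join_rot, h.rot_a₂], by rw [i5.join_rot, h.rot_b₁],
    by rw [i6.join_rot, h.rot_b₂], by rw [join_opp_inl, h.opp_t₂],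
    by rw [join_opp_inl, h.opp_a₃], hn⟩

section
variable {G : UniDiagram n F} {z : F} (h : G.LegVertex z) (i : Fin n)
include h

theorem LegVertex.row : (G.ins (G.rot z) i i).Row (.inl (G.rot (G.rot z))) (.inl z)
    (.inl (G.rot z)) (.inr aIn) (.inr aLeg) (.inr aOut) (.inr bIn) (.inr bLeg) (.inr bOut) := by
  have h1 := h.isTri
  have h2 := h1.rot_rot_ne
  have h3 : G.rot (G.rot z) ≠ G.rot z := h1.rot
  have h1 : G.rot z ≠ z := h1
  refine ⟨by simp [G.rot_rot_rot], by simp, by simp, by simp, by simp, by simp, by simp,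
    by simp, ?_⟩
  simp [h2, h3, h1.symm]

theorem LegVertex.opp_ins : (G.ins (G.rot z) i i).opp (.inl z) = .inl (G.opp z) :=
  ins_opp_of_ne _ _ _ _ (Ne.symm h.isTri) fun e => h.right (Or.inl e.symm)

end

/-- Facts on the flags next to a vertex with a leg. -/
theorem LegVertex.facts {G : UniDiagram n F} {z : F} (h : G.LegVertex z) :
    G.rot z ≠ z ∧ G.rot (G.rot z) ≠ z ∧ G.rot (G.rot z) ≠ G.rot z ∧ z ≠ G.opp z ∧
      G.rot z ≠ G.opp z ∧ G.rot (G.rot z) ≠ G.opp z ∧ G.opp (G.rot z) ≠ z ∧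
      G.opp (G.rot z) ≠ G.rot z ∧ G.opp (G.rot z) ≠ G.rot (G.rot z) ∧
      G.opp (G.rot z) ≠ G.opp z ∧ G.opp (G.rot (G.rot z)) ≠ z ∧
      G.opp (G.rot (G.rot z)) ≠ G.rot z ∧ G.opp (G.rot (G.rot z)) ≠ G.rot (G.rot z) ∧
      G.opp (G.rot (G.rot z)) ≠ G.opp z := by
  have h1 := h.isTri
  have h2 := h1.rot_rot_ne
  have h3 : G.rot (G.rot z) ≠ G.rot z := h1.rot
  have h4 := sameVertex_iff_ne.1 h.left
  have h5 := sameVertex_iff_ne.1 h.right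
  have h6 := fun f (hf : G.SameVertex z f) => h1.opp_ne_rot h.leg hf
  have h7 := G.opp_injective
  exact ⟨h1, h2, h3, h6 _ (Or.inl rfl), h6 _ (Or.inr (Or.inl rfl)), h6 _ (Or.inr (Or.inr rfl)),
    h5.1, h5.2.1, h5.2.2, fun e => h1 (h7 e), h4.1, h4.2.1, h4.2.2, fun e => h2 (h7 e)⟩

/-- The permutation of the flags of a row that exchanges its two ends. -/
def rowMirror (G : UniDiagram n F) (z : F) : Equiv.Perm (F ⊕ InsFlag) :=
  Equiv.swap (.inl z) (.inr bLeg) * (Equiv.swap (.inl (G.rot z)) (.inr aOut) *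
    (Equiv.swap (.inr aIn) (.inr bIn) * Equiv.swap (.inl (G.opp z)) (.inr bFoot)))

section
variable {G : UniDiagram n F} {z : F} (h : G.LegVertex z)
include h

theorem LegVertex.rowMirror_inl (f : F) : rowMirror G z (.inl f) =
    if f = z then .inr bLeg else if f = G.rot z then .inr aOut else if f = G.opp z then .inr bFoot
    else .inl f := by
  obtain ⟨e1, e2, e3, e4, e5, e6, -⟩ := h.facts
  simp only [rowMirror, Equiv.Perm.mul_apply, Equiv.swap_apply_def]
  grind

theorem LegVertex.rowMirror_inr (f : InsFlag) : rowMirror G z (.inr f) =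
    match f with
    | aIn => .inr bIn
    | aLeg => .inr aLeg
    | aOut => .inl (G.rot z)
    | aFoot => .inr aFoot
    | bIn => .inr aIn
    | bLeg => .inl z
    | bOut => .inr bOut
    | bFoot => .inl (G.opp z) := by
  obtain ⟨e1, e2, e3, e4, e5, e6, -⟩ := h.facts
  cases f <;> simp [rowMirror, Equiv.swap_apply_def, e1, e4.symm, e5.symm]

theorem LegVertex.opp_rowMirror (i : Fin n) (f : F ⊕ InsFlag) :
    (G.ins (G.rot z) i i).opp (rowMirror G z f) =
      rowMirror G z ((G.ins (G.rot z) i i).opp f) := by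
  have m1 := h.rowMirror_inl
  have m2 := h.rowMirror_inr
  obtain ⟨e1, e2, e3, e4, e5, e6, e7, e8, e9, e10, e11, e12, e13, e14⟩ := h.facts
  have ho := G.opp_opp
  have hz := h.opp_ins i
  have hm : (G.ins (G.rot z) i i).opp (.inl (G.opp z)) = .inl z := by
    rw [ins_opp_of_ne _ _ _ _ e5.symm e10.symm, ho]
  rcases f with f | f
  · by_cases fz : f = z
    · subst fz; rw [hz, m1, m1]; simp [e4.symm, e5.symm]
    by_cases fz1 : f = G.rot z
    · subst fz1; rw [m1, ins_opp_x, m2]; simp [e1]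
    by_cases fm : f = G.opp z
    · subst fm; rw [hm, m1, m1]; simp [e4.symm, e5.symm]
    by_cases fo : f = G.opp (G.rot z)
    · subst fo; rw [m1, ins_opp_opp_x, m2]; simp [fz, fz1, fm]
    rw [m1, if_neg fz, if_neg fz1, if_neg fm, ins_opp_of_ne _ _ _ _ fz1 fo, m1, if_neg, if_neg,
      if_neg]
    · exact fun e => fz (G.opp_injective e)
    · exact fun e => fo (by rw [← e, ho])
    · exact fun e => fm (by rw [← e, ho])
  · cases f
    · simp [m2, m1, e1]
    · simp [m2]
    · simp [m2]
    · simp [m2]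
    · simp [m2]
    · simp [m2, hz]
    · simp only [m2, ins_opp_bOut, m1]
      rw [if_neg e7, if_neg e8, if_neg e10]
    · simp [m2, hm]

theorem LegVertex.label_rowMirror {i : Fin n} (hi : G.label (G.opp z) = some i)
    (f : F ⊕ InsFlag) : (G.ins (G.rot z) i i).label (rowMirror G z f) =
      (G.ins (G.rot z) i i).label f := by
  have m1 := h.rowMirror_inl
  have m2 := h.rowMirror_inr
  have l1 : G.label z = none := G.label_eq_none h.isTri
  have l2 : G.label (G.rot z) = none := G.label_eq_none h.isTri.rot
  rcases f with f | f
  · rw [m1]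
    split_ifs with h1 h2 h3
    · rw [h1]; simp [l1]
    · rw [h2]; simp [l2]
    · rw [h3]; simp [hi]
    · rfl
  · cases f <;> simp [m2, l1, l2, hi]

end

/-- The correspondence of flags for `IsWeight.join_add_join`. -/
def rowShift (G : UniDiagram n F) (z : F) : (F ⊕ StemFlag) ⊕ InsFlag ≃ (F ⊕ InsFlag) ⊕ StemFlag :=
  (joinInsEquiv F).symm.trans <| Equiv.sumCongr
    (Equiv.swap (.inl z) (.inr bIn) * (Equiv.swap (.inr bIn) (.inr aIn) *
    (Equiv.swap (.inl (G.rot z)) (.inr bOut) * Equiv.swap (.inr bOut) (.inr aOut))))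
    (Equiv.refl _)

section
variable {G : UniDiagram n F} {z : F} (h : G.LegVertex z)

theorem rowShift_inl_inr (f : StemFlag) : rowShift G z (.inl (.inr f)) = .inr f := rfl

include h

theorem LegVertex.rowShift_inl (f : F) : rowShift G z (.inl (.inl f)) =
    .inl (if f = z then .inr bIn else if f = G.rot z then .inr bOut else .inl f) := by
  have e1 : G.rot z ≠ z := h.isTri
  simp only [rowShift, joinInsEquiv, Equiv.trans_apply, Equiv.sumCongr_apply]
  by_cases k1 : f = z
  · subst k1; simp [Equiv.swap_apply_def, e1.symm]
  by_cases k2 : f = G.rot z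
  · subst k2; simp [Equiv.swap_apply_def, e1]
  simp [Equiv.swap_apply_def, k1, k2]

theorem LegVertex.rowShift_inr (f : InsFlag) : rowShift G z (.inr f) =
    .inl (match f with
      | aIn => .inl z
      | aOut => .inl (G.rot z)
      | bIn => .inr aIn
      | bOut => .inr aOut
      | f => .inr f) := by
  have e1 : G.rot z ≠ z := h.isTri
  cases f <;> simp [rowShift, joinInsEquiv, Equiv.swap_apply_def, e1]

end

end UniDiagram

namespace IsWeight

open StemFlag InsFlag

variable {M : Type*} [AddCommGroup M] [Module (Lam n) M] {s : TriClass n → M} (hs : IsWeight s)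
variable [Finite F] {G : UniDiagram n F} {z r : F}
include hs

/-- In a row of three trivalent vertices whose legs are `opp z`, `a`, `b`, join the first or the
last leg with a further leg.  By `slide_left` and `slide_right` the sum of both diagrams, the places
of the first and the last leg being exchanged in the second one, is an insertion into an inner edge;
the third diagram of `slide_left` is the mirror image of the second summand. -/
theorem join_add_join (h : G.LegVertex z) {i : Fin n} (hi : G.label (G.opp z) = some i)
    (hr : G.LegPair (G.opp z) r)
    (O : LegOrder (G.ins (G.rot z) i i))
    (hb : (G.ins (G.rot z) i i).LegPair (.inr bFoot) (.inl r)) :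
    s (tri _ (O.join (hr.ins (G.rot z) i i))) +
      s (tri _ ((O.swap (.inl (G.opp z)) (.inr bFoot)).join hb)) =
    (d i * d i) • s (tri _ (O.old.join hr)) := by
  have hne := h.facts
  obtain ⟨e1, e2, e3, e4, e5, e6, e7, e8, e9, e10, e11, e12, e13, e14⟩ := hne
  have hrr := hr.right
  have hrm := hr.ne
  have a3 := G.rot_rot_rot
  have ho := G.opp_opp
  have r1 : ∀ f, G.SameVertex z f → f ≠ r := fun f hf e => hf.isTri h.isTri (e ▸ hrr)
  have r2 := r1 z (Or.inl rfl)
  have r3 := r1 _ (Or.inr (Or.inl rfl))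
  have r4 := r1 _ (Or.inr (Or.inr rfl))
  have lz : G.label z = none := G.label_eq_none h.isTri
  have lz1 : G.label (G.rot z) = none := G.label_eq_none h.isTri.rot
  have m1 := h.rowMirror_inl
  have m2 := h.rowMirror_inr
  have p1 := h.rowShift_inl
  have p2 := h.rowShift_inr
  have p3 := rowShift_inl_inr (G := G) (z := z)
  have lm : (G.ins (G.rot z) i i).label (.inl (G.opp z)) =
    (G.ins (G.rot z) i i).label (.inr bFoot) := hi
  obtain ⟨H, X, hH, hX, oH, oX, rH, rX, hHX⟩ :=
    hs.slide_left ((h.row i).join (hr.ins (G.rot z) i i))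
    (by rw [join_opp_inl, h.opp_ins]; simp [IsTri])
  obtain ⟨L, hL, oL, ⟨l1, l2, l3, l4, l5, l6⟩, lold, hs3⟩ := hs.slide_right ((h.row i).join hb)
    (by simp [IsTri])
  -- the first diagram arises from the join of the leg `opp z` with `r` by an insertion
  have hiso : IsIso ((G.join _ _ hr).ins (.inl (G.opp z)) i i) H (rowShift G z) := by
    have q1 : rowShift G z (.inl (.inl z)) = .inl (.inr bIn) := by simp [p1]
    have q2 : rowShift G z (.inl (.inl (G.rot z))) = .inl (.inr bOut) := by simp [p1, e1]
    have q3 : ∀ f, f ≠ z → f ≠ G.rot z → rowShift G z (.inl (.inl f)) = .inl (.inl f) :=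
      fun f k1 k2 => by simp [p1, k1, k2]
    have hb1 : H.rot (.inl (.inr bIn)) = .inl (.inr bOut) := by rw [rH]; simp
    have hb3 : H.rot (.inl (.inr bOut)) = .inl (.inl (G.rot (G.rot z))) := by rw [rH]; simp
    have ht : H.rot (.inl (.inl (G.rot (G.rot z)))) = .inl (.inr bIn) := by rw [rH]; simp [e2, e3]
    apply isIso_ins
    · rw [q3 _ e4.symm e5.symm, p2, oH, join_opp_inl, ins_opp_of_ne _ _ _ _ e5.symm e10.symm, ho]
    · simp [p2, oH]
    · simp [p2, oH, q1, ho]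
    · simp [p2, oH]
    · simp [p2, oH]
    · rintro (f | (_ | _)) k1 k2
      · replace k1 : f ≠ G.opp z := fun e => k1 (by rw [e])
        replace k2 : f ≠ z := fun e => k2 (by rw [e, join_opp_inl, ho])
        rw [oH, join_opp_inl]
        by_cases k3 : f = G.rot z
        · subst k3
          rw [q2, join_opp_inl, ins_opp_bOut, q3 _ e7 e8]
        rw [q3 _ k2 k3, join_opp_inl]
        by_cases k4 : f = G.opp (G.rot z)
        · subst k4
          rw [ins_opp_opp_x, ho, q2]
        rw [ins_opp_of_ne _ _ _ _ k3 k4, q3]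
        · exact fun e => k1 (by rw [← e, ho])
        · exact fun e => k4 (by rw [← e, ho])
      · simp [p3, oH]
      · simp [p3, oH]
    · rw [p2, p2, rH]; simp [e1.symm]
    · rw [p2, p2, rH]; simp
    · rw [p2, p2, rH]; simp
    · rw [p2, p2, rH]; simp
    · rintro (f | (_ | _))
      · by_cases k1 : f = z
        · rw [k1, q1, hb1, join_rot_inl, if_neg e4, if_neg r2, q2]
        by_cases k2 : f = G.rot z
        · rw [k2, q2, hb3, join_rot_inl, if_neg e5, if_neg r3, q3 _ e2 e3]
        by_cases k3 : f = G.rot (G.rot z)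
        · rw [k3, q3 _ e2 e3, ht, join_rot_inl, if_neg e6, if_neg r4, a3, q1]
        rw [q3 _ k1 k2, rH]
        simp only [Sum.inl.injEq, k1, k2, k3, reduceCtorEq, if_false]
        rw [join_rot_inl, join_rot_inl]
        simp only [Sum.inl.injEq]
        split_ifs with k4 k5
        · rw [p3]
        · rw [q3 _ e4.symm e5.symm]
        · rw [ins_rot_inl, q3]
          · exact fun e => k3 (by rw [← e, a3])
          · exact fun e => k1 (G.rot_injective e)
      · rw [p3, rH]
        simp only [reduceCtorEq, if_false, join_rot_stem]
        rw [q3 _ r2.symm r3.symm]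
      · rw [p3, rH]
        simp [p3]
    · rw [p2, hH]; simp [join_label_inl]
    · rw [p2, hH]; simp [join_label_inl]
    · rintro (f | (_ | _))
      · rw [p1, hH]
        split_ifs with k1 k2
        · simp [join_label_inl, k1, lz]
        · simp [join_label_inl, k2, lz1]
        · simp [join_label_inl]
      · rw [p3, hH]; simp
      · rw [p3, hH]; simp
  have hin : (G.join _ _ hr).InnerEdge (.inl (G.opp z)) := by
    have t1 : (G.join _ _ hr).rot (.inl (G.opp z)) = .inr stem := by simp
    have t2 : (G.join _ _ hr).rot (.inl z) = .inl (G.rot z) := by simp [join_rot_inl, e4, r2]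
    refine ⟨?_, ?_, ?_⟩
    · unfold IsTri; rw [t1]; simp
    · unfold IsTri; rw [join_opp_inl, ho, t2]; simp [e1]
    · rw [join_opp_inl, ho]; unfold SameVertex; rw [t1]; simp [e4, r2]
  -- the third diagram of the first relation is the mirror image of the second summand
  have hmir : IsIso X L (Equiv.sumCongr (rowMirror G z) (Equiv.refl _)) := by
    refine ⟨?_, ?_, ?_⟩
    · rintro (f | (_ | _))
      · rw [oL, oX]
        exact congrArg Sum.inl (h.opp_rowMirror i f)
      · rw [oL, oX]; simp
      · rw [oL, oX]; simp
    · have x1 : X.rot (.inl (.inl (G.rot z))) = .inl (.inl z) := by rw [rX]; simp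
      have x2 : X.rot (.inl (.inl z)) = .inl (.inr aLeg) := by rw [rX]; simp [e1.symm]
      have x3 : X.rot (.inl (.inr aLeg)) = .inl (.inl (G.rot z)) := by rw [rX]; simp
      have x4 : X.rot (.inl (.inr aOut)) = .inl (.inl (G.rot (G.rot z))) := by rw [rX]; simp
      have x5 : X.rot (.inl (.inl (G.rot (G.rot z)))) = .inl (.inr bLeg) := by
        rw [rX]; simp [e2, e3]
      have x6 : X.rot (.inl (.inr bLeg)) = .inl (.inr aOut) := by rw [rX]; simp
      have x7 : X.rot (.inl (.inr bIn)) = .inl (.inr bOut) := by rw [rX]; simp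
      have x8 : X.rot (.inl (.inr bOut)) = .inl (.inr aIn) := by rw [rX]; simp
      have x9 : X.rot (.inl (.inr aIn)) = .inl (.inr bIn) := by rw [rX]; simp
      have lo : ∀ f, f ≠ r → L.rot (.inl (.inl f)) = .inl (.inl (G.rot f)) := fun f k => by
        rw [lold _ (by simp) (by simp) (by simp) (by simp) (by simp) (by simp), join_rot_inl,
          if_neg (by simp), if_neg (by simpa using k), ins_rot_inl]
      have y1 : ∀ f, f ≠ z → f ≠ G.rot z → f ≠ G.opp z →
          (Equiv.sumCongr (rowMirror G z) (Equiv.refl StemFlag)) (.inl (.inl f)) =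
            .inl (.inl f) := fun f k1 k2 k3 => by simp [m1, k1, k2, k3]
      have y2 : (Equiv.sumCongr (rowMirror G z) (Equiv.refl StemFlag)) (.inl (.inl z)) =
        .inl (.inr bLeg) := by simp [m1]
      have y3 : (Equiv.sumCongr (rowMirror G z) (Equiv.refl StemFlag)) (.inl (.inl (G.rot z))) =
        .inl (.inr aOut) := by simp [m1, e1]
      have y4 : (Equiv.sumCongr (rowMirror G z) (Equiv.refl StemFlag)) (.inl (.inl (G.opp z))) =
        .inl (.inr bFoot) := by simp [m1, e4.symm, e5.symm]
      have y5 : ∀ f, (Equiv.sumCongr (rowMirror G z) (Equiv.refl StemFlag)) (.inl (.inr f)) =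
        .inl (rowMirror G z (.inr f)) := fun f => rfl
      have y6 : ∀ f, (Equiv.sumCongr (rowMirror G z) (Equiv.refl StemFlag)) (.inr f) = .inr f :=
        fun f => rfl
      rintro ((f | f) | (_ | _))
      · by_cases k1 : f = z
        · rw [k1, y2, x2, l2, y5, m2]
        by_cases k2 : f = G.rot z
        · rw [k2, y3, x1, l1, y2]
        by_cases k3 : f = G.rot (G.rot z)
        · rw [k3, y1 _ e2 e3 e6, x5, lo _ r4, a3, y5, m2]
        rw [rX]
        simp only [Sum.inl.injEq, k1, k2, k3, reduceCtorEq, if_false]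
        rw [join_rot_inl]
        simp only [Sum.inl.injEq]
        split_ifs with k4 k5
        · rw [k4, y4, y6, lold _ (by simp) (by simp) (by simp) (by simp) (by simp) (by simp)]
          simp
        · rw [k5, y4, y1 _ r2.symm r3.symm hrm.symm,
            lold _ (by simp) (by simp) (by simp) (by simp) (by simp) (by simp)]
          simp
        · rw [y1 _ k1 k2 k4, lo _ k5, ins_rot_inl, y1]
          · exact fun e => k3 (by rw [← e, a3])
          · exact fun e => k1 (G.rot_injective e)
          · exact fun e => k4 (G.rot_injective (e.trans hr.left.symm))
      · cases f
        · rw [y5, m2, x9, l4, y5, m2]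
        · rw [y5, m2, x3, l3, y3]
        · rw [y5, m2, x4, lo _ r3, y1 _ e2 e3 e6]
        · rw [rX, y5, m2, lold _ (by simp) (by simp) (by simp) (by simp) (by simp) (by simp)]
          simp [join_rot_inl, m2]
        · rw [y5, m2, x7, l5, y5, m2]
        · rw [y5, m2, x6, lo _ r2, y5, m2]
        · rw [y5, m2, x8, l6, y5, m2]
        · rw [rX, y5, m2, lold _ (by simp) (by simp) (by simp) (by simp) (by simp) (by simp)]
          simp [join_rot_inl, m2, hrm, hr.left]
      · rw [rX, y6, lold _ (by simp) (by simp) (by simp) (by simp) (by simp) (by simp)]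
        simp [m1, r2.symm, r3.symm, hrm.symm]
      · rw [rX, y6, lold _ (by simp) (by simp) (by simp) (by simp) (by simp) (by simp)]
        simp
    · rintro (f | (_ | _))
      · rw [hL, hX, Equiv.sumCongr_apply, Sum.map_inl, join_label_inl, join_label_inl,
          h.label_rowMirror hi]
        have j1 : rowMirror G z f = .inr bFoot ↔ f = .inl (G.opp z) := by
          rw [← (rowMirror G z).injective.eq_iff (a := f) (b := .inl (G.opp z)), m1,
            if_neg e4.symm, if_neg e5.symm, if_pos rfl]
        have j2 : rowMirror G z f = .inl r ↔ f = .inl r := by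
          rw [← (rowMirror G z).injective.eq_iff (a := f) (b := .inl r), m1, if_neg r2.symm,
            if_neg r3.symm, if_neg hrm.symm]
        simp only [j1, j2]
        congr
      · rw [hL, hX]; simp
      · rw [hL, hX]; simp [hi]
  have key : ∀ f j, X.label f = some j → Equiv.swap (.inl (G.opp z)) (.inr bFoot)
      (place (.inr bFoot) ((Equiv.sumCongr (rowMirror G z) (Equiv.refl _)) f)) =
        place (.inl (G.opp z)) f := by
    intro f j hj
    rw [hX] at hj
    rcases f with (f | f) | (_ | _)
    · obtain ⟨k1, -, k2⟩ := label_of_join_inl hj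
      have k3 : f ≠ z := by rintro rfl; simp [lz] at k2
      have k4 : f ≠ G.rot z := by rintro rfl; simp [lz1] at k2
      have k1' : f ≠ G.opp z := fun e => k1 (by rw [e])
      simp only [Equiv.sumCongr_apply, Sum.map_inl, m1, k3, k4, k1', if_false, place]
      exact Equiv.swap_apply_of_ne_of_ne k1 (by simp)
    · cases f <;> simp [place, m2, join_label_inl] at hj ⊢
      exact Equiv.swap_apply_of_ne_of_ne (by simp) (by simp)
    · simp at hj
    · simp [place]
  have hsw : ∀ f g, (O.swap (.inl (G.opp z)) (.inr bFoot)).lt f g ↔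
      O.lt (Equiv.swap (.inl (G.opp z)) (.inr bFoot) f)
        (Equiv.swap (.inl (G.opp z)) (.inr bFoot) g) := fun f g => by
    convert swap_lt_iff O lm f g
  have hXL : tri X ((O.join (hr.ins (G.rot z) i i)).copy X hX) =
      tri L (((O.swap (.inl (G.opp z)) (.inr bFoot)).join hb).copy L hL) := by
    refine tri_eq_of_iso_of_label hmir fun f g j hf hg => ?_
    have hf' := (hL _).symm.trans ((hmir.label f).trans hf)
    have hg' := (hL _).symm.trans ((hmir.label g).trans hg)
    rw [copy_lt, copy_lt, join_lt_of_label _ _ ((hX f).symm.trans hf) ((hX g).symm.trans hg),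
      join_lt_of_label _ _ hf' hg', hsw, key f j hf, key g j hg]
  have hW : (((O.join (hr.ins (G.rot z) i i)).copy H hH).comap (rowShift G z)
      (Equiv.injective _) hiso.label).old = O.old.join hr := by
    have key' : ∀ f j, (G.join _ _ hr).label f = some j →
        place (.inl (G.opp z)) (rowShift G z (.inl f)) = .inl (place (G.opp z) f) := by
      intro f j hj
      rcases f with f | (_ | _)
      · obtain ⟨-, -, k2⟩ := label_of_join_inl hj
        have k3 : f ≠ z := by rintro rfl; simp [lz] at k2
        have k4 : f ≠ G.rot z := by rintro rfl; simp [lz1] at k2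
        simp [p1, k3, k4, place]
      · simp at hj
      · rfl
    have key2 : ∀ f g j, (G.join _ _ hr).label f = some j → (G.join _ _ hr).label g = some j →
        ((((O.join (hr.ins (G.rot z) i i)).copy H hH).comap (rowShift G z)
          (Equiv.injective _) hiso.label).old.lt f g ↔ (O.old.join hr).lt f g) := by
      intro f g j hf hg
      change (O.join (hr.ins (G.rot z) i i)).lt (rowShift G z (.inl f)) (rowShift G z (.inl g)) ↔ _
      rw [join_lt_of_label _ _ ((hH _).symm.trans ((hiso.label (.inl f)).trans hf))
        ((hH _).symm.trans ((hiso.label (.inl g)).trans hg)), key' f j hf, key' g j hg,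
        join_lt_of_label _ _ hf hg, old_lt]
    ext f g
    refine ⟨fun hl => ?_, fun hl => ?_⟩
    · obtain ⟨j, hf, hg⟩ := LegOrder.label_of_lt _ _ _ hl
      exact (key2 f g j hf hg).1 hl
    · obtain ⟨j, hf, hg⟩ := LegOrder.label_of_lt _ _ _ hl
      exact (key2 f g j hf hg).2 hl
  rw [hHX, hs3, hXL, sub_add_cancel, ← tri_comap hiso, hs.cl2 hin, hW]

end IsWeight

/-! ### Reversing the order on some legs -/

namespace UniDiagram.LegOrder

variable {G : UniDiagram n F} {P : F → Prop} {w v w₀ : LegOrder G} {l r : F}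

/-- Two orders agree except on pairs of legs that satisfy `P`. -/
def Agree (P : F → Prop) (w v : LegOrder G) : Prop :=
  ∀ f g, ¬ (P f ∧ P g) → (w.lt f g ↔ v.lt f g)

/-- The order `v` arises from `w` by reversing the order on the legs that satisfy `P`. -/
def IsReversal (P : F → Prop) (w v : LegOrder G) : Prop :=
  ∀ f g, v.lt f g ↔ if P f ∧ P g then w.lt g f else w.lt f g

theorem Agree.swap (h : Agree P w v) (hc : w.Consec l r) (hl : P l) (hr : P r) :
    Agree P (w.swap l r) v := by
  intro f g hfg
  rw [hc.swap_lt, ← h f g hfg]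
  have h1 : ¬ (f = l ∧ g = r) := fun h1 => hfg ⟨h1.1 ▸ hl, h1.2 ▸ hr⟩
  have h2 : ¬ (f = r ∧ g = l) := fun h1 => hfg ⟨h1.1 ▸ hr, h1.2 ▸ hl⟩
  simp [h1, h2]

theorem Agree.of_lt (h : Agree P w v) (h1 : w.lt l r) (h2 : v.lt r l) : P l ∧ P r := by
  by_contra hcon
  exact v.asymm h2 ((h _ _ hcon).1 h1)

/-- A function that is invariant under the exchange of consecutive legs that satisfy `P` is constant
on orders that agree elsewhere. -/
theorem eq_of_agree [Finite F] {α : Type*} {φ : LegOrder G → α}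
    (hs : ∀ w l r, w.Consec l r → P l → P r → φ w = φ (w.swap l r)) (h : Agree P w w₀) :
    φ w = φ w₀ := by
  refine induction_on w₀ (p := fun w => Agree P w w₀ → φ w = φ w₀) (fun _ => rfl) ?_ w h
  intro w l r hc h₀ ih ha
  obtain ⟨hl, hr⟩ := ha.of_lt hc.lt h₀
  exact (hs w l r hc hl hr).trans (ih (ha.swap hc hl hr))

theorem IsReversal.consec (h : IsReversal P w v) (hc : w.Consec l r) (hl : P l) (hr : P r) :
    v.Consec r l := by
  refine ⟨(h _ _).2 (by rw [if_pos ⟨hr, hl⟩]; exact hc.lt), fun f hf => ?_⟩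
  rw [h, h] at hf
  by_cases hP : P f
  · rw [if_pos ⟨hr, hP⟩, if_pos ⟨hP, hl⟩] at hf
    exact hc.not_between f hf.symm
  · rw [if_neg fun h => hP h.2, if_neg fun h => hP h.1] at hf
    exact w.asymm hc.lt (w.trans _ _ _ hf.1 hf.2)

theorem IsReversal.swap (h : IsReversal P w v) (hc : w.Consec l r) (hl : P l) (hr : P r) :
    IsReversal P (w.swap l r) (v.swap r l) := by
  intro f g
  rw [(h.consec hc hl hr).swap_lt, hc.swap_lt, hc.swap_lt, h]
  have := hc.ne
  grind

theorem IsReversal.symm (h : IsReversal P w v) : IsReversal P v w := by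
  intro f g
  rw [h, h]
  by_cases hP : P f ∧ P g
  · rw [if_pos hP, if_pos hP.symm]
  · rw [if_neg hP, if_neg hP]

theorem IsReversal.unique {v' : LegOrder G} (h : IsReversal P w v) (h' : IsReversal P w v') :
    v = v' := by
  ext f g
  rw [h, h']

/-- The order in which the legs of a component are reversed. -/
def reverse (w : BlockOrder G) (x : F) : BlockOrder G where
  val :=
    { lt := fun f g => if G.SameComponent x f ∧ G.SameComponent x g then w.1.lt g f else w.1.lt f g
      label_of_lt := fun f g h => by
        split_ifs at h
        · obtain ⟨i, h1, h2⟩ := w.1.label_of_lt _ _ h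
          exact ⟨i, h2, h1⟩
        · exact w.1.label_of_lt _ _ h
      irrefl := fun f h => by
        split_ifs at h <;> exact w.1.irrefl _ h
      trans := fun f g k h1 h2 => by
        have hw := fun f g k (h1 : G.SameComponent x f) (h2 : G.SameComponent x k) h3 h4 =>
          h1.trans (w.2 f k g (h1.symm.trans h2) h3 h4)
        have tot : ∀ {f g k : F}, f ≠ g → w.1.lt f k ∨ w.1.lt k f → w.1.lt g k ∨ w.1.lt k g →
            w.1.lt f g ∨ w.1.lt g f := fun {f g k} hne h1 h2 => by
          have e1 : G.label f = G.label k := h1.elim w.1.label_eq fun h => (w.1.label_eq h).symm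
          have e2 : G.label g = G.label k := h2.elim w.1.label_eq fun h => (w.1.label_eq h).symm
          exact w.1.total' (h1.elim w.1.rot_left w.1.rot_right) (e1.trans e2.symm) hne
        have ht := w.1.trans
        by_cases hf : G.SameComponent x f <;> by_cases hg : G.SameComponent x g <;>
          by_cases hk : G.SameComponent x k <;>
          simp only [hf, hg, hk, and_self, and_true, and_false, if_true, if_false] at h1 h2 ⊢
        · exact ht _ _ _ h2 h1
        · rcases tot (k := g) (show f ≠ k by rintro rfl; exact hk hf) (Or.inr h1)
            (Or.inr h2) with h | h
          · exact h
          · exact absurd (hw _ _ _ hg hf h2 h) hk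
        · exact absurd (hw _ _ _ hf hk h1 h2) hg
        · exact ht _ _ _ h1 h2
        · rcases tot (k := g) (show f ≠ k by rintro rfl; exact hf hk) (Or.inl h1)
            (Or.inl h2) with h | h
          · exact h
          · exact absurd (hw _ _ _ hk hg h h1) hf
        · exact ht _ _ _ h1 h2
        · exact ht _ _ _ h1 h2
        · exact ht _ _ _ h1 h2
      total := fun f g i hf hg hne => by
        split_ifs with h1 h2 h2
        · exact (w.1.total f g i hf hg hne).symm
        · exact absurd h1.symm h2
        · exact absurd h2.symm h1
        · exact w.1.total f g i hf hg hne }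
  property := fun a b c h h1 h2 => by
    have hx : ∀ {f}, G.SameComponent x f ↔ G.SameComponent f x := ⟨.symm, .symm⟩
    by_cases ha : G.SameComponent x a
    · have hb := ha.trans h
      by_cases hc : G.SameComponent x c
      · exact ha.symm.trans hc
      · simp only [hc, and_false, false_and, if_false] at h1 h2
        exact w.2 a b c h h1 h2
    · have hb : ¬ G.SameComponent x b := fun hb => ha (hb.trans h.symm)
      simp only [ha, hb, and_false, false_and, if_false] at h1 h2
      exact w.2 a b c h h1 h2

theorem isReversal_reverse (w : BlockOrder G) (x : F) :
    IsReversal (G.SameComponent x) w.1 (reverse w x).1 := fun _ _ => Iff.rfl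

end UniDiagram.LegOrder

/-- A function on the orders, composed with the reversal of the order in the component of `x`. -/
def reversed {M : Type*} [Zero M] {G : UniDiagram n F} (x : F) (φ : LegOrder G → M)
    (w : LegOrder G) : M :=
  if hw : w.IsBlock then φ (reverse ⟨w, hw⟩ x).1 else 0

theorem reversed_eq {M : Type*} [Zero M] {G : UniDiagram n F} {x : F} {φ : LegOrder G → M}
    {w v : LegOrder G} (hw : w.IsBlock) (h : IsReversal (G.SameComponent x) w v) :
    reversed x φ w = φ v := by
  rw [reversed, dif_pos hw, h.unique (isReversal_reverse ⟨w, hw⟩ x)]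

theorem avg_reversed {M : Type*} [AddCommGroup M] [Module ℚ M] [Finite F] {G : UniDiagram n F}
    (x : F) (φ : LegOrder G → M) : avg G (reversed x φ) = avg G φ := by
  have hinv : Function.Involutive fun w : BlockOrder G => reverse w x := fun w =>
    Subtype.ext ((isReversal_reverse _ x).unique (isReversal_reverse w x).symm)
  unfold avg
  rw [← Equiv.sum_comp hinv.toPerm fun w => φ w.1]
  exact congrArg _ (Finset.sum_congr rfl fun w _ => reversed_eq w.2 (isReversal_reverse w x))

namespace IsWeight

variable {M : Type*} [AddCommGroup M] [Module (Lam n) M] {s : TriClass n → M} (hs : IsWeight s)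
variable [Finite F] {G : UniDiagram n F} {P : F → Prop}
include hs

/-- If joining twice legs that satisfy `P` always yields zero, then the sum of the values at an order
and at its reversal on `P` does not depend on the order on `P`: an exchange of two legs changes both
summands by opposite amounts. -/
theorem add_reversal_eq
    (hP : ∀ {l r : F} (h : G.LegPair l r) {l' r' : F ⊕ StemFlag}
      (h' : (G.join l r h).LegPair l' r'), P l → P r → P (place l l') → P (place l r') →
      ∀ u, s (tri ((G.join l r h).join l' r' h') u) = 0)
    {w w₀ v v₀ : LegOrder G} (h : Agree P w w₀) (hv : IsReversal P w v)
    (hv₀ : IsReversal P w₀ v₀) : s (tri G w) + s (tri G v) = s (tri G w₀) + s (tri G v₀) := by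
  have hJ : ∀ {w v : LegOrder G} {l r : F} (hl : G.LegPair l r), P l → P r → Agree P w v →
      s (tri _ (w.join hl)) = s (tri _ (v.join hl)) := by
    intro w v l r hl h1 h2 ha
    refine eq_of_agree (P := fun f => P (place l f)) (φ := fun u => s (tri (G.join l r hl) u)) ?_ ?_
    · intro u l' r' hc k1 k2
      have := hs.stu hc
      rw [hP hl hc.legPair h1 h2 k1 k2, eq_comm, sub_eq_zero] at this
      exact this
    · intro f g hfg
      rw [join_lt, join_lt, ha _ _ hfg]
  refine induction_on w₀ (p := fun w => ∀ v, Agree P w w₀ → IsReversal P w v →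
    s (tri G w) + s (tri G v) = s (tri G w₀) + s (tri G v₀)) ?_ ?_ w v h hv
  · intro v _ hv
    rw [hv.unique hv₀]
  · intro w l r hc h₀ ih v ha hv
    obtain ⟨hl, hr⟩ := ha.of_lt hc.lt h₀
    have hk := hv.consec hc hl hr
    rw [← ih _ (ha.swap hc hl hr) (hv.swap hc hl hr)]
    have e1 := hs.stu hc
    have e2 := hs.stu hk.swap
    rw [swap_comm _ l r, swap_swap] at e2
    have e3 := hJ (w := w) (v := v.swap r l) hc.legPair hl hr fun f g hfg => by
      rw [hk.swap_lt, hv, if_neg hfg]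
      have h1 : ¬ (f = l ∧ g = r) := fun h1 => hfg ⟨h1.1 ▸ hl, h1.2 ▸ hr⟩
      have h2 : ¬ (f = r ∧ g = l) := fun h1 => hfg ⟨h1.1 ▸ hr, h1.2 ▸ hl⟩
      simp [h1, h2]
    rw [e1, e2, sub_eq_sub_iff_add_eq_add] at e3
    rw [e3, add_comm]

end IsWeight

/-! ### Rows of three legs -/

namespace UniDiagram

open StemFlag InsFlag

variable {G : UniDiagram n F}

theorem LegOrder.swap_lift_lt (w : LegOrder G) (x : F) {i : Fin n} {u : F} (hu : G.label u = some i)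
    (f g : F ⊕ InsFlag) : ((w.lift x i u hu).swap (.inl u) (.inr bFoot)).lt f g ↔
      (w.lift x i u hu).lt (Equiv.swap (.inl u) (.inr bFoot) f)
        (Equiv.swap (.inl u) (.inr bFoot) g) := by
  convert swap_lt_iff (w.lift x i u hu) (show (G.ins x i i).label (.inl u) =
    (G.ins x i i).label (.inr bFoot) from hu) f g

theorem LegOrder.old_swap_lift (w : LegOrder G) (x : F) {i : Fin n} {u : F}
    (hu : G.label u = some i) : ((w.lift x i u hu).swap (.inl u) (.inr bFoot)).old = w := by
  ext f g
  rw [old_lt, swap_lift_lt, Equiv.swap_apply_def, Equiv.swap_apply_def]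
  by_cases hf : f = u <;> by_cases hg : g = u <;> simp [hf, hg, LegOrder.irrefl]

/-- In a row of three legs, the last two vertices can be regarded as the old vertex and the first
inserted vertex; the last new leg then replaces the old one. -/
theorem old_rowEquiv {z : F} (h : G.LegVertex z) {i : Fin n} (hi : G.label (G.opp z) = some i)
    (w : LegOrder (G.ins (G.rot z) i i)) {f g : F} (hf : G.rot f = f) (hg : G.rot g = g) :
    (w.comap (rowEquiv h) (Equiv.injective _) (isIso_row h hi).label).old.lt f g ↔
      w.lt (if f = G.opp z then .inr bFoot else .inl f)
        (if g = G.opp z then .inr bFoot else .inl g) := by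
  have key : ∀ f, G.rot f = f → rowEquiv h (.inl f) =
      if f = G.opp z then .inr bFoot else .inl f := by
    intro f hf
    have h1 : ∀ v, G.SameVertex z v → f ≠ v := fun v hv h' => hv.isTri h.isTri (h' ▸ hf)
    change rowMap z (G.rot z) (G.rot (G.rot z)) (G.opp z) (.inl f) = _
    simp only [rowMap]
    rw [if_neg (h1 _ (Or.inr (Or.inr rfl))), if_neg (h1 _ (Or.inl rfl)),
      if_neg (h1 _ (Or.inr (Or.inl rfl)))]
  rw [old_lt]
  change w.lt (rowEquiv h (.inl f)) (rowEquiv h (.inl g)) ↔ _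
  rw [key f hf, key g hg]

theorem LegOrder.ext_of_rot {w v : LegOrder G}
    (h : ∀ f g, G.rot f = f → G.rot g = g → (w.lt f g ↔ v.lt f g)) : w = v := by
  ext f g
  exact ⟨fun hl => (h _ _ (rot_left _ hl) (rot_right _ hl)).1 hl,
    fun hl => (h _ _ (rot_left _ hl) (rot_right _ hl)).2 hl⟩

theorem LegVertex.innerEdge {z : F} (h : G.LegVertex z) (ht : G.IsTri (G.opp (G.rot z))) :
    G.InnerEdge (G.rot z) :=
  ⟨h.isTri.rot, ht, fun h' => h.right (SameVertex.trans (Or.inr (Or.inl rfl)) h')⟩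

theorem LegVertex.innerEdge_opp {z : F} (h : G.LegVertex z)
    (ht : G.IsTri (G.opp (G.rot (G.rot z)))) : G.InnerEdge (G.opp (G.rot (G.rot z))) :=
  InnerEdge.opp ⟨h.isTri.rot.rot, ht, fun h' =>
    h.left (SameVertex.trans (Or.inr (Or.inr rfl)) h')⟩

variable {i : Fin n}

/-- For a trivalent vertex with a leg `u` and next flag `x`, the sum over the two ways to glue the
three legs of a row, that replaces this vertex, to consecutive places: in the order of the row, and
in the opposite order.  The second term is the negative of the diagram with exchanged ends of the
row in (CL1A). -/
def rowSum {M : Type*} [AddCommGroup M] [Finite F] (s : TriClass n → M) (x : F) {u : F}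
    (hu : G.label u = some i) (w : LegOrder G) : M :=
  s (tri _ (w.lift x i u hu)) + s (tri _ ((w.lift x i u hu).swap (.inl u) (.inr bFoot)))

end UniDiagram

namespace IsWeight

open StemFlag InsFlag

variable {M : Type*} [AddCommGroup M] [Module (Lam n) M] {s : TriClass n → M} (hs : IsWeight s)
variable [Finite F] {G : UniDiagram n F} {z : F} {i : Fin n}
include hs

/-- Relation (CL1A) follows from (CL2A) if one of the ends of the row is a trivalent vertex. -/
theorem rowSum_of_isTri (h : G.LegVertex z) (hi : G.label (G.opp z) = some i)
    (ht : G.IsTri (G.opp (G.rot z)) ∨ G.IsTri (G.opp (G.rot (G.rot z)))) (w : LegOrder G) :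
    rowSum s (G.rot z) hi w = (2 * d i ^ 2) • s (tri G w) := by
  have key : ∀ x : M, (d i * d i) • x + (d i * d i) • x = (2 * d i ^ 2) • x := fun x => by
    rw [← add_smul]; congr 1; ring
  unfold rowSum
  rcases ht with ht | ht
  · rw [hs.cl2 (h.innerEdge ht), hs.cl2 (h.innerEdge ht), lift_old, old_swap_lift, key]
  · rw [← tri_comap (isIso_row h hi), ← tri_comap (isIso_row h hi), hs.cl2 (h.innerEdge_opp ht),
      hs.cl2 (h.innerEdge_opp ht), ← key]
    congr 4
    · refine ext_of_rot fun f g hf hg => ?_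
      rw [old_rowEquiv h hi _ hf hg]
      by_cases hf : f = G.opp z <;> by_cases hg : g = G.opp z <;> simp [hf, hg, LegOrder.irrefl]
    · refine ext_of_rot fun f g hf hg => ?_
      rw [old_rowEquiv h hi _ hf hg, swap_lift_lt]
      by_cases hf : f = G.opp z <;> by_cases hg : g = G.opp z <;>
        simp [hf, hg, LegOrder.irrefl, Equiv.swap_apply_def]

end IsWeight

/-! ### The average over a row between two legs -/

namespace UniDiagram

open StemFlag InsFlag

variable {G : UniDiagram n F} {z : F} {i : Fin n}

/-- A connected component with one trivalent vertex and three legs. -/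
structure IsTripod (G : UniDiagram n F) (z : F) : Prop where
  isTri : G.IsTri z
  leg : G.rot (G.opp z) = G.opp z
  leg_one : G.rot (G.opp (G.rot z)) = G.opp (G.rot z)
  leg_two : G.rot (G.opp (G.rot (G.rot z))) = G.opp (G.rot (G.rot z))

theorem IsTripod.legVertex (h : G.IsTripod z) : G.LegVertex z :=
  ⟨h.isTri, h.leg, fun h' => h'.isTri h.isTri h.leg_two, fun h' => h'.isTri h.isTri h.leg_one⟩

theorem IsTripod.sameComponent_iff (h : G.IsTripod z) {f : F} (hf : G.rot f = f) :
    G.SameComponent (G.opp z) f ↔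
      f = G.opp z ∨ f = G.opp (G.rot z) ∨ f = G.opp (G.rot (G.rot z)) := by
  have h0 := SameComponent.closed (G := G) (f := G.opp z) (g := f) (p := fun f =>
    (G.SameVertex z f ∨ f = G.opp z ∨
      f = G.opp (G.rot z) ∨ f = G.opp (G.rot (G.rot z)))) (fun f => ?_) (fun f => ?_)
  constructor
  · intro hc
    rcases (h0 hc).1 (Or.inr (Or.inl rfl)) with h1 | h1
    · exact absurd hf (h1.isTri h.isTri)
    · exact h1
  · have h1 := (G.sameComponent_opp z).symm
    rintro (rfl | rfl | rfl)
    · exact .refl _ _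
    · exact (h1.trans (G.sameComponent_rot z)).trans (G.sameComponent_opp _)
    · exact ((h1.trans (G.sameComponent_rot z)).trans (G.sameComponent_rot _)).trans
        (G.sameComponent_opp _)
  · rintro ((rfl | rfl | rfl) | rfl | rfl | rfl) <;> simp [SameVertex, G.opp_opp]
  · have := h.leg; have := h.leg_one; have := h.leg_two
    rintro ((rfl | rfl | rfl) | rfl | rfl | rfl) <;> simp [SameVertex, G.rot_rot_rot, *]

/-- The component of a row of three vertices between two legs has five legs. -/
theorem IsTripod.sameComponent_ins_iff (h : G.IsTripod z) {f : F ⊕ InsFlag}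
    (hf : (G.ins (G.rot z) i i).rot f = f) :
    (G.ins (G.rot z) i i).SameComponent (.inl (G.opp z)) f ↔
      f = .inl (G.opp z) ∨ f = .inl (G.opp (G.rot z)) ∨ f = .inl (G.opp (G.rot (G.rot z))) ∨
        f = .inr aFoot ∨ f = .inr bFoot := by
  set K := G.ins (G.rot z) i i with hK
  rcases f with f | f
  · rw [(blockEmbedding_ins G (G.rot z) i i).comp, h.sameComponent_iff (Sum.inl_injective hf)]
    simp
  · have h0 : K.SameComponent (.inl (G.opp z)) (.inr aIn) :=
      ((blockEmbedding_ins G (G.rot z) i i).comp (G.opp z) (G.rot z)).2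
        ((G.sameComponent_opp z).symm.trans (G.sameComponent_rot z)) |>.trans
        (K.sameComponent_opp _ |> fun h' => by rwa [hK, ins_opp_x, ← hK] at h')
    have h1 := h0.trans (K.sameComponent_rot _)
    have h2 := h1.trans (K.sameComponent_rot _)
    have h3 := h2.trans (K.sameComponent_opp _)
    have h4 := (h3.trans (K.sameComponent_rot _)).trans (K.sameComponent_opp _)
    have h5 := h1.trans (K.sameComponent_opp _)
    cases f <;> simp [K] at hf ⊢
    · exact h5
    · exact h4

/-- If two pairs of legs of a row of three vertices between two legs are joined, then the diagram has
an internal vertex: the new vertex of the first pair, the middle vertex of the row or its first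
vertex. -/
theorem IsTripod.exists_isInternal_join_join (h : G.IsTripod z) {l r : F ⊕ InsFlag}
    (hlr : (G.ins (G.rot z) i i).LegPair l r) {l' r' : (F ⊕ InsFlag) ⊕ StemFlag}
    (hlr' : ((G.ins (G.rot z) i i).join l r hlr).LegPair l' r')
    (hl : (G.ins (G.rot z) i i).SameComponent (.inl (G.opp z)) l)
    (hr : (G.ins (G.rot z) i i).SameComponent (.inl (G.opp z)) r)
    (hl' : (G.ins (G.rot z) i i).SameComponent (.inl (G.opp z)) (place l l'))
    (hr' : (G.ins (G.rot z) i i).SameComponent (.inl (G.opp z)) (place l r')) :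
    ∃ v, (((G.ins (G.rot z) i i).join l r hlr).join l' r' hlr').IsInternal v := by
  obtain ⟨e1, e2, e3, e4, e5, e6, e7, e8, e9, e10, e11, e12, e13, e14⟩ := h.legVertex.facts
  set K := G.ins (G.rot z) i i with hK
  set J := K.join l r hlr with hJ
  set JJ := J.join l' r' hlr' with hJJ
  have tJ : ∀ f, K.IsTri f → JJ.IsTri (.inl (.inl f)) := fun f hf => (hf.join hlr).join hlr'
  have jl : J.IsTri (.inl l) := by simp [hJ, IsTri]
  have jr : J.IsTri (.inl r) := by simp [hJ, IsTri, hlr.ne]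
  have jl' : JJ.IsTri (.inl l') := by simp [hJJ, IsTri]
  have jr' : JJ.IsTri (.inl r') := by simp [hJJ, IsTri, hlr'.ne]
  have tz : G.IsTri z := h.isTri
  have ho : ∀ f, JJ.opp (.inl (.inl f)) = .inl (.inl (K.opp f)) := fun f => rfl
  have o1 : K.opp (.inl z) = .inl (G.opp z) := h.legVertex.opp_ins i
  have o2 : K.opp (.inl (G.rot (G.rot z))) = .inl (G.opp (G.rot (G.rot z))) :=
    ins_opp_of_ne _ _ _ _ e3 e9.symm
  have five : ∀ {f}, K.SameComponent (.inl (G.opp z)) f → K.rot f = f → K.IsTri (K.opp f) := by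
    intro f hf hf'
    rcases (h.sameComponent_ins_iff hf').1 hf with rfl | rfl | rfl | rfl | rfl
    · rw [← o1, K.opp_opp]; exact (isTri_ins_inl _).2 tz
    · simp [hK, IsTri]
    · rw [← o2, K.opp_opp]; exact (isTri_ins_inl _).2 tz.rot.rot
    · simp [hK, IsTri]
    · simp [hK, IsTri]
  have hfoot : l' = .inr foot ∨ r' = .inr foot → JJ.IsInternal (.inl (.inr stem)) := by
    intro hf
    have t0 : J.IsTri (.inr stem) := by simp [hJ, IsTri]
    refine .mk' (t0.join hlr') ?_ ?_ ?_
    · change JJ.IsTri (.inl (.inr foot))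
      rcases hf with hf | hf
      · rw [← hf]; exact jl'
      · rw [← hf]; exact jr'
    · rw [t0.join_rot]
      simp only [hJ, join_rot_stem]
      exact tJ _ (five hr hlr.right)
    · rw [t0.join_rot, t0.rot.join_rot]
      simp only [hJ, join_rot_stem, join_rot_right]
      exact tJ _ (five hl hlr.left)
  rcases l' with l₁ | (_ | _)
  · rcases r' with r₁ | (_ | _)
    · obtain ⟨n1, n2, k1⟩ := LegPair.ne_of_join hlr'.left
      obtain ⟨n3, n4, k2⟩ := LegPair.ne_of_join hlr'.right
      have n5 : l₁ ≠ r₁ := fun e => hlr'.ne (by rw [e])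
      have n6 := hlr.ne
      have c1 := (h.sameComponent_ins_iff hlr.left).1 hl
      have c2 := (h.sameComponent_ins_iff hlr.right).1 hr
      have c3 := (h.sameComponent_ins_iff k1).1 hl'
      have c4 := (h.sameComponent_ins_iff k2).1 hr'
      have t : ∀ f, f = l ∨ f = r ∨ f = l₁ ∨ f = r₁ → JJ.IsTri (.inl (.inl f)) := by
        rintro f (rfl | rfl | rfl | rfl)
        · exact jl.join hlr'
        · exact jr.join hlr'
        · exact jl'
        · exact jr'
      have hrot : ∀ f, K.IsTri f → JJ.rot (.inl (.inl f)) = .inl (.inl (K.rot f)) := fun f hf => by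
        rw [hJJ, (hf.join hlr).join_rot]
        exact congrArg Sum.inl (hf.join_rot hlr)
      by_cases ha : .inr aFoot = l ∨ .inr aFoot = r ∨ .inr aFoot = l₁ ∨ .inr aFoot = r₁
      · have ta : K.IsTri (.inr aLeg) := by simp [hK, IsTri]
        refine ⟨.inl (.inl (.inr aLeg)), .mk' (tJ _ ta) (t _ ha) ?_ ?_⟩
        · rw [hrot _ ta]
          exact tJ (.inr bIn) (by simp [hK, IsTri])
        · rw [hrot _ ta, hrot _ ta.rot]
          exact tJ (.inl (G.rot z)) ((isTri_ins_inl _).2 tz.rot)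
      · have h1 : .inl (G.opp z) = l ∨ .inl (G.opp z) = r ∨ .inl (G.opp z) = l₁ ∨
            .inl (G.opp z) = r₁ := by grind
        have h2 : .inl (G.opp (G.rot (G.rot z))) = l ∨ .inl (G.opp (G.rot (G.rot z))) = r ∨
            .inl (G.opp (G.rot (G.rot z))) = l₁ ∨ .inl (G.opp (G.rot (G.rot z))) = r₁ := by grind
        have tz' : K.IsTri (.inl z) := (isTri_ins_inl _).2 tz
        refine ⟨.inl (.inl (.inl z)), .mk' (tJ _ tz') ?_ ?_ ?_⟩
        · rw [ho, o1]; exact t _ h1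
        · rw [hrot _ tz', ho, hK, ins_rot_inl, ins_opp_x]
          exact tJ _ (by simp [hK, IsTri])
        · rw [hrot _ tz', hrot _ tz'.rot, ho, hK, ins_rot_inl, ins_rot_inl, ← hK, o2]
          exact t _ h2
    · exact absurd hlr'.right (by simp [hJ])
    · exact ⟨_, hfoot (Or.inr rfl)⟩
  · exact absurd hlr'.left (by simp [hJ])
  · exact ⟨_, hfoot (Or.inl rfl)⟩

theorem IsTripod.isReversal_lift (h : G.IsTripod z) (hi : G.label (G.opp z) = some i)
    {u v : LegOrder G} (huv : IsReversal (G.SameComponent (G.opp z)) u v) :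
    IsReversal ((G.ins (G.rot z) i i).SameComponent (.inl (G.opp z)))
      (u.lift (G.rot z) i (G.opp z) hi)
      ((v.lift (G.rot z) i (G.opp z) hi).swap (.inl (G.opp z)) (.inr bFoot)) := by
  set K := G.ins (G.rot z) i i with hK
  have hin : ∀ f, K.SameComponent (.inl (G.opp z)) (.inl f) ↔ G.SameComponent (G.opp z) f :=
    (blockEmbedding_ins G (G.rot z) i i).comp _
  have ha : K.SameComponent (.inl (G.opp z)) (.inr aFoot) :=
    (h.sameComponent_ins_iff (by simp)).2 (by simp)
  have hb : K.SameComponent (.inl (G.opp z)) (.inr bFoot) :=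
    (h.sameComponent_ins_iff (by simp)).2 (by simp)
  have hm : G.SameComponent (G.opp z) (G.opp z) := .refl _ _
  intro f g
  suffices K.rot f = f → K.rot g = g → (((v.lift (G.rot z) i (G.opp z) hi).swap (.inl (G.opp z))
      (.inr bFoot)).lt f g ↔ if K.SameComponent (.inl (G.opp z)) f ∧
        K.SameComponent (.inl (G.opp z)) g then (u.lift (G.rot z) i (G.opp z) hi).lt g f
      else (u.lift (G.rot z) i (G.opp z) hi).lt f g) by
    refine ⟨fun hl => (this (rot_left _ hl) (rot_right _ hl)).1 hl, fun hl => ?_⟩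
    have hr : K.rot f = f ∧ K.rot g = g := by
      split_ifs at hl
      · exact ⟨rot_right _ hl, rot_left _ hl⟩
      · exact ⟨rot_left _ hl, rot_right _ hl⟩
    exact (this hr.1 hr.2).2 hl
  intro hf hg
  rw [swap_lift_lt, Equiv.swap_apply_def, Equiv.swap_apply_def]
  rcases f with f | f
  · rcases g with g | g
    · by_cases h1 : f = G.opp z <;> by_cases h2 : g = G.opp z <;>
        simp [h1, h2, LegOrder.irrefl, hin, hm, huv f g, huv f (G.opp z), huv (G.opp z) g]
    · cases g <;> simp [hK] at hg <;> by_cases h1 : f = G.opp z <;>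
        simp [h1, LegOrder.irrefl, hin, hm, ha, hb, huv f (G.opp z), LegOrder.asymm]
  · rcases g with g | g
    · cases f <;> simp [hK] at hf <;> by_cases h1 : g = G.opp z <;>
        simp [h1, LegOrder.irrefl, hin, hm, ha, hb, huv (G.opp z) g]
    · cases f <;> simp [hK] at hf <;> cases g <;> simp [hK] at hg <;>
        simp [LegOrder.irrefl, ha, hb, LegOrder.asymm]

theorem IsTripod.agree_lift (h : G.IsTripod z) (hi : G.label (G.opp z) = some i)
    {w : LegOrder (G.ins (G.rot z) i i)} (hw : w.IsBlock) :
    Agree ((G.ins (G.rot z) i i).SameComponent (.inl (G.opp z))) w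
      (w.old.lift (G.rot z) i (G.opp z) hi) := by
  have ha : (G.ins (G.rot z) i i).SameComponent (.inl (G.opp z)) (.inr aFoot) :=
    (h.sameComponent_ins_iff (by simp)).2 (by simp)
  have hb : (G.ins (G.rot z) i i).SameComponent (.inl (G.opp z)) (.inr bFoot) :=
    (h.sameComponent_ins_iff (by simp)).2 (by simp)
  have ba : (G.ins (G.rot z) i i).SameBlock (.inl (G.opp z)) (.inr aFoot) := ⟨ha, hi⟩
  have bb : (G.ins (G.rot z) i i).SameBlock (.inl (G.opp z)) (.inr bFoot) := ⟨hb, hi⟩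
  intro f g hfg
  suffices (G.ins (G.rot z) i i).rot f = f → (G.ins (G.rot z) i i).rot g = g → (w.lt f g ↔
      (w.old.lift (G.rot z) i (G.opp z) hi).lt f g) from
    ⟨fun hl => (this (rot_left _ hl) (rot_right _ hl)).1 hl,
      fun hl => (this (rot_left _ hl) (rot_right _ hl)).2 hl⟩
  intro hf hg
  rcases f with f | f
  · rcases g with g | g
    · rw [lift_inl, old_lt]
    · have hne : ∀ g, (G.ins (G.rot z) i i).SameComponent (.inl (G.opp z)) g →
          ¬ ((G.ins (G.rot z) i i).SameComponent (.inl (G.opp z)) (.inl f) ∧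
            (G.ins (G.rot z) i i).SameComponent (.inl (G.opp z)) g) →
          ¬ (G.ins (G.rot z) i i).SameBlock (.inl (G.opp z)) (.inl f) ∧ f ≠ G.opp z :=
            fun g hg h' =>
        ⟨fun h'' => h' ⟨h''.1, hg⟩, fun e => h' ⟨e ▸ .refl _ _, hg⟩⟩
      cases g <;> simp at hg
      · obtain ⟨h1, h2⟩ := hne _ ha hfg
        rw [lift_inl_aFoot, old_lt, ← hw.lt_iff_right ba h1]
        simp [h2]
      · obtain ⟨h1, h2⟩ := hne _ hb hfg
        rw [lift_inl_bFoot, old_lt, ← hw.lt_iff_right bb h1]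
        simp [h2]
  · rcases g with g | g
    · cases f <;> simp at hf
      · rw [lift_aFoot_inl, old_lt, ← hw.lt_iff_left ba fun h' => hfg ⟨ha, h'.1⟩]
      · rw [lift_bFoot_inl, old_lt, ← hw.lt_iff_left bb fun h' => hfg ⟨hb, h'.1⟩]
    · cases f <;> simp at hf <;> cases g <;> simp at hg <;>
        exact absurd ⟨by assumption, by assumption⟩ hfg

end UniDiagram

namespace IsWeight

open StemFlag InsFlag

variable {M : Type*} [AddCommGroup M] [Module (Lam n) M] [Module ℚ M] {s : TriClass n → M}
variable (hs : IsWeight s) [Finite F] {G : UniDiagram n F} {z : F} {i : Fin n}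
include hs

/-- Averaging over the orders of the five legs of a row between two legs amounts to averaging over
the three legs of the old component and over the two directions of the row. -/
theorem avg_row (h : G.IsTripod z) (hi : G.label (G.opp z) = some i) :
    avg (G.ins (G.rot z) i i) (fun w => s (tri _ w)) +
      avg (G.ins (G.rot z) i i) (fun w => s (tri _ w)) = avg G (rowSum s (G.rot z) hi) := by
  have hE := blockEmbedding_ins G (G.rot z) i i
  set φ : LegOrder G → M := fun w => s (tri _ (w.lift (G.rot z) i (G.opp z) hi))
  set ψ : LegOrder G → M := fun w =>
    s (tri _ ((w.lift (G.rot z) i (G.opp z) hi).swap (.inl (G.opp z)) (.inr bFoot)))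
  have h0 : avg G (rowSum s (G.rot z) hi) = avg G φ + avg G ψ := avg_add φ ψ
  nth_rewrite 2 [← avg_reversed (.inl (G.opp z))]
  rw [h0, ← avg_add, ← avg_reversed (G.opp z) ψ, ← avg_add, ← avg_comap hE]
  refine avg_congr fun w hw => ?_
  have hold : w.old.IsBlock := (hE.restrict ⟨w, hw⟩).2
  have h1 := isReversal_reverse ⟨w, hw⟩ (.inl (G.opp z))
  have h2 := isReversal_reverse ⟨w.old, hold⟩ (G.opp z)
  have e1 := reversed_eq (φ := fun w => s (tri _ w)) hw h1
  have e2 := reversed_eq (φ := ψ) hold h2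
  refine (congrArg _ e1).trans (Eq.trans ?_ (congrArg _ e2.symm))
  refine hs.add_reversal_eq (fun hl _ _ hl' k1 k2 k3 k4 u => ?_) (h.agree_lift hi hw) h1
    (h.isReversal_lift hi h2)
  obtain ⟨v, hv⟩ := h.exists_isInternal_join_join hl hl' k1 k2 k3 k4
  exact hs.eq_zero_of_isInternal hv u

end IsWeight

/-! ### Relation (CL1A) for all orders -/

namespace UniDiagram

open StemFlag InsFlag

variable {G : UniDiagram n F}

theorem LegOrder.consec_swap_iff (w : LegOrder G) {x y : F} (h : G.label x = G.label y) (l r : F) :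
    (w.swap x y).Consec l r ↔ w.Consec (Equiv.swap x y l) (Equiv.swap x y r) := by
  constructor
  · rintro ⟨h1, h2⟩
    refine ⟨(swap_lt_iff w h _ _).1 h1, fun f hf => h2 (Equiv.swap x y f) ?_⟩
    rw [swap_lt_iff w h, swap_lt_iff w h, Equiv.swap_apply_self]
    exact hf
  · rintro ⟨h1, h2⟩
    refine ⟨(swap_lt_iff w h _ _).2 h1, fun f hf => h2 (Equiv.swap x y f) ?_⟩
    rw [swap_lt_iff w h, swap_lt_iff w h] at hf
    exact hf

theorem LegOrder.swap_conj (w : LegOrder G) {x y p q p' q' : F} (h : G.label x = G.label y)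
    (hpq : G.label p = G.label q) (hpq' : G.label p' = G.label q') (hp : Equiv.swap x y p = p')
    (hq : Equiv.swap x y q = q') : (w.swap x y).swap p' q' = (w.swap p q).swap x y := by
  have key : ∀ f, Equiv.swap x y (Equiv.swap p' q' f) = Equiv.swap p q (Equiv.swap x y f) :=
    fun f => by rw [← hp, ← hq, Equiv.swap_apply_apply]; simp
  ext f g
  rw [swap_lt_iff _ hpq', swap_lt_iff _ h, swap_lt_iff _ h, swap_lt_iff _ hpq, key, key]

section
variable (w : LegOrder G) (x : F) {i : Fin n} {u : F} (hu : G.label u = some i)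

theorem LegOrder.not_lift_lt_inr {f : InsFlag} (h : f ≠ aFoot) (h' : f ≠ bFoot) (g : F ⊕ InsFlag) :
    ¬ (w.lift x i u hu).lt (.inr f) g ∧ ¬ (w.lift x i u hu).lt g (.inr f) := by
  constructor
  · intro hl
    obtain ⟨j, h1, -⟩ := label_of_lt _ _ _ hl
    cases f <;> simp at h1 h h'
  · intro hl
    obtain ⟨j, -, h1⟩ := label_of_lt _ _ _ hl
    cases f <;> simp at h1 h h'

theorem LegOrder.consec_lift_aFoot : (w.lift x i u hu).Consec (.inl u) (.inr aFoot) := by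
  refine ⟨by simp, ?_⟩
  rintro (f | f)
  · simp only [lift_inl, lift_inl_aFoot, not_and, not_or]
    exact fun h => ⟨w.asymm h, (w.ne_of_lt h).symm⟩
  · by_cases h1 : f = aFoot
    · subst h1; simp [LegOrder.irrefl]
    · by_cases h2 : f = bFoot
      · subst h2; simp [LegOrder.asymm]
      · exact fun h => (not_lift_lt_inr w x hu h1 h2 _).2 h.1

theorem LegOrder.consec_lift_bFoot : (w.lift x i u hu).Consec (.inr aFoot) (.inr bFoot) := by
  refine ⟨by simp, ?_⟩
  rintro (f | f)
  · simp only [lift_aFoot_inl, lift_inl_bFoot, not_and, not_or]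
    exact fun h => ⟨w.asymm h, (w.ne_of_lt h).symm⟩
  · by_cases h1 : f = aFoot
    · subst h1; simp [LegOrder.irrefl]
    · by_cases h2 : f = bFoot
      · subst h2; simp [LegOrder.irrefl]
      · exact fun h => (not_lift_lt_inr w x hu h1 h2 _).2 h.1

variable {w}

theorem LegOrder.Consec.lift_right {r : F} (hc : w.Consec u r) :
    (w.lift x i u hu).Consec (.inr bFoot) (.inl r) := by
  refine ⟨by simpa using hc.lt, ?_⟩
  rintro (f | f)
  · simpa using hc.not_between f
  · by_cases h1 : f = aFoot
    · subst h1; simp [LegOrder.asymm]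
    · by_cases h2 : f = bFoot
      · subst h2; simp [LegOrder.irrefl]
      · exact fun h => (not_lift_lt_inr w x hu h1 h2 _).2 h.1

theorem LegOrder.Consec.lift_of_ne {l r : F} (hc : w.Consec l r) (hl : l ≠ u) :
    (w.lift x i u hu).Consec (.inl l) (.inl r) := by
  refine ⟨by simpa using hc.lt, ?_⟩
  rintro (f | f)
  · simpa using hc.not_between f
  · by_cases h1 : f = aFoot
    · subst h1; simpa [hl] using hc.not_between u
    · by_cases h2 : f = bFoot
      · subst h2; simpa [hl] using hc.not_between u
      · exact fun h => (not_lift_lt_inr w x hu h1 h2 _).2 h.1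

theorem LegOrder.ext_ins {y : F} {w v : LegOrder (G.ins y i i)}
    (h1 : ∀ f g, w.lt (.inl f) (.inl g) ↔ v.lt (.inl f) (.inl g))
    (h2 : ∀ f, (w.lt (.inl f) (.inr aFoot) ↔ v.lt (.inl f) (.inr aFoot)) ∧
      (w.lt (.inl f) (.inr bFoot) ↔ v.lt (.inl f) (.inr bFoot)))
    (h3 : ∀ f, (w.lt (.inr aFoot) (.inl f) ↔ v.lt (.inr aFoot) (.inl f)) ∧
      (w.lt (.inr bFoot) (.inl f) ↔ v.lt (.inr bFoot) (.inl f)))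
    (h4 : w.lt (.inr aFoot) (.inr bFoot) ↔ v.lt (.inr aFoot) (.inr bFoot))
    (h5 : w.lt (.inr bFoot) (.inr aFoot) ↔ v.lt (.inr bFoot) (.inr aFoot)) : w = v := by
  refine ext_of_rot fun f g hf hg => ?_
  rcases f with f | f
  · rcases g with g | g
    · exact h1 f g
    · cases g <;> simp at hg
      exacts [(h2 f).1, (h2 f).2]
  · rcases g with g | g
    · cases f <;> simp at hf
      exacts [(h3 g).1, (h3 g).2]
    · cases f <;> simp at hf <;> cases g <;> simp at hg
      · simp [LegOrder.irrefl]
      · exact h4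
      · exact h5
      · simp [LegOrder.irrefl]

theorem LegOrder.Consec.lift_swap {l r : F} (hc : w.Consec l r) (hl : l ≠ u) (hr : r ≠ u) :
    (w.lift x i u hu).swap (.inl l) (.inl r) = (w.swap l r).lift x i u hu := by
  have hk := hc.lift_of_ne x hu hl
  have h1 := hc.lt_left_iff hl.symm
  have h2 := hc.right_lt_iff hr.symm
  refine ext_ins (fun f g => ?_) (fun f => ⟨?_, ?_⟩) (fun f => ⟨?_, ?_⟩) ?_ ?_ <;>
    rw [hk.swap_lt] <;> simp [hc.swap_lt, hl.symm, hr.symm, LegOrder.asymm]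

/-- Moving the three consecutive legs of a row one after the other past the next leg. -/
theorem LegOrder.Consec.lift_swap_right {r : F} (hc : w.Consec u r) :
    (((w.lift x i u hu).swap (.inr bFoot) (.inl r)).swap (.inr aFoot) (.inl r)).swap
      (.inl u) (.inl r) = (w.swap u r).lift x i u hu := by
  have c1 := hc.lift_right x hu
  have c0 := consec_lift_bFoot w x hu
  have cm := consec_lift_aFoot w x hu
  have c2 := consec_swap_right c0 c1
  have hne := hc.ne
  have c3 := consec_swap_right (c1.swap_of_disjoint cm (by simp) (by simp [hne]) (by simp)
    (by simp)) c2
  refine ext_ins (fun f g => ?_) (fun f => ⟨?_, ?_⟩) (fun f => ⟨?_, ?_⟩) ?_ ?_ <;>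
    rw [c3.swap_lt, c2.swap_lt, c1.swap_lt]
  · simp [hc.swap_lt]
  · by_cases h1 : f = u
    · subst h1; simp [hne]
    · by_cases h2 : f = r
      · subst h2; simp [hc.swap_lt]
      · simp [hc.swap_lt, h1, h2]
  · by_cases h1 : f = u
    · subst h1; simp [hne]
    · by_cases h2 : f = r
      · subst h2; simp [hc.swap_lt]
      · simp [hc.swap_lt, h1, h2]
  · by_cases h1 : f = u
    · subst h1; simp [hne, LegOrder.irrefl]
    · by_cases h2 : f = r
      · subst h2; simp [hc.swap_lt, hne.symm]
      · simp [hc.swap_lt, h1, h2]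
  · by_cases h1 : f = u
    · subst h1; simp [hne, LegOrder.irrefl]
    · by_cases h2 : f = r
      · subst h2; simp [hc.swap_lt, hne.symm]
      · simp [hc.swap_lt, h1, h2]
  · simp
  · simp [LegOrder.asymm]

theorem LegOrder.joinIns_lt {l r : F} (h : G.LegPair l r) {y : F} {j : Fin n}
    (O : LegOrder (G.ins y i j)) (f g : (F ⊕ StemFlag) ⊕ InsFlag) : (O.joinIns h).lt f g ↔
      (O.join (h.ins y i j)).lt ((joinInsEquiv F).symm f) ((joinInsEquiv F).symm g) := Iff.rfl

theorem LegOrder.joinIns_lift {l r : F} (h : G.LegPair l r) (hl : l ≠ u) (hr : r ≠ u)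
    (hu' : (G.join l r h).label (.inl u) = some i) :
    (w.lift x i u hu).joinIns h = (w.join h).lift (.inl x) i (.inl u) hu' := by
  have e1 : ∀ f, (joinInsEquiv F).symm (.inl (.inl f)) = .inl (.inl f) := fun _ => rfl
  have e2 : ∀ a, (joinInsEquiv F).symm (.inr a) = .inl (.inr a) := fun _ => rfl
  have e3 : ∀ s, (joinInsEquiv F).symm (.inl (.inr s)) = .inr s := fun _ => rfl
  refine ext_ins (fun f g => ?_) (fun f => ⟨?_, ?_⟩) (fun f => ⟨?_, ?_⟩) ?_ ?_
  · rw [lift_inl, ← old_lt, joinIns_old, lift_old]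
  all_goals rw [joinIns_lt]
  · rcases f with f | (_ | _)
    · by_cases hf : f = l ∨ f = r
      · rcases hf with rfl | rfl <;> simp [e1, e2, join_lt, join_label_inl, hl, hr]
      · rcases eq_or_ne f u with rfl | hfu
        · simp [e1, e2, join_lt, join_label_inl, place, hl.symm, hr.symm, hu]
        · simp [e1, e2, join_lt, join_label_inl, hf, place, hl.symm, hr.symm, hu, hfu]
    · simp [e2, e3, join_lt]
    · simp [e2, e3, join_lt, join_label_inl, place, hl, hl.symm, hr.symm, hu]
  · rcases f with f | (_ | _)
    · by_cases hf : f = l ∨ f = r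
      · rcases hf with rfl | rfl <;> simp [e1, e2, join_lt, join_label_inl, hl, hr]
      · rcases eq_or_ne f u with rfl | hfu
        · simp [e1, e2, join_lt, join_label_inl, place, hl.symm, hr.symm, hu]
        · simp [e1, e2, join_lt, join_label_inl, hf, place, hl.symm, hr.symm, hu, hfu]
    · simp [e2, e3, join_lt]
    · simp [e2, e3, join_lt, join_label_inl, place, hl, hl.symm, hr.symm, hu]
  · rcases f with f | (_ | _)
    · simp [e1, e2, join_lt, join_label_inl, place, hl.symm, hr.symm, hu]
    · simp [e2, e3, join_lt]
    · simp [e2, e3, join_lt, join_label_inl, place, hl.symm, hr.symm, hu]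
  · rcases f with f | (_ | _)
    · simp [e1, e2, join_lt, join_label_inl, place, hl.symm, hr.symm, hu]
    · simp [e2, e3, join_lt]
    · simp [e2, e3, join_lt, join_label_inl, place, hl.symm, hr.symm, hu]
  · simp [e2, join_lt, join_label_inl, place]
  · simp [e2, join_lt, join_label_inl, place, LegOrder.asymm]

theorem LegOrder.joinIns_swap {l r : F} (h : G.LegPair l r) (hl : l ≠ u) (hr : r ≠ u)
    (hu' : (G.join l r h).label (.inl u) = some i) :
    ((w.lift x i u hu).swap (.inl u) (.inr bFoot)).joinIns h =
      ((w.join h).lift (.inl x) i (.inl u) hu').swap (.inl (.inl u)) (.inr bFoot) := by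
  rw [← joinIns_lift x hu h hl hr hu']
  let : DecidableEq (F ⊕ InsFlag) := fun a b => Classical.propDecidable (a = b)
  let : DecidableEq ((F ⊕ StemFlag) ⊕ InsFlag) := fun a b => Classical.propDecidable (a = b)
  set O := w.lift x i u hu
  have e1 : ∀ f, (joinInsEquiv F).symm (.inl (.inl f)) = .inl (.inl f) := fun _ => rfl
  have e2 : ∀ a, (joinInsEquiv F).symm (.inr a) = .inl (.inr a) := fun _ => rfl
  have e3 : ∀ s, (joinInsEquiv F).symm (.inl (.inr s)) = .inr s := fun _ => rfl
  have hm : (G.ins x i i).label (.inl u) = (G.ins x i i).label (.inr bFoot) := hu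
  have hm' : ((G.join l r h).ins (.inl x) i i).label (.inl (.inl u)) =
    ((G.join l r h).ins (.inl x) i i).label (.inr bFoot) := hu'
  have key : ∀ f, Equiv.swap (.inl u) (.inr bFoot) (place (.inl l) ((joinInsEquiv F).symm f)) =
      place (.inl l) ((joinInsEquiv F).symm (Equiv.swap (.inl (.inl u)) (.inr bFoot) f)) := by
    intro f
    simp only [Equiv.swap_apply_def]
    rcases f with (f | (_ | _)) | f
    · by_cases hf : f = u
      · simp [hf, e1, e2, place]
      · simp [hf, e1, place]
    · simp [e3, place, hl]
    · simp [e3, place, hl]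
    · by_cases hf : f = bFoot
      · simp [hf, e1, e2, place]
      · simp [hf, e2, place]
  have hlab : ∀ f, ((G.ins x i i).join _ _ (h.ins x i i)).label ((joinInsEquiv F).symm
      (Equiv.swap (.inl (.inl u)) (.inr bFoot) f)) =
      ((G.ins x i i).join _ _ (h.ins x i i)).label ((joinInsEquiv F).symm f) := by
    intro f
    rw [(isIso_join_ins G h x i i).symm.label, (isIso_join_ins G h x i i).symm.label,
      Equiv.swap_apply_def]
    split_ifs with h1 h2
    · rw [h1, hm']
    · rw [h2, hm']
    · rfl
  ext f g
  have s1 := swap_lt_iff O hm (place (.inl l) ((joinInsEquiv F).symm f))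
    (place (.inl l) ((joinInsEquiv F).symm g))
  have s2 := swap_lt_iff (O.joinIns h) hm' f g
  rw [joinIns_lt, join_lt, s1, s2, joinIns_lt, join_lt]
  rw [key, key, ← hlab f, ← hlab g]

end

end UniDiagram

open StemFlag InsFlag

theorem UniDiagram.LegVertex.join {G : UniDiagram n F} {z l r : F} (hz : G.LegVertex z)
    (h : G.LegPair l r) (hl : l ≠ G.opp z) (hr : r ≠ G.opp z) :
    (G.join l r h).LegVertex (.inl z) := by
  have ht := hz.isTri
  refine ⟨ht.join h, ?_, ?_, ?_⟩
  · rw [join_opp_inl, join_rot_of_ne h hl.symm hr.symm, hz.leg]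
  · rw [ht.sameVertex_join h, ht.join_rot h, ht.rot.join_rot h, join_opp_inl]
    rintro ⟨g, e, hg⟩
    exact hz.left (Sum.inl_injective e ▸ hg)
  · rw [ht.sameVertex_join h, ht.join_rot h, join_opp_inl]
    rintro ⟨g, e, hg⟩
    exact hz.right (Sum.inl_injective e ▸ hg)

namespace IsWeight

variable {M : Type*} [AddCommGroup M] [Module (Lam n) M] {s : TriClass n → M}
variable (hs : IsWeight s) [Finite F] {G : UniDiagram n F} {z : F} {i : Fin n}
include hs

/-- Exchanging two consecutive legs different from the one of the row. -/
theorem rowSum_sub_of_ne (x : F) {u : F} (hu : G.label u = some i) {w : LegOrder G} {l r : F}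
    (hc : w.Consec l r) (hl : l ≠ u) (hr : r ≠ u)
    (hu' : (G.join l r hc.legPair).label (.inl u) = some i) :
    rowSum s x hu w - rowSum s x hu (w.swap l r) =
      rowSum s (.inl x) hu' (w.join hc.legPair) := by
  have hm : (G.ins x i i).label (.inl u) = (G.ins x i i).label (.inr bFoot) := hu
  have hlr : (G.ins x i i).label (.inl l) = (G.ins x i i).label (.inl r) := hc.label
  have c1 := hc.lift_of_ne x hu hl
  let : DecidableEq (F ⊕ InsFlag) := fun a b => Classical.propDecidable (a = b)
  have e1 : Equiv.swap (Sum.inl u) (.inr bFoot) (.inl l) = (.inl l : F ⊕ InsFlag) :=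
    Equiv.swap_apply_of_ne_of_ne (by simpa using hl) (by simp)
  have e2 : Equiv.swap (Sum.inl u) (.inr bFoot) (.inl r) = (.inl r : F ⊕ InsFlag) :=
    Equiv.swap_apply_of_ne_of_ne (by simpa using hr) (by simp)
  have c2 : ((w.lift x i u hu).swap (.inl u) (.inr bFoot)).Consec (.inl l) (.inl r) := by
    rw [consec_swap_iff _ hm, e1, e2]
    exact c1
  have k1 := hs.stu c1
  have k2 := hs.stu c2
  rw [swap_conj _ hm hlr hlr e1 e2, hc.lift_swap x hu hl hr] at k2
  rw [hc.lift_swap x hu hl hr] at k1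
  unfold rowSum
  rw [← joinIns_swap x hu hc.legPair hl hr hu', ← joinIns_lift x hu hc.legPair hl hr hu',
    ← tri_join_ins, ← tri_join_ins, k1, k2]
  abel

/-- Exchanging the leg of the row with the next leg: the legs of the row are moved one after the
other, in both terms of the sum, and the resulting joins cancel by `join_add_join`, up to the same
expression for the diagram without row. -/
theorem rowSum_sub_of_eq (h : G.LegVertex z) (hi : G.label (G.opp z) = some i) {w : LegOrder G}
    {r : F} (hc : w.Consec (G.opp z) r) :
    rowSum s (G.rot z) hi w - rowSum s (G.rot z) hi (w.swap (G.opp z) r) =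
      (2 * d i ^ 2) • (s (tri G w) - s (tri G (w.swap (G.opp z) r))) := by
  set O := w.lift (G.rot z) i (G.opp z) hi with hO
  have hri : G.label r = some i := hc.label ▸ hi
  have hne := hc.ne
  have lm : (G.ins (G.rot z) i i).label (.inl (G.opp z)) =
    (G.ins (G.rot z) i i).label (.inr bFoot) := hi
  have lmr : (G.ins (G.rot z) i i).label (.inl (G.opp z)) =
    (G.ins (G.rot z) i i).label (.inl r) := hi.trans hri.symm
  have lar : (G.ins (G.rot z) i i).label (.inr aFoot) =
    (G.ins (G.rot z) i i).label (.inl r) := hri.symm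
  have lbr : (G.ins (G.rot z) i i).label (.inr bFoot) =
    (G.ins (G.rot z) i i).label (.inl r) := hri.symm
  let : DecidableEq (F ⊕ InsFlag) := fun a b => Classical.propDecidable (a = b)
  have e1 : Equiv.swap (Sum.inl (G.opp z)) (.inr bFoot) (.inl r) = (.inl r : F ⊕ InsFlag) :=
    Equiv.swap_apply_of_ne_of_ne (by simpa using hne.symm) (by simp)
  have e2 : Equiv.swap (Sum.inl (G.opp z)) (.inr bFoot) (.inr aFoot) = (.inr aFoot : F ⊕ InsFlag) :=
    Equiv.swap_apply_of_ne_of_ne (by simp) (by simp)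
  have e3 : Equiv.swap (Sum.inl (G.opp z)) (.inr bFoot) (.inl (G.opp z)) =
    (.inr bFoot : F ⊕ InsFlag) := Equiv.swap_apply_left _ _
  have e4 : Equiv.swap (Sum.inl (G.opp z)) (.inr bFoot) (.inr bFoot) =
    (.inl (G.opp z) : F ⊕ InsFlag) := Equiv.swap_apply_right _ _
  -- move the legs `bFoot`, `aFoot`, `opp z` past `r`
  have c0 := consec_lift_bFoot w (G.rot z) hi
  have cm := consec_lift_aFoot w (G.rot z) hi
  have c1 := hc.lift_right (G.rot z) hi
  have c2 := consec_swap_right c0 c1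
  have c3 := consec_swap_right (c1.swap_of_disjoint cm (by simp) (by simpa using hne) (by simp)
    (by simp)) c2
  have c4 := hc.lift_swap_right (G.rot z) hi
  rw [← hO] at c0 cm c1 c2 c3 c4
  set O₁ := O.swap (.inr bFoot) (.inl r) with hO₁
  set O₂ := O₁.swap (.inr aFoot) (.inl r) with hO₂
  have d1 : (O.swap (.inl (G.opp z)) (.inr bFoot)).swap (.inl (G.opp z)) (.inl r) =
    O₁.swap (.inl (G.opp z)) (.inr bFoot) := swap_conj _ lm lbr lmr e4 e1
  have d2 : (O₁.swap (.inl (G.opp z)) (.inr bFoot)).swap (.inr aFoot) (.inl r) =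
    O₂.swap (.inl (G.opp z)) (.inr bFoot) := swap_conj _ lm lar lar e2 e1
  have d3 : (O₂.swap (.inl (G.opp z)) (.inr bFoot)).swap (.inr bFoot) (.inl r) =
    (O₂.swap (.inl (G.opp z)) (.inl r)).swap (.inl (G.opp z)) (.inr bFoot) :=
    swap_conj _ lm lmr lbr e3 e1
  have c1' : (O.swap (.inl (G.opp z)) (.inr bFoot)).Consec (.inl (G.opp z)) (.inl r) := by
    rw [consec_swap_iff _ lm, e3, e1]; exact c1
  have c2' : (O₁.swap (.inl (G.opp z)) (.inr bFoot)).Consec (.inr aFoot) (.inl r) := by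
    rw [consec_swap_iff _ lm, e2, e1]; exact c2
  have c3' : (O₂.swap (.inl (G.opp z)) (.inr bFoot)).Consec (.inr bFoot) (.inl r) := by
    rw [consec_swap_iff _ lm, e4, e1]; exact c3
  have hzero : ∀ (hp : (G.ins (G.rot z) i i).LegPair (.inr aFoot) (.inl r)) v,
      s (tri ((G.ins (G.rot z) i i).join _ _ hp) v) = 0 := fun hp v => by
    have ta : (G.ins (G.rot z) i i).IsTri (.inr aLeg) := by simp [IsTri]
    refine hs.eq_zero_of_isInternal (v := .inl (.inr aLeg)) (.mk' (ta.join hp) ?_ ?_ ?_) v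
    · rw [join_opp_inl, ins_opp_aLeg]
      simp [IsTri]
    · rw [ta.join_rot]
      exact IsTri.join (v := .inr bIn) (by simp [IsTri]) hp
    · rw [ta.join_rot, ta.rot.join_rot]
      exact IsTri.join ((isTri_ins_inl _).2 h.isTri.rot) hp
  have o1 : O₂.old = w := by
    ext f g
    rw [old_lt, hO₂, c2.swap_lt, hO₁, c1.swap_lt, hO, lift_inl]
    simp
  have o2 : (O.swap (.inl (G.opp z)) (.inr bFoot)).old = w := old_swap_lift _ _ _
  have j1 := hs.join_add_join h hi hc.legPair O₂ c3'.legPair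
  have j2 := hs.join_add_join h hi hc.legPair (O.swap (.inl (G.opp z)) (.inr bFoot)) c1.legPair
  rw [swap_swap, o2] at j2
  rw [o1] at j1
  have k1 := hs.stu c1
  have k2 := hs.stu c2
  have k3 := hs.stu c3
  have k1' := hs.stu c1'
  have k2' := hs.stu c2'
  have k3' := hs.stu c3'
  rw [hzero, eq_comm, sub_eq_zero] at k2 k2'
  rw [d1] at k1'
  rw [d2] at k2'
  rw [d3, c4] at k3'
  rw [c4] at k3
  rw [k3, k3', hs.stu hc] at j1
  rw [k1, k1', hs.stu hc] at j2
  have : (2 * d i ^ 2) • (s (tri G w) - s (tri G (w.swap (G.opp z) r))) =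
      (d i * d i) • (s (tri G w) - s (tri G (w.swap (G.opp z) r))) +
      (d i * d i) • (s (tri G w) - s (tri G (w.swap (G.opp z) r))) := by
    rw [← add_smul]; congr 1; ring
  rw [this]
  nth_rewrite 1 [← j1]
  rw [← j2]
  unfold rowSum
  rw [← hO, ← hO₁, ← hO₂] at *
  rw [k2, k2']
  abel

/-- If the averages of the row sums over a tripod are as required by (CL1A), then so are all row
sums: the difference of both sides is invariant under the exchange of consecutive legs, by induction
on the number of legs. -/
theorem rowSum_eq [Module ℚ M]
    (havg : ∀ {F : Type} [Finite F] {G : UniDiagram n F} {z : F} {i : Fin n} (_ : G.IsTripod z)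
      (hi : G.label (G.opp z) = some i),
      avg G (rowSum s (G.rot z) hi) = avg G fun w => (2 * d i ^ 2) • s (tri G w))
    (h : G.LegVertex z) (hi : G.label (G.opp z) = some i) (w : LegOrder G) :
    rowSum s (G.rot z) hi w = (2 * d i ^ 2) • s (tri G w) := by
  induction hk : G.numLegs using Nat.strong_induction_on generalizing F with
  | _ k ih =>
    by_cases ht : G.IsTri (G.opp (G.rot z)) ∨ G.IsTri (G.opp (G.rot (G.rot z)))
    · exact hs.rowSum_of_isTri h hi ht w
    rw [not_or] at ht
    have hT : G.IsTripod z := ⟨h.isTri, h.leg, not_not.1 ht.1, not_not.1 ht.2⟩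
    rw [← sub_eq_zero, avg_eq_of_swap_invariant (φ := fun w => rowSum s (G.rot z) hi w -
      (2 * d i ^ 2) • s (tri G w)) ?_ w]
    · rw [avg_sub, sub_eq_zero]
      exact havg hT hi
    have hright : ∀ {w : LegOrder G} {r : F}, w.Consec (G.opp z) r →
        rowSum s (G.rot z) hi w - (2 * d i ^ 2) • s (tri G w) =
          rowSum s (G.rot z) hi (w.swap (G.opp z) r) -
            (2 * d i ^ 2) • s (tri G (w.swap (G.opp z) r)) := fun {w r} hc => by
      rw [sub_eq_sub_iff_sub_eq_sub, hs.rowSum_sub_of_eq h hi hc, smul_sub]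
    intro w l r hc
    by_cases hl : l = G.opp z
    · subst hl; exact hright hc
    by_cases hr : r = G.opp z
    · subst hr
      have := hright hc.swap
      rw [swap_comm _ (G.opp z) l, swap_swap] at this
      exact this.symm
    have hu' : (G.join l r hc.legPair).label ((G.join l r hc.legPair).opp (.inl z)) = some i := by
      rw [join_opp_inl, join_label_inl, if_neg (by simp [Ne.symm hl, Ne.symm hr]), hi]
    have hz := h.join hc.legPair hl hr
    have := ih _ (by have := numLegs_join hc.legPair; omega) hz hu' (w.join hc.legPair) rfl
    rw [h.isTri.join_rot] at this
    rw [sub_eq_sub_iff_sub_eq_sub, hs.rowSum_sub_of_ne (G.rot z) hi hc hl hr hu', ← smul_sub,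
      ← hs.stu hc]
    exact this

end IsWeight

/-! ### Exchanging the ends of a row -/

namespace UniDiagram

open StemFlag InsFlag

variable {G : UniDiagram n F} {z : F} {i : Fin n}

theorem opp_swap_opp [DecidableEq F] (G : UniDiagram n F) (x f : F) :
    G.opp (Equiv.swap x (G.opp x) f) = Equiv.swap x (G.opp x) (G.opp f) := by
  by_cases h1 : f = x
  · subst h1; simp [G.opp_opp]
  by_cases h2 : f = G.opp x
  · subst h2; simp [G.opp_opp]
  rw [Equiv.swap_apply_of_ne_of_ne h1 h2, Equiv.swap_apply_of_ne_of_ne]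
  · exact fun e => h2 (by rw [← e, G.opp_opp])
  · exact fun e => h1 (G.opp_injective e)

/-- The permutation of the flags of a row that turns the row around and fixes its end flags. -/
def rowTurn (G : UniDiagram n F) (z : F) : Equiv.Perm (F ⊕ InsFlag) :=
  Equiv.swap (.inl (G.rot z)) (.inr aIn) * (Equiv.swap (.inr aOut) (.inr bIn) * rowMirror G z)

section
variable (h : G.LegVertex z)
include h

theorem LegVertex.rowTurn_inl (f : F) : rowTurn G z (.inl f) =
    if f = z then .inr bLeg else if f = G.rot z then .inr bIn else if f = G.opp z then .inr bFoot
    else .inl f := by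
  rw [rowTurn, Equiv.Perm.mul_apply, Equiv.Perm.mul_apply, h.rowMirror_inl]
  by_cases h1 : f = z
  · simp [h1, Equiv.swap_apply_def]
  by_cases h2 : f = G.rot z
  · simp [h2, show G.rot z ≠ z from h.isTri, Equiv.swap_apply_def]
  by_cases h3 : f = G.opp z
  · simp [h3, h.facts.2.2.2.1.symm, h.facts.2.2.2.2.1.symm, Equiv.swap_apply_def]
  simp [h1, h2, h3, Equiv.swap_apply_def]

theorem LegVertex.rowTurn_inr (f : InsFlag) : rowTurn G z (.inr f) =
    match f with
    | aIn => .inr aOut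
    | aLeg => .inr aLeg
    | aOut => .inr aIn
    | aFoot => .inr aFoot
    | bIn => .inl (G.rot z)
    | bLeg => .inl z
    | bOut => .inr bOut
    | bFoot => .inl (G.opp z) := by
  rw [rowTurn, Equiv.Perm.mul_apply, Equiv.Perm.mul_apply, h.rowMirror_inr]
  have h1 : G.rot z ≠ z := h.isTri
  have h2 := h.facts.2.2.2.2.1
  cases f <;> simp [Equiv.swap_apply_def, h1.symm, h2.symm]

theorem LegVertex.opp_rowTurn (f : F ⊕ InsFlag) : (G.ins (G.rot z) i i).opp (rowTurn G z f) =
    rowTurn G z ((G.ins (G.rot z) i i).opp f) := by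
  have h1 := opp_swap_opp (G.ins (G.rot z) i i) (.inl (G.rot z))
  have h2 := opp_swap_opp (G.ins (G.rot z) i i) (.inr aOut)
  rw [ins_opp_x] at h1
  rw [ins_opp_aOut] at h2
  simp only [rowTurn, Equiv.Perm.mul_apply]
  rw [h1, h2, h.opp_rowMirror]

theorem LegVertex.label_rowTurn (hi : G.label (G.opp z) = some i) (f : F ⊕ InsFlag) :
    (G.ins (G.rot z) i i).label (rowTurn G z f) = (G.ins (G.rot z) i i).label f := by
  have l2 : G.label (G.rot z) = none := G.label_eq_none h.isTri.rot
  have key : ∀ x y f : F ⊕ InsFlag, (G.ins (G.rot z) i i).label x = none →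
      (G.ins (G.rot z) i i).label y = none → (G.ins (G.rot z) i i).label (Equiv.swap x y f) =
        (G.ins (G.rot z) i i).label f := by
    intro x y f hx hy
    rw [Equiv.swap_apply_def]
    split_ifs with h1 h2
    · rw [h1, hx, hy]
    · rw [h2, hx, hy]
    · rfl
  simp only [rowTurn, Equiv.Perm.mul_apply]
  rw [key (.inl (G.rot z)) _ _ l2 rfl, key (.inr aOut) (.inr bIn) _ rfl rfl, h.label_rowMirror hi]

/-- The row with reversed cyclic orders at its three vertices. -/
abbrev rowFlip (G : UniDiagram n F) (z : F) (i : Fin n) : UniDiagram n (F ⊕ InsFlag) :=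
  (((G.ins (G.rot z) i i).flip (.inl z)).flip (.inr aLeg)).flip (.inr bLeg)

theorem LegVertex.rowFlip_rot (f : F ⊕ InsFlag) : (rowFlip G z i).rot (rowTurn G z f) =
    rowTurn G z (Equiv.swap (.inl (G.rot (G.rot z))) (.inr bOut)
      ((G.ins (G.rot z) i i).rot (Equiv.swap (.inl (G.rot (G.rot z))) (.inr bOut) f))) := by
  obtain ⟨e1, e2, e3, e4, e5, e6, -⟩ := h.facts
  have a3 := G.rot_rot_rot
  have hleg := h.leg
  have m1 := h.rowTurn_inl
  have m2 := h.rowTurn_inr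
  have hin : ∀ f, f ≠ z → f ≠ G.rot z → f ≠ G.rot (G.rot z) →
      (rowFlip G z i).rot (.inl f) = .inl (G.rot f) := fun f h1 h2 h3 => by
    simp [rowFlip, flip_rot, SameVertex, h1, h2, h3]
  have r1 : (rowFlip G z i).rot (.inl z) = .inl (G.rot (G.rot z)) := by
    simp [rowFlip, flip_rot, SameVertex]
  have r2 : (rowFlip G z i).rot (.inl (G.rot z)) = .inl z := by
    simp [rowFlip, flip_rot, SameVertex, a3]
  have r3 : (rowFlip G z i).rot (.inl (G.rot (G.rot z))) = .inl (G.rot z) := by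
    simp [rowFlip, flip_rot, SameVertex, a3]
  have r4 : (rowFlip G z i).rot (.inr aIn) = .inr aOut := by simp [rowFlip, flip_rot, SameVertex]
  have r5 : (rowFlip G z i).rot (.inr aLeg) = .inr aIn := by simp [rowFlip, flip_rot, SameVertex]
  have r6 : (rowFlip G z i).rot (.inr aOut) = .inr aLeg := by simp [rowFlip, flip_rot, SameVertex]
  have r7 : (rowFlip G z i).rot (.inr bIn) = .inr bOut := by simp [rowFlip, flip_rot, SameVertex]
  have r8 : (rowFlip G z i).rot (.inr bLeg) = .inr bIn := by simp [rowFlip, flip_rot, SameVertex]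
  have r9 : (rowFlip G z i).rot (.inr bOut) = .inr bLeg := by simp [rowFlip, flip_rot, SameVertex]
  have s1 : ∀ f, f ≠ G.rot (G.rot z) → Equiv.swap (Sum.inl (G.rot (G.rot z))) (.inr bOut) (.inl f) =
    (.inl f : F ⊕ InsFlag) := fun f hf => Equiv.swap_apply_of_ne_of_ne (by simpa using hf) (by simp)
  have s2 : ∀ f, f ≠ bOut → Equiv.swap (Sum.inl (G.rot (G.rot z))) (.inr bOut) (.inr f) =
    (.inr f : F ⊕ InsFlag) := fun f hf => Equiv.swap_apply_of_ne_of_ne (by simp) (by simpa using hf)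
  rcases f with f | f
  · by_cases k1 : f = z
    · rw [k1, s1 _ e2.symm, ins_rot_inl, s1 _ e3.symm, m1, if_pos rfl, r8, m1,
        if_neg e1, if_pos rfl]
    by_cases k2 : f = G.rot z
    · rw [k2, s1 _ e3.symm, ins_rot_inl, Equiv.swap_apply_left, m1, if_neg e1, if_pos rfl, r7, m2]
    by_cases k3 : f = G.rot (G.rot z)
    · rw [k3, Equiv.swap_apply_left, ins_rot_bOut, s2 _ (by simp), m1, if_neg e2, if_neg e3,
        if_neg e6, r3, m2]
    have k4 : G.rot f ≠ z := fun e => k3 (by rw [← e, a3])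
    have k5 : G.rot f ≠ G.rot z := fun e => k1 (G.rot_injective e)
    have k6 : G.rot f ≠ G.rot (G.rot z) := fun e => k2 (G.rot_injective e)
    rw [s1 _ k3, ins_rot_inl, s1 _ k6, m1, m1, if_neg k1, if_neg k2, if_neg k4, if_neg k5]
    by_cases k7 : f = G.opp z
    · rw [if_pos k7, k7, hleg, if_pos rfl]
      simp [rowFlip, flip_rot, SameVertex]
    · rw [if_neg k7, if_neg fun e => k7 (G.rot_injective (e.trans hleg.symm)), hin f k1 k2 k3]
  · by_cases k : f = bOut
    · subst k
      rw [Equiv.swap_apply_right, ins_rot_inl, a3, s1 _ e2.symm, m2, r9, m1, if_pos rfl]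
    rw [s2 _ k]
    cases f
    · rw [ins_rot_aIn, s2 _ (by simp), m2, m2, r6]
    · rw [ins_rot_aLeg, s2 _ (by simp), m2, m2, r5]
    · rw [ins_rot_aOut, s2 _ (by simp), m2, m2, r4]
    · rw [ins_rot_aFoot, s2 _ (by simp), m2]
      simp [rowFlip, flip_rot, SameVertex]
    · rw [ins_rot_bIn, s2 _ (by simp), m2, m2, r2]
    · rw [ins_rot_bLeg, Equiv.swap_apply_right, m2, m1, if_neg e2, if_neg e3, if_neg e6, r1]
    · exact absurd rfl k
    · rw [ins_rot_bFoot, s2 _ (by simp), m2, hin _ e4.symm e5.symm e6.symm, hleg]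

end

theorem LegOrder.eq_lift {x u : F} (hu : G.label u = some i) {w : LegOrder (G.ins x i i)}
    (h1 : w.lt (.inl u) (.inr aFoot)) (h2 : w.lt (.inr aFoot) (.inr bFoot))
    (h3 : ∀ f, ¬ (w.lt (.inl u) (.inl f) ∧ w.lt (.inl f) (.inr bFoot))) :
    w = w.old.lift x i u hu := by
  have h4 := w.trans _ _ _ h1 h2
  have ht := w.trans
  have key : ∀ f, w.lt (.inl f) (.inr bFoot) → w.lt (.inl f) (.inl u) ∨ f = u := by
    intro f hf
    by_cases hfu : f = u
    · exact Or.inr hfu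
    refine Or.inl ((w.total' (w.rot_left hf) ((w.label_eq hf).trans (w.label_eq h4).symm)
      (by simpa using hfu)).resolve_right fun h' => h3 f ⟨h', hf⟩)
  have key' : ∀ f, w.lt (.inl u) (.inl f) → w.lt (.inr bFoot) (.inl f) := fun f hf =>
    (w.total' (w.rot_right hf) ((w.label_eq hf).symm.trans (w.label_eq h4))
      (by simp)).resolve_left fun h' => h3 f ⟨hf, h'⟩
  refine ext_ins (fun f g => ?_) (fun f => ⟨?_, ?_⟩) (fun f => ⟨?_, ?_⟩) ?_ ?_
  · rw [lift_inl, old_lt]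
  · rw [lift_inl_aFoot, old_lt]
    refine ⟨fun h => key f (ht _ _ _ h h2), ?_⟩
    rintro (h | rfl)
    · exact ht _ _ _ h h1
    · exact h1
  · rw [lift_inl_bFoot, old_lt]
    refine ⟨key f, ?_⟩
    rintro (h | rfl)
    · exact ht _ _ _ h h4
    · exact h4
  · rw [lift_aFoot_inl, old_lt]
    exact ⟨ht _ _ _ h1, fun h => ht _ _ _ h2 (key' f h)⟩
  · rw [lift_bFoot_inl, old_lt]
    exact ⟨ht _ _ _ h4, key' f⟩
  · simp [h2]
  · exact iff_of_false (w.asymm h2) (LegOrder.asymm _ (lift_aFoot_bFoot _ _ _ _ _))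

end UniDiagram

namespace IsWeight

open StemFlag InsFlag

variable {M : Type*} [AddCommGroup M] [Module (Lam n) M] {s : TriClass n → M} (hs : IsWeight s)
variable [Finite F] {G : UniDiagram n F} {z : F} {i : Fin n}
include hs

/-- The exchange of the ends of a row amounts, up to a sign, to the reversal of the order of its
three legs: turn the row around, which reverses the cyclic orders at three vertices. -/
theorem eq_neg_of_exchange (h : G.LegVertex z) (hi : G.label (G.opp z) = some i)
    (O : LegOrder (G.ins (G.rot z) i i)) {P' : TriDiagram n (F ⊕ InsFlag)}
    (ho : ∀ f, P'.graph.opp f = (G.ins (G.rot z) i i).opp f)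
    (hr : ∀ f, P'.graph.rot f = Equiv.swap (.inl (G.rot (G.rot z))) (.inr bOut)
      ((G.ins (G.rot z) i i).rot (Equiv.swap (.inl (G.rot (G.rot z))) (.inr bOut) f)))
    (hl : ∀ f, P'.graph.label f = (G.ins (G.rot z) i i).label f)
    (hlt : ∀ f g, P'.ord.lt f g ↔ O.lt f g) :
    s (triClass P') = - s (tri _ (O.swap (.inl (G.opp z)) (.inr bFoot))) := by
  have lm : (G.ins (G.rot z) i i).label (.inl (G.opp z)) =
    (G.ins (G.rot z) i i).label (.inr bFoot) := hi
  have hiso : IsIso P'.graph (rowFlip G z i) (rowTurn G z) :=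
    ⟨fun f => by rw [ho]; exact h.opp_rowTurn f, fun f => by rw [hr]; exact h.rowFlip_rot f,
      fun f => by rw [hl]; exact h.label_rowTurn hi f⟩
  let : DecidableEq (F ⊕ InsFlag) := fun a b => Classical.propDecidable (a = b)
  have key : ∀ f j, P'.graph.label f = some j →
      Equiv.swap (.inl (G.opp z)) (.inr bFoot) (rowTurn G z f) = f := by
    intro f j hj
    rw [hl] at hj
    have l1 : G.label z = none := G.label_eq_none h.isTri
    have l2 : G.label (G.rot z) = none := G.label_eq_none h.isTri.rot
    rcases f with f | f
    · rw [h.rowTurn_inl, if_neg (by rintro rfl; simp [l1] at hj),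
        if_neg (by rintro rfl; simp [l2] at hj)]
      split_ifs with h1
      · rw [Equiv.swap_apply_right, h1]
      · exact Equiv.swap_apply_of_ne_of_ne (by simpa using h1) (by simp)
    · cases f <;> simp at hj
      · rw [h.rowTurn_inr]; exact Equiv.swap_apply_of_ne_of_ne (by simp) (by simp)
      · rw [h.rowTurn_inr]; exact Equiv.swap_apply_left _ _
  set Q := O.swap (.inl (G.opp z)) (.inr bFoot) with hQ
  have t1 : (G.ins (G.rot z) i i).IsTri (.inl z) := (isTri_ins_inl _).2 h.isTri
  have t2 : ((G.ins (G.rot z) i i).flip (.inl z)).IsTri (.inr aLeg) := by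
    rw [isTri_flip]; simp [IsTri]
  have t3 : (((G.ins (G.rot z) i i).flip (.inl z)).flip (.inr aLeg)).IsTri (.inr bLeg) := by
    rw [isTri_flip, isTri_flip]; simp [IsTri]
  have k1 := hs.flip t1 Q
  have k2 := hs.flip t2 (Q.copy _ (flip_label _ _))
  have k3 := hs.flip t3 ((Q.copy _ (flip_label _ _)).copy _ (flip_label _ _))
  rw [k2, k1, neg_neg] at k3
  rw [← k3]
  refine congrArg s (tri_eq_of_iso_of_label (w := P'.ord) hiso fun f g j hf hg => ?_)
  rw [copy_lt, copy_lt, copy_lt, hQ, swap_lt_iff _ lm, key f j hf, key g j hg, hlt]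

/-- Relation (CL1A) holds for a weight whose row sums have the expected values. -/
theorem sub_of_isCL1A {P P' : TriDiagram n (F ⊕ InsFlag)} {Y : TriDiagram n F} {t : F}
    (hrow : Y.graph.LegVertex (Y.graph.rot t) →
      ∀ hi : Y.graph.label (Y.graph.opp (Y.graph.rot t)) = some i,
        rowSum s (Y.graph.rot (Y.graph.rot t)) hi Y.ord =
          (2 * d i ^ 2) • s (tri Y.graph Y.ord))
    (h : IsCL1A P P' Y i t) :
    s (triClass P) - s (triClass P') = (2 * d i ^ 2) • s (triClass Y) := by
  obtain ⟨h1, hi, h2, h3, h4, h5, ho, hr, hl, hlt⟩ := h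
  obtain ⟨O, rfl, hO⟩ := h2.eq_ins
  obtain ⟨G, w⟩ := Y
  dsimp only at *
  have a3 := G.rot_rot_rot
  have hleg := G.rot_eq_of_label hi
  have hOl : O = w.lift (G.rot (G.rot t)) i (G.opp (G.rot t)) hi := by
    rw [← hO]; exact eq_lift hi h3 h4 h5
  by_cases hloop : G.opp t = G.rot (G.rot t)
  · -- the row closes up to a circle, and both diagrams are isomorphic
    have hz := hs.eq_zero_of_loop (z := G.rot t) h1.rot hleg
      (by rw [a3, ← hloop, G.opp_opp]) w
    have lt : G.label t = none := G.label_eq_none h1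
    have hx : (G.ins (G.rot (G.rot t)) i i).opp (.inl t) = .inr bOut := by
      have := ins_opp_opp_x G (G.rot (G.rot t)) i i
      rwa [← hloop, G.opp_opp, hloop] at this
    have hfix : ∀ f j, (G.ins (G.rot (G.rot t)) i i).label f = some j →
        Equiv.swap (.inl t) (.inr bOut) f = f := by
      rintro f j hj
      refine Equiv.swap_apply_of_ne_of_ne ?_ ?_
      · rintro rfl; simp [lt] at hj
      · rintro rfl; simp at hj
    have hiso : IsIso (G.ins (G.rot (G.rot t)) i i) P'.graph (Equiv.swap (.inl t) (.inr bOut)) := by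
      refine ⟨fun f => ?_, fun f => ?_, fun f => ?_⟩
      · have := opp_swap_opp (G.ins (G.rot (G.rot t)) i i) (.inl t) f
        rw [hx] at this
        rw [ho, this]
      · rw [hr, Equiv.swap_apply_self]
      · rw [hl, Equiv.swap_apply_def]
        split_ifs with k1 k2
        · rw [k1]; simp [lt]
        · rw [k2]; simp [lt]
        · rfl
    have : triClass (⟨G.ins (G.rot (G.rot t)) i i, O⟩ : TriDiagram n (F ⊕ InsFlag)) =
        triClass P' := tri_eq_of_iso_of_label (w' := P'.ord) hiso fun f g j hf hg => by
      rw [hfix f j hf, hfix g j hg, hlt]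
    rw [this, sub_self]
    change 0 = _ • s (tri G w)
    rw [hz, smul_zero]
  · have hz : G.LegVertex (G.rot t) := by
      have hn : ∀ f, G.SameVertex (G.rot t) f → f ≠ G.opp (G.rot t) := fun f hf e =>
        hf.isTri h1.rot (e ▸ hleg)
      refine ⟨h1.rot, hleg, ?_, ?_⟩
      · rw [a3]
        rintro (e | e | e)
        · exact hn t (Or.inr (Or.inr (a3 t).symm)) (by rw [← e, G.opp_opp])
        · exact hloop e
        · exact G.opp_ne t (e.trans (a3 t))
      · rintro (e | e | e)
        · exact hn (G.rot (G.rot t)) (Or.inr (Or.inl rfl))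
            ((G.opp_opp _).symm.trans (congrArg G.opp e))
        · exact G.opp_ne _ e
        · exact hloop ((congrArg G.opp (e.trans (a3 t))).symm.trans (G.opp_opp _))
    have k1 := hs.eq_neg_of_exchange hz hi O ho (by rw [a3]; exact hr) hl hlt
    rw [k1, sub_neg_eq_add]
    have k2 := hrow hz hi
    rw [rowSum, ← hOl] at k2
    exact k2

/-- Conversely, (CL1A) determines the row sums. -/
theorem rowSum_of_cl1a
    (hc : ∀ {P P' : TriDiagram n (F ⊕ InsFlag)} {Y : TriDiagram n F} {t : F},
      IsCL1A P P' Y i t → s (triClass P) - s (triClass P') = (2 * d i ^ 2) • s (triClass Y))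
    (h : G.LegVertex z) (hi : G.label (G.opp z) = some i) (w : LegOrder G) :
    rowSum s (G.rot z) hi w = (2 * d i ^ 2) • s (tri G w) := by
  have hO : ∃ O, O = w.lift (G.rot z) i (G.opp z) hi := ⟨_, rfl⟩
  obtain ⟨O, hO⟩ := hO
  let K := G.ins (G.rot z) i i
  have hK : K = G.ins (G.rot z) i i := rfl
  have e2 : G.rot (G.rot z) ≠ z := h.facts.2.1
  have e3 := h.facts.2.2.1
  have a3 := G.rot_rot_rot
  have s1 : ∀ f, f ≠ G.rot (G.rot z) → Equiv.swap (Sum.inl (G.rot (G.rot z))) (.inr bOut) (.inl f) =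
    (.inl f : F ⊕ InsFlag) := fun f hf => Equiv.swap_apply_of_ne_of_ne (by simpa using hf) (by simp)
  have s2 : ∀ f, f ≠ bOut → Equiv.swap (Sum.inl (G.rot (G.rot z))) (.inr bOut) (.inr f) =
    (.inr f : F ⊕ InsFlag) := fun f hf => Equiv.swap_apply_of_ne_of_ne (by simp) (by simpa using hf)
  -- the diagram with exchanged ends exists: its row is connected
  let P' : UniDiagram n (F ⊕ InsFlag) :=
    K.conj (Equiv.swap (.inl (G.rot (G.rot z))) (.inr bOut)) (fun f hf => by
      refine Equiv.swap_apply_of_ne_of_ne ?_ ?_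
      · rintro rfl
        exact h.isTri.rot.rot (Sum.inl_injective hf)
      · rintro rfl; simp [hK] at hf) (fun f => by
      set R := Relation.EqvGen fun a b => b = K.opp a ∨
        b = Equiv.swap (.inl (G.rot (G.rot z))) (.inr bOut) (K.rot
          ((Equiv.swap (.inl (G.rot (G.rot z))) (.inr bOut)).symm a)) with hR
      have hpath : R (.inl (G.rot (G.rot z))) (.inr bOut) := by
        have p1 : R (.inl (G.rot (G.rot z))) (.inr bIn) := .rel _ _ (Or.inr (by
          rw [Equiv.symm_swap, Equiv.swap_apply_left, hK, ins_rot_bOut, s2 _ (by simp)]))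
        have p2 : R (.inr bIn) (.inr aOut) := .rel _ _ (Or.inl (by rw [hK, ins_opp_bIn]))
        have p3 : R (.inr aOut) (.inr aIn) := .rel _ _ (Or.inr (by
          rw [Equiv.symm_swap, s2 _ (by simp), hK, ins_rot_aOut, s2 _ (by simp)]))
        have p4 : R (.inr aIn) (.inl (G.rot z)) := .rel _ _ (Or.inl (by rw [hK, ins_opp_aIn]))
        have p5 : R (.inl (G.rot z)) (.inr bOut) := .rel _ _ (Or.inr (by
          rw [Equiv.symm_swap, s1 _ e3.symm, hK, ins_rot_inl, Equiv.swap_apply_left]))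
        exact p1.trans _ _ _ (p2.trans _ _ _ (p3.trans _ _ _ (p4.trans _ _ _ p5)))
      by_cases k1 : f = .inl (G.rot (G.rot z))
      · rw [k1, Equiv.swap_apply_left]; exact hpath
      by_cases k2 : f = .inr bOut
      · rw [k2, Equiv.swap_apply_right]; exact hpath.symm _ _
      · rw [Equiv.swap_apply_of_ne_of_ne k1 k2]; exact .refl _)
  have hcl : IsCL1A ⟨K, O⟩ ⟨P', O.copy P' fun _ => rfl⟩ ⟨G, w⟩ i (G.rot (G.rot z)) :=
    { isTri := h.isTri.rot.rot
      label_leg := by rw [a3]; exact hi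
      insertion := by
        dsimp only
        rw [a3]
        exact ⟨isInsertion_ins _ _ _ _, fun f g => by
          change O.lt _ _ ↔ w.lt f g
          rw [hO, lift_inl]⟩
      lt_first := by dsimp only; rw [a3]; simp [hO]
      lt_second := by simp [hO]
      consecutive := fun f hf => by
        dsimp only at hf
        rw [a3] at hf
        simp only [hO, lift_inl, lift_inl_bFoot] at hf
        rcases hf with ⟨h1, h2 | h2⟩
        · exact w.asymm h1 h2
        · exact w.ne_of_lt h1 h2.symm
      opp_eq := fun _ => rfl
      rot_eq := fun f => by
        change Equiv.swap _ _ (K.rot ((Equiv.swap _ _).symm f)) = _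
        rw [Equiv.symm_swap]
      label_eq := fun _ => rfl
      lt_iff := fun _ _ => Iff.rfl }
  have k1 := hc hcl
  rw [hs.eq_neg_of_exchange h hi O hcl.opp_eq hcl.rot_eq hcl.label_eq hcl.lt_iff,
    sub_neg_eq_add] at k1
  rw [rowSum, ← hO]
  exact k1

end IsWeight

/-! ### Relation (CL1A) for the inverse of the averaging map -/

theorem UniDiagram.IsTripod.exists_label {G : UniDiagram n F} {z : F} (h : G.IsTripod z) :
    ∃ j k, G.label (G.opp (G.rot z)) = some k ∧ G.label (G.opp (G.rot (G.rot z))) = some j :=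
  (G.exists_label h.leg_two).imp fun _ hj => (G.exists_label h.leg_one).imp fun _ hk => ⟨hk, hj⟩

theorem D.mk_ins_tripod [Finite F] {G : UniDiagram n F} {z : F} {i : Fin n} (h : G.IsTripod z)
    (hi : G.label (G.opp z) = some i) : D.mk (G.ins (G.rot z) i i) = d i ^ 2 • D.mk G := by
  obtain ⟨j, k, hk, hj⟩ := h.exists_label
  have a3 := G.rot_rot_rot
  refine sub_eq_zero.1 (D.eq_zero_of_mem (x := gen (G.ins (G.rot z) i i) - d i ^ 2 • gen G)
    (Or.inl (Or.inr ⟨F, inferInstance, G.ins (G.rot z) i i, G, i, j, k, G.rot (G.rot z),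
      h.isTri.rot.rot, hj, ?_, ?_, ?_, rfl⟩)))
  · rw [a3, hi]
  · rw [a3, hk]
  · rw [a3]; exact G.isInsertion_ins _ _ _

/-- A weight that also satisfies (CL1A). These are the functions that factor through `C(n)`. -/
structure IsStrongWeight {M : Type*} [AddCommGroup M] [Module (Lam n) M] (s : TriClass n → M) :
    Prop extends IsWeight s where
  cl1 : ∀ {F : Type} [Finite F] {P P' : TriDiagram n (F ⊕ InsFlag)} {Y : TriDiagram n F}
    {i : Fin n} {t : F}, IsCL1A P P' Y i t →
      s (triClass P) - s (triClass P') = (2 * d i ^ 2) • s (triClass Y)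

theorem isStrongWeight_unglue (n : ℕ) : IsStrongWeight (unglue n) where
  toIsWeight := isWeight_unglue n
  cl1 h := (isWeight_unglue n).sub_of_isCL1A (fun hz hi => (isWeight_unglue n).rowSum_eq
    (fun {F} _ {G z i} hz hi => by
      rw [← (isWeight_unglue n).avg_row hz hi, avg_unglue, D.mk_ins_tripod hz hi, avg_smul,
        avg_unglue, ← add_smul, two_mul]) hz hi _) h

/-! ### Functions that factor through `C(n)` -/

/-- The class in `C(n)` of an equivalence class of trivalent diagrams. -/
def C.ofClass (c : TriClass n) : C n :=
  Submodule.Quotient.mk ((1 : Lam n) ⊗ₜ[ℚ] (Submodule.Quotient.mk (Finsupp.single c 1) : A n))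

theorem C.eq_zero_of_mem {x : Lam n ⊗[ℚ] A n} (h : x ∈ cl1aRel n ∪ cl2aRel n) :
    (Submodule.Quotient.mk x : C n) = 0 :=
  (Submodule.Quotient.mk_eq_zero _).2 (Submodule.subset_span h)

theorem C.mk_tmul (a : Lam n) (x : A n) :
    (Submodule.Quotient.mk (a ⊗ₜ[ℚ] x) : C n) =
      a • (Submodule.Quotient.mk ((1 : Lam n) ⊗ₜ[ℚ] x) : C n) := by
  rw [← Submodule.Quotient.mk_smul, TensorProduct.smul_tmul', smul_eq_mul, mul_one]

theorem isStrongWeight_ofClass (n : ℕ) : IsStrongWeight (C.ofClass (n := n)) where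
  stu {F} _ {G w l r} hc := by
    have h : (A.mk (⟨_, w.join hc.legPair⟩ : TriDiagram n _)) =
        A.mk (⟨G, w⟩ : TriDiagram n F) - A.mk (⟨G, w.swap l r⟩ : TriDiagram n F) :=
      sub_eq_zero.1 ((Submodule.Quotient.mk_eq_zero _).2 (Submodule.subset_span
        ⟨F, inferInstance, _, _, _, l, r, isSTU_join hc, rfl⟩))
    change C.mk _ = C.mk _ - C.mk _
    unfold C.mk
    rw [h, TensorProduct.tmul_sub, Submodule.Quotient.mk_sub]
  cl2 {F} _ {G x} hx {i j} w := by
    have h := C.eq_zero_of_mem (n := n) (Or.inr ⟨F, inferInstance, ⟨G.ins x i j, w⟩,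
      ⟨G, w.old⟩, i, j, x, hx.isTri, hx.isTri_opp, hx.not_same, isTriInsertion_ins G x i j w, rfl⟩)
    rw [Submodule.Quotient.mk_sub, C.mk_tmul (d i * d j), sub_eq_zero] at h
    exact h
  cl1 {F} _ {P P' Y i t} h := by
    have h := C.eq_zero_of_mem (n := n) (Or.inl ⟨F, inferInstance, P, P', Y, i, t, h, rfl⟩)
    rw [Submodule.Quotient.mk_sub, Submodule.Quotient.mk_sub, C.mk_tmul (2 * d i ^ 2),
      sub_eq_zero] at h
    exact h

namespace IsStrongWeight

variable {M : Type*} [AddCommGroup M] [Module (Lam n) M] [Module ℚ M] [IsScalarTower ℚ (Lam n) M]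
variable {s : TriClass n → M}

/-- The linear map on `C(n)` given by a function on trivalent diagrams that satisfies (STU), (CL1A)
and (CL2A). -/
def lift (hs : IsStrongWeight s) : C n →ₗ[Lam n] M :=
  Submodule.liftQ _ (LinearMap.liftBaseChange (Lam n) (Submodule.liftQ _
    (Finsupp.linearCombination ℚ s) (by
      rw [Submodule.span_le]
      rintro _ ⟨F, _, S, T, U, l, r, h, rfl⟩
      obtain ⟨hc, rfl, rfl⟩ := h.exists_consec
      have := hs.stu hc
      rw [← sub_eq_zero] at this
      simpa [tri] using this))) (by
    rw [Submodule.span_le]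
    rintro _ (⟨F, _, P, P', Y, i, t, h, rfl⟩ | ⟨F, _, D', D, i, j, x, h1, h2, h3, h4, rfl⟩)
    · have := hs.cl1 h
      rw [← sub_eq_zero] at this
      simpa [A.mk] using this
    · obtain ⟨w, rfl, hw⟩ := h4.eq_ins
      have := hs.cl2 ⟨h1, h2, h3⟩ w
      rw [← sub_eq_zero, LegOrder.old, hw] at this
      simpa [A.mk, tri] using this)

theorem lift_ofClass (hs : IsStrongWeight s) (c : TriClass n) : hs.lift (C.ofClass c) = s c := by
  unfold lift C.ofClass
  erw [Submodule.liftQ_apply]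
  rw [LinearMap.liftBaseChange_tmul, one_smul]
  erw [Submodule.liftQ_apply]
  rw [Finsupp.linearCombination_single, one_smul]

end IsStrongWeight

theorem C.hom_ext {M : Type*} [AddCommGroup M] [Module (Lam n) M] {f g : C n →ₗ[Lam n] M}
    (h : ∀ c, f (C.ofClass c) = g (C.ofClass c)) : f = g := by
  refine Submodule.linearMap_qext _ (LinearMap.ext fun x => ?_)
  induction x using TensorProduct.induction_on with
  | zero => simp
  | add x y hx hy => rw [map_add, map_add, hx, hy]
  | tmul a x =>
    change f (Submodule.Quotient.mk _) = g (Submodule.Quotient.mk _)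
    rw [C.mk_tmul, map_smul, map_smul]
    congr 1
    obtain ⟨x, rfl⟩ := Submodule.Quotient.mk_surjective _ x
    induction x using Finsupp.induction_linear with
    | zero => simp
    | add x y hx hy =>
      rw [Submodule.Quotient.mk_add, TensorProduct.tmul_add, Submodule.Quotient.mk_add,
        map_add, map_add, hx, hy]
    | single c q =>
      rw [← mul_one q, ← smul_eq_mul, ← Finsupp.smul_single, Submodule.Quotient.mk_smul,
        TensorProduct.tmul_smul, Submodule.Quotient.mk_smul, ← algebraMap_smul (Lam n) q,
        map_smul, map_smul]
      exact congrArg _ (h c)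

/-! ### Averages satisfy the relations of `D(n)` -/

section
variable {M : Type*} [AddCommGroup M] [Module ℚ M]

theorem avg_tri_eq_of_iso [Finite F] [Finite F'] {G : UniDiagram n F} {G' : UniDiagram n F'}
    {φ : F ≃ F'} (h : IsIso G G' φ) (s : TriClass n → M) :
    avg G (fun w => s (tri G w)) = avg G' (fun w => s (tri G' w)) := by
  rw [← avg_comap h.blockEmbedding]
  exact avg_congr fun w _ => congrArg s (tri_comap h w)

/-- The average of a function over the gluings of a univalent diagram. -/
def avgClass (s : TriClass n → M) (c : UniClass n) : M :=
  Quotient.lift (fun B : BundledUni n => have := B.finite; avg B.graph fun w => s (tri B.graph w))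
    (by
      rintro A B ⟨_, h⟩
      have := A.finite
      have := B.finite
      exact avg_tri_eq_of_iso h s) c

end

namespace IsStrongWeight

variable {M : Type*} [AddCommGroup M] [Module (Lam n) M] [Module ℚ M]
variable {s : TriClass n → M}

theorem avg_ins_tripod [Finite F] (hs : IsStrongWeight s) {G : UniDiagram n F} {z : F} {i : Fin n}
    (h : G.IsTripod z) (hi : G.label (G.opp z) = some i) :
    avg (G.ins (G.rot z) i i) (fun w => s (tri _ w)) =
      d i ^ 2 • avg G (fun w => s (tri G w)) := by
  have h1 := hs.avg_row h hi
  rw [avg_congr fun w _ => hs.rowSum_of_cl1a hs.cl1 h.legVertex hi w, avg_smul, mul_smul, two_smul,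
    ← two_smul ℚ, ← two_smul ℚ (d i ^ 2 • _)] at h1
  exact smul_right_injective _ two_ne_zero h1

/-- The linear map on `D(n)` that sends a univalent diagram to the average over its gluings. -/
def average (hs : IsStrongWeight s) : D n →ₗ[Lam n] M :=
  Submodule.liftQ _ (Finsupp.linearCombination (Lam n) (avgClass s)) (by
    rw [Submodule.span_le]
    have key : ∀ {F : Type} [Finite F] (G : UniDiagram n F), avgClass s (uniClass G) =
      avg G fun w => s (tri G w) := fun _ => rfl
    rintro _ ((((⟨F, _, I, H, X, x, p, q, r, t, h, rfl⟩ |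
      ⟨F, _, G, G', v, hv, h1, h2, h3, h4, rfl⟩) | ⟨F, _, G, v, hv, h1, rfl⟩) |
      ⟨F, _, G', G, i, j, k, t, ht, hj, hi, hk, h, rfl⟩) |
      ⟨F, _, G', G, i, j, x, h1, h2, h3, h, rfl⟩)
    · simp only [SetLike.mem_coe, LinearMap.mem_ker, gen, map_sub,
        Finsupp.linearCombination_single, one_smul, key]
      have hb := blockEmbedding_of_isIHX h
      have hI := h.innerEdge
      obtain ⟨-, -, -, -, hH, hX⟩ := h.eq
      replace hH : H = ihxH hI := hH
      replace hX : X = ihxX hI := hX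
      clear h
      subst hH hX
      rw [sub_eq_zero, ← avg_copy hb.1, ← avg_copy hb.2, ← avg_sub]
      exact avg_congr fun w _ => hs.ihx hI w
    · obtain rfl : G' = G.flip v := UniDiagram.ext' (fun f => by rw [h1]; rfl) (fun f => by
        rw [flip_rot]
        split_ifs with hf
        · exact h3 f hf
        · exact h4 f hf) (fun f => by rw [h2]; rfl)
      simp only [SetLike.mem_coe, LinearMap.mem_ker, gen, map_add,
        Finsupp.linearCombination_single, one_smul, key]
      rw [← avg_copy (blockEmbedding_flip v) (fun w => s (tri (G.flip v) w)), ← avg_add,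
        avg_congr (ψ := fun _ => 0), avg_const]
      intro w _
      rw [hs.flip hv w, add_neg_cancel]
    · simp only [SetLike.mem_coe, LinearMap.mem_ker, gen,
        Finsupp.linearCombination_single, one_smul, key]
      rw [avg_congr fun w _ => hs.eq_zero_of_isInternal ⟨hv, h1⟩ w, avg_const]
    · obtain rfl := h.eq_ins
      have a3 := G.rot_rot_rot
      have hz : G.IsTripod (G.rot t) := ⟨ht.rot, G.rot_eq_of_label hi, G.rot_eq_of_label hk, by
        rw [a3]; exact G.rot_eq_of_label hj⟩
      simp only [SetLike.mem_coe, LinearMap.mem_ker, gen, map_sub, map_smul,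
        Finsupp.linearCombination_single, one_smul, key]
      rw [hs.avg_ins_tripod hz hi, sub_self]
    · obtain rfl := h.eq_ins
      simp only [SetLike.mem_coe, LinearMap.mem_ker, gen, map_sub, map_smul,
        Finsupp.linearCombination_single, one_smul, key]
      rw [avg_congr fun w _ => hs.cl2 ⟨h1, h2, h3⟩ w, avg_smul,
        ← avg_comap (G.blockEmbedding_ins x i j) (fun w => s (tri G w))]
      exact sub_self _)

theorem average_mk [Finite F] (hs : IsStrongWeight s) (G : UniDiagram n F) :
    hs.average (D.mk G) = avg G fun w => s (tri G w) := by
  unfold average D.mk gen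
  erw [Submodule.liftQ_apply]
  rw [Finsupp.linearCombination_single, one_smul]
  rfl

end IsStrongWeight

theorem D.hom_ext {M : Type*} [AddCommGroup M] [Module (Lam n) M] {f g : D n →ₗ[Lam n] M}
    (h : ∀ {F : Type} [Finite F] (G : UniDiagram n F), f (D.mk G) = g (D.mk G)) : f = g := by
  refine Submodule.linearMap_qext _ (Finsupp.lhom_ext fun c a => ?_)
  obtain ⟨⟨F, hF, G⟩, rfl⟩ := Quotient.exists_rep c
  rw [← mul_one a, ← smul_eq_mul, ← Finsupp.smul_single, map_smul, map_smul]
  exact congrArg _ (h G)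

/-- The averaged gluing map is an isomorphism; its inverse is `unglue`. -/
def chiEquiv (n : ℕ) : D n ≃ₗ[Lam n] C n :=
  LinearEquiv.ofLinearMap (isStrongWeight_ofClass n).average (isStrongWeight_unglue n).lift
    (C.hom_ext fun c => by
      obtain ⟨⟨F, hF, G, w⟩, rfl⟩ := Quotient.exists_rep c
      rw [LinearMap.comp_apply, IsStrongWeight.lift_ofClass, LinearMap.id_apply]
      refine SatisfiesSTU.ext (m := G.numLegs + 1)
        (s := fun c => (isStrongWeight_ofClass n).average (unglue n c)) (t := C.ofClass) ?_ ?_ ?_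
        (Nat.lt_succ_self _) w
      · intro F _ G w l r hc _
        change IsStrongWeight.average _ _ = IsStrongWeight.average _ _ - IsStrongWeight.average _ _
        rw [unglue_stu hc, map_sub]
      · intro F _ G w l r hc _
        exact (isStrongWeight_ofClass n).stu hc
      · intro F _ G _
        have := avg_map ((isStrongWeight_ofClass n).average.restrictScalars ℚ)
          (fun w => unglue n (tri G w))
        rw [avg_unglue] at this
        exact this.trans ((isStrongWeight_ofClass n).average_mk G))
    (D.hom_ext fun {F} _ G => by
      rw [LinearMap.comp_apply, IsStrongWeight.average_mk, LinearMap.id_apply, ← avg_unglue]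
      have := avg_map ((isStrongWeight_unglue n).lift.restrictScalars ℚ)
          (fun w => C.ofClass (tri G w))
      refine Eq.trans this.symm (avg_congr fun w _ => ?_)
      exact (isStrongWeight_unglue n).lift_ofClass _)

theorem chiEquiv_mk [Finite F] (G : UniDiagram n F) : chiEquiv n (D.mk G) = chi G :=
  (isStrongWeight_ofClass n).average_mk G

theorem chiEquiv_symm_mk [Finite F] (G : UniDiagram n F) (w : LegOrder G) :
    (chiEquiv n).symm (C.mk ⟨G, w⟩) = unglue n (tri G w) :=
  (isStrongWeight_unglue n).lift_ofClass (tri G w)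

/-! ### The number of vertices -/

theorem card_stemFlag : Nat.card StemFlag = 2 := by
  have h : (Finset.univ : Finset StemFlag) = {.stem, .foot} := by ext f; cases f <;> simp
  rw [Nat.card_eq_fintype_card, ← Finset.card_univ, h]
  simp

theorem card_insFlag : Nat.card InsFlag = 8 := by
  have h : (Finset.univ : Finset InsFlag) =
    {.aIn, .aLeg, .aOut, .aFoot, .bIn, .bLeg, .bOut, .bFoot} := by ext f; cases f <;> simp
  rw [Nat.card_eq_fintype_card, ← Finset.card_univ, h]
  simp

namespace UniDiagram

theorem quot_mk_eq_iff (G : UniDiagram n F) {v f : F} :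
    Quot.mk (fun f g : F => g = G.rot f) f = Quot.mk _ v ↔ G.SameVertex v f := by
  constructor
  · intro h
    rw [Quot.eq] at h
    induction h with
    | rel a b h => rw [h]; exact Or.inr (Or.inr (G.rot_rot_rot a).symm)
    | refl a => exact Or.inl rfl
    | symm a b _ ih => exact ih.symm
    | trans a b c _ _ ih1 ih2 => exact ih2.trans ih1
  · have key : ∀ f, Quot.mk (fun f g : F => g = G.rot f) (G.rot f) = Quot.mk _ f :=
      fun f => (Quot.sound (r := fun f g : F => g = G.rot f) rfl).symm
    rintro (h | h | h)
    · rw [h]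
    · rw [h, key]
    · rw [h, key, key]

/-- Count the flags, where those of the univalent vertices have weight three. -/
theorem three_mul_numVertices [Finite F] (G : UniDiagram n F) :
    3 * G.numVertices = Nat.card F + 2 * G.numLegs := by
  have := Fintype.ofFinite F
  have h1 : ∑ f : F, (1 + 2 * if G.rot f = f then 1 else 0) = Nat.card F + 2 * G.numLegs := by
    rw [Finset.sum_add_distrib, ← Finset.mul_sum, Finset.sum_boole, numLegs,
      Set.ncard_eq_toFinset_card', Set.toFinset_ofPred]
    simp
  have : Fintype (Quot fun f g : F => g = G.rot f) := Fintype.ofFinite _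
  rw [← h1, numVertices, Nat.card_eq_fintype_card, ← Finset.card_univ, mul_comm, ← smul_eq_mul,
    ← Finset.sum_const,
    ← Finset.sum_fiberwise (g := Quot.mk fun f g : F => g = G.rot f) Finset.univ]
  refine Finset.sum_congr rfl fun c _ => ?_
  obtain ⟨v, rfl⟩ := Quot.exists_rep c
  have h2 : (Finset.univ.filter fun f => Quot.mk (fun f g : F => g = G.rot f) f = Quot.mk _ v) =
      {v, G.rot v, G.rot (G.rot v)} := by
    ext f
    simp [G.quot_mk_eq_iff, SameVertex]
  rw [h2]
  by_cases hv : G.rot v = v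
  · simp [hv]
  · have hv' : G.IsTri v := hv
    rw [Finset.sum_insert, Finset.sum_insert, Finset.sum_singleton, if_neg hv, if_neg hv'.rot,
      if_neg hv'.rot.rot]
    · simp
    · simpa using hv'.rot.symm
    · simpa using ⟨Ne.symm hv, hv'.rot_rot_ne.symm⟩

theorem even_card [Finite F] (G : UniDiagram n F) : Even (Nat.card F) := by
  have := Fintype.ofFinite F
  have h := Finset.sum_involution (s := Finset.univ) (f := fun _ : F => (1 : ZMod 2))
    (fun f _ => G.opp f) (fun _ _ => by decide) (fun f _ _ => G.opp_ne f) (by simp)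
    (fun f _ => G.opp_opp f)
  rw [Finset.sum_const, nsmul_one, Finset.card_univ] at h
  rw [Nat.card_eq_fintype_card]
  exact (ZMod.natCast_eq_zero_iff_even).1 h

theorem exists_numVertices_eq [Finite F] (G : UniDiagram n F) :
    ∃ q : ℤ, (G.numVertices : ℤ) = 2 * q := by
  obtain ⟨k, hk⟩ := G.even_card
  have := G.three_mul_numVertices
  exact ⟨G.numVertices / 2, by omega⟩

theorem numVertices_join [Finite F] {G : UniDiagram n F} {l r : F} (h : G.LegPair l r) :
    (G.join l r h).numVertices = G.numVertices := by
  have h1 := G.three_mul_numVertices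
  have h2 := (G.join l r h).three_mul_numVertices
  have h3 := numLegs_join h
  have h4 : Nat.card (F ⊕ StemFlag) = Nat.card F + 2 := by
    rw [Nat.card_sum, card_stemFlag]
  omega

theorem numLegs_ins [Finite F] (G : UniDiagram n F) (x : F) (i j : Fin n) :
    (G.ins x i j).numLegs = G.numLegs + 2 := by
  have h : {f | (G.ins x i j).rot f = f} =
      Sum.inl '' {f | G.rot f = f} ∪ {.inr .aFoot, .inr .bFoot} := by
    ext f
    rcases f with f | f
    · simp
    · cases f <;> simp
  unfold numLegs
  rw [h, Set.ncard_union_eq, Set.ncard_image_of_injective _ Sum.inl_injective,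
    Set.ncard_pair (by simp)]
  rw [Set.disjoint_left]
  rintro _ ⟨f, _, rfl⟩
  simp

theorem numVertices_ins [Finite F] (G : UniDiagram n F) (x : F) (i j : Fin n) :
    (G.ins x i j).numVertices = G.numVertices + 4 := by
  have h1 := G.three_mul_numVertices
  have h2 := (G.ins x i j).three_mul_numVertices
  have h3 := G.numLegs_ins x i j
  have h4 : Nat.card (F ⊕ InsFlag) = Nat.card F + 8 := by
    rw [Nat.card_sum, card_insFlag]
  omega

theorem numVertices_congr [Finite F] {G G' : UniDiagram n F} (h : G'.label = G.label) :
    G'.numVertices = G.numVertices := by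
  have h1 := G.three_mul_numVertices
  have h2 := G'.three_mul_numVertices
  have h3 := numLegs_congr (congrFun h)
  omega

theorem IsIso.numVertices [Finite F] [Finite F'] {G : UniDiagram n F} {G' : UniDiagram n F'}
    {φ : F ≃ F'} (h : IsIso G G' φ) : G'.numVertices = G.numVertices := by
  have h1 := G.three_mul_numVertices
  have h2 := G'.three_mul_numVertices
  have h3 := h.numLegs
  have h4 := Nat.card_congr φ
  omega

end UniDiagram

/-- The number of vertices of a class of univalent diagrams. -/
def UniClass.numVertices (c : UniClass n) : ℕ :=
  Quotient.lift (fun B : BundledUni n => B.graph.numVertices) (by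
    rintro A B ⟨_, h⟩
    have := A.finite
    have := B.finite
    exact h.numVertices.symm) c

/-! ### The gradings -/

theorem single_mem_lamDeg (e : Fin n →₀ ℤ) (q : ℚ) :
    (AddMonoidAlgebra.single e q : Lam n) ∈ lamDeg n (∑ i, e i) := by
  have h : (AddMonoidAlgebra.single e 1 : Lam n) ∈ lamDeg n (∑ i, e i) :=
    Submodule.subset_span ⟨e, rfl, rfl⟩
  have := Submodule.smul_mem _ q h
  rwa [AddMonoidAlgebra.smul_single, smul_eq_mul, mul_one] at this

theorem mul_mem_lamDeg {k l : ℤ} {a b : Lam n} (ha : a ∈ lamDeg n k) (hb : b ∈ lamDeg n l) :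
    a * b ∈ lamDeg n (k + l) := by
  unfold lamDeg at ha
  induction ha using Submodule.span_induction with
  | zero => rw [zero_mul]; exact zero_mem _
  | add x y _ _ hx hy => rw [add_mul]; exact add_mem hx hy
  | smul q x _ hx => rw [smul_mul_assoc]; exact Submodule.smul_mem _ q hx
  | mem x hx =>
    obtain ⟨e, rfl, rfl⟩ := hx
    unfold lamDeg at hb
    induction hb using Submodule.span_induction with
    | zero => rw [mul_zero]; exact zero_mem _
    | add x y _ _ hx hy => rw [mul_add]; exact add_mem hx hy
    | smul q x _ hx => rw [mul_smul_comm]; exact Submodule.smul_mem _ q hx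
    | mem x hx =>
      obtain ⟨e', rfl, rfl⟩ := hx
      rw [AddMonoidAlgebra.single_mul_single, ← Finset.sum_add_distrib]
      exact single_mem_lamDeg (e + e') _

/-- The ring homomorphism `d_i ↦ 4 d_i`. -/
def scale (n : ℕ) : Lam n →ₐ[ℚ] Lam n :=
  AddMonoidAlgebra.lift ℚ (Lam n) (Fin n →₀ ℤ)
    { toFun := fun e => AddMonoidAlgebra.single e.toAdd ((4 : ℚ) ^ ∑ i, e.toAdd i)
      map_one' := by simp [AddMonoidAlgebra.one_def]
      map_mul' := fun e f => by
        rw [AddMonoidAlgebra.single_mul_single, ← zpow_add₀ (by norm_num),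
          ← Finset.sum_add_distrib]
        rfl }

theorem scale_single (e : Fin n →₀ ℤ) (q : ℚ) : scale n (AddMonoidAlgebra.single e q) =
    (4 : ℚ) ^ (∑ i, e i) • AddMonoidAlgebra.single e q := by
  unfold scale
  rw [AddMonoidAlgebra.lift_single, AddMonoidAlgebra.smul_single]
  simp [AddMonoidAlgebra.smul_single, mul_comm]

theorem scale_of_mem {k : ℤ} {a : Lam n} (ha : a ∈ lamDeg n k) : scale n a = (4 : ℚ) ^ k • a := by
  unfold lamDeg at ha
  induction ha using Submodule.span_induction with
  | zero => simp
  | add x y _ _ hx hy => rw [map_add, hx, hy, smul_add]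
  | smul q x _ hx => rw [map_smul, hx, smul_comm]
  | mem x hx =>
    obtain ⟨e, rfl, rfl⟩ := hx
    exact scale_single e 1

theorem scale_d (i : Fin n) : scale n (d i) = (4 : ℚ) • d i := by
  unfold d
  rw [scale_single]
  simp [Finsupp.single_apply]

section
variable [Finite F]

/-- The semilinear map that multiplies a diagram with `2 q` vertices and a coefficient of degree `p`
by `4 ^ (p + q)`. -/
def rescaleGen (n : ℕ) : (UniClass n →₀ Lam n) →ₛₗ[(scale n : Lam n →+* Lam n)] D n where
  toFun x := x.sum fun c a =>
    scale n a • (2 : ℚ) ^ c.numVertices • (Submodule.Quotient.mk (Finsupp.single c 1) : D n)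
  map_add' x y := Finsupp.sum_add_index' (fun _ => by rw [map_zero, zero_smul])
    (fun _ _ _ => by rw [map_add, add_smul])
  map_smul' a x := by
    rw [Finsupp.sum_smul_index (fun _ => by rw [map_zero, zero_smul]), Finsupp.smul_sum]
    refine Finsupp.sum_congr fun c _ => ?_
    rw [map_mul, mul_smul]
    rfl

theorem rescaleGen_gen (G : UniDiagram n F) :
    rescaleGen n (gen G) = (2 : ℚ) ^ G.numVertices • D.mk G := by
  have h := Finsupp.sum_single_index (a := uniClass G) (b := (1 : Lam n))
    (h := fun c a => scale n a • (2 : ℚ) ^ c.numVertices •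
      (Submodule.Quotient.mk (Finsupp.single c 1) : D n)) (by rw [map_zero, zero_smul])
  rw [map_one, one_smul] at h
  refine h.trans ?_
  rfl

theorem rescaleGen_smul (a : Lam n) (x : UniClass n →₀ Lam n) :
    rescaleGen n (a • x) = scale n a • rescaleGen n x := LinearMap.map_smulₛₗ _ _ _

theorem rescaleGen_eq_zero {x : UniClass n →₀ Lam n}
    (h : x ∈ ihxRel n ∪ asRel n ∪ intVRel n ∪ cl1bRel n ∪ cl2bRel n) : rescaleGen n x = 0 := by
  have h0 := D.eq_zero_of_mem h
  have hd : ∀ i j : Fin n, scale n (d i * d j) = (2 : ℚ) ^ 4 • (d i * d j) := fun i j => by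
    rw [map_mul, scale_d, scale_d, smul_mul_smul_comm]
    norm_num
  obtain ((((⟨F, _, I, H, X, x, p, q, r, t, h, rfl⟩ |
      ⟨F, _, G, G', v, hv, h1, h2, h3, h4, rfl⟩) | ⟨F, _, G, v, hv, h1, rfl⟩) |
      ⟨F, _, G', G, i, j, k, t, ht, hj, hi, hk, h, rfl⟩) |
      ⟨F, _, G', G, i, j, x, h1, h2, h3, h, rfl⟩) := h
  · rw [map_sub, map_sub, rescaleGen_gen, rescaleGen_gen, rescaleGen_gen,
      numVertices_congr h.labelH, numVertices_congr h.labelX, ← smul_sub, ← smul_sub]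
    exact smul_eq_zero_of_right _ h0
  · rw [map_add, rescaleGen_gen, rescaleGen_gen, numVertices_congr h2, ← smul_add]
    exact smul_eq_zero_of_right _ h0
  · rw [rescaleGen_gen]
    exact smul_eq_zero_of_right _ h0
  · obtain rfl := h.eq_ins
    rw [map_sub, rescaleGen_smul, rescaleGen_gen, rescaleGen_gen, numVertices_ins, sq, hd,
      smul_assoc, smul_comm (d i * d i), smul_smul, add_comm, pow_add, ← smul_sub, ← sq]
    exact smul_eq_zero_of_right _ h0
  · obtain rfl := h.eq_ins
    rw [map_sub, rescaleGen_smul, rescaleGen_gen, rescaleGen_gen, numVertices_ins, hd,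
      smul_assoc, smul_comm (d i * d j), smul_smul, add_comm, pow_add, ← smul_sub]
    exact smul_eq_zero_of_right _ h0

/-- The endomorphism of `D(n)` that multiplies the elements of degree `k` by `4 ^ k`. -/
def rescale (n : ℕ) : D n →ₛₗ[(scale n : Lam n →+* Lam n)] D n :=
  Submodule.liftQ _ (rescaleGen n) (Submodule.span_le.2 fun _ h => rescaleGen_eq_zero h)

theorem rescale_mk (G : UniDiagram n F) :
    rescale n (D.mk G) = (2 : ℚ) ^ G.numVertices • D.mk G :=
  rescaleGen_gen G

theorem rescale_rat_smul (q : ℚ) (x : D n) : rescale n (q • x) = q • rescale n x := by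
  rw [← algebraMap_smul (Lam n) q x, LinearMap.map_smulₛₗ]
  rw [RingHom.coe_coe, AlgHom.commutes, algebraMap_smul]

theorem D.smul_mk_mem {k p q : ℤ} {a : Lam n} (ha : a ∈ lamDeg n p) {G : UniDiagram n F}
    (hG : (G.numVertices : ℤ) = 2 * q) (h : p + q = k) : a • D.mk G ∈ D.deg n k :=
  Submodule.subset_span ⟨p, q, a, F, inferInstance, G, h, ha, hG, rfl⟩

theorem rescale_of_mem {k : ℤ} {x : D n} (hx : x ∈ D.deg n k) :
    rescale n x = (4 : ℚ) ^ k • x := by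
  unfold D.deg at hx
  induction hx using Submodule.span_induction with
  | zero => simp
  | add x y _ _ hx hy => rw [map_add, hx, hy, smul_add]
  | smul q x _ hx => rw [rescale_rat_smul, hx, smul_comm]
  | mem x hx =>
    obtain ⟨p, q, a, F, _, G, rfl, ha, hG, rfl⟩ := hx
    rw [LinearMap.map_smulₛₗ, RingHom.coe_coe, scale_of_mem ha, rescale_mk, smul_assoc,
      smul_comm a, smul_smul, zpow_add₀ (by norm_num)]
    congr 2
    rw [← zpow_natCast, hG, zpow_mul]
    norm_num

theorem D.iSupIndep_deg (n : ℕ) : iSupIndep (D.deg n) := by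
  let f : Module.End ℚ (D n) :=
    { toFun := rescale n, map_add' := map_add _, map_smul' := rescale_rat_smul }
  have h1 := (Module.End.eigenspaces_iSupIndep f).comp (f := fun k : ℤ => (4 : ℚ) ^ k)
    (zpow_right_injective₀ (by norm_num) (by norm_num))
  refine h1.mono fun k x hx => ?_
  exact Module.End.mem_eigenspace_iff.2 (rescale_of_mem hx)

theorem D.smul_mem_deg {k l : ℤ} {a : Lam n} {x : D n} (ha : a ∈ lamDeg n k)
    (hx : x ∈ D.deg n l) : a • x ∈ D.deg n (k + l) := by
  unfold D.deg at hx
  induction hx using Submodule.span_induction with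
  | zero => rw [smul_zero]; exact zero_mem _
  | add x y _ _ hx hy => rw [smul_add]; exact add_mem hx hy
  | smul q x _ hx => rw [smul_comm]; exact Submodule.smul_mem _ q hx
  | mem x hx =>
    obtain ⟨p, q, b, F, _, G, rfl, hb, hG, rfl⟩ := hx
    rw [smul_smul]
    exact smul_mk_mem (mul_mem_lamDeg ha hb) hG (add_assoc _ _ _)

theorem D.iSup_deg (n : ℕ) : ⨆ k, D.deg n k = ⊤ := by
  rw [eq_top_iff]
  rintro x -
  obtain ⟨x, rfl⟩ := Submodule.Quotient.mk_surjective _ x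
  induction x using Finsupp.induction_linear with
  | zero => exact zero_mem _
  | add x y hx hy => exact add_mem hx hy
  | single c a =>
    obtain ⟨⟨F, hF, G⟩, rfl⟩ := Quotient.exists_rep c
    have h : (Submodule.Quotient.mk (Finsupp.single (uniClass G) a) : D n) = a • D.mk G := by
      rw [D.mk, ← Submodule.Quotient.mk_smul, gen, Finsupp.smul_single, smul_eq_mul, mul_one]
    change (Submodule.Quotient.mk (Finsupp.single (uniClass G) a) : D n) ∈ _
    rw [h]
    clear h
    obtain ⟨q, hq⟩ := G.exists_numVertices_eq
    induction a using AddMonoidAlgebra.induction_linear with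
    | zero => rw [zero_smul]; exact zero_mem _
    | add a b ha hb => rw [add_smul]; exact add_mem ha hb
    | single e r => exact Submodule.mem_iSup_of_mem _ (D.smul_mk_mem (single_mem_lamDeg e r) hq rfl)

theorem D.isGrading_deg (n : ℕ) : IsGrading (n := n) (D.deg n) :=
  ⟨(DirectSum.isInternal_submodule_iff_iSupIndep_and_iSup_eq_top _).2
    ⟨iSupIndep_deg n, iSup_deg n⟩, fun _ _ _ _ => smul_mem_deg⟩

theorem one_mem_lamDeg : (1 : Lam n) ∈ lamDeg n 0 := by
  have := single_mem_lamDeg (0 : Fin n →₀ ℤ) 1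
  simpa [AddMonoidAlgebra.one_def] using this

/-- By induction on the number of legs: up to elements of degree `q` the value does not depend on
the order of the legs. -/
theorem unglue_mem_deg {q : ℤ} {G : UniDiagram n F} (hG : (G.numVertices : ℤ) = 2 * q)
    (w : LegOrder G) : unglue n (tri G w) ∈ D.deg n q := by
  induction hk : G.numLegs using Nat.strong_induction_on generalizing F with
  | _ k ih =>
    have h1 := avg_eq_of_swap_invariant
      (φ := fun w : LegOrder G => (D.deg n q).mkQ (unglue n (tri G w))) ?_ w
    · rw [avg_map, avg_unglue] at h1
      have h2 := D.smul_mk_mem one_mem_lamDeg hG (zero_add q)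
      rw [one_smul] at h2
      rwa [Submodule.mkQ_apply, Submodule.mkQ_apply, (Submodule.Quotient.mk_eq_zero _).2 h2,
        Submodule.Quotient.mk_eq_zero] at h1
    · intro w l r hc
      have h3 := numLegs_join hc.legPair
      have h4 := ih _ (by omega) (by rw [numVertices_join]; exact hG) (w.join hc.legPair) rfl
      rw [unglue_stu hc] at h4
      exact (Submodule.Quotient.eq _).2 h4

theorem map_deg (n : ℕ) (k : ℤ) :
    (D.deg n k).map ((chiEquiv n).restrictScalars ℚ : D n →ₗ[ℚ] C n) = C.deg n k := by
  apply le_antisymm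
  · rw [Submodule.map_le_iff_le_comap, D.deg, Submodule.span_le]
    rintro _ ⟨p, q, a, F, _, G, rfl, ha, hG, rfl⟩
    change chiEquiv n (a • D.mk G) ∈ C.deg n (p + q)
    rw [map_smul, chiEquiv_mk]
    change a • avg G (fun w => C.mk ⟨G, w⟩) ∈ _
    rw [← avg_smul]
    refine Submodule.smul_mem _ _ (Submodule.sum_mem _ fun w _ => ?_)
    exact Submodule.subset_span ⟨p, q, a, F, inferInstance, ⟨G, w.1⟩, rfl, ha, hG, rfl⟩
  · rw [C.deg, Submodule.span_le]
    rintro _ ⟨p, q, a, F, _, ⟨G, w⟩, rfl, ha, hG, rfl⟩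
    refine ⟨_, D.smul_mem_deg ha (unglue_mem_deg hG w), ?_⟩
    change chiEquiv n (a • unglue n (tri G w)) = _
    rw [map_smul, ← chiEquiv_symm_mk, LinearEquiv.apply_symm_apply]

theorem C.isGrading_deg (n : ℕ) : IsGrading (n := n) (C.deg n) := by
  have hmap := map_deg n
  refine ⟨(DirectSum.isInternal_submodule_iff_iSupIndep_and_iSup_eq_top _).2 ⟨?_, ?_⟩, ?_⟩
  · have := (D.iSupIndep_deg n).map_orderIso
      (Submodule.orderIsoMapComap ((chiEquiv n).restrictScalars ℚ))
    convert this using 1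
    exact funext fun k => (hmap k).symm
  · rw [show C.deg n = _ from funext fun k => (hmap k).symm, ← Submodule.map_iSup, D.iSup_deg,
      Submodule.map_top]
    exact LinearMap.range_eq_top.2 (chiEquiv n).surjective
  · intro k l a x ha hx
    rw [← hmap] at hx ⊢
    obtain ⟨y, hy, rfl⟩ := hx
    exact ⟨a • y, D.smul_mem_deg ha hy, map_smul (chiEquiv n) a y⟩

end
end DiagramAlgebra

end

theorem proposition7 (n : ℕ) :
    DiagramAlgebra.IsGrading (n := n) (DiagramAlgebra.D.deg n) ∧
    DiagramAlgebra.IsGrading (n := n) (DiagramAlgebra.C.deg n) ∧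
    ∃ e : DiagramAlgebra.D n ≃ₗ[DiagramAlgebra.Lam n] DiagramAlgebra.C n,
      (∀ (F : Type) [Finite F] (G : DiagramAlgebra.UniDiagram n F),
        e (DiagramAlgebra.D.mk G) = DiagramAlgebra.chi G) ∧
      ∀ k : ℤ, e '' (DiagramAlgebra.D.deg n k : Set (DiagramAlgebra.D n)) =
        (DiagramAlgebra.C.deg n k : Set (DiagramAlgebra.C n)) :=
  ⟨DiagramAlgebra.D.isGrading_deg n, DiagramAlgebra.C.isGrading_deg n, DiagramAlgebra.chiEquiv n,
    fun _ _ G => DiagramAlgebra.chiEquiv_mk G, fun k => by rw [← DiagramAlgebra.map_deg]; rfl⟩
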